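/- For integers $0\le k\le n$, a binary linear $[n,k]$ code is given by a parity-check matrix $H\in\mathbb F_2^{(n-k)\times n}$ of rank $n-k$. The syndrome decoding problem $\mathrm{SD}(n,k,\omega)$ asks, given $H$ and $s\in\mathbb F_2^{n-k}$, for a vector $e\in\mathbb F_2^n$ of Hamming weight $\omega$ with $He=s$. We consider a single (uniform) randomized classical algorithm on a random access machine with logarithmic costs (which may also draw uniformly random integers) that has access to a register of qubits, to which it can apply Toffoli gates and one-qubit rotation gates $R_y$ composed with $Z$, with $\sin^2$ of the half angle a given rational number, and which it can measure in the computational basis. **Theorem (Combined Hybrid).** There are such an algorithm and absolute constants $C,d\in\mathbb N$ with the following property. Let $n\in\mathbb N$, $\omega\in\{1,\dots,n\}$, $k=Rn$ an integer with $R\in[0,1]$, let $\delta\in[0,1]$ be a qubit reduction factor, and let $\alpha\in[0,R)$, $$\beta=(1-R)\Bigl(1-\frac{\delta R}{R-\alpha}\Bigr)$$ be such that $\alpha n$ and $\beta n$ are non-negative integers. Let $p$ be an integer with $0\le p\le\min(\omega,\beta n)$ and $\omega-p\le(1-\beta-R)n$. Then, given $n,k,\omega,\alpha n,\beta n,p$,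 $H$ and $s$, and using in total at most $\delta(1-R)Rn^2+Cn$ qubits (that is, $\delta(1-R)Rn^2$ qubits for the matrix representation and $O(n)$ auxiliary ones), the algorithm solves $\mathrm{SD}(n,k,\omega)$ in expected time $T_{\mathrm{CH}}$, in the following sense. Fix any $e\in\mathbb F_2^n$ of weight $\omega$. For every parity-check matrix $H$ of an $[n,k]$ code, on input $H$ and $s=He$ the algorithm halts with probability $1$ and its output is a vector $e'$ of weight $\omega$ with $He'=s$; and its expected running time, averaged also over a uniformly random parity-check matrix $H\in\mathbb F_2^{(n-k)\times n}$ of rank $n-k$, with $s=He$, is at most $$C\,n^{d}\cdot\frac{\binom n\omega}{\sqrt{\binom{(1-\alpha-\beta)n}{\omega-p}\binom{(1-\beta-R)n}{\omega-p}}\,\binom{\beta n}{p}}\cdot\max\left(1,\sqrt{\binom{(1-\alpha-\beta)n}{\omega-p}\,2^{-(1-\beta-R)n}}\right).$$ -/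

import Mathlib

open scoped ENNReal Matrix

/-! ## Syndrome decoding -/

/-- `e` solves the syndrome decoding instance `(H, s, ω)` over the field with two elements:
`H e = s`, and `e` has Hamming weight `ω`. -/
def IsSDSolution {r n : ℕ} (H : Matrix (Fin r) (Fin n) (ZMod 2)) (s : Fin r → ZMod 2) (ω : ℕ)
    (e : Fin n → ZMod 2) : Prop :=
  H *ᵥ e = s ∧ hammingNorm e = ω

open Classical in
/-- The parity-check matrices of the binary linear `[n, k]` codes, that is, the binary
`(n - k) × n` matrices of rank `n - k`. -/
noncomputable def parityCheckMatrices (n k : ℕ) : Finset (Matrix (Fin (n - k)) (Fin n) (ZMod 2)) :=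
  Finset.univ.filter fun H => H.rank = n - k

/-! ## A random access machine with a quantum register

Programs act on an unbounded random access memory of natural numbers (charged at logarithmic
cost, so that a step on long numbers is as expensive as the bit operations it stands for) and on a
register of `q` qubits. They may draw random numbers, apply elementary gates to qubits, and
measure qubits. -/

namespace Hybrid

/-- The arithmetic operations of the machine. -/
inductive Op
  | add
  | sub
  | mul
  | div
  | lt

/-- Subtraction is truncated at `0`, division is division with remainder (`x / 0 = 0`), and a
comparison evaluates to `1` or `0`. -/
def Op.eval : Op → ℕ → ℕ → ℕ
  | .add, x, y => x + y
  | .sub, x, y => x - y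
  | .mul, x, y => x * y
  | .div, x, y => x / y
  | .lt, x, y => if x < y then 1 else 0

/-- Expressions: constants, the contents of the memory cell whose address is given by an
expression, and arithmetic. -/
inductive Expr
  | const (c : ℕ)
  | load (a : Expr)
  | op (o : Op) (x y : Expr)

/-- The value of an expression when the memory is `m`. -/
def Expr.eval (m : ℕ → ℕ) : Expr → ℕ
  | .const c => c
  | .load a => m (a.eval m)
  | .op o x y => o.eval (x.eval m) (y.eval m)

/-- The cost of evaluating an expression, in terms of the binary lengths of all numbers involved.
An arithmetic operation on numbers of lengths `l` and `l'` costs `(1 + l) * (1 + l')`. -/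
def Expr.cost (m : ℕ → ℕ) : Expr → ℕ
  | .const c => 1 + c.size
  | .load a => a.cost m + (1 + (m (a.eval m)).size)
  | .op _ x y => x.cost m + y.cost m + (1 + (x.eval m).size) * (1 + (y.eval m).size)

/-- Programs. Addresses of memory cells and indices of qubits are given by expressions.
* `store a e`: write the value of `e` into cell `a`;
* `rand a e`: write a uniformly random number from `{0, …, e - 1}` into cell `a` (and `0` if
  `e = 0`);
* `rot t x y`: apply a one-qubit gate with parameter `x / y` to qubit `t`, see `rotate`;
* `toffoli c₁ c₂ t`: flip qubit `t` if qubits `c₁` and `c₂` are both one, see `toffoli`;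
* `measure t a`: measure qubit `t` in the computational basis and write the outcome into cell `a`;
* `seq c c'`: first `c`, then `c'`;
* `ite e c c'`: `c` if `e ≠ 0`, and `c'` otherwise;
* `loop e c`: repeat `c` as long as `e ≠ 0`. -/
inductive Cmd
  | store (a e : Expr)
  | rand (a e : Expr)
  | rot (t x y : Expr)
  | toffoli (c₁ c₂ t : Expr)
  | measure (t a : Expr)
  | seq (c c' : Cmd)
  | ite (e : Expr) (c c' : Cmd)
  | loop (e : Expr) (c : Cmd)

/-- A state vector of `q` qubits: the amplitudes of the `2 ^ q` computational basis states. -/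
abbrev QState (q : ℕ) : Type := (Fin q → Bool) → ℂ

/-- The state in which all qubits are zero. -/
noncomputable def QState.zero (q : ℕ) : QState q := Pi.single (fun _ => false) 1

/-- The gate with matrix `!![√(1 - π), √π; √π, -√(1 - π)]` on qubit `t`, where `π = x / y`
(truncated at `1`). It maps the basis state zero to a superposition in which one is measured with
probability `π`, and it is its own inverse. It is the Hadamard gate for `π = 1 / 2`, the Pauli gate
`X` for `π = 1` and the Pauli gate `Z` for `π = 0`. Nothing happens if there is no qubit `t`. -/
noncomputable def rotate {q : ℕ} (t x y : ℕ) (ψ : QState q) : QState q :=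
  if h : t < q then
    let π : ℝ := min ((x : ℝ) / y) 1
    let u : QState q := fun b => ψ (Function.update b ⟨t, h⟩ false)
    let v : QState q := fun b => ψ (Function.update b ⟨t, h⟩ true)
    fun b => if b ⟨t, h⟩ then (√π : ℂ) * u b - (√(1 - π) : ℂ) * v b
      else (√(1 - π) : ℂ) * u b + (√π : ℂ) * v b
  else ψ

/-- The Toffoli gate with controls `c₁`, `c₂` and target `t`; for `c₁ = c₂` it is the controlled
NOT gate. Nothing happens if one of the qubits does not exist or the target is a control. -/
def toffoli {q : ℕ} (c₁ c₂ t : ℕ) (ψ : QState q) : QState q :=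
  if h : c₁ < q ∧ c₂ < q ∧ t < q ∧ t ≠ c₁ ∧ t ≠ c₂ then
    fun b => if b ⟨c₁, h.1⟩ && b ⟨c₂, h.2.1⟩
      then ψ (Function.update b ⟨t, h.2.2.1⟩ (!b ⟨t, h.2.2.1⟩)) else ψ b
  else ψ

/-- The probability that a measurement of qubit `t` has outcome `v`. -/
noncomputable def measureProb {q : ℕ} (t : Fin q) (v : Bool) (ψ : QState q) : ℝ :=
  ∑ b with b t = v, ‖ψ b‖ ^ 2

/-- The state after a measurement of qubit `t` with outcome `v`. -/
noncomputable def collapse {q : ℕ} (t : Fin q) (v : Bool) (ψ : QState q) : QState q :=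
  fun b => if b t = v then ψ b / (√(measureProb t v ψ) : ℂ) else 0

/-- A state of the machine: the contents of the memory and the state of the qubits. -/
structure State (q : ℕ) where
  mem : ℕ → ℕ
  amp : QState q

/-- Write `v` into cell `a`. -/
def State.write {q : ℕ} (s : State q) (a v : ℕ) : State q :=
  { s with mem := Function.update s.mem a v }

/-- `expect τ c f s` is the expected value of `τ * (running time) + f (final state)` for a run of
the program `c` from the state `s`, where the term `f (final state)` is absent for runs that do not
halt. Every command takes one unit of time in addition to the cost of evaluating its expressions
(for a loop, one unit and the cost of its condition for each test of the condition). The value of a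
loop is the limit of the values of the loops that are cut off after `N` tests. -/
noncomputable def expect {q : ℕ} (τ : ℝ≥0∞) : Cmd → (State q → ℝ≥0∞) → State q → ℝ≥0∞
  | .store a e, f, s =>
      τ * (1 + a.cost s.mem + e.cost s.mem : ℕ) + f (s.write (a.eval s.mem) (e.eval s.mem))
  | .rand a e, f, s =>
      τ * (1 + a.cost s.mem + e.cost s.mem : ℕ) +
        if e.eval s.mem = 0 then f (s.write (a.eval s.mem) 0)
        else (∑ v ∈ Finset.range (e.eval s.mem), f (s.write (a.eval s.mem) v)) / (e.eval s.mem : ℕ)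
  | .rot t x y, f, s =>
      τ * (1 + t.cost s.mem + x.cost s.mem + y.cost s.mem : ℕ) +
        f { s with amp := rotate (t.eval s.mem) (x.eval s.mem) (y.eval s.mem) s.amp }
  | .toffoli c₁ c₂ t, f, s =>
      τ * (1 + c₁.cost s.mem + c₂.cost s.mem + t.cost s.mem : ℕ) +
        f { s with amp := toffoli (c₁.eval s.mem) (c₂.eval s.mem) (t.eval s.mem) s.amp }
  | .measure t a, f, s =>
      τ * (1 + t.cost s.mem + a.cost s.mem : ℕ) +
        if h : t.eval s.mem < q then
          ∑ v : Bool, ENNReal.ofReal (measureProb ⟨t.eval s.mem, h⟩ v s.amp) *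
            f { mem := Function.update s.mem (a.eval s.mem) v.toNat
                amp := collapse ⟨t.eval s.mem, h⟩ v s.amp }
        else f (s.write (a.eval s.mem) 0)
  | .seq c c', f, s => expect τ c (expect τ c' f) s
  | .ite e c c', f, s =>
      τ * (1 + e.cost s.mem : ℕ) +
        if e.eval s.mem = 0 then expect τ c' f s else expect τ c f s
  | .loop e c, f, s =>
      ⨆ N : ℕ, ((fun (X : State q → ℝ≥0∞) (s : State q) =>
        τ * (1 + e.cost s.mem : ℕ) +
          if e.eval s.mem = 0 then f s else expect τ c X s)^[N] fun _ => 0) s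

/-- The expected running time of the program `c` from the state `s`. -/
noncomputable def expectedTime {q : ℕ} (c : Cmd) (s : State q) : ℝ≥0∞ :=
  expect 1 c (fun _ => 0) s

open Classical in
/-- The probability that the program `c`, started in the state `s`, halts in a state with the
property `E`. -/
noncomputable def haltProb {q : ℕ} (c : Cmd) (E : State q → Prop) (s : State q) : ℝ≥0∞ :=
  expect 0 c (fun s' => if E s' then 1 else 0) s

/-- The initial state for parameters `n, k, ω, a, b, p`, a matrix `H` and a syndrome `s`: these data
in the memory cells `0, 1, 2, …` in this order (`H` row by row), all other cells zero, and all
qubits zero. -/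
noncomputable def initState (q n k ω a b p : ℕ) (H : Matrix (Fin (n - k)) (Fin n) (ZMod 2))
    (s : Fin (n - k) → ZMod 2) : State q where
  mem := fun c => ([n, k, ω, a, b, p]
    ++ (List.finRange (n - k)).flatMap (fun i => List.ofFn fun j => (H i j).val)
    ++ List.ofFn fun i => (s i).val).getD c 0
  amp := QState.zero q

/-- The vector that a halted program returns: its coordinates are the contents modulo two of the
memory cells `0, …, n - 1`. -/
def output {q : ℕ} (n : ℕ) (s : State q) : Fin n → ZMod 2 := fun j => (s.mem j : ZMod 2)

end Hybrid

/-- The time bound, with `a = α n`, `b = β n` and `k = R n`; then `n - a - b = (1 - α - β) n` and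
`n - k - b = (1 - β - R) n`. -/
noncomputable def combinedHybridBound (n k ω a b p : ℕ) : ℝ :=
  (n.choose ω : ℝ) /
      (√(((n - a - b).choose (ω - p) : ℝ) * ((n - k - b).choose (ω - p) : ℝ)) * (b.choose p : ℝ)) *
    max 1 √(((n - a - b).choose (ω - p) : ℝ) * (2 : ℝ) ^ (-((n - k - b : ℕ) : ℤ)))

/-! Write m = n - k for the number of equations, r = n - k - b, K = k - a and t = ω - p. The
algorithm repeats independent trials. Each trial ends with a classical check of its output, so a
reported vector is always a solution, and the expected time is the polynomial cost of a trial
divided by its success probability. The work lies in bounding this probability below, on average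
over H.

A trial permutes the coordinates at random and brings the permuted system into reduced form. This
gives an affine parametrization Φ of the solutions (`Partial.param`). The hope is that the permuted
e has p ones among the first b coordinates, t - j among the next r, j among the next K and none
among the last a. A quantum search then runs over pairs of masks, a set of the r rows and a set of
the K columns, each of size τ. For a pair of masks, the oracle solves the linear system that demands
zeros at the chosen rows from a vector whose tail is supported on the chosen columns, and it tests
the weight of the resulting candidate. The entries of Φ stay in classical memory and only decide
which gates are applied. The circuit stores the echelon form of the masked r × K matrix and
regenerates columns and coefficients whenever it needs them (`oracle_spec`, `solve_spec`). So it
uses rK = δ(1-R)R n² qubits and linearly many others.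

A pair of masks is good if the rows avoid the ones of e and the columns contain them. Summing
Vandermonde's identity twice and taking the largest term gives τ and j (`exists_parameters`) for
which the probability of a good permutation (`card_goodPerms`), times the square root of the weight
of the good masks, is up to a polynomial at least √(C(r+K,t) C(r,t)) C(b,p) / C(n,ω)
(`sqrt_choose_le`). This is the claimed bound even without its last factor.

Two degeneracies remain: the first m columns may be dependent, and the masked system may have
several solutions. Both are handled by random shifts, of the first m coordinates and of the tail.
The wanted solution is then found with probability at least the inverse of a product of sizes of
kernels of H restricted to certain coordinate sets (`card_goodHead`, `card_goodTail`). These sets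
have at most m elements, so for random H the fourth moments of the sizes are bounded by a constant
(`sum_card_kernelOn_pow_four`). The linear lower bound `sqrt_mul_ge` for the square root and the
Cauchy–Schwarz inequality turn this into a bound for the average of the inverse success probability
(`exists_trialBound`).

The weight P of the good masks is not known, so the number of Grover iterations is drawn from a
heavy-tailed distribution. Its mean is at most logarithmic in its range (`sum_div_le`), while it
succeeds with probability at least √P/16 (`average_success`). Every trial therefore has polynomial
expected cost, and the quadratic speedup appears in the number of trials.

To reason about the machine, programs are written in a language with bounded loops over
two-dimensional arrays, with an expectation transformer `wp`. The compiled program is sandwiched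
between the values of `wp` without cost and with one fixed charge per step (`simulates`). The only
unbounded loop, the one over the trials, is treated by a potential function (`loop_le`) and by the
geometric decay of the failure probability (`one_le_loop`). -/

namespace Hybrid

open Finset Function

/-! ## A language of bounded loops, and its compilation -/

/-- A weight that controls the cost of an expression. -/
def Expr.wt : Expr → ℕ
  | .const c => 1 + c.size
  | .load a => a.wt + 1
  | .op _ x y => x.wt + y.wt + (1 + x.wt) * (1 + y.wt)

/-- Under every operation lengths at most add, up to one carry bit, and the product in the weight
leaves room for it. A load is harmless whatever its address, because all cells are short. -/
lemma Expr.eval_lt {m : ℕ → ℕ} {L : ℕ} (h : ∀ c, m c < 2 ^ L) (x : Expr) :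
    x.eval m < 2 ^ (x.wt * (L + 1)) := by
  induction x with
  | const c =>
    refine (Nat.lt_size_self c).trans_le (Nat.pow_le_pow_right two_pos ?_)
    grind [Expr.wt]
  | load a _ =>
    refine (h _).trans_le (Nat.pow_le_pow_right two_pos ?_)
    simp only [Expr.wt]; grind
  | op o x y hx hy =>
    simp only [Expr.eval, Expr.wt]
    set A := x.eval m
    set B := y.eval m
    have hA : A < 2 ^ (x.wt * (L + 1)) := hx
    have hB : B < 2 ^ (y.wt * (L + 1)) := hy
    have h1 : 2 ^ (x.wt * (L + 1)) * 2 ^ (y.wt * (L + 1)) * 2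
        ≤ 2 ^ ((x.wt + y.wt + (1 + x.wt) * (1 + y.wt)) * (L + 1)) := by
      rw [← pow_add, ← pow_succ]
      refine Nat.pow_le_pow_right two_pos ?_
      grind
    cases o with
    | add => simp only [Op.eval]; nlinarith
    | sub => simp only [Op.eval]; have := Nat.sub_le A B; nlinarith
    | mul => simp only [Op.eval]; nlinarith [Nat.mul_lt_mul'' hA hB]
    | div => simp only [Op.eval]; have := Nat.div_le_self A B; nlinarith
    | lt => simp only [Op.eval]; split <;> nlinarith

lemma Expr.size_le {m : ℕ → ℕ} {L : ℕ} (h : ∀ c, m c < 2 ^ L) (x : Expr) :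
    (x.eval m).size ≤ x.wt * (L + 1) := Nat.size_le.2 (x.eval_lt h)

lemma Expr.cost_le {m : ℕ → ℕ} {L : ℕ} (h : ∀ c, m c < 2 ^ L) (x : Expr) :
    x.cost m ≤ x.wt * (L + 1) ^ 2 := by
  induction x with
  | const c => simp only [Expr.cost, Expr.wt]; grind
  | load a ha =>
    have : (m (a.eval m)).size ≤ L := Nat.size_le.2 (h _)
    simp only [Expr.cost, Expr.wt]; grind
  | op o x y hx hy =>
    have h1 := x.size_le h
    have h2 := y.size_le h
    have h3 : (1 + (x.eval m).size) * (1 + (y.eval m).size)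
        ≤ ((1 + x.wt) * (L + 1)) * ((1 + y.wt) * (L + 1)) :=
      Nat.mul_le_mul (by grind) (by grind)
    simp only [Expr.cost, Expr.wt]; grind

/-- The total weight of the expressions of a program. -/
def Cmd.wt : Cmd → ℕ
  | .store a e => 1 + a.wt + e.wt
  | .rand a e => 1 + a.wt + e.wt
  | .rot t x y => 1 + t.wt + x.wt + y.wt
  | .toffoli c₁ c₂ t => 1 + c₁.wt + c₂.wt + t.wt
  | .measure t a => 1 + t.wt + a.wt
  | .seq c c' => c.wt + c'.wt
  | .ite e c c' => 1 + e.wt + c.wt + c'.wt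
  | .loop e c => 1 + e.wt + c.wt

/-- Sixteen two-dimensional arrays of numbers. -/
abbrev Arr : Type := Fin 16 → ℕ → ℕ → ℕ

/-- Array expressions: constants, the modulus, loop variables, array entries, inputs,
arithmetic. -/
inductive Exp
  | const (c : ℕ)
  | top
  | var (i : ℕ)
  | arr (ρ : Fin 16) (i j : Exp)
  | inp (a : Exp)
  | op (o : Op) (x y : Exp)

instance : Add Exp := ⟨.op .add⟩
instance : Sub Exp := ⟨.op .sub⟩
instance : Mul Exp := ⟨.op .mul⟩
instance : Div Exp := ⟨.op .div⟩

/-- The inputs and the binary logarithm of the modulus. -/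
structure Ctx where
  inp : ℕ → ℕ
  lg : ℕ

/-- The modulus. -/
def Ctx.top (X : Ctx) : ℕ := 2 ^ X.lg

def Exp.ev (X : Ctx) (v : List ℕ) (D : Arr) : Exp → ℕ
  | .const c => c
  | .top => X.top
  | .var i => v.getD i 0
  | .arr ρ i j => D ρ (i.ev X v D) (j.ev X v D)
  | .inp a => X.inp (a.ev X v D)
  | .op o x y => o.eval (x.ev X v D) (y.ev X v D)

/-- Programs with bounded loops; the body of a loop has access to the loop variable of the
next level, which runs upwards or downwards. -/
inductive Prog
  | set (ρ : Fin 16) (i j e : Exp)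
  | rnd (ρ : Fin 16) (i j e : Exp)
  | gate (a b t : Exp)
  | rot (t x y : Exp)
  | meas (t : Exp) (ρ : Fin 16) (i j : Exp)
  | seq (g h : Prog)
  | ite (e : Exp) (g h : Prog)
  | loop (rev : Bool) (e : Exp) (g : Prog)

/-- Arrays and qubits. -/
structure St (q : ℕ) where
  arr : Arr
  amp : QState q

/-- Change one entry of an array. -/
def Arr.put (D : Arr) (ρ : Fin 16) (i j x : ℕ) : Arr :=
  update D ρ (update (D ρ) i (update (D ρ i) j x))

/-- The indices below `m`, in increasing or decreasing order. -/
def order (rev : Bool) (m : ℕ) : List ℕ := if rev then (List.range m).reverse else List.range m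

/-- The expected value of `f` after a run plus `κ` per step. -/
noncomputable def wp {q : ℕ} (X : Ctx) (κ : ℝ≥0∞) : Prog → List ℕ → (St q → ℝ≥0∞) → St q → ℝ≥0∞
  | .set ρ i j e, v, f, s =>
      κ + f ⟨s.arr.put ρ (i.ev X v s.arr) (j.ev X v s.arr) (e.ev X v s.arr % X.top), s.amp⟩
  | .rnd ρ i j e, v, f, s =>
      κ + if e.ev X v s.arr % X.top = 0 then
          f ⟨s.arr.put ρ (i.ev X v s.arr) (j.ev X v s.arr) 0, s.amp⟩
        else (∑ x ∈ range (e.ev X v s.arr % X.top),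
          f ⟨s.arr.put ρ (i.ev X v s.arr) (j.ev X v s.arr) x, s.amp⟩) /
            ((e.ev X v s.arr % X.top : ℕ) : ℝ≥0∞)
  | .gate a b t, v, f, s =>
      κ + f ⟨s.arr, toffoli (a.ev X v s.arr) (b.ev X v s.arr) (t.ev X v s.arr) s.amp⟩
  | .rot t x y, v, f, s =>
      κ + f ⟨s.arr, rotate (t.ev X v s.arr) (x.ev X v s.arr) (y.ev X v s.arr) s.amp⟩
  | .meas t ρ i j, v, f, s =>
      κ + if h : t.ev X v s.arr < q then
          ∑ x : Bool, ENNReal.ofReal (measureProb ⟨t.ev X v s.arr, h⟩ x s.amp) *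
            f ⟨s.arr.put ρ (i.ev X v s.arr) (j.ev X v s.arr) x.toNat,
              collapse ⟨t.ev X v s.arr, h⟩ x s.amp⟩
        else f ⟨s.arr.put ρ (i.ev X v s.arr) (j.ev X v s.arr) 0, s.amp⟩
  | .seq g h, v, f, s => wp X κ g v (wp X κ h v f) s
  | .ite e g h, v, f, s => κ + if e.ev X v s.arr = 0 then wp X κ h v f s else wp X κ g v f s
  | .loop rev e g, v, f, s =>
      κ + (order rev (e.ev X v s.arr % X.top)).foldr
        (fun i F s => κ + wp X κ g (v ++ [i]) (fun s => κ + F s) s) (fun s => κ + f s) s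

/-! ### Memory layout -/

/-- The cell with tag `t` and index `y`. -/
def cell (n t y : ℕ) : ℕ := (n + 4) * (n + 4) + (32 * y + t)

/-- An injective pairing: the value lies between (i + j)² and (i + j + 1)², so it determines i + j
and then j. Unlike a triangular pairing it needs no division. -/
def pr (i j : ℕ) : ℕ := (i + j) * (i + j) + j

lemma pr_inj {i j i' j' : ℕ} : pr i j = pr i' j' ↔ i = i' ∧ j = j' := by
  refine ⟨fun h => ?_, by grind⟩
  unfold pr at h
  have : i + j = i' + j' := by
    rcases lt_trichotomy (i + j) (i' + j') with h1 | h1 | h1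
    · have : (i + j + 1) * (i + j + 1) ≤ (i' + j') * (i' + j') := Nat.mul_le_mul h1 h1
      grind
    · exact h1
    · have : (i' + j' + 1) * (i' + j' + 1) ≤ (i + j) * (i + j) := Nat.mul_le_mul h1 h1
      grind
  grind

def cellE (t : ℕ) (y : Expr) : Expr := .op .add (.op .mul (.op .add (.load (.const 0)) (.const 4))
    (.op .add (.load (.const 0)) (.const 4)))
    (.op .add (.op .mul (.const 32) y) (.const t))

def prE (i j : Expr) : Expr := .op .add (.op .mul (.op .add i j) (.op .add i j)) j

def topE : Expr := .load (cellE 18 (.const 0))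

def modE (x : Expr) : Expr := .op .sub x (.op .mul topE (.op .div x topE))

/-- Loop variables are stored increased by one, hence the subtraction. An input address beyond (n +
4)² is multiplied by zero and reads cell 0, so that an input expression can never see a working
cell. -/
def Exp.comp (d : ℕ) : Exp → Expr
  | .const c => .const c
  | .top => topE
  | .var i => if i < d then .op .sub (.load (cellE 17 (.const i))) (.const 1) else .const 0
  | .arr ρ i j => .load (cellE ρ (prE (i.comp d) (j.comp d)))
  | .inp a => .load (.op .mul (a.comp d) (.op .lt (a.comp d)
      (.op .mul (.op .add (.load (.const 0)) (.const 4)) (.op .add (.load (.const 0)) (.const 4)))))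
  | .op o x y => .op o (x.comp d) (y.comp d)

/-- The memory holds the inputs, the modulus, and the loop variables and counters of the outer
levels. -/
structure Inv (X : Ctx) (v cs : List ℕ) (m : ℕ → ℕ) : Prop where
  inp : ∀ a, m (a * if a < (X.inp 0 + 4) * (X.inp 0 + 4) then 1 else 0) = X.inp a
  top : m (cell (X.inp 0) 18 0) = X.top
  le : ∀ c, m c ≤ X.top
  idx : ∀ i < v.length, m (cell (X.inp 0) 17 i) = v.getD i 0 + 1
  cnt : ∀ i < v.length, m (cell (X.inp 0) 16 i) = cs.getD i 0

lemma Inv.zero {X : Ctx} {v cs : List ℕ} {m : ℕ → ℕ} (h : Inv X v cs m) : m 0 = X.inp 0 := by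
  simpa using h.inp 0

lemma Inv.lt {X : Ctx} {v cs : List ℕ} {m : ℕ → ℕ} (h : Inv X v cs m) (c : ℕ) :
    m c < 2 ^ (X.lg + 1) :=
  (h.le c).trans_lt (Nat.pow_lt_pow_right one_lt_two (Nat.lt_succ_self _))

lemma Ctx.top_pos (X : Ctx) : 0 < X.top := Nat.pow_pos two_pos

/-- The arrays that a memory holds. -/
def arrOf (n : ℕ) (m : ℕ → ℕ) : Arr := fun ρ i j => m (cell n ρ (pr i j))

lemma cellE_eval_of {n : ℕ} {m : ℕ → ℕ} (h : m 0 = n) (t : ℕ) (y : Expr) :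
    (cellE t y).eval m = cell n t (y.eval m) := by
  simp [cellE, Expr.eval, Op.eval, cell, h]

lemma cellE_eval {X : Ctx} {v cs : List ℕ} {m : ℕ → ℕ} (h : Inv X v cs m) (t : ℕ) (y : Expr) :
    (cellE t y).eval m = cell (X.inp 0) t (y.eval m) := cellE_eval_of h.zero t y

lemma topE_eval {X : Ctx} {v cs : List ℕ} {m : ℕ → ℕ} (h : Inv X v cs m) : topE.eval m = X.top := by
  simp only [topE, Expr.eval, cellE_eval h, h.top]

lemma modE_eval {X : Ctx} {v cs : List ℕ} {m : ℕ → ℕ} (h : Inv X v cs m) (x : Expr) :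
    (modE x).eval m = x.eval m % X.top := by
  grind [modE, Expr.eval, Op.eval, topE_eval, Nat.mod_eq_sub_mul_div]

lemma Exp.comp_eval {X : Ctx} {v cs : List ℕ} {m : ℕ → ℕ} (h : Inv X v cs m) (x : Exp) :
    (x.comp v.length).eval m = x.ev X v (arrOf (X.inp 0) m) := by
  induction x with
  | const c => rfl
  | top => exact topE_eval h
  | var i =>
    simp only [Exp.comp, Exp.ev]
    split
    · simp only [Expr.eval, Op.eval, cellE_eval h, h.idx _ ‹_›, Nat.add_sub_cancel]
    · simp only [Expr.eval]; grind
  | arr ρ i j hi hj => grind [Exp.comp, Exp.ev, Expr.eval, cellE_eval, prE, Op.eval, arrOf, pr]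
  | inp a ha =>
    simp only [Exp.comp, Exp.ev, Expr.eval, Op.eval, ha, h.zero]
    exact h.inp _
  | op o x y hx hy => simp_all [Exp.comp, Exp.ev, Expr.eval]

def ctE (d : ℕ) : Expr := cellE 16 (.const d)
def ixE (d : ℕ) : Expr := cellE 17 (.const d)
def decE (d : ℕ) : Expr := .op .sub (.load (ctE d)) (.const 1)
-- The index is advanced before the body runs. Storing it increased by one lets an upward loop start
-- at 0 and a downward loop at m + 1.
def incE (rev : Bool) (d : ℕ) : Expr := .op (if rev then .sub else .add) (.load (ixE d)) (.const 1)

/-- The body of a compiled loop. -/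
def bodyOf (rev : Bool) (d : ℕ) (g : Cmd) : Cmd :=
  .seq (.store (ixE d) (incE rev d)) (.seq g (.store (ctE d) (decE d)))

def Prog.comp (d : ℕ) : Prog → Cmd
  | .set ρ i j e => .store (cellE ρ (prE (i.comp d) (j.comp d))) (modE (e.comp d))
  | .rnd ρ i j e => .rand (cellE ρ (prE (i.comp d) (j.comp d))) (modE (e.comp d))
  | .gate a b t => .toffoli (a.comp d) (b.comp d) (t.comp d)
  | .rot t x y => .rot (t.comp d) (x.comp d) (y.comp d)
  | .meas t ρ i j => .measure (t.comp d) (cellE ρ (prE (i.comp d) (j.comp d)))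
  | .seq g h => .seq (g.comp d) (h.comp d)
  | .ite e g h => .ite (e.comp d) (g.comp d) (h.comp d)
  | .loop rev e g => .seq (.store (ctE d) (modE (e.comp d)))
      (.seq (.store (ixE d) (if rev then .op .add (.load (ctE d)) (.const 1) else .const 0))
        (.loop (.load (ctE d)) (bodyOf rev d (g.comp (d + 1)))))

lemma cell_inj {n t y t' y' : ℕ} (h : t < 32) (h' : t' < 32) :
    cell n t y = cell n t' y' ↔ t = t' ∧ y = y' := by
  grind [cell]

lemma arrOf_update_arr (n : ℕ) (m : ℕ → ℕ) (ρ : Fin 16) (i j x : ℕ) :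
    arrOf n (update m (cell n ρ (pr i j)) x) = (arrOf n m).put ρ i j x := by
  funext ρ' i' j'
  have key : cell n ρ' (pr i' j') = cell n ρ (pr i j) ↔ ρ' = ρ ∧ i' = i ∧ j' = j := by
    rw [cell_inj (by omega) (by omega), pr_inj, Fin.ext_iff]
  simp only [arrOf, Arr.put, update_apply, key]
  by_cases h1 : ρ' = ρ
  · subst h1
    by_cases h2 : i' = i
    · subst h2
      by_cases h3 : j' = j <;> simp [h3, arrOf]
    · simp [h2, arrOf]
  · simp [h1, arrOf]

lemma arrOf_update {n : ℕ} {m : ℕ → ℕ} {t y x : ℕ} (h : 16 ≤ t) (h' : t < 32) :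
    arrOf n (update m (cell n t y) x) = arrOf n m := by
  grind [arrOf, update_of_ne, cell_inj]

lemma inp_ne_cell (n a t y : ℕ) : (a * if a < (n + 4) * (n + 4) then 1 else 0) ≠ cell n t y := by
  grind [cell]

/-- The tags allowed here are those of the arrays, of counters and indices of levels that are not
active, and of unused cells. The inputs lie below all tagged cells. -/
lemma Inv.upd {X : Ctx} {v cs : List ℕ} {m : ℕ → ℕ} (h : Inv X v cs m) {t y x : ℕ}
    (hx : x ≤ X.top) (ht : t < 32)
    (ht' : t < 16 ∨ ((t = 16 ∨ t = 17) ∧ v.length ≤ y) ∨ 18 < t) :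
    Inv X v cs (update m (cell (X.inp 0) t y) x) where
  inp a := by rw [update_of_ne (inp_ne_cell _ _ _ _)]; exact h.inp a
  top := by
    rw [update_of_ne]
    · exact h.top
    grind [cell_inj]
  le c := by
    by_cases hc : c = cell (X.inp 0) t y
    · grind
    · rw [update_of_ne hc]; exact h.le c
  idx i hi := by
    rw [update_of_ne]
    · exact h.idx i hi
    grind [cell_inj]
  cnt i hi := by
    rw [update_of_ne]
    · exact h.cnt i hi
    grind [cell_inj]

lemma Inv.push {X : Ctx} {v cs : List ℕ} {m : ℕ → ℕ} {i c : ℕ} (h : Inv X v cs m)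
    (hl : cs.length = v.length) (hi : m (cell (X.inp 0) 17 v.length) = i + 1)
    (hc : m (cell (X.inp 0) 16 v.length) = c) : Inv X (v ++ [i]) (cs ++ [c]) m where
  inp := h.inp
  top := h.top
  le := h.le
  idx j hj := by
    rw [List.length_append, List.length_singleton] at hj
    rcases (Nat.lt_succ_iff_lt_or_eq.1 hj) with h1 | rfl
    · rw [h.idx j h1, List.getD_append _ _ _ _ h1]
    grind
  cnt j hj := by
    rw [List.length_append, List.length_singleton] at hj
    rcases (Nat.lt_succ_iff_lt_or_eq.1 hj) with h1 | rfl
    · rw [h.cnt j h1, List.getD_append _ _ _ _ (by omega)]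
    grind

lemma Inv.pop {X : Ctx} {v cs : List ℕ} {m : ℕ → ℕ} {i c : ℕ}
    (h : Inv X (v ++ [i]) (cs ++ [c]) m) (hl : cs.length = v.length) : Inv X v cs m ∧
      m (cell (X.inp 0) 17 v.length) = i + 1 ∧ m (cell (X.inp 0) 16 v.length) = c := by
  refine ⟨⟨h.inp, h.top, h.le, fun j hj => ?_, fun j hj => ?_⟩, ?_, ?_⟩
  · rw [h.idx j (by grind), List.getD_append _ _ _ _ hj]
  · rw [h.cnt j (by grind), List.getD_append _ _ _ _ (by omega)]
  · rw [h.idx _ (by simp)]; simp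
  · rw [h.cnt _ (by simp), ← hl]; simp

/-- The arrays and qubits of a machine state. -/
def State.abs {q : ℕ} (n : ℕ) (s : State q) : St q := ⟨arrOf n s.mem, s.amp⟩

variable {q : ℕ}

/-- The indices that a loop has still to visit when its counter is `c`. -/
def remaining (rev : Bool) (m c : ℕ) : List ℕ :=
  if rev then (List.range c).reverse else List.range' (m - c) c

lemma remaining_self (rev : Bool) (m : ℕ) : remaining rev m m = order rev m := by
  simp [remaining, order, List.range_eq_range']

lemma remaining_zero (rev : Bool) (m : ℕ) : remaining rev m 0 = [] := by
  simp [remaining]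

lemma remaining_succ (rev : Bool) {m c : ℕ} (h : c + 1 ≤ m) :
    remaining rev m (c + 1) = (if rev then c else m - (c + 1)) :: remaining rev m c := by
  cases rev
  · simp only [remaining, Bool.false_eq_true, if_false, List.range'_succ]
    grind
  · simp [remaining, List.range_succ]

lemma tick_le {τ κ : ℝ≥0∞} {c w W L : ℕ} (hκ : τ * (W * (L + 1) ^ 2 : ℕ) ≤ κ)
    (hc : c ≤ w * (L + 1) ^ 2) (hw : w ≤ W) : τ * (c : ℕ) ≤ κ :=
  (mul_le_mul_right (by exact_mod_cast hc.trans (Nat.mul_le_mul_right _ hw)) τ).trans hκ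

lemma one_le_sq (L : ℕ) : 1 ≤ (L + 1) ^ 2 := Nat.one_le_pow _ _ (Nat.succ_pos _)

lemma St.ext' {s t : St q} (h : s.arr = t.arr) (h' : s.amp = t.amp) : s = t := by
  cases s; simp_all

/-- The iterates that define the value of a loop. -/
noncomputable def loopIter (τ : ℝ≥0∞) (e : Expr) (c : Cmd) (f : State q → ℝ≥0∞) (N : ℕ) :
    State q → ℝ≥0∞ :=
  (fun (X : State q → ℝ≥0∞) (s : State q) =>
        τ * (1 + e.cost s.mem : ℕ) +
          if e.eval s.mem = 0 then f s else expect τ c X s)^[N] fun _ => 0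

lemma loopIter_succ (τ : ℝ≥0∞) (e : Expr) (c : Cmd) (f : State q → ℝ≥0∞) (N : ℕ)
    (s : State q) : loopIter τ e c f (N + 1) s = τ * (1 + e.cost s.mem : ℕ) +
      if e.eval s.mem = 0 then f s else expect τ c (loopIter τ e c f N) s := by
  simp [loopIter, iterate_succ_apply']

lemma expect_loop (τ : ℝ≥0∞) (e : Expr) (c : Cmd) (f : State q → ℝ≥0∞) (s : State q) :
    expect τ (.loop e c) f s = ⨆ N, loopIter τ e c f N s := rfl

lemma abs_write_arr {X : Ctx} (s : State q) (ρ : Fin 16) (i j x : ℕ) :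
    State.abs (X.inp 0) (s.write (cell (X.inp 0) ρ (pr i j)) x)
      = ⟨(State.abs (X.inp 0) s).arr.put ρ i j x, s.amp⟩ :=
  St.ext' (arrOf_update_arr _ _ _ _ _ _) rfl

lemma abs_write {X : Ctx} (s : State q) {t y x : ℕ} (h : 16 ≤ t) (h' : t < 32) :
    State.abs (X.inp 0) (s.write (cell (X.inp 0) t y) x) = State.abs (X.inp 0) s :=
  St.ext' (arrOf_update h h') rfl

lemma write_mem_of_ne (s : State q) {n t y t' y' x : ℕ} (h : t' ≠ t) (ht : t < 32)
    (ht' : t' < 32) : (s.write (cell n t y) x).mem (cell n t' y') = s.mem (cell n t' y') := by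
  simp_all [State.write, update_of_ne, cell_inj]

/-- Two-sided comparison between a compiled program and its semantics. -/
def Simulates (q : ℕ) (X : Ctx) (τ κ : ℝ≥0∞) (g : Prog) : Prop :=
  ∀ (v cs : List ℕ), cs.length = v.length →
    τ * ((g.comp v.length).wt * (X.lg + 1 + 1) ^ 2 : ℕ) ≤ κ →
    ∀ (f₀ f₁ : St q → ℝ≥0∞) (F : State q → ℝ≥0∞),
      (∀ s, Inv X v cs s.mem → f₀ (s.abs (X.inp 0)) ≤ F s ∧ F s ≤ f₁ (s.abs (X.inp 0))) →
      ∀ s, Inv X v cs s.mem →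
        wp X 0 g v f₀ (s.abs (X.inp 0)) ≤ expect τ (g.comp v.length) F s ∧
        expect τ (g.comp v.length) F s ≤ wp X κ g v f₁ (s.abs (X.inp 0))

/-! ### Compiled loops -/

section loop

variable {X : Ctx} {τ κ : ℝ≥0∞} {v cs : List ℕ} {f₀ f₁ : St q → ℝ≥0∞} {F : State q → ℝ≥0∞}

lemma Inv.update_idx {m : ℕ → ℕ} (h : Inv X v cs m) {t x : ℕ} (hx : x ≤ X.top)
    (ht : t = 16 ∨ t = 17) : Inv X v cs (Function.update m (cell (X.inp 0) t v.length) x) :=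
  h.upd hx (by omega) (by omega)

/-- One pass through a compiled body. Loop test and index update are paid by the charge before the
body, the decrement of the counter by the charge in its continuation. The lower bound discards all
costs. -/
lemma loop_step {g : Prog} (ih : Simulates q X τ κ g) (hl : cs.length = v.length) {rev : Bool}
    {W : ℕ} (hκ : τ * (W * (X.lg + 1 + 1) ^ 2 : ℕ) ≤ κ)
    (hW : 1 + (Expr.load (ctE v.length)).wt + (bodyOf rev v.length (g.comp (v.length + 1))).wt ≤ W)
    {m c : ℕ} (hm : m < X.top) (hcm : c + 1 ≤ m) {s : State q} (hs : Inv X v cs s.mem)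
    (hc : s.mem (cell (X.inp 0) 16 v.length) = c + 1)
    (hi : s.mem (cell (X.inp 0) 17 v.length) = if rev then c + 2 else m - (c + 1))
    {LO UP : St q → ℝ≥0∞} {Y : State q → ℝ≥0∞}
    (hY : ∀ s, Inv X v cs s.mem → s.mem (cell (X.inp 0) 16 v.length) = c →
      s.mem (cell (X.inp 0) 17 v.length) = (if rev then c + 1 else m - c) →
        LO (s.abs (X.inp 0)) ≤ Y s ∧ Y s ≤ UP (s.abs (X.inp 0))) :
    wp X 0 g (v ++ [if rev then c else m - (c + 1)]) (fun s => 0 + LO s) (s.abs (X.inp 0)) ≤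
        expect τ (bodyOf rev v.length (g.comp (v.length + 1))) Y s ∧
      τ * (1 + (Expr.load (ctE v.length)).cost s.mem : ℕ) +
        expect τ (bodyOf rev v.length (g.comp (v.length + 1))) Y s ≤
      κ + wp X κ g (v ++ [if rev then c else m - (c + 1)]) (fun s => κ + UP s)
        (s.abs (X.inp 0)) := by
  have hsq := one_le_sq (X.lg + 1)
  simp only [bodyOf, Cmd.wt] at hW
  set d := v.length with hd
  set i₀ := if rev then c else m - (c + 1) with hi₀
  have hlen : (v ++ [i₀]).length = d + 1 := by grind
  have hlen2 : (cs ++ [c + 1]).length = (v ++ [i₀]).length := by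
    grind
  have hgw : τ * ((g.comp (v ++ [i₀]).length).wt * (X.lg + 1 + 1) ^ 2 : ℕ) ≤ κ := by
    rw [hlen]; exact tick_le hκ le_rfl (by omega)
  set s₁ := s.write (cell (X.inp 0) 17 d) (i₀ + 1) with hs₁
  have hexp : expect τ (bodyOf rev d (g.comp (d + 1))) Y s =
      τ * (1 + (ixE d).cost s.mem + (incE rev d).cost s.mem : ℕ) +
        expect τ (g.comp (d + 1)) (expect τ (.store (ctE d) (decE d)) Y) s₁ := by
    have e1 : (incE rev d).eval s.mem = i₀ + 1 := by
      grind [incE, Expr.eval, ixE, cellE_eval, Op.eval]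
    rw [hs₁, ← e1, ← show (ixE d).eval s.mem = cell (X.inp 0) 17 d from cellE_eval hs _ _]
    rfl
  have hs₁i : Inv X v cs s₁.mem := hs.update_idx (by grind) (Or.inr rfl)
  have hinv : Inv X (v ++ [i₀]) (cs ++ [c + 1]) s₁.mem := by
    refine hs₁i.push hl (by simp [hs₁, State.write, hd]) ?_
    grind [write_mem_of_ne]
  have habs : s₁.abs (X.inp 0) = s.abs (X.inp 0) := abs_write s (by omega) (by omega)
  have post : ∀ t : State q, Inv X (v ++ [i₀]) (cs ++ [c + 1]) t.mem →
      LO (t.abs (X.inp 0)) ≤ Y (t.write ((ctE d).eval t.mem) ((decE d).eval t.mem)) ∧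
      Y (t.write ((ctE d).eval t.mem) ((decE d).eval t.mem)) ≤ UP (t.abs (X.inp 0)) := by
    intro t ht
    obtain ⟨ht1, ht2, ht3⟩ := ht.pop hl
    rw [← hd] at ht2 ht3
    simp only [decE, Expr.eval, ctE, cellE_eval ht1, ht3, Op.eval, Nat.add_sub_cancel]
    rw [← abs_write (X := X) t (t := 16) (y := d) (x := c) (by omega) (by omega)]
    refine hY (t.write _ c) (ht1.update_idx (by omega) (Or.inl rfl)) (by simp [State.write]) ?_
    grind [write_mem_of_ne]
  rw [hexp, ← habs, ← hlen]
  constructor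
  · refine le_trans ?_ le_add_self
    refine (ih _ _ hlen2 hgw (fun s => 0 + LO s) (fun _ => ⊤) _
      (fun t ht => ⟨?_, le_top⟩) s₁ hinv).1
    rw [zero_add]
    exact (post t ht).1.trans le_add_self
  · rw [← add_assoc, ← mul_add, ← Nat.cast_add]
    have h1 := (Expr.load (ctE d)).cost_le hs.lt
    have h2 := (ixE d).cost_le hs.lt
    have h3 := (incE rev d).cost_le hs.lt
    refine add_le_add (tick_le hκ (w := 1 + (Expr.load (ctE d)).wt + (1 + (ixE d).wt +
      (incE rev d).wt)) (by grind) (by omega)) (ih _ _ hlen2 hgw (fun _ => 0)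
      (fun s => κ + UP s) _ (fun t ht => ⟨zero_le, ?_⟩) s₁ hinv).2
    have hc1 := (ctE d).cost_le ht.lt
    have hc2 := (decE d).cost_le ht.lt
    exact add_le_add (tick_le hκ (w := 1 + (ctE d).wt + (decE d).wt) (by grind) (by omega))
      (post t ht).2

/-- Induction on the counter c. The lower bound is reached by the iterate cut off after c + 1 tests,
and the upper bound holds for all iterates, so the supremum that defines the loop is enclosed by
both. -/
lemma loop_spec {g : Prog} (ih : Simulates q X τ κ g) (hl : cs.length = v.length) (rev : Bool)
    {W : ℕ} (hκ : τ * (W * (X.lg + 1 + 1) ^ 2 : ℕ) ≤ κ)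
    (hW : 1 + (Expr.load (ctE v.length)).wt
      + (bodyOf rev v.length (g.comp (v.length + 1))).wt ≤ W)
    (hF : ∀ s, Inv X v cs s.mem → f₀ (s.abs (X.inp 0)) ≤ F s ∧ F s ≤ f₁ (s.abs (X.inp 0)))
    {m : ℕ} (hm : m < X.top) :
    ∀ c ≤ m, ∀ s, Inv X v cs s.mem → s.mem (cell (X.inp 0) 16 v.length) = c →
      s.mem (cell (X.inp 0) 17 v.length) = (if rev then c + 1 else m - c) →
      (remaining rev m c).foldr (fun i F s => 0 + wp X 0 g (v ++ [i]) (fun s => 0 + F s) s)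
          (fun s => 0 + f₀ s) (s.abs (X.inp 0))
        ≤ loopIter τ (.load (ctE v.length))
            (bodyOf rev v.length (g.comp (v.length + 1))) F (c + 1) s ∧
      ∀ N, loopIter τ (.load (ctE v.length))
            (bodyOf rev v.length (g.comp (v.length + 1))) F N s ≤
        (remaining rev m c).foldr (fun i F s => κ + wp X κ g (v ++ [i]) (fun s => κ + F s) s)
          (fun s => κ + f₁ s) (s.abs (X.inp 0)) := by
  intro c
  have hsq := one_le_sq (X.lg + 1)
  induction c with
  | zero =>
    intro _ s hs hc _
    have h0 : (Expr.load (ctE v.length)).eval s.mem = 0 := by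
      grind [Expr.eval, ctE, cellE_eval]
    have hcost := (Expr.load (ctE v.length)).cost_le hs.lt
    have key : τ * (1 + (Expr.load (ctE v.length)).cost s.mem : ℕ) ≤ κ :=
      tick_le hκ (w := 1 + (Expr.load (ctE v.length)).wt) (by grind) (by omega)
    rw [remaining_zero]
    refine ⟨?_, fun N => ?_⟩
    · rw [loopIter_succ, if_pos h0]
      simp only [List.foldr_nil, zero_add]
      exact (hF s hs).1.trans le_add_self
    · cases N with
      | zero => exact zero_le
      | succ N =>
        simp_all [loopIter_succ, if_pos, add_le_add]
  | succ c hI =>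
    intro hcm s hs hc hi
    have hI := hI (by omega)
    have h0 : (Expr.load (ctE v.length)).eval s.mem ≠ 0 := by
      grind [Expr.eval, ctE, cellE_eval]
    rw [remaining_succ rev hcm]
    simp only [List.foldr_cons]
    refine ⟨?_, fun N => ?_⟩
    · rw [loopIter_succ, if_neg h0, zero_add]
      exact (loop_step ih hl hκ hW hm hcm hs hc hi (UP := fun _ => ⊤)
        fun s' h1 h2 h3 => ⟨(hI s' h1 h2 h3).1, le_top⟩).1.trans le_add_self
    · cases N with
      | zero => exact zero_le
      | succ N =>
        rw [loopIter_succ, if_neg h0]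
        exact (loop_step ih hl hκ hW hm hcm hs hc hi (LO := fun _ => 0)
          fun s' h1 h2 h3 => ⟨zero_le, (hI s' h1 h2 h3).2 N⟩).2

end loop

lemma abs_arr (n : ℕ) (s : State q) : (s.abs n).arr = arrOf n s.mem := rfl
lemma abs_amp (n : ℕ) (s : State q) : (s.abs n).amp = s.amp := rfl

/-- Structural induction. All stored numbers are reduced modulo `X.top`, so cells have at most lg +
1 bits and a command costs at most its weight times (lg + 2)². One charge κ covers this. -/
lemma simulates (X : Ctx) (τ κ : ℝ≥0∞) (g : Prog) : Simulates q X τ κ g := by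
  have hsq := one_le_sq (X.lg + 1)
  induction g with
  | set ρ i j e =>
    intro v cs hl hκ f₀ f₁ F hF s hs
    simp only [Prog.comp, wp, expect, abs_arr, abs_amp, cellE_eval hs, modE_eval hs, prE, Expr.eval, Op.eval,
      Exp.comp_eval hs]
    have hlt := (Nat.mod_lt (e.ev X v (arrOf (X.inp 0) s.mem)) X.top_pos).le
    have h := hF (s.write (cell (X.inp 0) ρ (pr (i.ev X v (arrOf (X.inp 0) s.mem))
      (j.ev X v (arrOf (X.inp 0) s.mem)))) (e.ev X v (arrOf (X.inp 0) s.mem) % X.top))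
      (hs.upd hlt (by omega) (by omega))
    rw [abs_write_arr] at h
    have h1 := (cellE ρ (prE (i.comp v.length) (j.comp v.length))).cost_le hs.lt
    have h2 := (modE (e.comp v.length)).cost_le hs.lt
    refine ⟨?_, add_le_add (tick_le hκ ?_ le_rfl) h.2⟩
    · rw [zero_add]; exact h.1.trans le_add_self
    · simp only [Prog.comp, Cmd.wt]
      grind [prE]
  | rnd ρ i j e =>
    intro v cs hl hκ f₀ f₁ F hF s hs
    simp only [Prog.comp, wp, expect, abs_arr, abs_amp, cellE_eval hs, modE_eval hs, prE, Expr.eval, Op.eval,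
      Exp.comp_eval hs]
    have hlt := (Nat.mod_lt (e.ev X v (arrOf (X.inp 0) s.mem)) X.top_pos).le
    have h : ∀ x ≤ X.top, _ := fun x hx =>
      hF (s.write (cell (X.inp 0) ρ (pr (i.ev X v (arrOf (X.inp 0) s.mem))
      (j.ev X v (arrOf (X.inp 0) s.mem)))) x) (hs.upd hx (by omega) (by omega))
    simp only [abs_write_arr] at h
    have h1 := (cellE ρ (prE (i.comp v.length) (j.comp v.length))).cost_le hs.lt
    have h2 := (modE (e.comp v.length)).cost_le hs.lt
    have key : τ * ((1 + (cellE ρ (prE (i.comp v.length) (j.comp v.length))).cost s.mem +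
        (modE (e.comp v.length)).cost s.mem : ℕ)) ≤ κ := by
      refine tick_le hκ ?_ le_rfl
      simp only [Prog.comp, Cmd.wt]
      grind
    refine ⟨?_, add_le_add key ?_⟩
    · rw [zero_add]
      refine le_trans ?_ le_add_self
      by_cases h0 : e.ev X v (arrOf (X.inp 0) s.mem) % X.top = 0
      · refine (le_of_eq (if_pos h0)).trans (le_trans ?_ (le_of_eq (if_pos h0).symm))
        exact (h 0 (Nat.zero_le _)).1
      · refine (le_of_eq (if_neg h0)).trans (le_trans ?_ (le_of_eq (if_neg h0).symm))
        refine ENNReal.div_le_div_right (sum_le_sum fun x hx => ?_) _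
        exact (h x (by grind)).1
    · by_cases h0 : e.ev X v (arrOf (X.inp 0) s.mem) % X.top = 0
      · refine (le_of_eq (if_pos h0)).trans (le_trans ?_ (le_of_eq (if_pos h0).symm))
        exact (h 0 (Nat.zero_le _)).2
      · refine (le_of_eq (if_neg h0)).trans (le_trans ?_ (le_of_eq (if_neg h0).symm))
        refine ENNReal.div_le_div_right (sum_le_sum fun x hx => ?_) _
        exact (h x (by grind)).2
  | gate a b t =>
    intro v cs hl hκ f₀ f₁ F hF s hs
    simp only [Prog.comp, wp, expect, abs_arr, abs_amp, Exp.comp_eval hs]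
    have h := hF ⟨s.mem, toffoli (a.ev X v (arrOf (X.inp 0) s.mem))
      (b.ev X v (arrOf (X.inp 0) s.mem)) (t.ev X v (arrOf (X.inp 0) s.mem)) s.amp⟩ hs
    have h1 := (a.comp v.length).cost_le hs.lt
    have h2 := (b.comp v.length).cost_le hs.lt
    have h3 := (t.comp v.length).cost_le hs.lt
    refine ⟨?_, add_le_add (tick_le hκ ?_ le_rfl) h.2⟩
    · rw [zero_add]; exact h.1.trans le_add_self
    · simp only [Prog.comp, Cmd.wt]; grind
  | rot t x y =>
    intro v cs hl hκ f₀ f₁ F hF s hs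
    simp only [Prog.comp, wp, expect, abs_arr, abs_amp, Exp.comp_eval hs]
    have h := hF ⟨s.mem, rotate (t.ev X v (arrOf (X.inp 0) s.mem))
      (x.ev X v (arrOf (X.inp 0) s.mem)) (y.ev X v (arrOf (X.inp 0) s.mem)) s.amp⟩ hs
    have h1 := (x.comp v.length).cost_le hs.lt
    have h2 := (y.comp v.length).cost_le hs.lt
    have h3 := (t.comp v.length).cost_le hs.lt
    refine ⟨?_, add_le_add (tick_le hκ ?_ le_rfl) h.2⟩
    · rw [zero_add]; exact h.1.trans le_add_self
    · simp only [Prog.comp, Cmd.wt]; grind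
  | meas t ρ i j =>
    intro v cs hl hκ f₀ f₁ F hF s hs
    simp only [Prog.comp, wp, expect, abs_arr, abs_amp, cellE_eval hs, prE, Expr.eval, Op.eval, Exp.comp_eval hs]
    have h : ∀ x ≤ X.top, ∀ ψ : QState q, _ := fun x hx ψ =>
      hF (State.mk (update s.mem (cell (X.inp 0) ρ (pr (i.ev X v (arrOf (X.inp 0) s.mem))
      (j.ev X v (arrOf (X.inp 0) s.mem)))) x) ψ) (hs.upd hx (by omega) (by omega))
    have habs : ∀ (x : ℕ) (ψ : QState q), (State.mk (update s.mem (cell (X.inp 0) ρ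
        (pr (i.ev X v (arrOf (X.inp 0) s.mem)) (j.ev X v (arrOf (X.inp 0) s.mem)))) x) ψ).abs
          (X.inp 0) = ⟨(arrOf (X.inp 0) s.mem).put ρ (i.ev X v (arrOf (X.inp 0) s.mem))
          (j.ev X v (arrOf (X.inp 0) s.mem)) x, ψ⟩ :=
      fun x ψ => St.ext' (arrOf_update_arr _ _ _ _ _ _) rfl
    simp only [habs] at h
    have h1 := (cellE ρ (prE (i.comp v.length) (j.comp v.length))).cost_le hs.lt
    have h2 := (t.comp v.length).cost_le hs.lt
    have key : τ * ((1 + (t.comp v.length).cost s.mem +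
        (cellE ρ (prE (i.comp v.length) (j.comp v.length))).cost s.mem : ℕ)) ≤ κ := by
      refine tick_le hκ ?_ le_rfl
      simp only [Prog.comp, Cmd.wt]
      grind
    have htop : 1 ≤ X.top := X.top_pos
    have hb : ∀ x : Bool, x.toNat ≤ X.top := fun x => by cases x <;> simp [htop]
    refine ⟨?_, add_le_add key ?_⟩
    · rw [zero_add]
      refine le_trans ?_ le_add_self
      by_cases h0 : t.ev X v (arrOf (X.inp 0) s.mem) < q
      · refine (le_of_eq (dif_pos h0)).trans (le_trans ?_ (le_of_eq (dif_pos h0).symm))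
        refine sum_le_sum fun x _ => mul_le_mul_right ?_ _
        exact (h _ (hb x) _).1
      · refine (le_of_eq (dif_neg h0)).trans (le_trans ?_ (le_of_eq (dif_neg h0).symm))
        exact (h 0 (Nat.zero_le _) _).1
    · by_cases h0 : t.ev X v (arrOf (X.inp 0) s.mem) < q
      · refine (le_of_eq (dif_pos h0)).trans (le_trans ?_ (le_of_eq (dif_pos h0).symm))
        refine sum_le_sum fun x _ => mul_le_mul_right ?_ _
        exact (h _ (hb x) _).2
      · refine (le_of_eq (dif_neg h0)).trans (le_trans ?_ (le_of_eq (dif_neg h0).symm))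
        exact (h 0 (Nat.zero_le _) _).2
  | seq g h ihg ihh =>
    intro v cs hl hκ f₀ f₁ F hF s hs
    refine ihg v cs hl (tick_le hκ le_rfl ?_) _ _ _ (fun s hs =>
      ihh v cs hl (tick_le hκ le_rfl ?_) _ _ _ hF s hs) s hs <;>
    simp [Prog.comp, Cmd.wt] <;> omega
  | ite e g h ihg ihh =>
    intro v cs hl hκ f₀ f₁ F hF s hs
    simp only [Prog.comp, wp, expect, abs_arr, abs_amp, Exp.comp_eval hs]
    have h1 := (e.comp v.length).cost_le hs.lt
    have hg := ihg v cs hl (tick_le hκ le_rfl (by grind [Prog.comp, Cmd.wt]))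
      _ _ _ hF s hs
    have hh := ihh v cs hl (tick_le hκ le_rfl (by simp [Prog.comp, Cmd.wt]))
      _ _ _ hF s hs
    refine ⟨?_, add_le_add (tick_le hκ (w := 1 + (e.comp v.length).wt) (by grind)
      (by grind [Prog.comp, Cmd.wt])) ?_⟩
    · rw [zero_add]
      refine le_trans ?_ le_add_self
      grind
    grind
  | loop rev e g ih =>
    intro v cs hl hκ f₀ f₁ F hF s hs
    simp only [Prog.comp] at hκ ⊢
    simp only [wp, expect, expect_loop, abs_arr, Exp.comp_eval hs, modE_eval hs]
    rw [show (ctE v.length).eval s.mem = cell (X.inp 0) 16 v.length from cellE_eval hs _ _]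
    set m := e.ev X v (arrOf (X.inp 0) s.mem) % X.top with hm
    have hmt : m < X.top := Nat.mod_lt _ X.top_pos
    set s₁ := s.write (cell (X.inp 0) 16 v.length) m with hs₁
    have hs₁i : Inv X v cs s₁.mem := hs.update_idx hmt.le (Or.inl rfl)
    have hs₁c : s₁.mem (cell (X.inp 0) 16 v.length) = m := by simp [hs₁, State.write]
    have e1 : (ixE v.length).eval s₁.mem = cell (X.inp 0) 17 v.length := cellE_eval hs₁i _ _
    have e2 : (if rev then Expr.op .add (.load (ctE v.length)) (.const 1) else .const 0).eval s₁.mem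
        = if rev then m + 1 else m - m := by
      grind [Expr.eval, Op.eval, ctE, cellE_eval]
    rw [e1, e2]
    set s₂ := s₁.write (cell (X.inp 0) 17 v.length) (if rev then m + 1 else m - m) with hs₂
    have hs₂i : Inv X v cs s₂.mem :=
      hs₁i.update_idx (by grind) (Or.inr rfl)
    have hs₂c : s₂.mem (cell (X.inp 0) 16 v.length) = m := by
      simp_all [write_mem_of_ne]
    have hs₂d : s₂.mem (cell (X.inp 0) 17 v.length) = if rev then m + 1 else m - m := by
      simp [hs₂, State.write]
    have habs : s₂.abs (X.inp 0) = s.abs (X.inp 0) := by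
      simp_all [abs_write]
    have spec := loop_spec ih hl rev hκ (by grind [Cmd.wt]) hF hmt m le_rfl s₂ hs₂i
      hs₂c hs₂d
    rw [remaining_self, habs] at spec
    refine ⟨?_, ?_⟩
    · rw [zero_add]
      refine (spec.1.trans (le_iSup (fun N => loopIter τ _ _ F N s₂) _)).trans ?_
      exact le_add_self.trans le_add_self
    · rw [← add_assoc, ← mul_add, ← Nat.cast_add]
      refine add_le_add ?_ (iSup_le spec.2)
      have h1 := (ctE v.length).cost_le hs.lt
      have h2 := (modE (e.comp v.length)).cost_le hs.lt
      have h3 := (ixE v.length).cost_le hs₁i.lt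
      have h4 := (if rev then Expr.op .add (.load (ctE v.length)) (.const 1) else .const 0).cost_le hs₁i.lt
      refine tick_le hκ (w := (1 + (ctE v.length).wt +
        (modE (e.comp v.length)).wt) + (1 + (ixE v.length).wt +
          (if rev then Expr.op .add (.load (ctE v.length)) (.const 1) else .const 0).wt)) ?_ ?_
      · grind
      simp [Cmd.wt]

/-! ## Gates on state vectors -/

/-- State vectors of norm one. -/
def QState.Normalized (ψ : QState q) : Prop := ∑ b, ‖ψ b‖ ^ 2 = 1

/-- The action of the Toffoli gate on basis states. -/
def tofMap (c₁ c₂ t : ℕ) (b : Fin q → Bool) : Fin q → Bool :=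
  if h : c₁ < q ∧ c₂ < q ∧ t < q ∧ t ≠ c₁ ∧ t ≠ c₂ then
    if b ⟨c₁, h.1⟩ && b ⟨c₂, h.2.1⟩ then
      update b ⟨t, h.2.2.1⟩ (!b ⟨t, h.2.2.1⟩) else b
  else b

lemma toffoli_apply (c₁ c₂ t : ℕ) (ψ : QState q) (b : Fin q → Bool) :
    toffoli c₁ c₂ t ψ b = ψ (tofMap c₁ c₂ t b) := by
  unfold toffoli tofMap
  split
  · grind
  · rfl

lemma tofMap_involutive (c₁ c₂ t : ℕ) : Involutive (tofMap (q := q) c₁ c₂ t) := by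
  intro b
  by_cases h : c₁ < q ∧ c₂ < q ∧ t < q ∧ t ≠ c₁ ∧ t ≠ c₂
  · have h1 : (⟨c₁, h.1⟩ : Fin q) ≠ ⟨t, h.2.2.1⟩ := by
      grind
    have h2 : (⟨c₂, h.2.1⟩ : Fin q) ≠ ⟨t, h.2.2.1⟩ := by
      grind
    simp only [tofMap, dif_pos h]
    grind
  · simp [tofMap, dif_neg h]

lemma toffoli_normalized (c₁ c₂ t : ℕ) {ψ : QState q} (h : ψ.Normalized) :
    (toffoli c₁ c₂ t ψ).Normalized := by
  unfold QState.Normalized at *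
  simp only [toffoli_apply]
  rw [← h]
  exact Equiv.sum_comp (tofMap_involutive c₁ c₂ t).toPerm fun b => ‖ψ b‖ ^ 2

/-- Flip one qubit. -/
def flip (t : Fin q) (b : Fin q → Bool) : Fin q → Bool := update b t (!b t)

lemma flip_involutive (t : Fin q) : Involutive (flip t) := by
  intro b; simp [flip]

/-- Doubling a sum over basis states allows each state to be paired with its flip. -/
lemma sum_congr_of_flip (t : Fin q) {F G : (Fin q → Bool) → ℂ}
    (h : ∀ b, F b + F (flip t b) = G b + G (flip t b)) : ∑ b, F b = ∑ b, G b := by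
  have key : ∀ H : (Fin q → Bool) → ℂ, 2 * ∑ b, H b = ∑ b, (H b + H (flip t b)) := by
    intro H
    have : ∑ b, H (flip t b) = ∑ b, H b := Equiv.sum_comp (flip_involutive t).toPerm H
    grind [sum_add_distrib]
  grind

/-- The probability parameter of `rotate`. -/
noncomputable def rotProb (x y : ℕ) : ℝ := min ((x : ℝ) / y) 1

lemma rotProb_nonneg (x y : ℕ) : 0 ≤ rotProb x y := le_min (by positivity) zero_le_one
lemma rotProb_le_one (x y : ℕ) : rotProb x y ≤ 1 := min_le_right _ _

lemma rotate_apply (t : Fin q) (x y : ℕ) (ψ : QState q) (b : Fin q → Bool) :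
    rotate t x y ψ b =
      if b t then (√(rotProb x y) : ℂ) * ψ (update b t false)
        - (√(1 - rotProb x y) : ℂ) * ψ (update b t true)
      else (√(1 - rotProb x y) : ℂ) * ψ (update b t false)
        + (√(rotProb x y) : ℂ) * ψ (update b t true) := by
  unfold rotate
  rw [dif_pos t.2]
  rfl

lemma rotate_of_le {t : ℕ} (h : q ≤ t) (x y : ℕ) (ψ : QState q) : rotate t x y ψ = ψ := by
  unfold rotate; grind

lemma sqrt_sq_add (x y : ℕ) :
    (√(rotProb x y) : ℂ) * √(rotProb x y) + (√(1 - rotProb x y) : ℂ) * √(1 - rotProb x y) = 1 := by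
  rw [← Complex.ofReal_mul, ← Complex.ofReal_mul, Real.mul_self_sqrt (rotProb_nonneg _ _),
    Real.mul_self_sqrt (by simp [rotProb_le_one])]
  simp

lemma rotate_rotate (t x y : ℕ) (ψ : QState q) : rotate t x y (rotate t x y ψ) = ψ := by
  rcases Nat.lt_or_ge t q with h | h
  · lift t to Fin q using h
    funext b
    have := sqrt_sq_add x y
    rw [rotate_apply]
    simp only [rotate_apply, update_self, update_idem, if_true,
      Bool.false_eq_true, if_false]
    cases hb : b t
    · have : update b t false = b := by grind
      grind
    · have : update b t true = b := by grind
      grind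
  simp_all [rotate_of_le]

/-- The matrix of the gate is real and symmetric. Together with `rotate_rotate` this makes it
unitary. -/
lemma rotate_symm (t x y : ℕ) (φ ψ : QState q) :
    ∑ b, rotate t x y φ b * ψ b = ∑ b, φ b * rotate t x y ψ b := by
  rcases Nat.lt_or_ge t q with h | h
  · lift t to Fin q using h
    refine sum_congr_of_flip t fun b => ?_
    cases hb : b t
    · have h0 : update b t false = b := by grind
      simp only [rotate_apply, flip, hb, update_self, update_idem,
        Bool.false_eq_true, if_false, h0, Bool.not_false, if_true]
      ring
    · have h0 : update b t true = b := by grind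
      simp only [rotate_apply, flip, hb, update_self, update_idem,
        Bool.false_eq_true, if_false, h0, Bool.not_true, if_true]
      ring
  simp_all [rotate_of_le]

lemma rotate_star (t x y : ℕ) (ψ : QState q) (b : Fin q → Bool) :
    rotate t x y (fun b => star (ψ b)) b = star (rotate t x y ψ b) := by
  rcases Nat.lt_or_ge t q with h | h
  · lift t to Fin q using h
    rw [rotate_apply, rotate_apply]
    split <;> simp
  simp_all [rotate_of_le]

lemma normalized_iff {ψ : QState q} : ψ.Normalized ↔ ∑ b, star (ψ b) * ψ b = 1 := by
  have h : ∑ b, star (ψ b) * ψ b = ((∑ b, ‖ψ b‖ ^ 2 : ℝ) : ℂ) := by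
    simp [sum_congr, Complex.conj_mul']
  rw [h, QState.Normalized]
  norm_cast

lemma rotate_normalized (t x y : ℕ) {ψ : QState q} (h : ψ.Normalized) :
    (rotate t x y ψ).Normalized := by
  rw [normalized_iff] at *
  simp only [← rotate_star]
  rw [rotate_symm, rotate_rotate, h]

lemma measureProb_nonneg (t : Fin q) (v : Bool) (ψ : QState q) : 0 ≤ measureProb t v ψ :=
  sum_nonneg fun _ _ => by simp

lemma sum_measureProb (t : Fin q) {ψ : QState q} (h : ψ.Normalized) :
    ∑ v : Bool, ENNReal.ofReal (measureProb t v ψ) = 1 := by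
  rw [← ENNReal.ofReal_sum_of_nonneg fun _ _ => measureProb_nonneg _ _ _]
  simp only [measureProb]
  rw [sum_fiberwise, h, ENNReal.ofReal_one]

lemma collapse_normalized (t : Fin q) (v : Bool) {ψ : QState q} (h : measureProb t v ψ ≠ 0) :
    (collapse t v ψ).Normalized := by
  have h0 := measureProb_nonneg t v ψ
  unfold QState.Normalized collapse
  have : ∀ b, ‖(if b t = v then ψ b / (√(measureProb t v ψ) : ℂ) else 0 : ℂ)‖ ^ 2
      = if b t = v then ‖ψ b‖ ^ 2 / measureProb t v ψ else 0 := by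
    intro b
    split
    · rw [norm_div, div_pow, Complex.norm_real, Real.norm_eq_abs, sq_abs, Real.sq_sqrt h0]
    · simp
  simp only [this]
  rw [← sum_filter, ← sum_div]
  exact div_self h

/-! ## Properties of the expectation -/

section wp

variable {X : Ctx} {κ κ' c : ℝ≥0∞} {v : List ℕ} {f h : St q → ℝ≥0∞} {g : Prog} {s : St q}

/-- It suffices to compare on normalized states. Gates preserve the norm, and so does a collapse
unless the outcome has probability zero, in which case its summand vanishes. -/
lemma wp_mono : ∀ (g : Prog) (v : List ℕ) (f h : St q → ℝ≥0∞) (s : St q), s.amp.Normalized →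
    (∀ s : St q, s.amp.Normalized → f s ≤ h s) → wp X κ g v f s ≤ wp X κ g v h s := by
  intro g
  induction g with
  | set ρ i j e => intro v f h s hs hf; exact add_le_add le_rfl (hf _ hs)
  | rnd ρ i j e =>
    intro v f h s hs hf
    refine add_le_add le_rfl ?_
    grind [ENNReal.div_le_div_right, sum_le_sum]
  | gate a b t =>
    intro v f h s hs hf
    exact add_le_add le_rfl (hf ⟨_, _⟩ (toffoli_normalized _ _ _ hs))
  | rot t x y =>
    intro v f h s hs hf
    exact add_le_add le_rfl (hf ⟨_, _⟩ (rotate_normalized _ _ _ hs))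
  | meas t ρ i j =>
    intro v f h s hs hf
    refine add_le_add le_rfl ?_
    split
    · refine sum_le_sum fun x _ => ?_
      by_cases h0 : measureProb ⟨t.ev X v s.arr, by omega⟩ x s.amp = 0
      · simp [h0]
      grind [mul_le_mul_right, collapse_normalized]
    grind
  | seq g h ihg ihh => intro v f h' s hs hf; exact ihg _ _ _ _ hs fun s hs => ihh _ _ _ _ hs hf
  | ite e g h ihg ihh =>
    intro v f h' s hs hf
    refine add_le_add le_rfl ?_
    grind
  | loop rev e g ih =>
    intro v f h s hs hf
    refine add_le_add le_rfl ?_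
    generalize order rev (e.ev X v s.arr % X.top) = l
    induction l generalizing s with
    | nil => simp_all [add_le_add, le_rfl]
    | cons i l ihl =>
      grind [add_le_add, le_rfl]

lemma wp_congr (hs : s.amp.Normalized) (hf : ∀ s : St q, s.amp.Normalized → f s = h s) :
    wp X κ g v f s = wp X κ g v h s :=
  le_antisymm (wp_mono _ _ _ _ _ hs fun s hs => (hf s hs).le)
    (wp_mono _ _ _ _ _ hs fun s hs => (hf s hs).ge)

/-- Linearity jointly in the charge per step and the final value. The rules `wp_split`, `wp_add` and
`wp_mul` below are special cases. -/
lemma wp_linear (c κ κ' : ℝ≥0∞) : ∀ (g : Prog) (v : List ℕ) (f h : St q → ℝ≥0∞) (s : St q),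
    wp X (c * κ + κ') g v (fun s => c * f s + h s) s = c * wp X κ g v f s + wp X κ' g v h s := by
  have ring4 : ∀ a b x y : ℝ≥0∞, c * a + b + (c * x + y) = c * (a + x) + (b + y) := by
    grind
  intro g
  induction g with
  | set ρ i j e => intro v f h s; exact ring4 _ _ _ _
  | rnd ρ i j e =>
    intro v f h s
    simp only [wp]
    rw [← ring4]
    congr 1
    split
    · rfl
    · rw [sum_add_distrib, ← mul_sum, ENNReal.add_div, mul_div_assoc]
  | gate a b t => intro v f h s; exact ring4 _ _ _ _
  | rot t x y => intro v f h s; exact ring4 _ _ _ _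
  | meas t ρ i j =>
    intro v f h s
    simp only [wp]
    rw [← ring4]
    congr 1
    split
    · rw [mul_sum, ← sum_add_distrib]
      refine sum_congr rfl fun x _ => by ring
    · rfl
  | seq g h ihg ihh =>
    intro v f h' s
    simp only [wp]
    rw [← ihg]
    congr 1
    grind
  | ite e g h ihg ihh =>
    grind [wp]
  | loop rev e g ih =>
    intro v f h s
    simp only [wp]
    rw [← ring4]
    congr 1
    generalize order rev (e.ev X v s.arr % X.top) = l
    induction l generalizing s with
    | nil => grind
    | cons i l ihl =>
      grind

/-- The expected number of steps separates from the expected final value, so cost and success can be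
analysed independently. -/
lemma wp_split (κ : ℝ≥0∞) (g : Prog) (v : List ℕ) (f : St q → ℝ≥0∞) (s : St q) :
    wp X κ g v f s = κ * wp X 1 g v (fun _ => 0) s + wp X 0 g v f s := by
  have := wp_linear (X := X) κ 1 0 g v (fun _ => 0) f s
  simp_all

lemma wp_add (g : Prog) (v : List ℕ) (f h : St q → ℝ≥0∞) (s : St q) :
    wp X 0 g v (fun s => f s + h s) s = wp X 0 g v f s + wp X 0 g v h s := by
  have := wp_linear (X := X) 1 0 0 g v f h s
  simp_all

/-- Bounded loops halt surely and the outcomes of a measurement have total probability one. -/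
lemma wp_const (c : ℝ≥0∞) : ∀ (g : Prog) (v : List ℕ) (s : St q), s.amp.Normalized →
    wp X 0 g v (fun _ => c) s = c := by
  intro g
  induction g with
  | set ρ i j e => simp [wp]
  | rnd ρ i j e =>
    simp_all [wp, zero_add, sum_const, card_range, nsmul_eq_mul, mul_comm, ENNReal.mul_div_cancel_right, ENNReal.natCast_ne_top]
  | gate a b t => simp [wp]
  | rot t x y => simp [wp]
  | meas t ρ i j =>
    intro v s hs
    simp only [wp, zero_add]
    split
    · rw [← sum_mul, sum_measureProb _ hs, one_mul]
    · rfl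
  | seq g h ihg ihh =>
    simp_all [wp, wp_congr]
  | ite e g h ihg ihh =>
    simp_all [wp, zero_add]
  | loop rev e g ih =>
    intro v s hs
    simp only [wp, zero_add]
    generalize order rev (e.ev X v s.arr % X.top) = l
    induction l generalizing s with
    | nil => rfl
    | cons i l ihl =>
      simp_all [List.foldr_cons, wp_congr]

lemma wp_mul (c : ℝ≥0∞) (g : Prog) (v : List ℕ) (f : St q → ℝ≥0∞) {s : St q}
    (hs : s.amp.Normalized) : wp X 0 g v (fun s => c * f s) s = c * wp X 0 g v f s := by
  have := wp_linear (X := X) c 0 0 g v f (fun _ => 0) s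
  simp_all [wp_const]

/-- A bound for the number of steps of a program whose loop bounds are at most `M`. -/
def Prog.steps (M : ℕ) : Prog → ℕ
  | .set _ _ _ _ => 1
  | .rnd _ _ _ _ => 1
  | .gate _ _ _ => 1
  | .rot _ _ _ => 1
  | .meas _ _ _ _ => 1
  | .seq g h => g.steps M + h.steps M
  | .ite _ g h => 1 + g.steps M + h.steps M
  | .loop _ _ g => 2 + M * (2 + g.steps M)

lemma Prog.steps_le (g : Prog) : ∃ C d : ℕ, ∀ M, g.steps M ≤ C * (M + 1) ^ d := by
  have aux : ∀ (C d C' d' M : ℕ),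
      1 + C * (M + 1) ^ d + C' * (M + 1) ^ d' ≤ (1 + C + C') * (M + 1) ^ (d + d') := by
    intro C d C' d' M
    have h1 : (M + 1) ^ d ≤ (M + 1) ^ (d + d') := Nat.pow_le_pow_right (by omega) (by omega)
    have h2 : (M + 1) ^ d' ≤ (M + 1) ^ (d + d') := Nat.pow_le_pow_right (by omega) (by omega)
    have h3 : 1 ≤ (M + 1) ^ (d + d') := Nat.one_le_pow _ _ (by omega)
    calc _ ≤ 1 * (M + 1) ^ (d + d') + C * (M + 1) ^ (d + d') + C' * (M + 1) ^ (d + d') := by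
          gcongr; omega
      _ = _ := by ring
  induction g with
  | set | rnd | gate | rot | meas => exact ⟨1, 0, fun M => by rfl⟩
  | seq g h ihg ihh =>
    obtain ⟨C, d, h1⟩ := ihg
    obtain ⟨C', d', h2⟩ := ihh
    refine ⟨_, _, fun M => le_trans ?_ (aux C d C' d' M)⟩
    grind [Prog.steps]
  | ite e g h ihg ihh =>
    obtain ⟨C, d, h1⟩ := ihg
    obtain ⟨C', d', h2⟩ := ihh
    refine ⟨_, _, fun M => le_trans ?_ (aux C d C' d' M)⟩
    grind [Prog.steps]
  | loop rev e g ih =>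
    obtain ⟨C, d, h1⟩ := ih
    refine ⟨C + 2, d + 1, fun M => ?_⟩
    have := h1 M
    have h3 : 1 ≤ (M + 1) ^ d := Nat.one_le_pow _ _ (by omega)
    simp only [Prog.steps]
    calc 2 + M * (2 + g.steps M) ≤ 2 * (M + 1) + (M + 1) * g.steps M := by grind
      _ ≤ 2 * (M + 1) * (M + 1) ^ d + (M + 1) * (C * (M + 1) ^ d) :=
          Nat.add_le_add (Nat.le_mul_of_pos_right _ h3) (Nat.mul_le_mul_left _ (h1 M))
      _ = _ := by ring

/-- All loop bounds are at most `M` when the loop variables from level `o` on are smaller than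
`M`. -/
def Prog.Capped (X : Ctx) (M o : ℕ) : ℕ → Prog → Prop
  | d, .seq g h => g.Capped X M o d ∧ h.Capped X M o d
  | d, .ite _ g h => g.Capped X M o d ∧ h.Capped X M o d
  | d, .loop _ e g =>
    (∀ v : List ℕ, v.length = d → (∀ i, o ≤ i → v.getD i 0 < M) → ∀ D, e.ev X v D ≤ M) ∧
      g.Capped X M o (d + 1)
  | _, _ => True

lemma mem_order {rev : Bool} {m i : ℕ} : i ∈ order rev m ↔ i < m := by
  grind [order]

lemma length_order (rev : Bool) (m : ℕ) : (order rev m).length = m := by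
  grind [order]

lemma wp_loop_steps {rev : Bool} {e : Exp} {g : Prog} {v : List ℕ} {s : St q} {m S : ℕ}
    (hm : e.ev X v s.arr % X.top = m)
    (hg : ∀ i < m, ∀ s : St q, s.amp.Normalized → wp X 1 g (v ++ [i]) (fun _ => 0) s ≤ S)
    (hs : s.amp.Normalized) :
    wp X 1 (.loop rev e g) v (fun _ => 0) s ≤ (2 + m * (2 + S) : ℕ) := by
  simp only [wp, hm]
  have hmem : ∀ i ∈ order rev m, i < m := fun i hi => mem_order.1 hi
  have key : ∀ (l : List ℕ), (∀ i ∈ l, i < m) → ∀ s : St q, s.amp.Normalized →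
      l.foldr (fun i F s => 1 + wp X 1 g (v ++ [i]) (fun s => 1 + F s) s)
        (fun s => 1 + (fun _ => 0) s) s ≤ (1 + l.length * (2 + S) : ℕ) := by
    intro l
    induction l with
    | nil => simp
    | cons i l ihl =>
      intro hl s hs
      have hl' : ∀ i ∈ l, i < m := fun i hi => hl i (List.mem_cons_of_mem _ hi)
      simp only [List.foldr_cons, List.length_cons]
      rw [wp_split, one_mul]
      have a1 := hg i (hl i List.mem_cons_self) s hs
      have a2 := (wp_mono (X := X) (κ := 0) g (v ++ [i]) _ _ s hs
        fun s hs => add_le_add (le_refl 1) (ihl hl' s hs)).trans (wp_const _ g _ s hs).le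
      refine (add_le_add le_rfl (add_le_add a1 a2)).trans (le_of_eq ?_)
      grind
  refine (add_le_add le_rfl (key _ hmem s hs)).trans (le_of_eq ?_)
  rw [length_order]
  grind

lemma wp_steps {M o : ℕ} (C : ℝ≥0∞) : ∀ (g : Prog) (v : List ℕ) (f : St q → ℝ≥0∞) (s : St q),
    g.Capped X M o v.length → (∀ i, o ≤ i → v.getD i 0 < M) →
    (∀ s : St q, s.amp.Normalized → f s ≤ C) →
    s.amp.Normalized → wp X 1 g v f s ≤ g.steps M + C := by
  intro g v f s hc hv hf hs
  rw [wp_split, one_mul]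
  refine add_le_add ?_ ((wp_mono _ _ _ _ _ hs hf).trans (wp_const C g v s hs).le)
  clear hf f C
  induction g generalizing v s with
  | set | rnd | gate | rot | meas => simp [wp, Prog.steps]
  | seq g h ihg ihh =>
    simp only [wp, Prog.steps]
    rw [wp_split, one_mul, Nat.cast_add]
    exact add_le_add (ihg v s hc.1 hv hs)
      ((wp_mono _ _ _ _ _ hs fun s hs => ihh v s hc.2 hv hs).trans (wp_const _ g v s hs).le)
  | ite e g h ihg ihh =>
    simp only [wp, Prog.steps]
    push_cast
    rw [add_assoc]
    refine add_le_add le_rfl ?_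
    split
    · exact (ihh v s hc.2 hv hs).trans le_add_self
    · exact (ihg v s hc.1 hv hs).trans le_self_add
  | loop rev e g ih =>
    obtain ⟨h1, h2⟩ := hc
    have hle : e.ev X v s.arr % X.top ≤ M := (Nat.mod_le _ _).trans (h1 v rfl hv _)
    refine (wp_loop_steps rfl (fun i hi s hs => ih (v ++ [i]) s (by grind) ?_ hs)
      hs).trans ?_
    · grind
    · simp only [Prog.steps]
      exact_mod_cast Nat.add_le_add_left (Nat.mul_le_mul_right _ hle) _

end wp

/-! ### Classical and unitary programs -/

/-- Elementary gates. -/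
inductive Gate
  | tof (a b t : ℕ)
  | rot (t x y : ℕ)

noncomputable def Gate.app : Gate → QState q → QState q
  | .tof a b t => toffoli a b t
  | .rot t x y => rotate t x y

/-- Apply the gates of a list, starting with the first one. -/
noncomputable def applyGates (L : List Gate) (ψ : QState q) : QState q :=
  L.foldl (fun ψ g => g.app ψ) ψ

/-- The gates that a program without measurements applies. -/
def Prog.gates (X : Ctx) : Prog → List ℕ → Arr → List Gate
  | .gate a b t, v, D => [.tof (a.ev X v D) (b.ev X v D) (t.ev X v D)]
  | .rot t x y, v, D => [.rot (t.ev X v D) (x.ev X v D) (y.ev X v D)]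
  | .seq g h, v, D => g.gates X v D ++ h.gates X v D
  | .ite e g h, v, D => if e.ev X v D = 0 then h.gates X v D else g.gates X v D
  | .loop rev e g, v, D =>
      (order rev (e.ev X v D % X.top)).flatMap fun i => g.gates X (v ++ [i]) D
  | _, _, _ => []

def Prog.unitary : Prog → Bool
  | .gate _ _ _ => true
  | .rot _ _ _ => true
  | .seq g h => g.unitary && h.unitary
  | .ite _ g h => g.unitary && h.unitary
  | .loop _ _ g => g.unitary
  | _ => false

lemma applyGates_append (L L' : List Gate) (ψ : QState q) :
    applyGates (L ++ L') ψ = applyGates L' (applyGates L ψ) := List.foldl_append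

/-- Without writes to the arrays all branches and loop bounds are fixed in advance, so the run is a
fixed list of gates. -/
lemma wp_unitary {X : Ctx} : ∀ (g : Prog) (v : List ℕ) (f : St q → ℝ≥0∞) (s : St q),
    g.unitary = true → wp X 0 g v f s = f ⟨s.arr, applyGates (g.gates X v s.arr) s.amp⟩ := by
  intro g
  induction g with
  | gate => simp [wp, Prog.gates, applyGates, Gate.app]
  | rot => simp [wp, Prog.gates, applyGates, Gate.app]
  | seq g h ihg ihh =>
    simp_all [Prog.unitary, Bool.and_eq_true, wp, Prog.gates, applyGates_append]
  | ite e g h ihg ihh =>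
    intro v f s hc
    simp only [Prog.unitary, Bool.and_eq_true] at hc
    grind [wp, Prog.gates, zero_add]
  | loop rev e g ih =>
    intro v f s hc
    simp only [wp, Prog.gates, zero_add]
    generalize order rev (e.ev X v s.arr % X.top) = l
    obtain ⟨D, ψ⟩ := s
    simp only
    induction l generalizing ψ with
    | nil => rfl
    | cons i l ihl =>
      simp only [List.foldr_cons, List.flatMap_cons, applyGates_append]
      rw [ih _ _ _ hc, ihl]
  | _ => simp [Prog.unitary]

lemma Gate.app_normalized (g : Gate) {ψ : QState q} (h : ψ.Normalized) :
    (g.app ψ).Normalized := by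
  cases g with
  | tof => exact toffoli_normalized _ _ _ h
  | rot => exact rotate_normalized _ _ _ h

lemma applyGates_normalized (L : List Gate) {ψ : QState q} (h : ψ.Normalized) :
    (applyGates L ψ).Normalized := by
  induction L generalizing ψ with
  | nil => exact h
  | cons g L ih => exact ih (g.app_normalized h)

/-- The program that applies the gates in reverse order. -/
def Prog.inv : Prog → Prog
  | .seq g h => .seq h.inv g.inv
  | .ite e g h => .ite e g.inv h.inv
  | .loop rev e g => .loop (!rev) e g.inv
  | g => g

lemma Prog.gates_inv (X : Ctx) (g : Prog) (v : List ℕ) (D : Arr) :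
    g.inv.gates X v D = (g.gates X v D).reverse := by
  induction g generalizing v with
  | seq g h ihg ihh => simp_all [Prog.inv, Prog.gates]
  | ite e g h ihg ihh => grind [Prog.inv, Prog.gates]
  | loop rev e g ih =>
    have : order (!rev) (e.ev X v D % X.top) = (order rev (e.ev X v D % X.top)).reverse := by
      grind [order]
    simp only [Prog.inv, Prog.gates, ih, this, List.reverse_flatMap]
    rfl
  | _ => rfl

/-- Every gate is its own inverse. -/
lemma applyGates_reverse (L : List Gate) (ψ : QState q) :
    applyGates L.reverse (applyGates L ψ) = ψ := by
  induction L generalizing ψ with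
  | nil => rfl
  | cons g L ih =>
    rw [List.reverse_cons, applyGates_append]
    have h1 : applyGates (g :: L) ψ = applyGates L (g.app ψ) := rfl
    have h2 : ∀ ψ : QState q, applyGates [g] ψ = g.app ψ := fun _ => rfl
    rw [h1, ih, h2]
    cases g with
    | tof a b t => funext c; simp only [Gate.app, toffoli_apply, tofMap_involutive a b t c]
    | rot t x y => exact rotate_rotate t x y ψ

/-! ## Circuits on basis states -/

/-- The effect of a Toffoli gate on a basis state. -/
def Gate.map : Gate → (Fin q → Bool) → (Fin q → Bool)
  | .tof a b t => tofMap a b t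
  | .rot _ _ _ => id

def Gate.isTof : Gate → Prop
  | .tof _ _ _ => True
  | .rot _ _ _ => False

/-- The effect of a list of Toffoli gates on a basis state. -/
def runBasis (L : List Gate) (b : Fin q → Bool) : Fin q → Bool := L.foldl (fun b g => g.map b) b

lemma applyGates_runBasis {L : List Gate} (hL : ∀ g ∈ L, g.isTof) (ψ : QState q)
    (b : Fin q → Bool) : applyGates L ψ (runBasis L b) = ψ b := by
  induction L generalizing ψ b with
  | nil => rfl
  | cons g L ih =>
    have h1 : applyGates (g :: L) ψ = applyGates L (g.app ψ) := rfl
    have h2 : runBasis (g :: L) b = runBasis L (g.map b) := rfl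
    rw [h1, h2, ih fun g hg => hL g (List.mem_cons_of_mem _ hg)]
    cases g with
    | tof a c t => simp only [Gate.app, Gate.map, toffoli_apply, tofMap_involutive a c t b]
    | rot t x y => exact (hL _ List.mem_cons_self).elim

lemma runBasis_injective {L : List Gate} (hL : ∀ g ∈ L, g.isTof) :
    Injective (runBasis (q := q) L) := by
  intro b b' h
  have h1 := applyGates_runBasis hL (Pi.single b (1 : ℂ)) b
  have h2 := applyGates_runBasis hL (Pi.single b (1 : ℂ)) b'
  grind

lemma sum_runBasis {M : Type*} [AddCommMonoid M] {L : List Gate} (hL : ∀ g ∈ L, g.isTof)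
    (F : (Fin q → Bool) → M) : ∑ b, F (runBasis L b) = ∑ b, F b :=
  Equiv.sum_comp (Equiv.ofBijective _ (Finite.injective_iff_bijective.1 (runBasis_injective hL))) F

lemma Gate.app_smul (g : Gate) (c : ℂ) (ψ : QState q) : g.app (c • ψ) = c • g.app ψ := by
  cases g with
  | tof a b t => funext x; simp [Gate.app, toffoli_apply]
  | rot t x y =>
    funext b
    simp only [Gate.app, Pi.smul_apply, smul_eq_mul]
    rcases Nat.lt_or_ge t q with h | h
    · lift t to Fin q using h
      grind [rotate_apply, Pi.smul_apply, smul_eq_mul]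
    · simp [rotate_of_le h]

lemma Gate.app_add (g : Gate) (φ ψ : QState q) : g.app (φ + ψ) = g.app φ + g.app ψ := by
  cases g with
  | tof a b t => funext x; simp [Gate.app, toffoli_apply]
  | rot t x y =>
    funext b
    simp only [Gate.app, Pi.add_apply]
    rcases Nat.lt_or_ge t q with h | h
    · lift t to Fin q using h
      grind [rotate_apply, Pi.add_apply]
    · simp [rotate_of_le h]

lemma applyGates_smul (L : List Gate) (c : ℂ) (ψ : QState q) :
    applyGates L (c • ψ) = c • applyGates L ψ := by
  induction L generalizing ψ with
  | nil => rfl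
  | cons g L ih => exact (congrArg (applyGates L) (g.app_smul c ψ)).trans (ih _)

lemma applyGates_add (L : List Gate) (φ ψ : QState q) :
    applyGates L (φ + ψ) = applyGates L φ + applyGates L ψ := by
  induction L generalizing φ ψ with
  | nil => rfl
  | cons g L ih => exact (congrArg (applyGates L) (g.app_add φ ψ)).trans (ih _ _)

lemma Gate.app_symm (g : Gate) (φ ψ : QState q) :
    ∑ b, g.app φ b * ψ b = ∑ b, φ b * g.app ψ b := by
  cases g with
  | tof a c t =>
    simp only [Gate.app, toffoli_apply]
    rw [← Equiv.sum_comp (tofMap_involutive a c t).toPerm]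
    simp only [Involutive.coe_toPerm, tofMap_involutive a c t _]
  | rot t x y => exact rotate_symm t x y φ ψ

lemma applyGates_symm (L : List Gate) (φ ψ : QState q) :
    ∑ b, applyGates L φ b * ψ b = ∑ b, φ b * applyGates L.reverse ψ b := by
  induction L generalizing φ ψ with
  | nil => rfl
  | cons g L ih =>
    have h1 : applyGates (g :: L) φ = applyGates L (g.app φ) := rfl
    have h2 : ∀ ψ : QState q, applyGates [g] ψ = g.app ψ := fun _ => rfl
    rw [h1, ih, g.app_symm, List.reverse_cons, applyGates_append, h2]

lemma rotProb_zero : rotProb 0 1 = 0 := by simp [rotProb]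
lemma rotProb_one : rotProb 1 1 = 1 := by simp [rotProb]

lemma rotate_zero_one (t : Fin q) (ψ : QState q) (b : Fin q → Bool) :
    rotate t 0 1 ψ b = (if b t then -1 else 1) * ψ b := by
  rw [rotate_apply, rotProb_zero]
  cases hb : b t
  · have : update b t false = b := by grind
    simp [this]
  · have : update b t true = b := by grind
    simp [this]

lemma rotate_one_one (t : Fin q) (ψ : QState q) (b : Fin q → Bool) :
    rotate t 1 1 ψ b = ψ (flip t b) := by
  rw [rotate_apply, rotProb_one]
  cases hb : b t <;> simp [flip, hb]

/-- Compute, apply Z, uncompute: a reversible predicate becomes a sign, and its workspace is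
restored. -/
lemma applyGates_conj_Z {L : List Gate} (hL : ∀ g ∈ L, g.isTof) (t : Fin q) (ψ : QState q)
    (b : Fin q → Bool) :
    applyGates (L ++ .rot t 0 1 :: L.reverse) ψ b
      = (if runBasis L b t then -1 else 1) * ψ b := by
  have hL' : ∀ g ∈ L.reverse, g.isTof := fun g hg => hL g (List.mem_reverse.1 hg)
  have hrev : runBasis L.reverse (runBasis L b) = b := by
    have h1 := applyGates_runBasis hL (Pi.single b (1 : ℂ)) b
    have h2 : ∀ ψ : QState q, ∀ c, applyGates L.reverse ψ (runBasis L.reverse c) = ψ c :=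
      fun ψ c => applyGates_runBasis hL' ψ c
    have h3 := h2 (applyGates L (Pi.single b (1 : ℂ))) (runBasis L b)
    rw [applyGates_reverse, h1, Pi.single_eq_same] at h3
    grind
  have h4 : applyGates (L ++ .rot t 0 1 :: L.reverse) ψ =
      applyGates L.reverse (rotate t 0 1 (applyGates L ψ)) := by
    rw [applyGates_append]; rfl
  rw [h4]
  grind [applyGates_runBasis, rotate_zero_one]

/-! ## Amplitude amplification -/

/-- The amplitudes of good and bad basis states relative to the initial ones, after `j` steps. -/
def amplify (P : ℝ) : ℕ → ℝ × ℝ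
  | 0 => (1, 1)
  | j + 1 => (-(1 - 2 * P) * (amplify P j).1 - 2 * (1 - P) * (amplify P j).2,
      2 * P * (amplify P j).1 - (1 - 2 * P) * (amplify P j).2)

/-- In the coordinates (first · sin θ, second · cos θ) the recursion is minus the rotation by 2θ. -/
lemma amplify_eq (θ : ℝ) (j : ℕ) :
    (amplify (Real.sin θ ^ 2) j).1 * Real.sin θ = (-1) ^ j * Real.sin ((2 * j + 1) * θ) ∧
    (amplify (Real.sin θ ^ 2) j).2 * Real.cos θ = (-1) ^ j * Real.cos ((2 * j + 1) * θ) := by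
  induction j with
  | zero => simp [amplify]
  | succ j ih =>
    have e : (2 * ((j + 1 : ℕ) : ℝ) + 1) * θ = (2 * j + 1) * θ + 2 * θ := by grind
    have hc : Real.sin θ ^ 2 = 1 - Real.cos θ ^ 2 := by grind [Real.sin_sq_add_cos_sq]
    rw [e, Real.sin_add, Real.cos_add, Real.cos_two_mul, Real.sin_two_mul, pow_succ (-1 : ℝ) j]
    grind [amplify]

/-- Telescoping: 2 sin 2θ cos (4j+2)θ = sin 4(j+1)θ - sin 4jθ. -/
lemma sum_cos (θ : ℝ) (J : ℕ) :
    2 * Real.sin (2 * θ) * ∑ j ∈ range J, Real.cos ((4 * j + 2) * θ)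
      = Real.sin (4 * J * θ) := by
  induction J with
  | zero => simp
  | succ J ih =>
    rw [sum_range_succ, mul_add, ih]
    have e1 : 4 * ((J + 1 : ℕ) : ℝ) * θ = (4 * J + 2) * θ + 2 * θ := by grind
    have e2 : 4 * (J : ℝ) * θ = (4 * J + 2) * θ - 2 * θ := by ring
    grind [Real.sin_add, Real.sin_sub]

/-- Since sin² = (1 - cos)/2, it suffices that the sum of the cosines is at most J/2. By `sum_cos`
it is at most 1/(4 sin θ cos θ), and cos θ ≥ 1/2 and J sin θ ≥ 1 suffice. -/
lemma sum_sin_sq {θ : ℝ} (h0 : 0 < Real.sin θ) (hc : 0 ≤ Real.cos θ)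
    (h1 : Real.sin θ ^ 2 ≤ 1 / 2) {J : ℕ} (hJ : 1 ≤ J * Real.sin θ) :
    (J : ℝ) / 4 ≤ ∑ j ∈ range J, Real.sin ((2 * j + 1) * θ) ^ 2 := by
  have h2 : ∀ j : ℕ, Real.sin ((2 * j + 1) * θ) ^ 2 = 1 / 2 - Real.cos ((4 * j + 2) * θ) / 2 := by
    grind [Real.sin_sq_eq_half_sub]
  simp only [h2, sum_sub_distrib, sum_const, card_range, nsmul_eq_mul,
    ← sum_div]
  have h3 := sum_cos θ J
  have h4 := Real.sin_le_one (4 * J * θ)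
  rw [Real.sin_two_mul] at h3
  have h5 : Real.sin θ ≤ Real.cos θ := by
    have := Real.sin_sq_add_cos_sq θ
    nlinarith
  have hpos : 0 < Real.cos θ := h0.trans_le h5
  set S := ∑ j ∈ range J, Real.cos ((4 * j + 2) * θ)
  have h6 : Real.cos θ * 2 ≥ 1 := by
    have := Real.sin_sq_add_cos_sq θ
    nlinarith
  have h7 : 2 * S * Real.sin θ ≤ 1 := by
    by_contra hcon
    nlinarith
  have h8 : 2 * S ≤ J := by
    by_contra hcon
    push Not at hcon
    nlinarith
  linarith

/-! ### The plane of good and bad amplitudes -/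

section amplification

variable (A L D : List Gate) (flag anc : Fin q) (b₀ : Fin q → Bool)

/-- The state that is amplified. -/
noncomputable def startState : QState q := applyGates A (Pi.single b₀ 1)

/-- One step of amplitude amplification. -/
def groverGates : List Gate :=
  (L ++ .rot flag 0 1 :: L.reverse) ++ A.reverse ++ (D ++ .rot anc 0 1 :: D.reverse) ++ A

/-- The probability of the good basis states in the initial state. -/
noncomputable def goodProb : ℝ := ∑ b with runBasis L b flag = true, ‖startState A b₀ b‖ ^ 2

variable {A L D flag anc b₀}

lemma sum_norm_sq {φ : QState q} (h : φ.Normalized) (p : (Fin q → Bool) → Bool) :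
    ∑ b with p b = true, ‖φ b‖ ^ 2 + ∑ b with ¬ p b = true, ‖φ b‖ ^ 2 = 1 := by
  rw [sum_filter_add_sum_filter_not]; exact h

lemma single_normalized (b₀ : Fin q → Bool) : QState.Normalized (Pi.single b₀ 1) := by
  unfold QState.Normalized
  rw [sum_eq_single b₀]
  · simp
  · simp_all
  · simp

lemma goodProb_nonneg : 0 ≤ goodProb A L flag b₀ := sum_nonneg fun _ _ => by simp

lemma goodProb_le_one : goodProb A L flag b₀ ≤ 1 := by
  have h := sum_norm_sq (applyGates_normalized A (single_normalized b₀)) (runBasis L · flag)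
  have : 0 ≤ ∑ b with ¬ runBasis L b flag = true, ‖startState A b₀ b‖ ^ 2 :=
    sum_nonneg fun _ _ => by simp
  have h2 : goodProb A L flag b₀ + ∑ b with ¬ runBasis L b flag = true, ‖startState A b₀ b‖ ^ 2
    = 1 := h
  linarith

/-- A set of basis states: those that agree with `b₀` outside of some qubits. -/
def near (co : Fin q → Prop) (b₀ : Fin q → Bool) (b : Fin q → Bool) : Prop :=
  ∀ t, ¬ co t → b t = b₀ t

lemma applyGates_supported {co : Fin q → Prop}
    (hA : ∀ g ∈ A, ∃ (t : Fin q) (x y : ℕ), co t ∧ g = .rot t x y) {φ : QState q}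
    (hφ : ∀ b, ¬ near co b₀ b → φ b = 0) (b : Fin q → Bool) (hb : ¬ near co b₀ b) :
    applyGates A φ b = 0 := by
  induction A generalizing φ with
  | nil => exact hφ b hb
  | cons g A ih =>
    obtain ⟨t, x, y, ht, rfl⟩ := hA _ List.mem_cons_self
    refine ih (φ := rotate t x y φ) (fun g hg => hA g (List.mem_cons_of_mem _ hg)) fun b hb => ?_
    have key : ∀ c, φ (update b t c) = 0 := by
      intro c
      apply hφ
      intro hn
      apply hb
      intro t' ht'
      have hne : t' ≠ t := by grind
      rw [← hn t' ht', update_of_ne hne]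
    simp_all [rotate_apply]

/-- Reality makes the bilinear pairing of `applyGates_symm` an inner product, so that norms of
amplitudes appear in `grover_step`. -/
lemma applyGates_real (hA : ∀ g ∈ A, ∃ (t : Fin q) (x y : ℕ), g = .rot t x y)
    {φ : QState q} (hφ : ∀ b, star (φ b) = φ b) (b : Fin q → Bool) :
    star (applyGates A φ b) = applyGates A φ b := by
  induction A generalizing φ with
  | nil => exact hφ b
  | cons g A ih =>
    obtain ⟨t, x, y, rfl⟩ := hA _ List.mem_cons_self
    refine ih (φ := rotate t x y φ) (fun g hg => hA g (List.mem_cons_of_mem _ hg)) fun b => ?_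
    rw [← rotate_star]
    simp_all

/-- The states that scale the start state by x on good and by y on bad basis states form an
invariant plane. The first sign flip turns x into -x. The second, between A⁻¹ and A, subtracts twice
the projection onto the start state, whose coefficient is -xP + y(1 - P). -/
lemma grover_step {co : Fin q → Prop}
    (hA : ∀ g ∈ A, ∃ (t : Fin q) (x y : ℕ), co t ∧ g = .rot t x y)
    (hL : ∀ g ∈ L, g.isTof) (hD : ∀ g ∈ D, g.isTof)
    (hanc : ∀ b, near co b₀ b → (runBasis D b anc = true ↔ b = b₀)) (x y : ℝ) :
    applyGates (groverGates A L D flag anc)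
      (fun b => ((if runBasis L b flag then x else y : ℝ) : ℂ) * startState A b₀ b) =
    fun b => ((if runBasis L b flag then
      -(1 - 2 * goodProb A L flag b₀) * x - 2 * (1 - goodProb A L flag b₀) * y
      else 2 * goodProb A L flag b₀ * x - (1 - 2 * goodProb A L flag b₀) * y : ℝ) : ℂ) *
      startState A b₀ b := by
  set a := startState A b₀ with ha
  set P := goodProb A L flag b₀ with hP
  have hsing : ∀ b, ¬ near co b₀ b → (Pi.single b₀ 1 : QState q) b = 0 := by
    intro b hb
    rw [Pi.single_eq_of_ne]
    rintro rfl
    exact hb fun _ _ => rfl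
  have hsupp : ∀ b, ¬ near co b₀ b → a b = 0 := applyGates_supported hA hsing
  have hreal : ∀ b, star (a b) = a b :=
    applyGates_real (fun g hg => by grind)
      fun b => by
        by_cases h : b = b₀
        · subst h; simp
        · simp_all
  have hsq : ∀ b, a b * a b = ((‖a b‖ ^ 2 : ℝ) : ℂ) := by
    intro b
    have := Complex.conj_mul' (a b)
    simp_all
  set ψ : QState q := fun b => ((if runBasis L b flag then x else y : ℝ) : ℂ) * a b
  set ψ' : QState q := fun b => ((if runBasis L b flag then -x else y : ℝ) : ℂ) * a b with hψ'
  have e1 : applyGates (L ++ .rot flag 0 1 :: L.reverse) ψ = ψ' := by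
    funext b
    rw [applyGates_conj_Z hL]
    simp only [ψ, ψ']
    split <;> push_cast <;> ring
  set φ := applyGates A.reverse ψ' with hφ
  have hφs : ∀ b, ¬ near co b₀ b → φ b = 0 := by
    refine applyGates_supported (fun g hg => hA g (List.mem_reverse.1 hg)) fun b hb => ?_
    grind
  have e2 : applyGates (D ++ .rot anc 0 1 :: D.reverse) φ
      = φ + (-2 * φ b₀) • (Pi.single b₀ 1 : QState q) := by
    funext b
    rw [applyGates_conj_Z hD]
    simp only [Pi.add_apply, Pi.smul_apply, smul_eq_mul]
    -- Away from b₀ the zero test may answer anything, but φ vanishes there because A acts on the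
    -- coins only.
    by_cases hn : near co b₀ b
    · grind
    grind
  have e3 : applyGates A φ = ψ' := by
    have := applyGates_reverse A.reverse ψ'
    grind
  -- The amplitude at b₀ after undoing A is the overlap with the start state.
  have e4 : φ b₀ = ((-x * P + y * (1 - P) : ℝ) : ℂ) := by
    have h1 := applyGates_symm A (Pi.single b₀ 1) ψ'
    rw [← hφ] at h1
    have h2 : ∑ b, (Pi.single b₀ 1 : QState q) b * φ b = φ b₀ := by
      rw [sum_eq_single b₀] <;> simp +contextual [Pi.single_eq_of_ne]
    rw [h2] at h1
    rw [← h1]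
    have h3 := sum_norm_sq (applyGates_normalized A (single_normalized b₀)) (runBasis L · flag)
    have h4 : ∑ b with ¬ runBasis L b flag = true, ‖a b‖ ^ 2 = 1 - P := by
      rw [← h3]
      exact (add_sub_cancel_left P _).symm
    have h5 : ∀ b, a b * ψ' b
        = (((if runBasis L b flag = true then -x * ‖a b‖ ^ 2 else y * ‖a b‖ ^ 2) : ℝ) : ℂ) := by
      intro b
      grind [mul_left_comm, Complex.ofReal_mul]
    have h6 : ∑ b, applyGates A (Pi.single b₀ 1) b * ψ' b = ∑ b, a b * ψ' b := rfl
    rw [h6, sum_congr rfl fun b _ => h5 b, ← Complex.ofReal_sum, sum_ite,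
      ← mul_sum, ← mul_sum, h4]
    rfl
  unfold groverGates
  rw [applyGates_append _ A, applyGates_append (L ++ _ ++ A.reverse),
    applyGates_append (L ++ _) A.reverse, e1, ← hφ, e2, applyGates_add,
    applyGates_smul, e3, e4]
  funext b
  have : applyGates A (Pi.single b₀ 1) = a := rfl
  rw [this]
  simp only [Pi.add_apply, Pi.smul_apply, smul_eq_mul, hψ']
  split <;> push_cast <;> ring

lemma grover_iterate {co : Fin q → Prop}
    (hA : ∀ g ∈ A, ∃ (t : Fin q) (x y : ℕ), co t ∧ g = .rot t x y)
    (hL : ∀ g ∈ L, g.isTof) (hD : ∀ g ∈ D, g.isTof)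
    (hanc : ∀ b, near co b₀ b → (runBasis D b anc = true ↔ b = b₀)) (j : ℕ) :
    (applyGates (groverGates A L D flag anc))^[j] (startState A b₀) =
    fun b => ((if runBasis L b flag then (amplify (goodProb A L flag b₀) j).1
      else (amplify (goodProb A L flag b₀) j).2 : ℝ) : ℂ) * startState A b₀ b := by
  induction j with
  | zero => simp [amplify]
  | succ j ih =>
    rw [iterate_succ_apply', ih, grover_step hA hL hD hanc]
    rfl

lemma grover_prob {co : Fin q → Prop}
    (hA : ∀ g ∈ A, ∃ (t : Fin q) (x y : ℕ), co t ∧ g = .rot t x y)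
    (hL : ∀ g ∈ L, g.isTof) (hD : ∀ g ∈ D, g.isTof)
    (hanc : ∀ b, near co b₀ b → (runBasis D b anc = true ↔ b = b₀)) (j : ℕ) :
    ∑ b with runBasis L b flag = true,
      ‖(applyGates (groverGates A L D flag anc))^[j] (startState A b₀) b‖ ^ 2 =
    Real.sin ((2 * j + 1) * Real.arcsin √(goodProb A L flag b₀)) ^ 2 := by
  rw [grover_iterate hA hL hD hanc]
  set P := goodProb A L flag b₀ with hP
  have hs : Real.sin (Real.arcsin √P) = √P :=
    Real.sin_arcsin (by grind [Real.sqrt_nonneg]) (Real.sqrt_le_one.2 goodProb_le_one)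
  have h1 := (amplify_eq (Real.arcsin √P) j).1
  have h2 : Real.sin ((2 * j + 1) * Real.arcsin √P) ^ 2 = (amplify P j).1 ^ 2 * P := by
    calc _ = ((-1) ^ j * Real.sin ((2 * j + 1) * Real.arcsin √P)) ^ 2 := by
          rw [mul_pow, ← pow_mul, mul_comm j 2, pow_mul]; simp
      _ = _ := by grind [mul_pow, Real.sq_sqrt, goodProb_nonneg]
  rw [h2, hP, goodProb, mul_sum, ← goodProb, ← hP]
  simp_all [sum_congr, if_pos, mem_filter, norm_mul, mul_pow, Complex.norm_real, Real.norm_eq_abs, sq_abs]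

end amplification

/-- The cutoff J = ⌊T/(x+1)⌋ exceeds 1/√P for a fraction of order √P of the values x, and for such J
a uniformly random number of iterations below J succeeds with probability at least 1/4. No knowledge
of P enters the choice. -/
lemma average_success {P : ℝ} (hP : 0 < P) (hP1 : P ≤ 1) {T : ℕ} (hT : 1 ≤ √P * T) :
    √P / 16 ≤ (∑ x ∈ range T, (∑ j ∈ range (T / (x + 1)),
      Real.sin ((2 * j + 1) * Real.arcsin √P) ^ 2) / (T / (x + 1) : ℕ)) / T := by
  have hs : Real.sin (Real.arcsin √P) = √P :=
    Real.sin_arcsin (by grind [Real.sqrt_nonneg]) (Real.sqrt_le_one.2 hP1)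
  have hs0 : 0 < √P := Real.sqrt_pos.2 hP
  have hs1 : √P ≤ 1 := Real.sqrt_le_one.2 hP1
  have hT0 : (0 : ℝ) < T := by
    by_contra h
    push Not at h
    nlinarith
  rw [le_div_iff₀ hT0]
  set F : ℕ → ℝ := fun x => (∑ j ∈ range (T / (x + 1)),
      Real.sin ((2 * j + 1) * Real.arcsin √P) ^ 2) / (T / (x + 1) : ℕ) with hF
  have hF0 : ∀ x, 0 ≤ F x := fun x =>
    div_nonneg (sum_nonneg fun _ _ => by positivity) (by simp)
  rcases le_or_gt P (1 / 2) with h2 | h2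
  -- For x < T/m the cutoff is at least m. The required T/m · 1/4 ≥ T√P/16 follows from m√P ≤ 2 and
  -- T < 2m⌊T/m⌋.
  · set m := ⌈1 / √P⌉₊ with hm
    have hm1 : 1 / √P ≤ m := Nat.le_ceil _
    have hm2 : (m : ℝ) < 1 / √P + 1 := Nat.ceil_lt_add_one (by simp)
    have h1s : 1 ≤ 1 / √P := by rw [le_div_iff₀ hs0]; linarith
    have hmT : m ≤ T := by
      rw [hm, Nat.ceil_le, div_le_iff₀ hs0]; linarith
    have hmpos : 0 < m := by
      simp_all
    have hterm : ∀ x ∈ range (T / m), 1 / 4 ≤ F x := by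
      intro x hx
      have hx := mem_range.1 hx
      have hJ : m ≤ T / (x + 1) := by
        rw [Nat.le_div_iff_mul_le (Nat.succ_pos _)]
        grind [Nat.le_div_iff_mul_le, Nat.succ_le_of_lt, mul_comm]
      have hJ' : (m : ℝ) ≤ (T / (x + 1) : ℕ) := by simp_all
      have hJ0 : (0 : ℝ) < (T / (x + 1) : ℕ) := lt_of_lt_of_le (by grind) hJ'
      simp only [hF]
      rw [le_div_iff₀ hJ0]
      have := sum_sin_sq (θ := Real.arcsin √P) (by grind)
        (Real.cos_arcsin_nonneg _) (by grind)
        (J := T / (x + 1)) (by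
          rw [hs]
          have : 1 / √P * √P = 1 := by grind
          nlinarith)
      linarith
    have hsub : range (T / m) ⊆ range T :=
      range_subset_range.2 (Nat.div_le_self _ _)
    have h3 : ((T / m : ℕ) : ℝ) * (1 / 4) ≤ ∑ x ∈ range T, F x := by
      calc ((T / m : ℕ) : ℝ) * (1 / 4) = ∑ x ∈ range (T / m), (1 / 4 : ℝ) := by simp
        _ ≤ ∑ x ∈ range (T / m), F x := sum_le_sum hterm
        _ ≤ _ := sum_le_sum_of_subset_of_nonneg hsub fun x _ _ => hF0 x
    refine le_trans ?_ h3
    have h4 : (T : ℝ) < (T / m : ℕ) * m + m := by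
      have := Nat.lt_div_mul_add (a := T) hmpos
      exact_mod_cast this
    have h5 : (1 : ℝ) ≤ (T / m : ℕ) := by
      exact_mod_cast (Nat.one_le_div_iff hmpos).2 hmT
    have h6 : (m : ℝ) * √P ≤ 2 := by
      have : 1 / √P * √P = 1 := by grind
      nlinarith
    nlinarith [mul_nonneg hs0.le (Nat.cast_nonneg (α := ℝ) (T / m)), mul_pos hs0 hT0]
  -- For P > 1/2 the upper half of the x has cutoff 1. No iteration is made then, and the success
  -- probability is P itself.
  · have hterm : ∀ x ∈ (range T).filter (fun x => T < 2 * (x + 1)), 1 / 2 ≤ F x := by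
      intro x hx
      obtain ⟨hx1, hx2⟩ := mem_filter.1 hx
      have hx1 := mem_range.1 hx1
      have : T / (x + 1) = 1 := by
        rw [Nat.div_eq_iff (Nat.succ_pos _)]
        omega
      simp only [hF, this]
      simp [hs, Real.sq_sqrt hP.le]
      linarith
    have hcard : T ≤ 2 * ((range T).filter (fun x => T < 2 * (x + 1))).card := by
      have : Finset.Ico (T / 2) T ⊆ (range T).filter (fun x => T < 2 * (x + 1)) := by
        grind
      have := card_le_card this
      grind [Nat.card_Ico]
    have hcard' : (T : ℝ) ≤ 2 * ((range T).filter (fun x => T < 2 * (x + 1))).card := by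
      exact_mod_cast hcard
    have h3 : (((range T).filter (fun x => T < 2 * (x + 1))).card : ℝ) * (1 / 2)
        ≤ ∑ x ∈ range T, F x := by
      calc _ = ∑ x ∈ (range T).filter (fun x => T < 2 * (x + 1)), (1 / 2 : ℝ) := by simp
        _ ≤ ∑ x ∈ (range T).filter (fun x => T < 2 * (x + 1)), F x :=
          sum_le_sum hterm
        _ ≤ _ := sum_le_sum_of_subset_of_nonneg (filter_subset _ _)
          fun x _ _ => hF0 x
    nlinarith

end Hybrid

namespace Hybrid

open Finset Function

/-! ## Circuits on labelled wires -/

/-- A label of a wire, consisting of a tag and two indices. -/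
abbrev Wire : Type := ℕ × ℕ × ℕ

/-- A Toffoli gate with two controls and a target. -/
abbrev TGate : Type := Wire × Wire × Wire

abbrev WState : Type := Wire → ZMod 2

def TGate.act (w : WState) (g : TGate) : WState := update w g.2.2 (w g.2.2 + w g.1 * w g.2.1)

def runW (L : List TGate) (w : WState) : WState := L.foldl TGate.act w

lemma runW_append (L L' : List TGate) (w : WState) : runW (L ++ L') w = runW L' (runW L w) :=
  List.foldl_append

lemma runW_cons (g : TGate) (L : List TGate) (w : WState) :
    runW (g :: L) w = runW L (TGate.act w g) := rfl

lemma runW_frame {L : List TGate} {x : Wire} (h : ∀ g ∈ L, g.2.2 ≠ x) (w : WState) :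
    runW L w x = w x := by
  induction L generalizing w with
  | nil => rfl
  | cons g L ih =>
    simp_all [runW_cons, List.mem_cons_of_mem, TGate.act, update_of_ne, List.mem_cons_self, symm]

lemma zmod2_mul_self (x : ZMod 2) : x * x = x := by revert x; decide
lemma zmod2_add_self (x : ZMod 2) : x + x = 0 := by grind

/-- What a list of gates adds to a wire if no target is a control. -/
def gain (w : WState) (x : Wire) (L : List TGate) : ZMod 2 :=
  (L.map fun g => if g.2.2 = x then w g.1 * w g.2.1 else 0).sum

lemma gain_nil (w : WState) (x : Wire) : gain w x [] = 0 := rfl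

lemma gain_cons (w : WState) (x : Wire) (g : TGate) (L : List TGate) :
    gain w x (g :: L) = (if g.2.2 = x then w g.1 * w g.2.1 else 0) + gain w x L := by
  rfl

lemma gain_append (w : WState) (x : Wire) (L L' : List TGate) :
    gain w x (L ++ L') = gain w x L + gain w x L' := by simp [gain]

lemma gain_flatMap (w : WState) (x : Wire) (m : ℕ) (F : ℕ → List TGate) :
    gain w x ((List.range m).flatMap F) = ∑ i ∈ range m, gain w x (F i) := by
  induction m with
  | zero => rfl
  | succ m ih => simp_all [List.range_succ, List.flatMap_append, gain_append, sum_range_succ]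

lemma gain_congr {w w' : WState} {L : List TGate}
    (h : ∀ g ∈ L, w g.1 = w' g.1 ∧ w g.2.1 = w' g.2.1) (x : Wire) : gain w x L = gain w' x L := by
  grind [gain, List.map_congr_left]

/-- As no target occurs as a control, every gate sees the initial values of its controls and the
additions do not interact. -/
lemma runW_parallel {L : List TGate} (h : ∀ g ∈ L, ∀ g' ∈ L, g.2.2 ≠ g'.1 ∧ g.2.2 ≠ g'.2.1)
    (w : WState) (x : Wire) : runW L w x = w x + gain w x L := by
  induction L generalizing w with
  | nil => simp [runW, gain_nil]
  | cons g L ih =>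
    rw [runW_cons, ih fun g hg g' hg' => h g (List.mem_cons_of_mem _ hg) g'
      (List.mem_cons_of_mem _ hg'), gain_cons]
    have h1 : gain (TGate.act w g) x L = gain w x L := by
      refine gain_congr (fun g' hg' => ?_) x
      simp only [TGate.act]
      grind
    rw [h1, ← add_assoc]
    by_cases hx : g.2.2 = x
    · subst hx; simp [TGate.act]
    · simp [TGate.act, hx, update_of_ne (Ne.symm hx)]

/-- The target of a gate is not one of its controls. -/
def TGate.Proper (g : TGate) : Prop := g.2.2 ≠ g.1 ∧ g.2.2 ≠ g.2.1

lemma TGate.act_act {g : TGate} (h : g.Proper) (w : WState) : TGate.act (TGate.act w g) g = w := by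
  simp only [TGate.act, update_of_ne h.1.symm, update_of_ne h.2.symm, update_self, update_idem]
  grind

lemma runW_reverse {L : List TGate} (h : ∀ g ∈ L, g.Proper) (w : WState) :
    runW L.reverse (runW L w) = w := by
  induction L generalizing w with
  | nil => rfl
  | cons g L ih =>
    grind [runW, TGate.act, List.reverse_cons, runW_append, List.mem_cons_of_mem, TGate.act_act, List.mem_cons_self]

lemma runW_congr {L : List TGate} {S : Wire → Prop} [DecidablePred S]
    (h : ∀ g ∈ L, ¬ S g.1 ∧ ¬ S g.2.1 ∧ ¬ S g.2.2) {w w' : WState} (hw : ∀ x, ¬ S x → w x = w' x)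
    (x : Wire) : runW L w x = if S x then w x else runW L w' x := by
  split
  · grind [runW_frame]
  · rename_i hx
    induction L generalizing w w' with
    | nil => exact hw x hx
    | cons g L ih =>
      refine ih (fun g hg => h g (List.mem_cons_of_mem _ hg)) fun y hy => ?_
      obtain ⟨h1, h2, h3⟩ := h g List.mem_cons_self
      simp only [TGate.act, update_apply, hw _ h1, hw _ h2, hw _ h3, hw _ hy]

/-- Compute, use, uncompute. The middle part writes only to wires in S, which the outer part never
touches, so reversing the outer part restores everything outside S. -/
lemma runW_conj {L H : List TGate} (S : Wire → Prop) [DecidablePred S]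
    (hL : ∀ g ∈ L, ¬ S g.1 ∧ ¬ S g.2.1 ∧ ¬ S g.2.2) (hP : ∀ g ∈ L, g.Proper)
    (hH : ∀ g ∈ H, S g.2.2) (w : WState) (x : Wire) :
    runW (L ++ (H ++ L.reverse)) w x = if S x then runW H (runW L w) x else w x := by
  rw [runW_append, runW_append]
  have h1 := runW_congr (L := L.reverse) (S := S) (fun g hg => hL g (List.mem_reverse.1 hg))
    (w := runW H (runW L w)) (w' := runW L w)
    (fun y hy => runW_frame (fun g hg e => hy (by grind)) _) x
  rw [h1, runW_reverse hP]

/-! ## Solving linear equations by circuits -/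

/-- The product of `1 + ν i'` for `i' < i`: whether `ν` vanishes before `i`. -/
def zerosBefore (ν : ℕ → ZMod 2) (i : ℕ) : ZMod 2 := ∏ i' ∈ range i, (1 + ν i')

/-- The coordinate of `T` at the first nonzero coordinate of `ν`. -/
def lead (r : ℕ) (ν T : ℕ → ZMod 2) : ZMod 2 := ∑ i ∈ range r, zerosBefore ν i * ν i * T i

/-- Reduce `T` by the first `m` columns of `ν`. -/
def reduce (r : ℕ) (ν : ℕ → ℕ → ZMod 2) : ℕ → (ℕ → ZMod 2) → ℕ → ZMod 2
  | 0, T => T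
  | l + 1, T => fun i => reduce r ν l T i + lead r (fun i => ν i l) (reduce r ν l T) * ν i l

/-- The coefficient of column `l` in the reduction of `T`. -/
def coeff (r : ℕ) (ν : ℕ → ℕ → ZMod 2) (T : ℕ → ZMod 2) (l : ℕ) : ZMod 2 :=
  lead r (fun i => ν i l) (reduce r ν l T)

/-- The first `m` reduced columns. -/
def echelon (r : ℕ) (col : ℕ → ℕ → ZMod 2) : ℕ → ℕ → ℕ → ZMod 2
  | 0 => fun _ _ => 0
  | m + 1 => fun i l => if l = m then reduce r (echelon r col m) m (fun i => col i m) i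
      else echelon r col m i l

/-- Backward substitution. -/
def backSub (r k : ℕ) (col : ℕ → ℕ → ZMod 2) (T : ℕ → ZMod 2) : ℕ → ℕ → ZMod 2
  | 0 => fun l => if l < k then coeff r (echelon r col k) T l else 0
  | t + 1 => fun l => backSub r k col T t l +
      if l < k - (t + 1) then coeff r (echelon r col k) (fun i => col i (k - (t + 1))) l *
        backSub r k col T t (k - (t + 1)) else 0

/-- A solution of a system of linear equations. -/
def solve (r k : ℕ) (col : ℕ → ℕ → ZMod 2) (T : ℕ → ZMod 2) : ℕ → ZMod 2 := backSub r k col T k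

section circuits

/-- The wire that is constantly one; with it a Toffoli gate flips a bit unconditionally. Tags of the
wires: 0 the constant, 1 row coins, 2 column coins, 3 the column being reduced, 4 its coefficients,
5 the prefix chain that finds a first one, 6 the solution, 7 the candidate, 8 its weight in unary, 9
the chain of the zero test, 10 the echelon matrix. Only the last tag has quadratically many wires.
-/
abbrev oneW : Wire := (0, 0, 0)

variable (r k n b : ℕ) (a : ℕ → ℕ → ℕ) (σ x₀ : ℕ → ℕ)

/-- The matrix a is classical: its entries decide which gates are present, so only the masked matrix
after reduction needs qubits. -/
def loadCol (m : ℕ) : List TGate := (List.range r).flatMap fun i =>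
  if a (b + i) m = 0 then [] else [((1, i, 0), (2, m, 0), (3, i, 0))]

def loadRhs : List TGate := (List.range r).flatMap fun i => [((1, i, 0), (7, b + i, 0), (3, i, 0))]

/-- Wire (5, i) receives the product `zerosBefore` of column l. In each pair the first gate, with
equal controls, copies the product so far and the second subtracts the part where the next entry is
one. -/
def firstOne (l : ℕ) : List TGate := (oneW, oneW, (5, 0, 0)) :: (List.range r).flatMap fun i =>
  [((5, i, 0), (5, i, 0), (5, i + 1, 0)), ((5, i, 0), (10, i, l), (5, i + 1, 0))]

/-- The indicator of the first one at position i is the sum of the chain at i and at i + 1, hence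
two gates per row for the coefficient. -/
def useOne (l : ℕ) : List TGate := ((List.range r).flatMap fun i =>
    [((5, i, 0), (3, i, 0), (4, l, 0)), ((5, i + 1, 0), (3, i, 0), (4, l, 0))]) ++
  (List.range r).flatMap fun i => [((4, l, 0), (10, i, l), (3, i, 0))]

def reduceBy (l : ℕ) : List TGate := firstOne r l ++ (useOne r l ++ (firstOne r l).reverse)

def reduceAll (m : ℕ) : List TGate := (List.range m).flatMap (reduceBy r)

def column (m : ℕ) : List TGate := loadCol r b a m ++ reduceAll r m

def rhs : List TGate := loadRhs r b ++ reduceAll r k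

def initE : List TGate := (List.range n).flatMap fun j =>
  (if σ j = 0 then [] else [(oneW, oneW, (7, j, 0))]) ++ (List.range k).flatMap fun c =>
    if x₀ c = 0 then [] else if a j c = 0 then [] else [((2, c, 0), (2, c, 0), (7, j, 0))]

/-- The workspace is cleared after each column: the reduced column is copied to its place in the
matrix, and its computation is undone. -/
def fillM : List TGate := (List.range k).flatMap fun m =>
  column r b a m ++ (((List.range r).flatMap fun i => [((3, i, 0), (3, i, 0), (10, i, m))]) ++
    (column r b a m).reverse)

def initY : List TGate :=
  rhs r k b ++ (((List.range k).flatMap fun l => [((4, l, 0), (4, l, 0), (6, l, 0))]) ++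
    (rhs r k b).reverse)

/-- The coefficients of column m are recomputed from the stored echelon columns instead of being
kept; a second quadratic register would exceed the number of qubits allowed. -/
def backY : List TGate := (List.range k).reverse.flatMap fun m =>
  column r b a m ++ (((List.range m).flatMap fun l => [((4, l, 0), (6, m, 0), (6, l, 0))]) ++
    (column r b a m).reverse)

def finalE : List TGate := (List.range n).flatMap fun j => (List.range k).flatMap fun c =>
  if a j c = 0 then [] else [((2, c, 0), (6, c, 0), (7, j, 0))]

/-- The weight so far is marked in unary. If bit j is set, the two gates for l move a mark from l to
l + 1. As l descends, a mark that has moved is not met again. -/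
def counter : List TGate := (oneW, oneW, (8, 0, 0)) :: (List.range n).flatMap fun j =>
  (List.range (j + 1)).reverse.flatMap fun l =>
    [((7, j, 0), (8, l, 0), (8, l + 1, 0)), ((7, j, 0), (8, l + 1, 0), (8, l, 0))]

/-- The circuit that computes the candidate for the solution and its weight. -/
def oracle : List TGate :=
  initE k n a σ x₀ ++ (fillM r k b a ++ (initY r k b ++ (backY r k b a ++ (finalE k n a ++
    counter n))))

/-- The circuit that tests whether all coins are zero. -/
def allZero : List TGate := (oneW, oneW, (9, 0, 0)) :: (((List.range r).flatMap fun i =>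
    [((9, i, 0), (9, i, 0), (9, i + 1, 0)), ((9, i, 0), (1, i, 0), (9, i + 1, 0))]) ++
  (List.range k).flatMap fun c => [((9, r + c, 0), (9, r + c, 0), (9, r + c + 1, 0)),
    ((9, r + c, 0), (2, c, 0), (9, r + c + 1, 0))])

variable {r k n b a σ x₀}

lemma zerosBefore_succ (ν : ℕ → ZMod 2) (i : ℕ) :
    zerosBefore ν (i + 1) = zerosBefore ν i + zerosBefore ν i * ν i := by
  grind [zerosBefore, prod_range_succ]

/-- The offset s lets a second chain continue where a first one has ended, as in `allZero`. -/
lemma runW_chain (s t : ℕ) (ctl : ℕ → Wire) (hc : ∀ i < r, ∀ j, ctl i ≠ (t, j, 0))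
    (w : WState) (hw : ∀ i < r, w (t, s + i + 1, 0) = 0) :
    (∀ i ≤ r, runW ((List.range r).flatMap fun i => [((t, s + i, 0), (t, s + i, 0), (t, s + i + 1, 0)),
      ((t, s + i, 0), ctl i, (t, s + i + 1, 0))]) w (t, s + i, 0) =
        w (t, s, 0) * zerosBefore (fun i => w (ctl i)) i) := by
  induction r with
  | zero => simp [runW, zerosBefore]
  | succ r ih =>
    rw [List.range_succ, List.flatMap_append, runW_append]
    set w' := runW ((List.range r).flatMap fun i => [((t, s + i, 0), (t, s + i, 0), (t, s + i + 1, 0)),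
      ((t, s + i, 0), ctl i, (t, s + i + 1, 0))]) w with hw'
    have h1 : w' (ctl r) = w (ctl r) := by
      refine runW_frame (fun g hg e => ?_) w
      grind
    have h2 : w' (t, s + r + 1, 0) = w (t, s + r + 1, 0) := by
      refine runW_frame (fun g hg e => ?_) w
      grind
    simp only [List.flatMap_cons, List.flatMap_nil, List.append_nil, runW_cons, TGate.act]
    have e1 : ∀ w : WState, runW [] w = w := fun _ => rfl
    rw [e1]
    grind [Nat.lt_or_ge, update_of_ne, update_self, le_rfl, zmod2_mul_self, zerosBefore_succ]

end circuits

section circuits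

variable {r k n b : ℕ} {a : ℕ → ℕ → ℕ} {σ x₀ : ℕ → ℕ}

/-- All elements of a list have a property. -/
def AllG {α : Type*} (P : α → Prop) (L : List α) : Prop := ∀ g ∈ L, P g

section
variable {α : Type*} {P : α → Prop} {L L' : List α}

@[simp] lemma AllG_nil : AllG P [] := by simp [AllG]
@[simp] lemma AllG_cons {g : α} : AllG P (g :: L) ↔ P g ∧ AllG P L := List.forall_mem_cons
@[simp] lemma AllG_append : AllG P (L ++ L') ↔ AllG P L ∧ AllG P L' := List.forall_mem_append
@[simp] lemma AllG_reverse : AllG P L.reverse ↔ AllG P L := by simp [AllG]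
@[simp] lemma AllG_flatMap {β : Type*} {l : List β} {F : β → List α} :
    AllG P (l.flatMap F) ↔ AllG (fun i => AllG P (F i)) l := by
  grind [AllG, List.mem_flatMap]
@[simp] lemma AllG_range {P : ℕ → Prop} {m : ℕ} : AllG P (List.range m) ↔ ∀ i < m, P i := by
  simp [AllG]
@[simp] lemma AllG_ite {c : Prop} [Decidable c] :
    AllG P (if c then L else L') ↔ (c → AllG P L) ∧ (¬ c → AllG P L') := by
  grind
end

lemma runW_frame_of {L : List TGate} {P : Wire → Prop} (hL : AllG (fun g => P g.2.2) L)
    {x : Wire} (hx : ¬ P x) (w : WState) : runW L w x = w x :=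
  runW_frame (fun g hg e => hx (by rw [← e]; exact hL g hg)) w

lemma runW_par {L : List TGate}
    (h : AllG (fun g => AllG (fun g' => g.2.2 ≠ g'.1 ∧ g.2.2 ≠ g'.2.1) L) L)
    (w : WState) (x : Wire) : runW L w x = w x + gain w x L := runW_parallel h w x

lemma runW_con {L H : List TGate} (S : Wire → Prop) [DecidablePred S]
    (hL : AllG (fun g => ¬ S g.1 ∧ ¬ S g.2.1 ∧ ¬ S g.2.2) L) (hP : AllG TGate.Proper L)
    (hH : AllG (fun g => S g.2.2) H) (w : WState) (x : Wire) :
    runW (L ++ (H ++ L.reverse)) w x = if S x then runW H (runW L w) x else w x :=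
  runW_conj S hL hP hH w x

lemma runW_flatMap_succ (m : ℕ) (F : ℕ → List TGate) (w : WState) :
    runW ((List.range (m + 1)).flatMap F) w = runW (F m) (runW ((List.range m).flatMap F) w) := by
  simp [List.range_succ, List.flatMap_append, runW_append]

/-! ### Congruence -/

lemma zerosBefore_congr {ν ν' : ℕ → ZMod 2} {i : ℕ} (h : ∀ i' < i, ν i' = ν' i') :
    zerosBefore ν i = zerosBefore ν' i :=
  prod_congr rfl fun i' hi' => by grind

lemma lead_congr {ν ν' T T' : ℕ → ZMod 2} (h : ∀ i < r, ν i = ν' i) (h' : ∀ i < r, T i = T' i) :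
    lead r ν T = lead r ν' T' := by
  refine sum_congr rfl fun i hi => ?_
  grind [mem_range, zerosBefore_congr]

lemma reduce_congr {ν ν' : ℕ → ℕ → ZMod 2} {T T' : ℕ → ZMod 2} {m : ℕ}
    (h : ∀ i < r, ∀ l < m, ν i l = ν' i l) (h' : ∀ i < r, T i = T' i) :
    ∀ i < r, reduce r ν m T i = reduce r ν' m T' i := by
  induction m with
  | zero => exact h'
  | succ m ih => grind [reduce, lead_congr]

lemma coeff_congr {ν ν' : ℕ → ℕ → ZMod 2} {T T' : ℕ → ZMod 2} {l : ℕ}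
    (h : ∀ i < r, ∀ l' ≤ l, ν i l' = ν' i l') (h' : ∀ i < r, T i = T' i) :
    coeff r ν T l = coeff r ν' T' l :=
  lead_congr (fun i hi => h i hi l le_rfl)
    (reduce_congr (fun i hi l' hl' => h i hi l' (by omega)) h')

/-! ### Wires -/

/-- The wires of the circuits that reduce a column. -/
def Inner (m : ℕ) (x : Wire) : Prop := x.1 ≤ 5 ∨ (x.1 = 10 ∧ x.2.2 < m)

/-- All wires of a gate have a property. -/
def TGate.On (P : Wire → Prop) (g : TGate) : Prop := P g.1 ∧ P g.2.1 ∧ P g.2.2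

lemma TGate.On.mono {P Q : Wire → Prop} (h : ∀ x, P x → Q x) {g : TGate} (hg : g.On P) :
    g.On Q := ⟨h _ hg.1, h _ hg.2.1, h _ hg.2.2⟩

lemma firstOne_on (l : ℕ) : AllG (fun g => g.On (fun x => x.1 = 0 ∨ x.1 = 5 ∨ (x.1 = 10 ∧ x.2.2 = l)) ∧ g.Proper) (firstOne r l) := by
  simp [firstOne, TGate.On, TGate.Proper, oneW]

lemma reduceBy_on (l : ℕ) : AllG (fun g => g.On (Inner (l + 1)) ∧ g.Proper) (reduceBy r l) := by
  simp [firstOne, Inner, firstOne_on, reduceBy, AllG_append, AllG_reverse, useOne, TGate.On, TGate.Proper]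

lemma reduceAll_on (m : ℕ) : AllG (fun g => g.On (Inner m) ∧ g.Proper) (reduceAll r m) := by
  simp only [reduceAll, AllG_flatMap, AllG_range]
  intro l hl g hg
  exact ⟨(reduceBy_on l g hg).1.mono fun x hx => by grind [Inner], (reduceBy_on l g hg).2⟩

lemma column_on (m : ℕ) : AllG (fun g => g.On (Inner m) ∧ g.Proper) (column r b a m) := by
  simp only [column, AllG_append]
  refine ⟨?_, reduceAll_on m⟩
  simp [loadCol, TGate.On, TGate.Proper, Inner]

lemma rhs_on : AllG (fun g => g.On (fun x => Inner k x ∨ x.1 = 7) ∧ g.Proper) (rhs r k b) := by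
  simp only [rhs, AllG_append]
  refine ⟨?_, fun g hg => ⟨(reduceAll_on k g hg).1.mono fun x hx => Or.inl hx,
    (reduceAll_on k g hg).2⟩⟩
  simp [loadRhs, TGate.On, TGate.Proper, Inner]

/-! ### Semantics -/

lemma sum_range_ite_prod {m : ℕ} (f : ℕ → ZMod 2) (t j : ℕ) :
    ∑ i ∈ range m, (if ((t, i, 0) : Wire) = (t, j, 0) then f i else 0)
      = if j < m then f j else 0 := by
  simp

lemma firstOne_spec {l : ℕ} {w : WState} (h1 : w oneW = 1) (h5 : ∀ i ≤ r, w (5, i, 0) = 0)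
    {i : ℕ} (hi : i ≤ r) :
    runW (firstOne r l) w (5, i, 0) = zerosBefore (fun i => w (10, i, l)) i := by
  have h := runW_chain (r := r) 0 5 (fun i => (10, i, l)) (by simp)
    (TGate.act w (oneW, oneW, (5, 0, 0))) (fun i hi => by simp_all [TGate.act, update_apply]) i hi
  simp_all [Nat.zero_add, firstOne, runW_cons, TGate.act, update_apply, Nat.zero_le]

/-- An instance of `runW_con` in which the chain for the first one is computed and undone. Between,
the coefficient is formed before the column is changed, so the two halves of `useOne` are parallel
circuits. -/
lemma reduceBy_spec {l : ℕ} {w : WState} (h1 : w oneW = 1) (h5 : ∀ i ≤ r, w (5, i, 0) = 0)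
    (h4 : w (4, l, 0) = 0) :
    runW (reduceBy r l) w (4, l, 0) = lead r (fun i => w (10, i, l)) (fun i => w (3, i, 0)) ∧
    (∀ i < r, runW (reduceBy r l) w (3, i, 0) = w (3, i, 0) +
      lead r (fun i => w (10, i, l)) (fun i => w (3, i, 0)) * w (10, i, l)) ∧
    ∀ x : Wire, x ≠ (4, l, 0) → (∀ i < r, x ≠ (3, i, 0)) → runW (reduceBy r l) w x = w x := by
  classical
  set S : Wire → Prop := fun x => x = (4, l, 0) ∨ ∃ i < r, x = (3, i, 0) with hS
  have conj := runW_con (L := firstOne r l) (H := useOne r l) S (fun g hg => by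
      have hn : ∀ x : Wire, (x.1 = 0 ∨ x.1 = 5 ∨ (x.1 = 10 ∧ x.2.2 = l)) → ¬ S x := by grind
      obtain ⟨⟨a1, a2, a3⟩, -⟩ := firstOne_on l g hg
      exact ⟨hn _ a1, hn _ a2, hn _ a3⟩)
    (fun g hg => (firstOne_on l g hg).2)
    (by simp_all [useOne, AllG_append, AllG_cons]) w
  rw [← reduceBy] at conj
  set w₁ := runW (firstOne r l) w with hw₁
  have f1 : ∀ x : Wire, x.1 ≠ 5 → w₁ x = w x := by
    intro x hx
    refine runW_frame_of (P := fun x => x.1 = 5) ?_ hx w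
    simp [firstOne]
  have n1 : ∀ i ≤ r, w₁ (5, i, 0) = zerosBefore (fun i => w (10, i, l)) i := fun i hi =>
    firstOne_spec h1 h5 hi
  set w₂ := runW ((List.range r).flatMap fun i =>
    [((5, i, 0), (3, i, 0), (4, l, 0)), ((5, i + 1, 0), (3, i, 0), (4, l, 0))]) w₁ with hw₂
  have p2 := runW_par (L := (List.range r).flatMap fun i =>
    [((5, i, 0), (3, i, 0), (4, l, 0)), ((5, i + 1, 0), (3, i, 0), (4, l, 0))]) (by simp) w₁
  rw [← hw₂] at p2
  have p3 := runW_par (L := (List.range r).flatMap fun i =>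
    [((4, l, 0), (10, i, l), (3, i, 0))]) (by simp) w₂
  have e2 : w₂ (4, l, 0) = lead r (fun i => w (10, i, l)) (fun i => w (3, i, 0)) := by
    rw [p2, gain_flatMap, f1 _ (by simp), h4, zero_add]
    refine sum_congr rfl fun i hi => ?_
    simp only [gain_cons, gain_nil, if_true, add_zero]
    grind [zerosBefore_succ, add_mul, add_assoc, zmod2_add_self, zero_add]
  have e2' : ∀ x : Wire, x.1 ≠ 4 → w₂ x = w₁ x := by
    intro x hx
    refine runW_frame_of (P := fun x => x.1 = 4) ?_ hx _
    simp
  have e3 : runW (useOne r l) w₁ = runW ((List.range r).flatMap fun i =>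
    [((4, l, 0), (10, i, l), (3, i, 0))]) w₂ := by rw [useOne, runW_append]
  refine ⟨?_, fun i hi => ?_, fun x hx hx' => ?_⟩
  · rw [conj, if_pos (Or.inl rfl), e3, p3, e2, gain_flatMap, sum_eq_zero, add_zero]
    intro i _; rfl
  · rw [conj, if_pos (Or.inr ⟨i, hi, rfl⟩), e3, p3, gain_flatMap, e2' _ (by simp), f1 _ (by simp)]
    simp only [gain_cons, gain_nil, add_zero]
    simp_all
  grind

/-- The auxiliary wires are zero. -/
structure Clean (w : WState) : Prop where
  one : w oneW = 1
  w3 : ∀ i, w (3, i, 0) = 0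
  w4 : ∀ i, w (4, i, 0) = 0
  w5 : ∀ i, w (5, i, 0) = 0

lemma reduceAll_spec {m : ℕ} {w : WState} (h1 : w oneW = 1) (h5 : ∀ i, w (5, i, 0) = 0)
    (h4 : ∀ l, w (4, l, 0) = 0) :
    (∀ l < m, runW (reduceAll r m) w (4, l, 0)
      = coeff r (fun i l => w (10, i, l)) (fun i => w (3, i, 0)) l) ∧
    (∀ i < r, runW (reduceAll r m) w (3, i, 0)
      = reduce r (fun i l => w (10, i, l)) m (fun i => w (3, i, 0)) i) ∧
    ∀ x : Wire, (∀ l < m, x ≠ (4, l, 0)) → (∀ i < r, x ≠ (3, i, 0)) →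
      runW (reduceAll r m) w x = w x := by
  induction m with
  | zero => exact ⟨by simp, fun i _ => rfl, fun x _ _ => rfl⟩
  | succ m ih =>
    obtain ⟨a1, a2, a3⟩ := ih
    set w' := runW (reduceAll r m) w with hw'
    have e : runW (reduceAll r (m + 1)) w = runW (reduceBy r m) w' := runW_flatMap_succ _ _ _
    have f10 : ∀ i l, w' (10, i, l) = w (10, i, l) := fun i l => a3 _ (by simp) (by simp)
    obtain ⟨c1, c2, c3⟩ := reduceBy_spec (r := r) (l := m) (w := w')
      ((a3 _ (by simp) (by simp)).trans h1)
      (fun i _ => (a3 _ (by simp) (by simp)).trans (h5 i))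
      ((a3 _ (by grind) (by simp)).trans (h4 m))
    have hl : lead r (fun i => w' (10, i, m)) (fun i => w' (3, i, 0))
        = coeff r (fun i l => w (10, i, l)) (fun i => w (3, i, 0)) m := by
      simp only [f10]
      exact lead_congr (fun _ _ => rfl) a2
    rw [e]
    refine ⟨fun l hl' => ?_, fun i hi => ?_, fun x hx hx' => ?_⟩
    · rcases Nat.lt_succ_iff_lt_or_eq.1 hl' with h | rfl
      · rw [c3 _ (by grind) (by simp), a1 l h]
      grind
    · rw [c2 i hi, a2 i hi, hl, f10]; rfl
    grind

/-- The masked columns. -/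
def maskedCol (b : ℕ) (a : ℕ → ℕ → ℕ) (w : WState) (i m : ℕ) : ZMod 2 :=
  if a (b + i) m = 0 then 0 else w (1, i, 0) * w (2, m, 0)

lemma column_spec {m : ℕ} {w : WState} (hw : Clean w) : (∀ l < m, runW (column r b a m) w (4, l, 0)
      = coeff r (fun i l => w (10, i, l)) (fun i => maskedCol b a w i m) l) ∧
    ∀ i < r, runW (column r b a m) w (3, i, 0)
      = reduce r (fun i l => w (10, i, l)) m (fun i => maskedCol b a w i m) i := by
  set w' := runW (loadCol r b a m) w with hw'
  have f : ∀ x : Wire, x.1 ≠ 3 → w' x = w x := by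
    intro x hx
    refine runW_frame_of (P := fun x => x.1 = 3) ?_ hx _
    simp [loadCol]
  have h3 : ∀ i < r, w' (3, i, 0) = maskedCol b a w i m := by
    intro j hj
    rw [hw', runW_par (by simp [loadCol]), hw.w3,
      zero_add, loadCol, gain_flatMap, ← if_pos (c := j < r) hj (t := maskedCol b a w j m) (e := 0),
      ← sum_range_ite_prod (fun j => maskedCol b a w j m) 3]
    grind [sum_congr, maskedCol, gain_cons, gain_nil]
  obtain ⟨a1, a2, -⟩ := reduceAll_spec (r := r) (m := m) (w := w')
    ((f _ (by simp)).trans hw.one) (fun i => (f _ (by simp)).trans (hw.w5 i))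
    (fun i => (f _ (by simp)).trans (hw.w4 i))
  have e : runW (column r b a m) w = runW (reduceAll r m) w' := by rw [column, runW_append]
  rw [e]
  grind [coeff_congr, reduce_congr]

lemma rhs_spec {w : WState} (hw : Clean w) : ∀ l < k, runW (rhs r k b) w (4, l, 0)
      = coeff r (fun i l => w (10, i, l)) (fun i => w (1, i, 0) * w (7, b + i, 0)) l := by
  set w' := runW (loadRhs r b) w with hw'
  have f : ∀ x : Wire, x.1 ≠ 3 → w' x = w x := by
    intro x hx
    refine runW_frame_of (P := fun x => x.1 = 3) ?_ hx _
    simp [loadRhs]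
  have h3 : ∀ i < r, w' (3, i, 0) = w (1, i, 0) * w (7, b + i, 0) := by
    intro j hj
    rw [hw', runW_par (by simp [loadRhs]), hw.w3, zero_add, loadRhs, gain_flatMap]
    simp only [gain_cons, gain_nil, add_zero]
    simp_all
  obtain ⟨a1, a2, -⟩ := reduceAll_spec (r := r) (m := k) (w := w')
    ((f _ (by simp)).trans hw.one) (fun i => (f _ (by simp)).trans (hw.w5 i))
    (fun i => (f _ (by simp)).trans (hw.w4 i))
  have e : runW (rhs r k b) w = runW (reduceAll r k) w' := by rw [rhs, runW_append]
  rw [e]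
  grind [coeff_congr]

lemma Clean.of_eq {w w' : WState} (hw : Clean w) (h : ∀ x : Wire, x.1 ≤ 5 → w' x = w x) :
    Clean w' where
  one := (h _ (by simp)).trans hw.one
  w3 i := (h _ (by simp)).trans (hw.w3 i)
  w4 i := (h _ (by simp)).trans (hw.w4 i)
  w5 i := (h _ (by simp)).trans (hw.w5 i)

lemma maskedCol_congr {w w' : WState} (h : ∀ x : Wire, x.1 ≤ 5 → w' x = w x) :
    maskedCol b a w' = maskedCol b a w := by
  grind [maskedCol]

lemma echelon_succ (col : ℕ → ℕ → ZMod 2) (m i l : ℕ) : echelon r col (m + 1) i l =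
    if l = m then reduce r (echelon r col m) m (fun i => col i m) i else echelon r col m i l := rfl

lemma echelon_of_lt {col : ℕ → ℕ → ZMod 2} {m m' l : ℕ} (h : l < m) (h' : m ≤ m') (i : ℕ) :
    echelon r col m' i l = echelon r col m i l := by
  induction m' with
  | zero => omega
  | succ m' ih =>
    rcases Nat.lt_or_ge m' m with h1 | h1
    · grind
    · rw [echelon_succ, if_neg (by omega), ih h1]

lemma fillM_spec {w : WState} (hw : Clean w) (h10 : ∀ i l, w (10, i, l) = 0) :
    (∀ i < r, ∀ l, runW (fillM r k b a) w (10, i, l) = echelon r (maskedCol b a w) k i l) ∧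
    ∀ x : Wire, x.1 ≠ 10 → runW (fillM r k b a) w x = w x := by
  classical
  induction k with
  | zero => exact ⟨fun i _ l => h10 i l, fun x _ => rfl⟩
  | succ m ih =>
    obtain ⟨a1, a2⟩ := ih
    set w' := runW (fillM r m b a) w with hw'
    have h5 : ∀ x : Wire, x.1 ≤ 5 → w' x = w x := fun x hx => a2 x (by omega)
    have hcl : Clean w' := hw.of_eq h5
    set S : Wire → Prop := fun x => ∃ i < r, x = (10, i, m) with hS
    have conj := runW_con (L := column r b a m)
      (H := (List.range r).flatMap fun i => [((3, i, 0), (3, i, 0), (10, i, m))]) S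
      (fun g hg => by
        have hn : ∀ x : Wire, Inner m x → ¬ S x := by grind [Inner]
        obtain ⟨⟨a1, a2, a3⟩, -⟩ := column_on m g hg
        grind)
      (fun g hg => (column_on m g hg).2) (by simp [hS]) w'
    have e : runW (fillM r (m + 1) b a) w = runW (column r b a m ++
      (((List.range r).flatMap fun i => [((3, i, 0), (3, i, 0), (10, i, m))]) ++
        (column r b a m).reverse)) w' := runW_flatMap_succ _ _ _
    rw [← e] at conj
    obtain ⟨-, c2⟩ := column_spec (r := r) (b := b) (a := a) (m := m) hcl
    have hcol := maskedCol_congr (b := b) (a := a) h5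
    refine ⟨fun i hi l => ?_, fun x hx => ?_⟩
    · rw [conj]
      by_cases hl : l = m
      · subst hl
        rw [if_pos ⟨i, hi, rfl⟩, runW_par (by simp), gain_flatMap]
        have : runW (column r b a l) w' (10, i, l) = 0 := by
          rw [runW_frame_of (P := fun x => x.1 ≠ 10) ?_ (by simp), a1 i hi]
          · have : ∀ m' ≤ l, echelon r (maskedCol b a w) m' i l = 0 := by
              intro m'
              induction m' with
              | zero => intro _; rfl
              | succ m' ih => intro h; rw [echelon_succ, if_neg (by omega), ih (by omega)]
            grind
          simp [column, reduceAll, reduceBy, useOne, loadCol, firstOne, or_imp, forall_and]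
        simp only [gain_cons, gain_nil, add_zero, zmod2_mul_self]
        have h2 : ∀ i', ((10, i', l) : Wire) = (10, i, l) ↔ i' = i := by simp
        simp only [h2, sum_ite_eq', mem_range, if_pos hi, c2 i hi, hcol]
        rw [echelon_succ, if_pos rfl]
        grind [reduce_congr]
      · rw [if_neg (by grind), a1 i hi, echelon_succ, if_neg hl]
    grind

lemma initY_spec {w : WState} (hw : Clean w) (h6 : ∀ l, w (6, l, 0) = 0) :
    (∀ l < k, runW (initY r k b) w (6, l, 0)
      = coeff r (fun i l => w (10, i, l)) (fun i => w (1, i, 0) * w (7, b + i, 0)) l) ∧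
    ∀ x : Wire, x.1 ≠ 6 → runW (initY r k b) w x = w x := by
  classical
  have conj := runW_con (L := rhs r k b)
    (H := (List.range k).flatMap fun l => [((4, l, 0), (4, l, 0), (6, l, 0))]) (fun x => x.1 = 6)
    (fun g hg => by
      have hn : ∀ x : Wire, (Inner k x ∨ x.1 = 7) → ¬ x.1 = 6 := by grind [Inner]
      obtain ⟨⟨a1, a2, a3⟩, -⟩ := rhs_on g hg
      grind)
    (fun g hg => (rhs_on g hg).2) (by simp) w
  rw [← initY] at conj
  refine ⟨fun l hl => ?_, fun x hx => by grind⟩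
  rw [conj, if_pos rfl, runW_par (by simp), gain_flatMap]
  have : runW (rhs r k b) w (6, l, 0) = 0 := by
    rw [runW_frame_of (P := fun x => x.1 ≠ 6) ?_ (by simp), h6]
    intro g hg h
    have := (rhs_on g hg).1.2.2
    simp_all [Inner]
  simp only [gain_cons, gain_nil, add_zero, zmod2_mul_self]
  rw [sum_range_ite_prod (fun l => runW (rhs r k b) w (4, l, 0)), if_pos hl, this, zero_add,
    rhs_spec hw l hl]

/-- Downward induction on the number of columns that are still to be processed. Wires other than tag
6 are unchanged between the passes, so each pass sees the same masked columns and echelon matrix. -/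
lemma backY_spec {w : WState} {T : ℕ → ZMod 2} (hw : Clean w)
    (h10 : ∀ i < r, ∀ l, w (10, i, l) = echelon r (maskedCol b a w) k i l)
    (h6 : ∀ l < k, w (6, l, 0) = coeff r (echelon r (maskedCol b a w) k) T l) :
    (∀ l < k, runW (backY r k b a) w (6, l, 0) = solve r k (maskedCol b a w) T l) ∧
    ∀ x : Wire, x.1 ≠ 6 → runW (backY r k b a) w x = w x := by
  classical
  have key : ∀ t ≤ k, ∀ w' : WState, (∀ x : Wire, x.1 ≠ 6 → w' x = w x) →
      (∀ l < k, w' (6, l, 0) = backSub r k (maskedCol b a w) T (k - t) l) →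
      (∀ l < k, runW ((List.range t).reverse.flatMap fun m => column r b a m ++
        (((List.range m).flatMap fun l => [((4, l, 0), (6, m, 0), (6, l, 0))]) ++
        (column r b a m).reverse)) w' (6, l, 0) = solve r k (maskedCol b a w) T l) ∧
      ∀ x : Wire, x.1 ≠ 6 → runW ((List.range t).reverse.flatMap fun m => column r b a m ++
        (((List.range m).flatMap fun l => [((4, l, 0), (6, m, 0), (6, l, 0))]) ++
        (column r b a m).reverse)) w' x = w x := by
    intro t
    induction t with
    | zero => intro _ w' h1 h2; exact ⟨h2, h1⟩
    | succ m ih =>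
      intro hm w' h1 h2
      have h5 : ∀ x : Wire, x.1 ≤ 5 → w' x = w x := fun x hx => h1 x (by omega)
      have hcl : Clean w' := hw.of_eq h5
      have hcol := maskedCol_congr (b := b) (a := a) h5
      rw [List.range_succ, List.reverse_append, List.reverse_singleton, List.singleton_append,
        List.flatMap_cons]
      simp only [runW_append _ (List.flatMap _ (List.range m).reverse)]
      set w'' := runW (column r b a m ++
        (((List.range m).flatMap fun l => [((4, l, 0), (6, m, 0), (6, l, 0))]) ++
        (column r b a m).reverse)) w' with hw''
      have conj := runW_con (L := column r b a m)
        (H := (List.range m).flatMap fun l => [((4, l, 0), (6, m, 0), (6, l, 0))])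
        (fun x => x.1 = 6)
        (fun g hg => by
          have hn : ∀ x : Wire, Inner m x → ¬ x.1 = 6 := by grind [Inner]
          obtain ⟨⟨a1, a2, a3⟩, -⟩ := column_on m g hg
          grind)
        (fun g hg => (column_on m g hg).2) (by simp) w'
      rw [← hw''] at conj
      refine ih (by omega) w'' (fun x hx => by grind) fun l hl => ?_
      have f6 : ∀ l, runW (column r b a m) w' (6, l, 0) = w' (6, l, 0) := by
        intro l
        refine runW_frame_of (P := fun x => x.1 ≠ 6) ?_ (by simp) _
        intro g hg h
        have := (column_on m g hg).1.2.2
        grind [Inner]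
      have hkm : k - m = (k - (m + 1)) + 1 := by omega
      have hkm' : k - (k - (m + 1) + 1) = m := by omega
      rw [conj, if_pos rfl, runW_par (by
        simp; omega), gain_flatMap, f6,
        h2 l hl, hkm]
      simp only [backSub, hkm']
      congr 1
      simp only [gain_cons, gain_nil, add_zero]
      rw [sum_range_ite_prod (fun l => runW (column r b a m) w' (4, l, 0) *
        runW (column r b a m) w' (6, m, 0))]
      by_cases hlm : l < m
      · obtain ⟨c1, -⟩ := column_spec (r := r) (b := b) (a := a) (m := m) hcl
        rw [if_pos hlm, if_pos hlm, c1 l hlm, f6, h2 m (by omega), hcol]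
        congr 1
        grind [coeff_congr]
      grind
  exact key k le_rfl w (fun _ _ => rfl) fun l hl => by
    simp only [Nat.sub_self, h6 l hl, backSub, if_pos hl]

end circuits

section circuits

variable {r k n b : ℕ} {a : ℕ → ℕ → ℕ} {σ x₀ : ℕ → ℕ}

/-! ### The oracle -/

/-- The bit that a number represents. -/
def bit (x : ℕ) : ZMod 2 := if x = 0 then 0 else 1

/-- The candidate before the equations have been solved. -/
def preCandidate (k : ℕ) (a : ℕ → ℕ → ℕ) (σ x₀ : ℕ → ℕ) (K : ℕ → ZMod 2) (j : ℕ) : ZMod 2 :=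
  bit (σ j) + ∑ c ∈ range k, bit (a j c) * (bit (x₀ c) * K c)

/-- The solution of the equations for the coins in `w`. -/
def solution (r k b : ℕ) (a : ℕ → ℕ → ℕ) (σ x₀ : ℕ → ℕ) (w : WState) : ℕ → ZMod 2 :=
  solve r k (maskedCol b a w)
    fun i => w (1, i, 0) * preCandidate k a σ x₀ (fun c => w (2, c, 0)) (b + i)

/-- The candidate for the coins in `w`. -/
def candidate (r k b : ℕ) (a : ℕ → ℕ → ℕ) (σ x₀ : ℕ → ℕ) (w : WState) (j : ℕ) : ZMod 2 :=
  preCandidate k a σ x₀ (fun c => w (2, c, 0)) j +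
    ∑ c ∈ range k, bit (a j c) * (w (2, c, 0) * solution r k b a σ x₀ w c)

/-- The initial states of the oracle. -/
structure Ready (w : WState) : Prop extends Clean w where
  w6 : ∀ i, w (6, i, 0) = 0
  w7 : ∀ i, w (7, i, 0) = 0
  w8 : ∀ i, w (8, i, 0) = 0
  w9 : ∀ i, w (9, i, 0) = 0
  w10 : ∀ i l, w (10, i, l) = 0

lemma initE_spec {w : WState} (h1 : w oneW = 1) (h7 : ∀ j, w (7, j, 0) = 0) {j : ℕ} (hj : j < n) :
    runW (initE k n a σ x₀) w (7, j, 0) = preCandidate k a σ x₀ (fun c => w (2, c, 0)) j := by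
  rw [runW_par (by simp [initE]), h7, zero_add, initE, gain_flatMap,
    ← if_pos hj (t := preCandidate k a σ x₀ (fun c => w (2, c, 0)) j) (e := 0),
    ← sum_range_ite_prod (fun j => preCandidate k a σ x₀ (fun c => w (2, c, 0)) j) 7]
  refine sum_congr rfl fun j' _ => ?_
  rw [gain_append, gain_flatMap]
  by_cases h : j' = j
  · subst h
    rw [if_pos rfl, preCandidate]
    grind [bit, gain_cons, gain_nil, sum_congr, zmod2_mul_self]
  · have hne : ¬ (((7, j', 0) : Wire) = (7, j, 0)) := by grind
    rw [if_neg hne, sum_eq_zero, add_zero]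
    · grind [gain_cons, gain_nil]
    grind [gain_cons, gain_nil]

lemma initE_frame (w : WState) {x : Wire} (hx : x.1 ≠ 7) : runW (initE k n a σ x₀) w x = w x :=
  runW_frame_of (P := fun x => x.1 = 7) (by simp [initE]) hx w

lemma finalE_spec {w : WState} {j : ℕ} (hj : j < n) :
    runW (finalE k n a) w (7, j, 0) = w (7, j, 0) +
      ∑ c ∈ range k, bit (a j c) * (w (2, c, 0) * w (6, c, 0)) := by
  rw [runW_par (by simp [finalE]), finalE, gain_flatMap]
  congr 1
  rw [← if_pos hj (t := ∑ c ∈ range k, bit (a j c) * (w (2, c, 0) * w (6, c, 0))) (e := 0),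
    ← sum_range_ite_prod (fun j => ∑ c ∈ range k, bit (a j c) * (w (2, c, 0) * w (6, c, 0))) 7]
  refine sum_congr rfl fun j' _ => ?_
  rw [gain_flatMap]
  by_cases h : j' = j
  · subst h
    grind [sum_congr, bit, gain_cons, gain_nil]
  · have hne : ¬ (((7, j', 0) : Wire) = (7, j, 0)) := by grind
    rw [if_neg hne, sum_eq_zero]
    grind [gain_cons, gain_nil]

lemma finalE_frame (w : WState) {x : Wire} (hx : x.1 ≠ 7) : runW (finalE k n a) w x = w x :=
  runW_frame_of (P := fun x => x.1 = 7) (by simp [finalE]) hx w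

/-- The gates that move the mark of the counter if the bit `j` is set. -/
def shiftGates (j t : ℕ) : List TGate := (List.range t).reverse.flatMap fun l =>
    [((7, j, 0), (8, l, 0), (8, l + 1, 0)), ((7, j, 0), (8, l + 1, 0), (8, l, 0))]

lemma shiftGates_zero {j : ℕ} (t : ℕ) {w : WState} (h : w (7, j, 0) = 0) :
    runW (shiftGates j t) w = w := by
  have : ∀ L : List TGate, AllG (fun g => g.1 = (7, j, 0)) L → runW L w = w := by
    intro L hL
    induction L with
    | nil => rfl
    | cons g L ih => simp_all [AllG_cons, TGate.act, zero_mul, add_zero, update_eq_self, runW_cons]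
  simp_all [shiftGates]

/-- The mark may not sit at the top position t: there the gates for l = t - 1 would copy it
downwards. In `counter` this is excluded because the first j bits have at most j ones. -/
lemma shiftGates_one {j : ℕ} (t : ℕ) {c : ℕ} (hc : c ≠ t) {w : WState} (h : w (7, j, 0) = 1)
    (hw : ∀ l, w (8, l, 0) = if l = c then 1 else 0) (l : ℕ) :
    runW (shiftGates j t) w (8, l, 0) = if l = (if c < t then c + 1 else c) then 1 else 0 := by
  induction t generalizing c w with
  | zero => simp [shiftGates, runW, hw]
  | succ t ih =>
    have e : shiftGates j (t + 1) = ((7, j, 0), (8, t, 0), (8, t + 1, 0)) ::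
        ((7, j, 0), (8, t + 1, 0), (8, t, 0)) :: shiftGates j t := by
      rw [shiftGates, List.range_succ, List.reverse_append]; rfl
    rw [e, runW_cons, runW_cons]
    set w' := TGate.act (TGate.act w ((7, j, 0), (8, t, 0), (8, t + 1, 0)))
      ((7, j, 0), (8, t + 1, 0), (8, t, 0)) with hw'
    have h7 : w' (7, j, 0) = 1 := by simp_all [TGate.act]
    by_cases hct : c = t
    · subst hct
      have h8 : ∀ l, w' (8, l, 0) = if l = c + 1 then 1 else 0 := by
        simp only [hw', TGate.act, update_apply, hw, h]
        grind
      rw [ih (c := c + 1) (by omega) h7 h8, if_neg (show ¬ c + 1 < c by omega),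
        if_pos (Nat.lt_succ_self c)]
    · have h8 : ∀ l, w' (8, l, 0) = if l = c then 1 else 0 := by
        simp only [hw', TGate.act, update_apply, hw, h]
        grind
      rw [ih hct h7 h8]
      grind

/-- The number of the first `m` bits that are set. -/
def countOnes (e : ℕ → ZMod 2) (m : ℕ) : ℕ := ((range m).filter fun j => e j = 1).card

lemma countOnes_le (e : ℕ → ZMod 2) (m : ℕ) : countOnes e m ≤ m :=
  (card_filter_le _ _).trans (card_range m).le

lemma countOnes_succ (e : ℕ → ZMod 2) (m : ℕ) :
    countOnes e (m + 1) = countOnes e m + if e m = 1 then 1 else 0 := by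
  unfold countOnes
  rw [range_add_one, filter_insert]
  grind

lemma counter_spec {w : WState} (h1 : w oneW = 1) (h8 : ∀ l, w (8, l, 0) = 0) :
    (∀ l, runW (counter n) w (8, l, 0) = if l = countOnes (fun j => w (7, j, 0)) n then 1 else 0) ∧
    ∀ x : Wire, x.1 ≠ 8 → runW (counter n) w x = w x := by
  refine ⟨?_, fun x hx => runW_frame_of (P := fun x => x.1 = 8) (by simp [counter]) hx w⟩
  have e : counter n = (oneW, oneW, (8, 0, 0)) ::
    (List.range n).flatMap fun j => shiftGates j (j + 1) := rfl
  rw [e, runW_cons]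
  set w₁ := TGate.act w (oneW, oneW, (8, 0, 0)) with hw₁
  have hw7 : ∀ j, w₁ (7, j, 0) = w (7, j, 0) := fun j => by rfl
  induction n with
  | zero =>
    simp_all [countOnes, List.range_zero, List.flatMap_nil, range_zero, filter_empty, card_empty, runW, TGate.act, update_apply]
  | succ n ih =>
    have ih := ih rfl
    rw [runW_flatMap_succ]
    set w' := runW ((List.range n).flatMap fun j => shiftGates j (j + 1)) w₁ with hw'
    have h7 : w' (7, n, 0) = w (7, n, 0) := by
      exact runW_frame_of (P := fun x => x.1 = 8) (by simp [shiftGates]) (by simp) w₁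
    have hb : w (7, n, 0) = 0 ∨ w (7, n, 0) = 1 := by generalize w (7, n, 0) = x; revert x; decide
    intro l
    rw [countOnes_succ]
    rcases hb with hb | hb
    · simp_all [shiftGates_zero]
    · have := countOnes_le (fun j => w (7, j, 0)) n
      rw [shiftGates_one _ (c := countOnes (fun j => w (7, j, 0)) n) (by omega) (h7.trans hb) ih,
        if_pos (Nat.lt_succ_of_le this), if_pos hb]

/-- Each of the six stages changes a single tag that starts out zero, except that the last addition
to the candidate returns to tag 7. All intermediate workspace has been restored when a later stage
reads it. -/
lemma oracle_spec (hb : b + r ≤ n) {w : WState} (hw : Ready w) :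
    (∀ j < n, runW (oracle r k n b a σ x₀) w (7, j, 0) = candidate r k b a σ x₀ w j) ∧
    ∀ l, runW (oracle r k n b a σ x₀) w (8, l, 0)
      = if l = countOnes (candidate r k b a σ x₀ w) n then 1 else 0 := by
  unfold oracle
  simp only [runW_append]
  set w₁ := runW (initE k n a σ x₀) w with hw₁
  have f₁ : ∀ x : Wire, x.1 ≠ 7 → w₁ x = w x := fun x hx => initE_frame w hx
  set w₂ := runW (fillM r k b a) w₁ with hw₂
  have c₁ : Clean w₁ := hw.toClean.of_eq fun x hx => f₁ x (by omega)
  obtain ⟨m₂, f₂⟩ := fillM_spec (r := r) (k := k) (b := b) (a := a) c₁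
    (fun i l => (f₁ _ (by simp)).trans (hw.w10 i l))
  rw [← hw₂] at m₂ f₂
  have c₂ : Clean w₂ := c₁.of_eq fun x hx => f₂ x (by omega)
  set w₃ := runW (initY r k b) w₂ with hw₃
  obtain ⟨y₃, f₃⟩ := initY_spec (r := r) (k := k) (b := b) c₂
    (fun l => (f₂ _ (by simp)).trans ((f₁ _ (by simp)).trans (hw.w6 l)))
  rw [← hw₃] at y₃ f₃
  have c₃ : Clean w₃ := c₂.of_eq fun x hx => f₃ x (by omega)
  have s₃ : ∀ x : Wire, x.1 ≤ 5 → w₃ x = w x := fun x hx => by grind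
  have col₃ := maskedCol_congr (b := b) (a := a) s₃
  have col₁ := maskedCol_congr (b := b) (a := a) (w := w) (w' := w₁) fun x hx => f₁ x (by omega)
  set w₄ := runW (backY r k b a) w₃ with hw₄
  set T : ℕ → ZMod 2 := fun i => w (1, i, 0) *
    preCandidate k a σ x₀ (fun c => w (2, c, 0)) (b + i) with hT
  obtain ⟨y₄, f₄⟩ := backY_spec (r := r) (k := k) (b := b) (a := a) (T := T) c₃
    (fun i hi l => by grind)
    (fun l hl => by
      rw [y₃ l hl, col₃]
      refine coeff_congr (fun i hi l _ => by grind) fun i hi => ?_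
      rw [f₂ (1, i, 0) (by simp), f₂ (7, b + i, 0) (by simp), f₁ (1, i, 0) (by simp), hw₁,
        initE_spec hw.one hw.w7 (by omega)])
  rw [← hw₄, col₃] at y₄
  rw [← hw₄] at f₄
  have g₄ : ∀ x : Wire, x.1 ≠ 6 → x.1 ≠ 10 → x.1 ≠ 7 → w₄ x = w x := fun x h1 h2 h3 => by grind
  set w₅ := runW (finalE k n a) w₄ with hw₅
  have e₅ : ∀ j < n, w₅ (7, j, 0) = candidate r k b a σ x₀ w j := by
    intro j hj
    rw [hw₅, finalE_spec hj, candidate, f₄ _ (by simp), f₃ _ (by simp), f₂ _ (by simp), hw₁,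
      initE_spec hw.one hw.w7 hj]
    congr 1
    refine sum_congr rfl fun c hc => ?_
    rw [y₄ c (mem_range.1 hc), g₄ _ (by simp) (by simp) (by simp)]
    rfl
  have f₅ : ∀ x : Wire, x.1 ≠ 7 → w₅ x = w₄ x := fun x hx => finalE_frame _ hx
  obtain ⟨o₆, f₆⟩ := counter_spec (n := n) (w := w₅)
    (by rw [f₅ _ (by simp), g₄ _ (by simp) (by simp) (by simp), hw.one])
    (fun l => by rw [f₅ _ (by simp), g₄ _ (by simp) (by simp) (by simp), hw.w8])
  grind [countOnes, candidate, filter_congr, mem_range]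

lemma allZero_spec {w : WState} (hw : Ready w) : runW (allZero r k) w (9, r + k, 0) =
      if (∀ i < r, w (1, i, 0) = 0) ∧ ∀ c < k, w (2, c, 0) = 0 then 1 else 0 := by
  have hz : ∀ (ν : ℕ → ZMod 2) (m : ℕ), zerosBefore ν m = if ∀ i < m, ν i = 0 then 1 else 0 := by
    intro ν m
    unfold zerosBefore
    split_ifs with h
    · simp_all
    · push Not at h
      obtain ⟨i, hi, h⟩ := h
      refine prod_eq_zero (mem_range.2 hi) ?_
      generalize ν i = x at h; revert x; decide
  unfold allZero
  rw [runW_cons, runW_append]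
  set w₁ := TGate.act w (oneW, oneW, (9, 0, 0)) with hw₁
  have f₁ : ∀ x : Wire, x ≠ (9, 0, 0) → w₁ x = w x := fun x hx => by
    simp_all [TGate.act, update_of_ne]
  set w₂ := runW ((List.range r).flatMap fun i =>
    [((9, i, 0), (9, i, 0), (9, i + 1, 0)), ((9, i, 0), (1, i, 0), (9, i + 1, 0))]) w₁ with hw₂
  have f₂ : ∀ x : Wire, x.1 ≠ 9 → w₂ x = w₁ x := fun x hx =>
    runW_frame_of (P := fun x => x.1 = 9) (by simp) hx _
  have h0 : w₁ (9, 0, 0) = 1 := by simp [hw₁, TGate.act, hw.one, hw.w9]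
  have c₁ := runW_chain (r := r) 0 9 (fun i => (1, i, 0)) (by simp) w₁
    (fun i _ => by rw [f₁ _ (by simp), hw.w9]) r le_rfl
  simp only [Nat.zero_add, ← hw₂] at c₁
  have c₂ := runW_chain (r := k) r 9 (fun i => (2, i, 0)) (by simp) w₂ (fun i _ => by
      rw [hw₂, runW_frame_of (P := fun x => x.2.1 ≤ r) (by simp) (by simp),
        f₁ _ (by simp), hw.w9]) k le_rfl
  rw [c₂, c₁, h0, one_mul, hz, hz]
  have e1 : ∀ i, w₁ (1, i, 0) = w (1, i, 0) := fun i => f₁ _ (by simp)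
  have e2 : ∀ i, w₂ (2, i, 0) = w (2, i, 0) := fun i => by grind
  simp only [e1, e2]
  grind

/-! ### Correctness of the solution -/

lemma sum_zerosBefore (ν : ℕ → ZMod 2) (m : ℕ) :
    ∑ i ∈ range m, zerosBefore ν i * ν i = 1 + zerosBefore ν m := by
  induction m with
  | zero => simp [zerosBefore, zmod2_add_self]
  | succ m ih => grind [sum_range_succ, zerosBefore_succ]

/-- The coefficient of ν in itself is one unless ν vanishes on the first r coordinates. -/
lemma lead_self (ν : ℕ → ZMod 2) {i : ℕ} (hi : i < r) : ν i + lead r ν ν * ν i = 0 := by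
  have h1 : lead r ν ν = 1 + zerosBefore ν r := by
    rw [← sum_zerosBefore]
    exact sum_congr rfl fun i _ => by rw [mul_assoc, zmod2_mul_self]
  have h2 : zerosBefore ν r * ν i = 0 := by
    unfold zerosBefore
    rw [← mul_prod_erase _ _ (mem_range.2 hi), mul_right_comm]
    have : (1 + ν i) * ν i = 0 := by generalize ν i = x; revert x; decide
    grind
  grind

lemma lead_add (ν T T' : ℕ → ZMod 2) :
    lead r ν (fun i => T i + T' i) = lead r ν T + lead r ν T' := by
  simp [lead, mul_add, sum_add_distrib]

lemma lead_mul (ν T : ℕ → ZMod 2) (c : ZMod 2) : lead r ν (fun i => c * T i) = c * lead r ν T := by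
  grind [lead, mul_sum, sum_congr]

lemma reduce_succ (ν : ℕ → ℕ → ZMod 2) (l : ℕ) (T : ℕ → ZMod 2) (i : ℕ) : reduce r ν (l + 1) T i
      = reduce r ν l T i + lead r (fun i => ν i l) (reduce r ν l T) * ν i l := rfl

lemma reduce_add (ν : ℕ → ℕ → ZMod 2) (m : ℕ) (T T' : ℕ → ZMod 2) :
    reduce r ν m (fun i => T i + T' i) = fun i => reduce r ν m T i + reduce r ν m T' i := by
  induction m with
  | zero => rfl
  | succ m ih => grind [reduce, lead_add]

lemma reduce_mul (ν : ℕ → ℕ → ZMod 2) (m : ℕ) (T : ℕ → ZMod 2) (c : ZMod 2) :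
    reduce r ν m (fun i => c * T i) = fun i => c * reduce r ν m T i := by
  induction m with
  | zero => rfl
  | succ m ih => funext i; simp only [reduce, ih, lead_mul]; ring

lemma reduce_sum (ν : ℕ → ℕ → ZMod 2) (m : ℕ) (col : ℕ → ℕ → ZMod 2) (y : ℕ → ZMod 2) (t : ℕ) :
    reduce r ν m (fun i => ∑ l ∈ range t, col i l * y l) =
      fun i => ∑ l ∈ range t, reduce r ν m (fun i => col i l) i * y l := by
  induction t with
  | zero =>
    have := reduce_mul (r := r) ν m (fun _ => 0) 0
    simp_all
  | succ t ih =>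
    simp only [sum_range_succ, reduce_add, ih]
    funext i
    have := congrFun (reduce_mul (r := r) ν m (fun i => col i t) (y t)) i
    grind

lemma reduce_eq (ν : ℕ → ℕ → ZMod 2) (m : ℕ) (T : ℕ → ZMod 2) (i : ℕ) :
    reduce r ν m T i = T i + ∑ l ∈ range m, coeff r ν T l * ν i l := by
  induction m with
  | zero => simp [reduce]
  | succ m ih => grind [sum_range_succ, reduce_succ, coeff]

lemma reduce_zero_mono {ν : ℕ → ℕ → ZMod 2} {m m' : ℕ} {T : ℕ → ZMod 2} (h : m ≤ m')
    (h0 : ∀ i < r, reduce r ν m T i = 0) : ∀ i < r, reduce r ν m' T i = 0 := by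
  induction m' with
  | zero => grind
  | succ m' ih =>
    rcases Nat.lt_or_ge m' m with h1 | h1
    · grind
    · have h2 : lead r (fun i => ν i m') (reduce r ν m' T) = 0 := by
        rw [lead_congr (fun _ _ => rfl) (T' := fun _ => 0) (ih h1)]
        simp [lead]
      simp_all [reduce_succ, zero_mul, add_zero]

lemma echelon_eq (col : ℕ → ℕ → ZMod 2) {m : ℕ} (hm : m < k) {i : ℕ} (hi : i < r) :
    echelon r col k i m = reduce r (echelon r col k) m (fun i => col i m) i := by
  rw [echelon_of_lt (Nat.lt_succ_self m) hm, echelon_succ, if_pos rfl]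
  exact reduce_congr (fun i _ l hl => (echelon_of_lt hl hm.le i).symm) (fun _ _ => rfl) i hi

/-- Reduction by the earlier columns turns column m into its echelon column, and reduction by that
one annihilates it. Zero stays zero afterwards. -/
lemma reduce_col (col : ℕ → ℕ → ZMod 2) {m : ℕ} (hm : m < k) :
    ∀ i < r, reduce r (echelon r col k) k (fun i => col i m) i = 0 := by
  refine reduce_zero_mono (m := m + 1) hm fun i hi => ?_
  simp_all [reduce_succ, echelon_eq, lead_congr, symm, lead_self, echelon]

/-- If the system is solvable, then T is a combination of columns, all of which reduce to zero. So T
does too, and T is the combination of echelon columns with its recorded coefficients. Back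
substitution trades, from the last to the first, an echelon column for the original column plus the
recorded combination of earlier echelon columns. No uniqueness is needed, and zero columns do no
harm. -/
lemma solve_spec {col : ℕ → ℕ → ZMod 2} {T y : ℕ → ZMod 2}
    (h : ∀ i < r, ∑ l ∈ range k, col i l * y l = T i) :
    ∀ i < r, ∑ l ∈ range k, col i l * solve r k col T l = T i := by
  set ν := echelon r col k with hν
  have h0 : ∀ i < r, reduce r ν k T i = 0 := by
    intro i hi
    rw [← reduce_congr (fun _ _ _ _ => rfl) h i hi, reduce_sum]
    simp_all [sum_eq_zero, reduce_col, mem_range, zero_mul]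
  have hT : ∀ i < r, ∑ l ∈ range k, ν i l * coeff r ν T l = T i := by
    grind [reduce_eq, coeff, sum_congr, mul_comm]
  -- After t steps the last t columns are the original ones and the others are still in echelon
  -- form.
  have key : ∀ t ≤ k, ∀ i < r, ∑ l ∈ range k,
      (if l < k - t then ν i l else col i l) * backSub r k col T t l = T i := by
    intro t
    induction t with
    | zero => simp_all [sum_congr, mem_range, Nat.sub_zero, backSub, if_pos]
    | succ t ih =>
      intro ht i hi
      set m := k - (t + 1) with hm
      rw [← ih (by omega) i hi]
      have hmk : m < k := by omega
      have hνm : ν i m = col i m + ∑ l ∈ range k,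
          if l < m then coeff r ν (fun i => col i m) l * ν i l else 0 := by
        rw [hν, echelon_eq col hmk hi, reduce_eq, ← sum_filter]
        congr 1
        refine sum_congr ?_ fun _ _ => rfl
        grind
      set Y := backSub r k col T t with hY
      have e1 : ∀ l ∈ range k, (if l < m then ν i l else col i l) *
          backSub r k col T (t + 1) l = (if l < k - t then ν i l else col i l) * Y l +
          ((if l = m then (col i m + ν i m) * Y m else 0) +
          (if l < m then coeff r ν (fun i => col i m) l * ν i l else 0) * Y m) := by
        intro l hl
        have : backSub r k col T (t + 1) l = Y l + if l < m then
            coeff r ν (fun i => col i m) l * Y m else 0 := rfl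
        grind
      rw [sum_congr rfl e1, sum_add_distrib, sum_add_distrib,
        ← sum_mul, sum_ite_eq', if_pos (mem_range.2 hmk)]
      grind
  intro i hi
  rw [← key k le_rfl i hi]
  refine sum_congr rfl fun l _ => ?_
  rw [if_neg (by omega)]
  rfl

end circuits

variable {q : ℕ}

section encode

variable {n r k : ℕ}

/-- The wires that the register holds. -/
def Wire.Ok (n r k : ℕ) (x : Wire) : Prop :=
  (x.1 < 10 ∧ x.2.1 < n + 2 ∧ x.2.2 = 0) ∨ (x.1 = 10 ∧ x.2.1 < r ∧ x.2.2 < k)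

/-- The number of the qubit of a wire. -/
def Wire.enc (n k : ℕ) (x : Wire) : ℕ :=
  x.1 * (n + 2) + if x.1 = 10 then x.2.1 * k + x.2.2 else x.2.1

def numQubits (n r k : ℕ) : ℕ := 10 * (n + 2) + r * k

lemma Wire.enc_lt {x : Wire} (h : x.Ok n r k) : x.enc n k < numQubits n r k := by
  obtain ⟨t, i, l⟩ := x
  unfold numQubits
  rcases h with ⟨h1, h2, h3⟩ | ⟨h1, h2, h3⟩ <;> simp only [Wire.enc] at *
  · rw [if_neg (by omega)]
    have : (t + 1) * (n + 2) ≤ 10 * (n + 2) := Nat.mul_le_mul_right _ (by omega)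
    grind
  · rw [if_pos h1, h1]
    have : (i + 1) * k ≤ r * k := Nat.mul_le_mul_right _ (by omega)
    grind

lemma mul_add_inj {m i l i' l' : ℕ} (h : l < m) (h' : l' < m) (e : i * m + l = i' * m + l') :
    i = i' ∧ l = l' := by
  have h1 : i = i' := by
    have := congrArg (· / m) e
    simpa [Nat.add_div_of_dvd_right (Dvd.intro_left i rfl), Nat.mul_div_cancel _ (by omega : 0 < m),
      Nat.div_eq_of_lt h, Nat.div_eq_of_lt h',
      Nat.add_div_of_dvd_right (Dvd.intro_left i' rfl)] using this
  grind

lemma Wire.enc_inj {x y : Wire} (hx : x.Ok n r k) (hy : y.Ok n r k) (e : x.enc n k = y.enc n k) :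
    x = y := by
  have key : ∀ x y : Wire, x.Ok n r k → y.Ok n r k → x.1 < 10 → y.1 = 10 →
      x.enc n k < y.enc n k := by
    rintro ⟨t, i, l⟩ ⟨t', i', l'⟩ hx hy h1 h2
    simp only [Wire.Ok, Wire.enc] at *
    have : (t + 1) * (n + 2) ≤ 10 * (n + 2) := Nat.mul_le_mul_right _ (by omega)
    grind
  have h1 : x.1 < 10 ∨ x.1 = 10 := by grind [Wire.Ok]
  have h2 : y.1 < 10 ∨ y.1 = 10 := by grind [Wire.Ok]
  rcases h1 with h1 | h1 <;> rcases h2 with h2 | h2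
  · obtain ⟨t, i, l⟩ := x
    obtain ⟨t', i', l'⟩ := y
    simp only [Wire.Ok, Wire.enc] at *
    rw [if_neg (by omega), if_neg (by omega)] at e
    obtain ⟨rfl, rfl⟩ := mul_add_inj (by omega) (by omega) e
    grind
  · grind
  · grind
  · obtain ⟨t, i, l⟩ := x
    obtain ⟨t', i', l'⟩ := y
    simp only [Wire.Ok, Wire.enc] at *
    subst h1 h2
    simp only [if_true] at e
    obtain ⟨rfl, rfl⟩ := mul_add_inj (m := k) (by omega) (by omega) (Nat.add_left_cancel e)
    rfl

/-- The gate on qubits of a gate on wires. -/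
def TGate.enc (n k : ℕ) (g : TGate) : Gate := .tof (g.1.enc n k) (g.2.1.enc n k) (g.2.2.enc n k)

open Classical in
/-- The values of the wires in a basis state. -/
noncomputable def readW (n r k : ℕ) (b : Fin (numQubits n r k) → Bool) : WState := fun x =>
  if h : x.Ok n r k then (if b ⟨x.enc n k, Wire.enc_lt h⟩ then 1 else 0) else 0

lemma readW_ok {b : Fin (numQubits n r k) → Bool} {x : Wire} (h : x.Ok n r k) :
    readW n r k b x = if b ⟨x.enc n k, Wire.enc_lt h⟩ then 1 else 0 := dif_pos h

lemma readW_map {g : TGate} (h : g.On (Wire.Ok n r k)) (hp : g.Proper)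
    (b : Fin (numQubits n r k) → Bool) :
    readW n r k ((g.enc n k).map b) = TGate.act (readW n r k b) g := by
  obtain ⟨c, c', t⟩ := g
  obtain ⟨h1, h2, h3⟩ := h
  simp only at h1 h2 h3
  have hv : c.enc n k < numQubits n r k ∧ c'.enc n k < numQubits n r k ∧
      t.enc n k < numQubits n r k ∧ t.enc n k ≠ c.enc n k ∧ t.enc n k ≠ c'.enc n k :=
    ⟨Wire.enc_lt h1, Wire.enc_lt h2, Wire.enc_lt h3, fun e => hp.1 (Wire.enc_inj h3 h1 e),
      fun e => hp.2 (Wire.enc_inj h3 h2 e)⟩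
  funext x
  simp only [TGate.act, Gate.map, TGate.enc, tofMap, dif_pos hv]
  by_cases hx : x.Ok n r k
  · grind [readW_ok, update_self, update_of_ne, Wire.enc_lt, numQubits, Wire.enc_inj, Fin.ext_iff]
  · have hxt : x ≠ t := fun e => hx (e ▸ h3)
    simp_all [update_of_ne, readW, dif_neg]

lemma readW_run {L : List TGate} (hL : AllG (fun g => g.On (Wire.Ok n r k) ∧ g.Proper) L)
    (b : Fin (numQubits n r k) → Bool) :
    readW n r k (runBasis (L.map (TGate.enc n k)) b) = runW L (readW n r k b) := by
  induction L generalizing b with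
  | nil => rfl
  | cons g L ih =>
    obtain ⟨⟨h1, h2⟩, h3⟩ := AllG_cons.1 hL
    rw [List.map_cons, runW_cons, ← readW_map h1 h2, ← ih h3]
    rfl

lemma isTof_map (L : List TGate) : ∀ g ∈ L.map (TGate.enc n k), g.isTof := by
  simp only [List.mem_map]
  rintro _ ⟨g, _, rfl⟩
  trivial

variable {b : ℕ} {a : ℕ → ℕ → ℕ} {σ x₀ : ℕ → ℕ}

lemma reduceAll_ok (hr : r ≤ n) {m : ℕ} (hm : m ≤ k) (hk : k ≤ n) :
    AllG (fun g => g.On (Wire.Ok n r k)) (reduceAll r m) := by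
  have h1 : ∀ l < k, AllG (fun g => g.On (Wire.Ok n r k)) (firstOne r l) := by
    simp [firstOne, TGate.On, Wire.Ok]
    omega
  have h2 : ∀ l < k, AllG (fun g => g.On (Wire.Ok n r k)) (useOne r l) := by
    simp [useOne, TGate.On, Wire.Ok]
    grind
  grind [reduceAll, reduceBy, AllG_flatMap, AllG_range, AllG_append, AllG_reverse]

lemma column_ok (hr : r ≤ n) (hk : k ≤ n) {m : ℕ} (hm : m < k) :
    AllG (fun g => g.On (Wire.Ok n r k)) (column r b a m) := by
  rw [column, AllG_append]
  refine ⟨?_, reduceAll_ok hr hm.le hk⟩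
  simp [loadCol, TGate.On, Wire.Ok]
  omega

lemma oracle_ok (hb : b + r ≤ n) (hk : k ≤ n) :
    AllG (fun g => g.On (Wire.Ok n r k) ∧ g.Proper) (oracle r k n b a σ x₀) := by
  have hr : r ≤ n := by omega
  have hcol : ∀ m < k, AllG (fun g => g.On (Wire.Ok n r k) ∧ g.Proper) (column r b a m) :=
    fun m hm g hg => ⟨column_ok hr hk hm g hg, (column_on m g hg).2⟩
  have hrhs : AllG (fun g => g.On (Wire.Ok n r k) ∧ g.Proper) (rhs r k b) := by
    intro g hg
    refine ⟨?_, (rhs_on g hg).2⟩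
    revert g
    show AllG _ _
    rw [rhs, AllG_append]
    refine ⟨?_, reduceAll_ok hr le_rfl hk⟩
    simp [loadRhs, TGate.On, Wire.Ok]
    omega
  simp only [oracle, AllG_append]
  refine ⟨?_, ?_, ?_, ?_, ?_, ?_⟩
  · simp [initE, TGate.On, TGate.Proper, Wire.Ok]
    grind
  · simp only [fillM, AllG_flatMap, AllG_range, AllG_append, AllG_reverse]
    intro m hm
    refine ⟨hcol m hm, ?_, hcol m hm⟩
    simp [TGate.On, TGate.Proper, Wire.Ok]
    omega
  · simp only [initY, AllG_append, AllG_reverse]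
    refine ⟨hrhs, ?_, hrhs⟩
    simp [TGate.On, TGate.Proper, Wire.Ok]
    omega
  · simp only [backY, AllG_flatMap, AllG_reverse, AllG_range, AllG_append]
    intro m hm
    refine ⟨hcol m hm, ?_, hcol m hm⟩
    simp [TGate.On, TGate.Proper, Wire.Ok]
    omega
  · simp [finalE, TGate.On, TGate.Proper, Wire.Ok]
    omega
  · simp [counter, TGate.On, TGate.Proper, Wire.Ok]
    omega

lemma allZero_ok (h : r + k ≤ n) :
    AllG (fun g => g.On (Wire.Ok n r k) ∧ g.Proper) (allZero r k) := by
  simp [allZero, TGate.On, TGate.Proper, Wire.Ok]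
  grind

end encode

/-! ## Independent coins -/

/-- The state is a product state. When a coin is rotated, the branch where it is already one has
amplitude zero, so only one column of the rotation matters. -/
lemma rots_amp {b₀ : Fin q → Bool} (l : List (Fin q × ℕ × ℕ)) (hn : (l.map Prod.fst).Nodup)
    (h0 : ∀ p ∈ l, b₀ p.1 = false) (b : Fin q → Bool) (hb : near (· ∈ l.map Prod.fst) b₀ b) :
    applyGates (l.map fun p => .rot p.1 p.2.1 p.2.2) (Pi.single b₀ 1) b =
      (l.map fun p => if b p.1 then (√(rotProb p.2.1 p.2.2) : ℂ)
        else (√(1 - rotProb p.2.1 p.2.2) : ℂ)).prod := by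
  induction l using List.reverseRecOn generalizing b with
  | nil =>
    have : b = b₀ := funext fun t => hb t (by simp)
    simp_all [applyGates]
  | append_singleton l p ih =>
    obtain ⟨t, x, y⟩ := p
    have hn' : (l.map Prod.fst).Nodup ∧ t ∉ l.map Prod.fst := by
      grind
    rw [List.map_append, applyGates_append, List.map_append, List.prod_append]
    have e : ∀ ψ : QState q, applyGates ([(t, x, y)].map fun p => Gate.rot p.1 p.2.1 p.2.2) ψ
        = rotate t x y ψ := fun _ => rfl
    rw [e, rotate_apply]
    have ht : b₀ t = false := h0 (t, x, y) (by simp)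
    have z : applyGates (l.map fun p => Gate.rot p.1 p.2.1 p.2.2) (Pi.single b₀ 1)
        (update b t true) = 0 := by
      refine applyGates_supported (co := (· ∈ l.map Prod.fst)) (b₀ := b₀) ?_ ?_ _ ?_
      · grind
      · intro b hb
        rw [Pi.single_eq_of_ne]
        rintro rfl
        exact hb fun _ _ => rfl
      · intro h
        have := h t hn'.2
        grind
    have nz := ih hn'.1 (fun p hp => h0 p (List.mem_append_left _ hp)) (update b t false)
      (fun t' ht' => by
        by_cases h : t' = t
        · grind
        · rw [update_of_ne h]
          refine hb t' ?_
          grind)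
    have hmap : (l.map fun p => if update b t false p.1 then (√(rotProb p.2.1 p.2.2) : ℂ)
        else (√(1 - rotProb p.2.1 p.2.2) : ℂ)) = l.map fun p => if b p.1 then
          (√(rotProb p.2.1 p.2.2) : ℂ) else (√(1 - rotProb p.2.1 p.2.2) : ℂ) := by
      refine List.map_congr_left fun p hp => ?_
      grind
    grind

lemma rots_prob {b₀ : Fin q → Bool} (l : List (Fin q × ℕ × ℕ)) (hn : (l.map Prod.fst).Nodup)
    (h0 : ∀ p ∈ l, b₀ p.1 = false) (b : Fin q → Bool) (hb : near (· ∈ l.map Prod.fst) b₀ b) :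
    ‖applyGates (l.map fun p => .rot p.1 p.2.1 p.2.2) (Pi.single b₀ 1) b‖ ^ 2 =
      (l.map fun p => if b p.1 then rotProb p.2.1 p.2.2 else 1 - rotProb p.2.1 p.2.2).prod := by
  rw [rots_amp l hn h0 b hb, ← Complex.normSq_eq_norm_sq, map_list_prod, List.map_map]
  grind [List.map_congr_left, Complex.normSq_ofReal, Real.mul_self_sqrt, rotProb_nonneg, rotProb_le_one]

/-! ## Measuring and resetting all qubits -/

/-- A program that does nothing. -/
def skip : Prog := .loop false (.const 0) (.gate (.const 0) (.const 0) (.const 0))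

lemma wp_skip (X : Ctx) (v : List ℕ) (f : St q → ℝ≥0∞) (s : St q) : wp X 0 skip v f s = f s := by
  simp [skip, wp, Exp.ev, order]

/-- Measure one qubit, store the result, and reset the qubit. -/
def measureOne (d : ℕ) : Prog :=
  .seq (.meas (.var d) 10 (.var d) (.const 0))
    (.ite (.arr 10 (.var d) (.const 0)) (.rot (.var d) (.const 1) (.const 1)) skip)

lemma Arr.put_apply (D : Arr) (ρ ρ' : Fin 16) (i j x i' j' : ℕ) :
    D.put ρ i j x ρ' i' j' = if ρ' = ρ ∧ i' = i ∧ j' = j then x else D ρ' i' j' := by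
  unfold Arr.put
  by_cases h1 : ρ' = ρ
  · subst h1
    by_cases h2 : i' = i
    · subst h2
      by_cases h3 : j' = j <;> simp [h3]
    simp_all
  simp_all

lemma wp_measureOne (X : Ctx) (t : Fin q) (f : St q → ℝ≥0∞) (s : St q) :
    wp X 0 (measureOne 0) [↑t] f s = ∑ x : Bool, ENNReal.ofReal (measureProb t x s.amp) *
      f ⟨s.arr.put 10 t 0 x.toNat,
        if x then rotate t 1 1 (collapse t x s.amp) else collapse t x s.amp⟩ := by
  have h : wp X 0 (measureOne 0) [↑t] f s = ∑ x : Bool,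
      ENNReal.ofReal (measureProb t x s.amp) *
      wp X 0 (.ite (.arr 10 (.var 0) (.const 0)) (.rot (.var 0) (.const 1) (.const 1)) skip) [↑t] f
        ⟨s.arr.put 10 t 0 x.toNat, collapse t x s.amp⟩ := by
    simp only [measureOne, wp, zero_add]
    rw [dif_pos (show (Exp.var 0).ev X [↑t] s.arr < q from t.2)]
    rfl
  simp_all [sum_congr, wp, zero_add, Exp.ev, Arr.put_apply, List.getD_cons_zero, and_self, if_true, Bool.toNat_false, Bool.false_eq_true, if_false, wp_skip, Bool.toNat_true, one_ne_zero]

/-- Induction over the qubits that remain. The vector h records the outcomes so far, and the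
measured qubits have been reset, so ψ lives on states that are zero there. Restoring the
normalization of a collapse cancels the probability of its outcome, which leaves the Born rule for
the joint outcome. At the end only a global phase u remains. -/
lemma measureOne_loop (X : Ctx) (f : St q → ℝ≥0∞) (c : (Fin q → Bool) → ℝ≥0∞) (D : Arr)
    (hf : ∀ (D' : Arr) (u : ℂ) (b : Fin q → Bool), ‖u‖ = 1 → (∀ ρ ≠ 10, D' ρ = D ρ) →
      (∀ t : Fin q, D' 10 t 0 = (b t).toNat) → c b ≤ f ⟨D', u • QState.zero q⟩) (m : ℕ) :
    ∀ (i : ℕ), i + m = q → ∀ (D' : Arr) (ψ : QState q) (h : Fin q → Bool), ψ.Normalized →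
      (∀ b, (∃ t : Fin q, (t : ℕ) < i ∧ b t = true) → ψ b = 0) →
      (∀ ρ ≠ 10, D' ρ = D ρ) → (∀ t : Fin q, (t : ℕ) < i → D' 10 t 0 = (h t).toNat) →
      (∀ t : Fin q, i ≤ (t : ℕ) → h t = false) →
      ∑ b, ENNReal.ofReal (‖ψ b‖ ^ 2) * c (fun t => b t || h t) ≤
        (List.range' i m).foldr (fun i F s => wp X 0 (measureOne 0) [i] F s) f ⟨D', ψ⟩ := by
  induction m with
  | zero =>
    intro i hi D' ψ h hψ hz hD hD' hh
    obtain rfl : i = q := by omega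
    have hz' : ∀ b, b ≠ (fun _ => false) → ψ b = 0 := by
      grind
    have hn : ‖ψ fun _ => false‖ = 1 := by
      unfold QState.Normalized at hψ
      rw [sum_eq_single (fun _ => false) (fun b _ hb => by simp_all)
        (by simp)] at hψ
      grind [pow_eq_one_iff_of_nonneg, norm_nonneg, two_ne_zero]
    rw [sum_eq_single (fun _ => false) (fun b _ hb => by simp_all)
      (by simp), hn]
    simp only [one_pow, ENNReal.ofReal_one, one_mul, Bool.false_or, List.range'_zero,
      List.foldr_nil]
    have hψ' : ψ = (ψ fun _ => false) • QState.zero i := by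
      funext b
      simp only [QState.zero, Pi.smul_apply, smul_eq_mul]
      by_cases hb : b = fun _ => false
      · grind
      simp_all
    grind
  | succ m ih =>
    intro i hi D' ψ h hψ hz hD hD' hh
    have hiq : i < q := by omega
    set t : Fin q := ⟨i, hiq⟩ with ht
    rw [List.range'_succ, List.foldr_cons]
    have key := wp_measureOne X t (fun s => (List.range' (i + 1) m).foldr
      (fun i F s => wp X 0 (measureOne 0) [i] F s) f s) ⟨D', ψ⟩
    refine le_trans ?_ (le_of_eq key.symm)
    have hsplit : ∑ b, ENNReal.ofReal (‖ψ b‖ ^ 2) * c (fun t => b t || h t) = ∑ x : Bool,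
        ∑ b with b t = x, ENNReal.ofReal (‖ψ b‖ ^ 2) * c (fun t => b t || h t) :=
      (sum_fiberwise _ _ _).symm
    rw [hsplit]
    refine sum_le_sum fun x _ => ?_
    simp only
    by_cases hp : measureProb t x ψ = 0
    · have : ∀ b ∈ univ.filter (fun b : Fin q → Bool => b t = x), ‖ψ b‖ ^ 2 = 0 :=
        (sum_eq_zero_iff_of_nonneg fun _ _ => by simp).1 hp
      grind [ENNReal.ofReal_zero, zero_mul, nonpos_iff_eq_zero, sum_eq_zero]
    set φ : QState q := if x then rotate t 1 1 (collapse t x ψ) else collapse t x ψ with hφ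
    have hcol : (collapse t x ψ).Normalized := collapse_normalized t x hp
    have hφn : φ.Normalized := by
      grind [rotate_normalized]
    have hφv : ∀ b, φ b = if b t then 0 else
        ψ (update b t x) / (√(measureProb t x ψ) : ℂ) := by
      intro b
      cases x
      · simp only [hφ, Bool.false_eq_true, if_false, collapse]
        grind [update_eq_self]
      · simp only [hφ, if_true, rotate_one_one, collapse]
        by_cases hb : b t = true
        · have e : flip t b = update b t false := by simp [flip, hb]
          rw [e]; grind
        · rw [Bool.not_eq_true] at hb
          have e : flip t b = update b t true := by simp [flip, hb]
          rw [e]; grind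
    have hp0 := measureProb_nonneg t x ψ
    have := ih (i + 1) (by omega) (D'.put 10 t 0 x.toNat) φ (update h t x) hφn
      (by
        rintro b ⟨t', ht', hb⟩
        rw [hφv]
        by_cases e : t' = t
        · grind
        · have hlt : (t' : ℕ) < i := by
            grind
          split
          · rfl
          · rw [hz _ ⟨t', hlt, by grind⟩, zero_div])
      (by
        intro ρ hρ
        rw [← hD ρ hρ]
        funext i' j'
        rw [Arr.put_apply, if_neg (fun h => hρ h.1)])
      (by
        intro t' ht'
        rw [Arr.put_apply]
        grind)
      (by
        grind)
    refine le_trans (le_of_eq ?_) (mul_le_mul_right this _)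
    rw [mul_sum]
    have hzero : ∀ b ∈ univ.filter (fun b : Fin q → Bool => ¬ b t = false),
        ENNReal.ofReal (measureProb t x ψ) * (ENNReal.ofReal (‖φ b‖ ^ 2) *
          c (fun t' => b t' || update h t x t')) = 0 := by
      intro b hb
      have hb := (mem_filter.1 hb).2
      rw [hφv, if_pos (by grind)]; simp
    rw [← sum_filter_add_sum_filter_not univ (fun b : Fin q → Bool => b t = false),
      sum_eq_zero hzero, add_zero]
    refine sum_nbij' (fun b => update b t false) (fun b => update b t x)
      ?_ ?_ ?_ ?_ ?_
    · simp
    · simp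
    · grind
    · simp
    · intro b hb
      have hb := (mem_filter.1 hb).2
      have e1 : update (update b t false) t x = b := by grind
      have e2 : (fun t' => update b t false t' || update h t x t')
          = fun t' => b t' || h t' := by
        grind
      rw [hφv, update_self, if_neg (by simp), e1, e2, ← mul_assoc,
        ← ENNReal.ofReal_mul hp0, norm_div, div_pow, Complex.norm_real, Real.norm_eq_abs, sq_abs,
        Real.sq_sqrt hp0, mul_div_cancel₀ _ hp]

/-- Measure and reset all qubits. -/
def measureAll (e : Exp) : Prog := .loop false e (measureOne 0)

lemma wp_measureAll (X : Ctx) (e : Exp) (s : St q) (he : e.ev X [] s.arr = q) (hq : q < X.top)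
    (f : St q → ℝ≥0∞) (c : (Fin q → Bool) → ℝ≥0∞)
    (hf : ∀ (D' : Arr) (u : ℂ) (b : Fin q → Bool), ‖u‖ = 1 → (∀ ρ ≠ 10, D' ρ = s.arr ρ) →
      (∀ t : Fin q, D' 10 t 0 = (b t).toNat) → c b ≤ f ⟨D', u • QState.zero q⟩)
    (hs : s.amp.Normalized) :
    ∑ b, ENNReal.ofReal (‖s.amp b‖ ^ 2) * c b ≤ wp X 0 (measureAll e) [] f s := by
  have := measureOne_loop X f c s.arr hf q 0 (by omega) s.arr s.amp (fun _ => false) hs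
    (by simp) (fun _ _ => rfl) (by simp) (fun _ _ => rfl)
  simp_all [Bool.or_false, le_of_eq, measureAll, wp, zero_add, Nat.mod_eq_of_lt, order, Bool.false_eq_true, if_false, List.range_eq_range', List.nil_append]

end Hybrid

namespace Hybrid

open Finset Function

/-! ## Programs for the circuits -/

def Ctx.n (X : Ctx) : ℕ := X.inp 0
def Ctx.w (X : Ctx) : ℕ := X.inp 2
def Ctx.b (X : Ctx) : ℕ := X.inp 4
/-- The number of rows of the linear system. -/
def Ctx.r (X : Ctx) : ℕ := X.inp 0 - X.inp 1 - X.inp 4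
/-- The number of columns of the linear system. -/
def Ctx.k (X : Ctx) : ℕ := X.inp 1 - X.inp 3

def eN : Exp := .inp (.const 0)
def eOm : Exp := .inp (.const 2)
def eB : Exp := .inp (.const 4)
def eR : Exp := .inp (.const 0) - .inp (.const 1) - .inp (.const 4)
def eK : Exp := .inp (.const 1) - .inp (.const 3)
/-- The number of the qubit with tag `t` and index `i`. -/
def eW (t : ℕ) (i : Exp) : Exp := .const t * (eN + .const 2) + i
/-- The number of the qubit for an entry of the matrix. -/
def eM (i l : Exp) : Exp := .const 10 * (eN + .const 2) + (i * eK + l)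

section ev

variable (X : Ctx) (v : List ℕ) (D : Arr)

@[simp] lemma ev_const (c : ℕ) : (Exp.const c).ev X v D = c := rfl
@[simp] lemma ev_top : Exp.top.ev X v D = X.top := rfl
@[simp] lemma ev_arr (ρ : Fin 16) (i j : Exp) :
    (Exp.arr ρ i j).ev X v D = D ρ (i.ev X v D) (j.ev X v D) := rfl
@[simp] lemma ev_inp (i : Exp) : (Exp.inp i).ev X v D = X.inp (i.ev X v D) := rfl
@[simp] lemma ev_add (x y : Exp) : (x + y).ev X v D = x.ev X v D + y.ev X v D := rfl
@[simp] lemma ev_sub (x y : Exp) : (x - y).ev X v D = x.ev X v D - y.ev X v D := rfl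
@[simp] lemma ev_mul (x y : Exp) : (x * y).ev X v D = x.ev X v D * y.ev X v D := rfl
@[simp] lemma ev_div (x y : Exp) : (x / y).ev X v D = x.ev X v D / y.ev X v D := rfl
@[simp] lemma ev_eN : eN.ev X v D = X.n := rfl
@[simp] lemma ev_eOm : eOm.ev X v D = X.w := rfl
@[simp] lemma ev_eB : eB.ev X v D = X.b := rfl
@[simp] lemma ev_eR : eR.ev X v D = X.r := rfl
@[simp] lemma ev_eK : eK.ev X v D = X.k := rfl
@[simp] lemma ev_eW (t : ℕ) (i : Exp) : (eW t i).ev X v D = t * (X.n + 2) + i.ev X v D := rfl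
@[simp] lemma ev_eM (i l : Exp) :
    (eM i l).ev X v D = 10 * (X.n + 2) + (i.ev X v D * X.k + l.ev X v D) := rfl

variable {v}

lemma ev_var_last {d : ℕ} (hd : v.length = d) (i : ℕ) (u : List ℕ) :
    (Exp.var d).ev X (v ++ i :: u) D = i := by
  simp_all [Exp.ev]

end ev

section progs

def gate1 (c t : Exp) : Prog := .gate c c t
def eOne : Exp := eW 0 (.const 0)

/-- Array 8 is the table of the coefficients of the tail coordinates, array 9 the constant shift of
the candidate, array 3 the offset of the tail. -/
def pLoadCol (d : ℕ) (m : Exp) : Prog := .loop false eR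
  (.ite (.arr 8 (eB + .var d) m) (.gate (eW 1 (.var d)) (eW 2 m) (eW 3 (.var d))) skip)

def pLoadRhs (d : ℕ) : Prog := .loop false eR
  (.gate (eW 1 (.var d)) (eW 7 (eB + .var d)) (eW 3 (.var d)))

def pFirstOne (d : ℕ) (l : Exp) : Prog := .seq (gate1 eOne (eW 5 (.const 0))) (.loop false eR
  (.seq (gate1 (eW 5 (.var d)) (eW 5 (.var d + .const 1)))
    (.gate (eW 5 (.var d)) (eM (.var d) l) (eW 5 (.var d + .const 1)))))

def pUseOne (d : ℕ) (l : Exp) : Prog := .seq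
  (.loop false eR (.seq (.gate (eW 5 (.var d)) (eW 3 (.var d)) (eW 4 l))
    (.gate (eW 5 (.var d + .const 1)) (eW 3 (.var d)) (eW 4 l))))
  (.loop false eR (.gate (eW 4 l) (eM (.var d) l) (eW 3 (.var d))))

def pReduceBy (d : ℕ) (l : Exp) : Prog :=
  .seq (pFirstOne d l) (.seq (pUseOne d l) (pFirstOne d l).inv)

def pReduceAll (d : ℕ) (m : Exp) : Prog := .loop false m (pReduceBy (d + 1) (.var d))

def pColumn (d : ℕ) (m : Exp) : Prog := .seq (pLoadCol d m) (pReduceAll d m)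

def pRhs (d : ℕ) : Prog := .seq (pLoadRhs d) (pReduceAll d eK)

def pInitE (d : ℕ) : Prog := .loop false eN (.seq
  (.ite (.arr 9 (.var d) (.const 0)) (gate1 eOne (eW 7 (.var d))) skip)
  (.loop false eK (.ite (.arr 3 (.var (d + 1)) (.const 0))
    (.ite (.arr 8 (.var d) (.var (d + 1))) (gate1 (eW 2 (.var (d + 1))) (eW 7 (.var d))) skip)
    skip)))

def pFillM (d : ℕ) : Prog := .loop false eK (.seq (pColumn (d + 1) (.var d)) (.seq
  (.loop false eR (gate1 (eW 3 (.var (d + 1))) (eM (.var (d + 1)) (.var d))))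
  (pColumn (d + 1) (.var d)).inv))

def pInitY (d : ℕ) : Prog := .seq (pRhs d) (.seq
  (.loop false eK (gate1 (eW 4 (.var d)) (eW 6 (.var d)))) (pRhs d).inv)

def pBackY (d : ℕ) : Prog := .loop true eK (.seq (pColumn (d + 1) (.var d)) (.seq
  (.loop false (.var d) (.gate (eW 4 (.var (d + 1))) (eW 6 (.var d)) (eW 6 (.var (d + 1)))))
  (pColumn (d + 1) (.var d)).inv))

def pFinalE (d : ℕ) : Prog := .loop false eN (.loop false eK (.ite (.arr 8 (.var d) (.var (d + 1)))
    (.gate (eW 2 (.var (d + 1))) (eW 6 (.var (d + 1))) (eW 7 (.var d))) skip))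

def pCounter (d : ℕ) : Prog := .seq (gate1 eOne (eW 8 (.const 0))) (.loop false eN
  (.loop true (.var d + .const 1) (.seq
    (.gate (eW 7 (.var d)) (eW 8 (.var (d + 1))) (eW 8 (.var (d + 1) + .const 1)))
    (.gate (eW 7 (.var d)) (eW 8 (.var (d + 1) + .const 1)) (eW 8 (.var (d + 1)))))))

def pOracle (d : ℕ) : Prog := .seq (pInitE d) (.seq (pFillM d) (.seq (pInitY d)
  (.seq (pBackY d) (.seq (pFinalE d) (pCounter d)))))

def pAllZero (d : ℕ) : Prog := .seq (gate1 eOne (eW 9 (.const 0))) (.seq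
  (.loop false eR (.seq (gate1 (eW 9 (.var d)) (eW 9 (.var d + .const 1)))
    (.gate (eW 9 (.var d)) (eW 1 (.var d)) (eW 9 (.var d + .const 1)))))
  (.loop false eK (.seq (gate1 (eW 9 (eR + .var d)) (eW 9 (eR + .var d + .const 1)))
    (.gate (eW 9 (eR + .var d)) (eW 2 (.var d)) (eW 9 (eR + .var d + .const 1))))))

variable {X : Ctx} {v : List ℕ} {D : Arr} {d : ℕ}

lemma skip_gates : skip.gates X v D = [] := by rfl

lemma gates_loop {e : Exp} {g : Prog} {m : ℕ} {F : ℕ → List TGate} (he : e.ev X v D = m)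
    (hm : m < X.top) (hg : ∀ i < m, g.gates X (v ++ [i]) D = (F i).map (TGate.enc X.n X.k)) :
    (Prog.loop false e g).gates X v D = ((List.range m).flatMap F).map (TGate.enc X.n X.k) := by
  simp only [Prog.gates, he, Nat.mod_eq_of_lt hm, order, Bool.false_eq_true, if_false,
    List.map_flatMap]
  grind [List.flatMap_congr, List.mem_range]

lemma gates_loop_rev {e : Exp} {g : Prog} {m : ℕ} {F : ℕ → List TGate} (he : e.ev X v D = m)
    (hm : m < X.top) (hg : ∀ i < m, g.gates X (v ++ [i]) D = (F i).map (TGate.enc X.n X.k)) :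
    (Prog.loop true e g).gates X v D
      = ((List.range m).reverse.flatMap F).map (TGate.enc X.n X.k) := by
  simp only [Prog.gates, he, Nat.mod_eq_of_lt hm, order, if_true, List.map_flatMap]
  grind [List.flatMap_congr, List.mem_range, List.mem_reverse]

lemma gates_seq {g h : Prog} {L L' : List TGate} (hg : g.gates X v D = L.map (TGate.enc X.n X.k))
    (hh : h.gates X v D = L'.map (TGate.enc X.n X.k)) :
    (Prog.seq g h).gates X v D = (L ++ L').map (TGate.enc X.n X.k) := by
  grind [Prog.gates, List.map_append]

lemma gates_inv' {g : Prog} {L : List TGate} (hg : g.gates X v D = L.map (TGate.enc X.n X.k)) :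
    g.inv.gates X v D = L.reverse.map (TGate.enc X.n X.k) := by
  rw [Prog.gates_inv, hg, List.map_reverse]

/-- The parameters are small. -/
structure Fits (X : Ctx) : Prop where
  bound : X.b + X.r ≤ X.n
  sum : X.r + X.k ≤ X.n
  weight : X.w ≤ X.n
  top : numQubits X.n X.r X.k < X.top

lemma Fits.n_lt (h : Fits X) : X.n + 1 < X.top := by
  have := h.top
  grind [numQubits]
lemma Fits.r_lt (h : Fits X) : X.r < X.top := by have := h.n_lt; have := h.sum; omega
lemma Fits.k_lt (h : Fits X) : X.k < X.top := by have := h.n_lt; have := h.sum; omega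

section
variable {m : Exp} {M : ℕ}

lemma gates_pLoadCol (hX : Fits X) (hd : v.length = d) (hm : ∀ u, m.ev X (v ++ u) D = M) :
    (pLoadCol d m).gates X v D = (loadCol X.r X.b (D 8) M).map (TGate.enc X.n X.k) := by
  refine gates_loop rfl hX.r_lt fun i _ => ?_
  grind [Prog.gates, ev_arr, ev_add, ev_eB, ev_var_last, ev_eW, skip_gates, TGate.enc, Wire.enc]

lemma gates_pLoadRhs (hX : Fits X) (hd : v.length = d) :
    (pLoadRhs d).gates X v D = (loadRhs X.r X.b).map (TGate.enc X.n X.k) := by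
  refine gates_loop rfl hX.r_lt fun i _ => ?_
  simp [Prog.gates, ev_var_last _ _ hd, TGate.enc, Wire.enc]

lemma gates_pFirstOne (hX : Fits X) (hd : v.length = d) (hm : ∀ u, m.ev X (v ++ u) D = M) :
    (pFirstOne d m).gates X v D = (firstOne X.r M).map (TGate.enc X.n X.k) := by
  refine gates_seq (L := [_]) (by rfl) (gates_loop rfl hX.r_lt fun i _ => ?_)
  simp_all [Prog.gates, gate1, ev_var_last, TGate.enc, Wire.enc]

lemma gates_pUseOne (hX : Fits X) (hd : v.length = d) (hm : ∀ u, m.ev X (v ++ u) D = M) :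
    (pUseOne d m).gates X v D = (useOne X.r M).map (TGate.enc X.n X.k) := by
  refine gates_seq (gates_loop rfl hX.r_lt fun i _ => ?_) (gates_loop rfl hX.r_lt fun i _ => ?_) <;>
  simp_all [Prog.gates, ev_var_last, TGate.enc, Wire.enc]

lemma gates_pReduceBy (hX : Fits X) (hd : v.length = d) (hm : ∀ u, m.ev X (v ++ u) D = M) :
    (pReduceBy d m).gates X v D = (reduceBy X.r M).map (TGate.enc X.n X.k) :=
  gates_seq (gates_pFirstOne hX hd hm)
    (gates_seq (gates_pUseOne hX hd hm) (gates_inv' (gates_pFirstOne hX hd hm)))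

lemma stable_var (hd : v.length = d) (i : ℕ) (u : List ℕ) :
    (Exp.var d).ev X ((v ++ [i]) ++ u) D = i := by
  simp_all [List.append_assoc, ev_var_last]

lemma gates_pReduceAll (hX : Fits X) (hd : v.length = d) (hm : m.ev X v D = M) (hM : M < X.top) :
    (pReduceAll d m).gates X v D = (reduceAll X.r M).map (TGate.enc X.n X.k) :=
  gates_loop hm hM fun i _ => gates_pReduceBy hX (by grind) (stable_var hd i)

lemma gates_pColumn (hX : Fits X) (hd : v.length = d) (hm : ∀ u, m.ev X (v ++ u) D = M)
    (hM : M < X.top) :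
    (pColumn d m).gates X v D = (column X.r X.b (D 8) M).map (TGate.enc X.n X.k) :=
  gates_seq (gates_pLoadCol hX hd hm) (gates_pReduceAll hX hd (by simpa using hm []) hM)

lemma gates_pRhs (hX : Fits X) (hd : v.length = d) :
    (pRhs d).gates X v D = (rhs X.r X.k X.b).map (TGate.enc X.n X.k) :=
  gates_seq (gates_pLoadRhs hX hd) (gates_pReduceAll hX hd rfl hX.k_lt)

lemma gates_pInitE (hX : Fits X) (hd : v.length = d) :
    (pInitE d).gates X v D = (initE X.k X.n (D 8) (fun j => D 9 j 0) (fun c => D 3 c 0)).map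
      (TGate.enc X.n X.k) := by
  refine gates_loop (m := X.n) rfl (by have := hX.n_lt; omega) fun j _ => gates_seq ?_
    (gates_loop rfl hX.k_lt fun c _ => ?_)
  · simp only [Prog.gates, ev_arr, ev_const, ev_var_last _ _ hd, skip_gates]
    split <;> simp [gate1, Prog.gates, eOne, TGate.enc, Wire.enc, oneW, ev_var_last _ _ hd]
  grind [Prog.gates, ev_arr, ev_const, stable_var, skip_gates, ev_var_last, gate1, eW, ev_eW, TGate.enc, Wire.enc]

lemma gates_pFillM (hX : Fits X) (hd : v.length = d) :
    (pFillM d).gates X v D = (fillM X.r X.k X.b (D 8)).map (TGate.enc X.n X.k) := by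
  refine gates_loop rfl hX.k_lt fun m hm => ?_
  have hc := gates_pColumn (D := D) hX (v := v ++ [m]) (d := d + 1) (by grind)
    (stable_var hd m) (hm.trans hX.k_lt)
  refine gates_seq hc (gates_seq (gates_loop rfl hX.r_lt fun i _ => ?_) (gates_inv' hc))
  grind [gate1, Prog.gates, ev_eW, ev_eM, stable_var, ev_var_last, TGate.enc, Wire.enc]

lemma gates_pInitY (hX : Fits X) (hd : v.length = d) :
    (pInitY d).gates X v D = (initY X.r X.k X.b).map (TGate.enc X.n X.k) := by
  refine gates_seq (gates_pRhs hX hd) (gates_seq (gates_loop rfl hX.k_lt fun i _ => ?_)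
    (gates_inv' (gates_pRhs hX hd)))
  simp [gate1, Prog.gates, ev_var_last _ _ hd, TGate.enc, Wire.enc]

lemma gates_pBackY (hX : Fits X) (hd : v.length = d) :
    (pBackY d).gates X v D = (backY X.r X.k X.b (D 8)).map (TGate.enc X.n X.k) := by
  refine gates_loop_rev rfl hX.k_lt fun m hm => ?_
  have hc := gates_pColumn (D := D) hX (v := v ++ [m]) (d := d + 1) (by grind)
    (stable_var hd m) (hm.trans hX.k_lt)
  refine gates_seq hc (gates_seq (gates_loop (ev_var_last _ _ hd _ _) (hm.trans hX.k_lt)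
    fun l _ => ?_) (gates_inv' hc))
  grind [Prog.gates, ev_eW, stable_var, ev_var_last, TGate.enc, Wire.enc]

lemma gates_pFinalE (hX : Fits X) (hd : v.length = d) :
    (pFinalE d).gates X v D = (finalE X.k X.n (D 8)).map (TGate.enc X.n X.k) := by
  refine gates_loop (m := X.n) rfl (by have := hX.n_lt; omega) fun j _ =>
    gates_loop rfl hX.k_lt fun c _ => ?_
  grind [Prog.gates, ev_eW, ev_arr, stable_var, skip_gates, ev_var_last, TGate.enc, Wire.enc]

lemma gates_pCounter (hX : Fits X) (hd : v.length = d) :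
    (pCounter d).gates X v D = (counter X.n).map (TGate.enc X.n X.k) := by
  have := hX.n_lt
  refine gates_seq (L := [_]) (by rfl) (gates_loop (m := X.n) rfl (by omega) fun j hj =>
      gates_loop_rev (m := j + 1) (by simp [ev_var_last _ _ hd]) (by omega) fun l _ => ?_)
  grind [Prog.gates, ev_eW, ev_add, ev_const, stable_var, ev_var_last, TGate.enc, Wire.enc]

lemma gates_pOracle (hX : Fits X) (hd : v.length = d) :
    (pOracle d).gates X v D = (oracle X.r X.k X.n X.b (D 8) (fun j => D 9 j 0)
      (fun c => D 3 c 0)).map (TGate.enc X.n X.k) :=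
  gates_seq (gates_pInitE hX hd) (gates_seq (gates_pFillM hX hd) (gates_seq (gates_pInitY hX hd)
    (gates_seq (gates_pBackY hX hd) (gates_seq (gates_pFinalE hX hd) (gates_pCounter hX hd)))))

lemma gates_pAllZero (hX : Fits X) (hd : v.length = d) :
    (pAllZero d).gates X v D = (allZero X.r X.k).map (TGate.enc X.n X.k) := by
  refine gates_seq (L := [_]) (by rfl)
    (gates_seq (gates_loop rfl hX.r_lt fun i _ => ?_) (gates_loop rfl hX.k_lt fun i _ => ?_)) <;>
  simp [Prog.gates, gate1, ev_var_last _ _ hd, TGate.enc, Wire.enc]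

end

end progs

/-! ## The quantum search -/

variable {q : ℕ}

abbrev Ctx.qubits (X : Ctx) : ℕ := numQubits X.n X.r X.k

lemma numQubits_pos (n r k : ℕ) : 0 < numQubits n r k := by simp [numQubits]

/-- The qubit of a wire. -/
def qb (X : Ctx) (x : Wire) : Fin X.qubits :=
  ⟨x.enc X.n X.k % X.qubits, Nat.mod_lt _ (numQubits_pos _ _ _)⟩

lemma qb_val {X : Ctx} {x : Wire} (h : x.Ok X.n X.r X.k) : (qb X x : ℕ) = x.enc X.n X.k :=
  Nat.mod_eq_of_lt (Wire.enc_lt h)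

lemma qb_inj {X : Ctx} {x y : Wire} (hx : x.Ok X.n X.r X.k) (hy : y.Ok X.n X.r X.k) :
    qb X x = qb X y ↔ x = y :=
  ⟨fun e => Wire.enc_inj hx hy (by grind [qb_val]), fun e => e ▸ rfl⟩

lemma readW_qb {X : Ctx} {x : Wire} (h : x.Ok X.n X.r X.k) (b : Fin X.qubits → Bool) :
    readW X.n X.r X.k b x = if b (qb X x) then 1 else 0 := by
  rw [readW_ok h]
  congr 3
  exact Fin.ext (qb_val h).symm

def eTau : Exp := .arr 4 (.const 0) (.const 0)

/-- A coin is one with probability τ/r or τ/k, so both masks have expected size τ. -/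
def pCoins (d : ℕ) : Prog := .seq (.loop false eR (.rot (eW 1 (.var d)) eTau eR))
  (.loop false eK (.rot (eW 2 (.var d)) eTau eK))

/-- The coins, with their probabilities. -/
def coins (X : Ctx) (τ : ℕ) : List (Fin X.qubits × ℕ × ℕ) :=
  (List.range X.r).map (fun i => (qb X (1, i, 0), τ, X.r)) ++
    (List.range X.k).map (fun c => (qb X (2, c, 0), τ, X.k))

def coinGates (X : Ctx) (τ : ℕ) : List Gate := (coins X τ).map fun p => .rot p.1 p.2.1 p.2.2

def pGrover (d : ℕ) : Prog :=
  .seq (.seq (.seq (.seq (pOracle d) (.seq (.rot (eW 8 eOm) (.const 0) (.const 1)) (pOracle d).inv))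
    (pCoins d).inv)
    (.seq (pAllZero d) (.seq (.rot (eW 9 (eR + eK)) (.const 0) (.const 1)) (pAllZero d).inv)))
    (pCoins d)

def pAmplify : Prog := .seq (.rot eOne (.const 1) (.const 1)) (.seq (pCoins 0) (.seq
    (.loop false (.arr 4 (.const 3) (.const 0)) (pGrover 1)) (pOracle 0)))

def pSearch : Prog := .seq pAmplify (measureAll (.const 10 * (eN + .const 2) + eR * eK))

def oracleGates (X : Ctx) (D : Arr) : List Gate :=
  (oracle X.r X.k X.n X.b (D 8) (fun j => D 9 j 0) (fun c => D 3 c 0)).map (TGate.enc X.n X.k)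

def zeroGates (X : Ctx) : List Gate := (allZero X.r X.k).map (TGate.enc X.n X.k)

/-- The candidate for the coins in `w`. -/
def cand (X : Ctx) (D : Arr) (w : WState) : ℕ → ZMod 2 :=
  candidate X.r X.k X.b (D 8) (fun j => D 9 j 0) (fun c => D 3 c 0) w

/-- The initial basis state. -/
def base (X : Ctx) : Fin X.qubits → Bool := fun t => decide (t = qb X oneW)

/-- The probability of a good candidate before amplification. -/
noncomputable def searchProb (X : Ctx) (D : Arr) : ℝ :=
  goodProb (coinGates X (D 4 0 0)) (oracleGates X D) (qb X (8, X.w, 0)) (base X)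

variable {X : Ctx} {v : List ℕ} {D : Arr} {d τ : ℕ}

lemma ok_of_lt {t i : ℕ} (ht : t < 10) (hi : i < X.n + 2) :
    Wire.Ok X.n X.r X.k (t, i, 0) := Or.inl ⟨ht, hi, rfl⟩

lemma gates_pCoins (hX : Fits X) (hd : v.length = d) :
    (pCoins d).gates X v D = coinGates X (D 4 0 0) := by
  have hs := hX.sum
  simp only [pCoins, Prog.gates, ev_eR, ev_eK, Nat.mod_eq_of_lt hX.r_lt, Nat.mod_eq_of_lt hX.k_lt,
    order, Bool.false_eq_true, if_false, ev_eW, ev_var_last _ _ hd, eTau, ev_arr, ev_const,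
    coinGates, coins, List.map_append, List.map_map]
  congr 1 <;> rw [← List.map_eq_flatMap] <;> refine List.map_congr_left fun i hi => ?_ <;>
    have := List.mem_range.1 hi <;> simp only [comp] <;>
    rw [qb_val (ok_of_lt (by omega) (by omega))] <;> rfl

lemma gates_pGrover (hX : Fits X) (hd : v.length = d) :
    (pGrover d).gates X v D = groverGates (coinGates X (D 4 0 0)) (oracleGates X D) (zeroGates X)
      (qb X (8, X.w, 0)) (qb X (9, X.r + X.k, 0)) := by
  have h1 := hX.weight
  have h2 := hX.sum
  have o := gates_pOracle (D := D) hX hd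
  have z := gates_pAllZero (D := D) hX hd
  have e8 : ((qb X (8, X.w, 0) : Fin _) : ℕ) = 8 * (X.n + 2) + X.w := by
    grind [qb_val, ok_of_lt, Wire.enc]
  have e9 : ((qb X (9, X.r + X.k, 0) : Fin _) : ℕ) = 9 * (X.n + 2) + (X.r + X.k) := by
    grind [qb_val, ok_of_lt, Wire.enc]
  simp_all [pGrover, Prog.gates, Prog.gates_inv, gates_pCoins, groverGates, oracleGates, zeroGates, ev_eW, ev_eOm, ev_add, ev_eR, ev_eK, ev_const]

lemma applyGates_replicate (L : List Gate) (j : ℕ) (ψ : QState q) :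
    applyGates ((List.range j).flatMap fun _ => L) ψ = (applyGates L)^[j] ψ := by
  induction j with
  | zero => rfl
  | succ j ih =>
    simp_all [List.range_succ, List.flatMap_append, applyGates_append, iterate_succ_apply']

lemma pAmplify_unitary : pAmplify.unitary = true := by rfl

lemma base_start (X : Ctx) (hX : Fits X) (u : ℂ) :
    rotate (eOne.ev X [] D) 1 1 (u • QState.zero X.qubits) = u • Pi.single (base X) 1 := by
  have e : eOne.ev X [] D = (qb X oneW : ℕ) := by rw [qb_val (Or.inl ⟨by simp, by simp, rfl⟩)]; rfl
  funext b
  rw [e, rotate_one_one]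
  simp only [Pi.smul_apply, QState.zero, Pi.single_apply]
  congr 2
  refine propext ⟨fun h => ?_, fun h => ?_⟩
  · rw [← flip_involutive (qb X oneW) b, h]
    funext t
    by_cases ht : t = qb X oneW
    · subst ht; rfl
    · simp [flip, base, ht]
  · rw [h]
    funext t
    by_cases ht : t = qb X oneW
    · simp_all [flip, base]
    · simp [flip, base, ht]

lemma amp_pAmplify (hX : Fits X) (hj : D 4 3 0 < X.top) (u : ℂ) :
    applyGates (pAmplify.gates X [] D) (u • QState.zero X.qubits) =
      u • applyGates (oracleGates X D) ((applyGates (groverGates (coinGates X (D 4 0 0))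
        (oracleGates X D) (zeroGates X) (qb X (8, X.w, 0)) (qb X (9, X.r + X.k, 0))))^[D 4 3 0]
          (startState (coinGates X (D 4 0 0)) (base X))) := by
  have e1 : ∀ L ψ, applyGates (q := X.qubits) (Gate.rot (eOne.ev X [] D) 1 1 :: L) ψ
      = applyGates L (rotate (eOne.ev X [] D) 1 1 ψ) := fun _ _ => rfl
  have e2 : (pOracle 0).gates X [] D = oracleGates X D := gates_pOracle hX rfl
  simp only [pAmplify, Prog.gates, e2, ev_arr, ev_const,
    Nat.mod_eq_of_lt hj, order, Bool.false_eq_true, if_false, List.cons_append, List.nil_append]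
  have e3 : (List.range (D 4 3 0)).flatMap (fun i => (pGrover 1).gates X [i] D)
      = (List.range (D 4 3 0)).flatMap fun _ => groverGates (coinGates X (D 4 0 0))
        (oracleGates X D) (zeroGates X) (qb X (8, X.w, 0)) (qb X (9, X.r + X.k, 0)) :=
    List.flatMap_congr fun i _ => gates_pGrover hX rfl
  rw [e1, base_start X hX, applyGates_smul, applyGates_append, applyGates_append, e3,
    applyGates_replicate, gates_pCoins (v := []) (d := 0) hX rfl]
  rfl

lemma mem_coins {t : Fin X.qubits} : t ∈ (coins X τ).map Prod.fst ↔
    (∃ i < X.r, qb X (1, i, 0) = t) ∨ ∃ c < X.k, qb X (2, c, 0) = t := by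
  simp [coins]

lemma near_base (hX : Fits X) {b : Fin X.qubits → Bool}
    (hb : near (· ∈ (coins X τ).map Prod.fst) (base X) b) {x : Wire} (hx : x.1 ≠ 1)
    (hx2 : x.1 ≠ 2) : readW X.n X.r X.k b x = if x = oneW then 1 else 0 := by
  have hs := hX.sum
  by_cases h : x.Ok X.n X.r X.k
  · rw [readW_qb h, hb, base]
    · have ho : Wire.Ok X.n X.r X.k oneW := ok_of_lt (by omega) (by omega)
      grind [qb_inj]
    grind [mem_coins, qb_inj, ok_of_lt]
  · rw [readW, dif_neg h, if_neg]
    grind [ok_of_lt]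

lemma near_ready (hX : Fits X) {b : Fin X.qubits → Bool}
    (hb : near (· ∈ (coins X τ).map Prod.fst) (base X) b) : Ready (readW X.n X.r X.k b) := by
  have h := fun x h1 h2 => near_base hX hb (x := x) h1 h2
  constructor
  · constructor
    · grind
    all_goals grind
  · grind
  · grind
  · grind
  · grind
  grind

/-- Near the initial state the coins are the only freedom, so the zero test of the coins recognizes
that state. -/
lemma anc_iff (hX : Fits X) {b : Fin X.qubits → Bool}
    (hb : near (· ∈ (coins X τ).map Prod.fst) (base X) b) :
    runBasis (zeroGates X) b (qb X (9, X.r + X.k, 0)) = true ↔ b = base X := by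
  have hs := hX.sum
  have h9 : Wire.Ok X.n X.r X.k (9, X.r + X.k, 0) := ok_of_lt (by omega) (by omega)
  have h1 := readW_qb h9 (runBasis (zeroGates X) b)
  rw [zeroGates, readW_run (allZero_ok hs), allZero_spec (near_ready hX hb)] at h1
  have e1 : ∀ i < X.r, readW X.n X.r X.k b (1, i, 0) = if b (qb X (1, i, 0)) then 1 else 0 :=
    fun i hi => readW_qb (ok_of_lt (by omega) (by omega)) b
  have e2 : ∀ i < X.k, readW X.n X.r X.k b (2, i, 0) = if b (qb X (2, i, 0)) then 1 else 0 :=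
    fun i hi => readW_qb (ok_of_lt (by omega) (by omega)) b
  have key : ((∀ i < X.r, readW X.n X.r X.k b (1, i, 0) = 0) ∧
      ∀ c < X.k, readW X.n X.r X.k b (2, c, 0) = 0) ↔ b = base X := by
    have ho : Wire.Ok X.n X.r X.k oneW := ok_of_lt (by omega) (by omega)
    constructor
    · rintro ⟨h1, h2⟩
      funext t
      by_cases ht : t ∈ (coins X τ).map Prod.fst
      · rcases mem_coins.1 ht with ⟨i, hi, rfl⟩ | ⟨i, hi, rfl⟩
        · have := h1 i hi
          have h3 : qb X (1, i, 0) ≠ qb X oneW := fun e => by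
            simpa [oneW] using (qb_inj (ok_of_lt (by omega) (by omega)) ho).1 e
          grind [base]
        · have := h2 i hi
          have h3 : qb X (2, i, 0) ≠ qb X oneW := fun e => by
            simpa [oneW] using (qb_inj (ok_of_lt (by omega) (by omega)) ho).1 e
          grind [base]
      · exact hb t ht
    · rintro rfl
      refine ⟨fun i hi => ?_, fun i hi => ?_⟩
      · have h3 : qb X (1, i, 0) ≠ qb X oneW := fun e => by
          simpa [oneW] using (qb_inj (ok_of_lt (by omega) (by omega)) ho).1 e
        simp_all [base]
      · have h3 : qb X (2, i, 0) ≠ qb X oneW := fun e => by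
          simpa [oneW] using (qb_inj (ok_of_lt (by omega) (by omega)) ho).1 e
        simp_all [base]
  rw [zeroGates]
  by_cases hc : (∀ i < X.r, readW X.n X.r X.k b (1, i, 0) = 0) ∧
      ∀ c < X.k, readW X.n X.r X.k b (2, c, 0) = 0
  · rw [if_pos hc] at h1; grind
  grind

lemma coinGates_mem : ∀ g ∈ coinGates X τ, ∃ (t : Fin X.qubits) (x y : ℕ),
    t ∈ (coins X τ).map Prod.fst ∧ g = .rot t x y := by
  intro g hg
  obtain ⟨p, hp, rfl⟩ := List.mem_map.1 hg
  grind

lemma flag_iff (hX : Fits X) {b : Fin X.qubits → Bool}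
    (hb : near (· ∈ (coins X τ).map Prod.fst) (base X) b) :
    runBasis (oracleGates X D) b (qb X (8, X.w, 0)) = true ↔
      countOnes (cand X D (readW X.n X.r X.k b)) X.n = X.w := by
  have hw := hX.weight
  have h1 := readW_qb (X := X) (x := (8, X.w, 0)) (ok_of_lt (by omega) (by omega))
    (runBasis (oracleGates X D) b)
  rw [oracleGates, readW_run (oracle_ok hX.bound (by have := hX.sum; omega)),
    (oracle_spec hX.bound (near_ready hX hb)).2] at h1
  rw [oracleGates]
  change _ ↔ countOnes (candidate X.r X.k X.b (D 8) (fun j => D 9 j 0) (fun c => D 3 c 0)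
    (readW X.n X.r X.k b)) X.n = X.w
  grind

lemma zeroGates_isTof (X : Ctx) : ∀ g ∈ zeroGates X, g.isTof := isTof_map _

/-- The oracle is applied once more before the measurement, so every outcome is the image of a basis
state under the oracle. If the flag of this state is set, then the measured wires with tag 7 hold a
candidate of the right weight. The probability of this event is given by `grover_prob`. -/
lemma wp_pSearch (hX : Fits X) (f : St X.qubits → ℝ≥0∞) (s : St X.qubits) {u : ℂ} (hu : ‖u‖ = 1)
    (hs : s.amp = u • QState.zero X.qubits) (hj : s.arr 4 3 0 < X.top)
    (hf : ∀ (D' : Arr) (u' : ℂ) (w : WState), ‖u'‖ = 1 → Ready w → (∀ ρ ≠ 10, D' ρ = s.arr ρ) →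
      (∀ j < X.n, D' 10 (7 * (X.n + 2) + j) 0 = (cand X s.arr w j).val) →
      countOnes (cand X s.arr w) X.n = X.w → 1 ≤ f ⟨D', u' • QState.zero X.qubits⟩) :
    ENNReal.ofReal (Real.sin ((2 * s.arr 4 3 0 + 1) * Real.arcsin √(searchProb X s.arr)) ^ 2) ≤
      wp X 0 pSearch [] f s := by
  obtain ⟨D, ψ⟩ := s
  simp only at hs hj hf ⊢
  subst hs
  simp only [pSearch, wp]
  rw [wp_unitary _ _ _ _ pAmplify_unitary, amp_pAmplify hX hj]
  set τ := D 4 0 0 with hτ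
  set φ := (applyGates (groverGates (coinGates X τ) (oracleGates X D) (zeroGates X)
    (qb X (8, X.w, 0)) (qb X (9, X.r + X.k, 0))))^[D 4 3 0] (startState (coinGates X τ) (base X))
    with hφ
  have hL : ∀ g ∈ oracleGates X D, g.isTof := isTof_map _
  have hsup : ∀ b, ¬ near (· ∈ (coins X τ).map Prod.fst) (base X) b → φ b = 0 := by
    intro b hb
    rw [hφ, grover_iterate (co := (· ∈ (coins X τ).map Prod.fst)) coinGates_mem hL
      (zeroGates_isTof X) fun b hb => anc_iff hX hb]
    simp only
    rw [startState, applyGates_supported (co := (· ∈ (coins X τ).map Prod.fst))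
      coinGates_mem (b₀ := base X) _ b hb, mul_zero]
    intro b hb
    rw [Pi.single_apply, if_neg]
    rintro rfl
    exact hb fun _ _ => rfl
  have hN : φ.Normalized := by
    rw [hφ]
    generalize D 4 3 0 = j
    induction j with
    | zero => exact applyGates_normalized _ (single_normalized _)
    | succ j ih => grind [iterate_succ_apply', applyGates_normalized]
  have hN2 : QState.Normalized (u • applyGates (oracleGates X D) φ) := by
    have := applyGates_normalized (oracleGates X D) hN
    unfold QState.Normalized at *
    simpa [hu] using this
  set good : (Fin X.qubits → Bool) → Prop := fun b =>
    near (· ∈ (coins X τ).map Prod.fst) (base X) b ∧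
      runBasis (oracleGates X D) b (qb X (8, X.w, 0)) = true with hgood
  classical
  -- The outcomes are images under the oracle of states with good coins; all others are counted as
  -- failures.
  set c : (Fin X.qubits → Bool) → ℝ≥0∞ := fun b' =>
    if ∃ b, runBasis (oracleGates X D) b = b' ∧ good b then 1 else 0 with hc
  refine le_trans ?_ (wp_measureAll X (.const 10 * (eN + .const 2) + eR * eK)
    ⟨D, u • applyGates (oracleGates X D) φ⟩ rfl hX.top f c ?_ hN2)
  · rw [searchProb, ← grover_prob (co := (· ∈ (coins X τ).map Prod.fst)) coinGates_mem hL
      (zeroGates_isTof X) (fun b hb => anc_iff hX hb) (D 4 3 0), ← hφ, ← sum_runBasis hL,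
      ENNReal.ofReal_sum_of_nonneg fun _ _ => by simp, sum_filter]
    refine sum_le_sum fun b _ => ?_
    simp only [Pi.smul_apply, norm_smul, hu, one_mul, applyGates_runBasis hL]
    split_ifs with h
    · by_cases hb : near (· ∈ (coins X τ).map Prod.fst) (base X) b
      · rw [hc]; simp only; rw [if_pos ⟨b, rfl, hb, h⟩, mul_one]
      · simp [hsup b hb]
    simp
  · intro D' u' b' hu' hD' h10
    rw [hc]
    simp only
    split_ifs with h
    · obtain ⟨b, rfl, hb, hfl⟩ := h
      refine hf D' u' (readW X.n X.r X.k b) hu' (near_ready hX hb) hD' (fun j hj => ?_)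
        ((flag_iff hX hb).1 hfl)
      have ho : Wire.Ok X.n X.r X.k (7, j, 0) := ok_of_lt (by omega) (by omega)
      have e : 7 * (X.n + 2) + j = (qb X (7, j, 0) : ℕ) := by rw [qb_val ho]; rfl
      have h1 := readW_qb ho (runBasis (oracleGates X D) b)
      rw [oracleGates, readW_run (oracle_ok hX.bound (by have := hX.sum; omega)),
        (oracle_spec hX.bound (near_ready hX hb)).1 j hj] at h1
      rw [e, h10, cand, h1, ← oracleGates]
      cases runBasis (oracleGates X D) b (qb X (7, j, 0)) <;> rfl
    simp

/-- Whatever is measured, the register is reset up to a phase. This suffices for soundness. -/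
lemma wp_pSearch_zero (hX : Fits X) (f : St X.qubits → ℝ≥0∞) (s : St X.qubits) {c : ℝ≥0∞}
    (hs : s.amp.Normalized)
    (hf : ∀ (D' : Arr) (u' : ℂ), ‖u'‖ = 1 →
      (∀ ρ ≠ 10, D' ρ = s.arr ρ) → c ≤ f ⟨D', u' • QState.zero X.qubits⟩) :
    c ≤ wp X 0 pSearch [] f s := by
  have h1 : wp X 0 pSearch [] f s =
      wp X 0 pAmplify [] (wp X 0 (measureAll (.const 10 * (eN + .const 2) + eR * eK)) [] f) s := rfl
  rw [h1, wp_unitary _ _ _ _ pAmplify_unitary]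
  have hN := applyGates_normalized (pAmplify.gates X [] s.arr) hs
  generalize applyGates (pAmplify.gates X [] s.arr) s.amp = φ at hN
  have h2 := wp_measureAll X (.const 10 * (eN + .const 2) + eR * eK) ⟨s.arr, φ⟩ rfl hX.top f
    (fun _ => c) (fun D' u b hu hD _ => hf D' u hu hD) hN
  rw [← sum_mul, ← ENNReal.ofReal_sum_of_nonneg fun _ _ => by simp] at h2
  rwa [show ∑ b, ‖φ b‖ ^ 2 = 1 from hN, ENNReal.ofReal_one, one_mul] at h2

/-! ### The probability of good coins -/

/-- The basis state in which the coins in `I` and `K` are one. -/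
def coinState (X : Ctx) (I K : Finset ℕ) : Fin X.qubits → Bool := fun t =>
  decide (t = qb X oneW ∨ (∃ i ∈ I, t = qb X (1, i, 0)) ∨ ∃ c ∈ K, t = qb X (2, c, 0))

/-- The values of the coin wires. -/
def coinW (I K : Finset ℕ) : WState := fun x =>
  if x.1 = 1 then (if x.2.1 ∈ I then 1 else 0) else if x.2.1 ∈ K then 1 else 0

section coinState
variable {I K : Finset ℕ}

lemma coinState_wire (hX : Fits X) (hI : I ⊆ range X.r) (hK : K ⊆ range X.k)
    {x : Wire} (hx : x.Ok X.n X.r X.k) : coinState X I K (qb X x) = true ↔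
      x = oneW ∨ (∃ i ∈ I, x = (1, i, 0)) ∨ ∃ c ∈ K, x = (2, c, 0) := by
  have hs := hX.sum
  have h1 : ∀ i ∈ I, (qb X x = qb X (1, i, 0) ↔ x = (1, i, 0)) := fun i hi =>
    qb_inj hx (ok_of_lt (by omega) (by grind))
  have h2 : ∀ i ∈ K, (qb X x = qb X (2, i, 0) ↔ x = (2, i, 0)) := fun i hi =>
    qb_inj hx (ok_of_lt (by omega) (by grind))
  have h0 : qb X x = qb X oneW ↔ x = oneW := qb_inj hx (ok_of_lt (by omega) (by omega))
  simp only [coinState, decide_eq_true_eq, h0]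
  grind

lemma coinState_near (hI : I ⊆ range X.r) (hK : K ⊆ range X.k) :
    near (· ∈ (coins X τ).map Prod.fst) (base X) (coinState X I K) := by
  intro t ht
  replace ht := mem_coins.not.1 ht
  grind [coinState, base, mem_range]

lemma readW_coinState (hX : Fits X) (hI : I ⊆ range X.r) (hK : K ⊆ range X.k)
    {t : ℕ} (ht : t = 1 ∨ t = 2) (i : ℕ) :
    readW X.n X.r X.k (coinState X I K) (t, i, 0) = coinW I K (t, i, 0) := by
  have hs := hX.sum
  by_cases h : Wire.Ok X.n X.r X.k (t, i, 0)
  · rw [readW_qb h]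
    simp only [coinState_wire hX hI hK h]
    rcases ht with rfl | rfl <;> simp [oneW, coinW]
  · rw [readW, dif_neg h]
    grind [ok_of_lt, mem_range, coinW]

lemma cand_congr {w w' : WState} (h1 : ∀ i, w (1, i, 0) = w' (1, i, 0))
    (h2 : ∀ i, w (2, i, 0) = w' (2, i, 0)) : cand X D w = cand X D w' := by
  funext j
  have h3 : maskedCol X.b (D 8) w = maskedCol X.b (D 8) w' := by grind [maskedCol]
  simp_all [cand, candidate, solution]

lemma coins_prod (p q : ℝ) (hI : I ⊆ range d) :
    ((List.range d).map fun i => if i ∈ I then p else q).prod = p ^ I.card * q ^ (d - I.card) := by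
  have : ((List.range d).map fun i => if i ∈ I then p else q).prod
      = ∏ i ∈ range d, if i ∈ I then p else q := by
    rfl
  simp_all [prod_ite, prod_const, filter_mem_eq_inter, inter_eq_right, filter_notMem_eq_sdiff, card_sdiff_of_subset, card_range]

/-- The weight of a set of coins of which `τ` out of `m` are one. -/
noncomputable def coinWeight (τ m : ℕ) : ℝ := rotProb τ m ^ τ * (1 - rotProb τ m) ^ (m - τ)

lemma startState_coinState (hX : Fits X) (hI : I ⊆ range X.r)
    (hK : K ⊆ range X.k) (cI : I.card = τ) (cK : K.card = τ) :
    ‖startState (coinGates X τ) (base X) (coinState X I K)‖ ^ 2 =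
      coinWeight τ X.r * coinWeight τ X.k := by
  have hs := hX.sum
  have ho : Wire.Ok X.n X.r X.k oneW := ok_of_lt (by omega) (by omega)
  have h1 : ∀ i < X.r, Wire.Ok X.n X.r X.k (1, i, 0) := fun i hi => ok_of_lt (by omega) (by omega)
  have h2 : ∀ i < X.k, Wire.Ok X.n X.r X.k (2, i, 0) := fun i hi => ok_of_lt (by omega) (by omega)
  rw [startState, coinGates, rots_prob (coins X τ) _ _ _ (coinState_near hI hK)]
  · rw [coins, List.map_append, List.prod_append, List.map_map, List.map_map]
    simp only [comp_def]
    rw [coinWeight, coinWeight]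
    congr 1
    · have := coins_prod (rotProb τ X.r) (1 - rotProb τ X.r) hI
      rw [cI] at this
      rw [← this]
      congr 1
      simp_all [List.map_congr_left, coinState_wire, List.mem_range, oneW]
    · have := coins_prod (rotProb τ X.k) (1 - rotProb τ X.k) hK
      rw [cK] at this
      rw [← this]
      congr 1
      simp_all [List.map_congr_left, coinState_wire, List.mem_range, oneW]
  · rw [coins, List.map_append, List.map_map, List.map_map, List.nodup_append]
    grind [List.Nodup.map_on, List.nodup_range, qb_inj, List.mem_range, List.mem_map]
  · intro p hp
    have := mem_coins.1 (List.mem_map_of_mem (f := Prod.fst) hp)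
    rcases this with ⟨i, hi, e⟩ | ⟨i, hi, e⟩ <;> rw [← e, base, decide_eq_false_iff_not] <;>
      intro e2
    · simpa [oneW] using (qb_inj (h1 i hi) ho).1 e2
    · simpa [oneW] using (qb_inj (h2 i hi) ho).1 e2

/-- Different masks are different basis states, so their probabilities add up. Only masks of the
exact size are used, and these all have the same weight. -/
lemma le_searchProb (hX : Fits X) (S : Finset (Finset ℕ × Finset ℕ))
    (hS : ∀ p ∈ S, p.1 ⊆ range X.r ∧ p.2 ⊆ range X.k ∧ p.1.card = D 4 0 0 ∧
      p.2.card = D 4 0 0 ∧ countOnes (cand X D (coinW p.1 p.2)) X.n = X.w) :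
    S.card * (coinWeight (D 4 0 0) X.r * coinWeight (D 4 0 0) X.k) ≤ searchProb X D := by
  classical
  have hs := hX.sum
  have hinj : Set.InjOn (fun p : Finset ℕ × Finset ℕ => coinState X p.1 p.2) S := by
    intro p hp p' hp' e
    obtain ⟨a1, a2, _⟩ := hS p hp
    obtain ⟨b1, b2, _⟩ := hS p' hp'
    have key : ∀ x : Wire, x.Ok X.n X.r X.k →
        (coinState X p.1 p.2 (qb X x) = true ↔ coinState X p'.1 p'.2 (qb X x) = true) := by
      simp_all
    refine Prod.ext (ext fun i => ?_) (ext fun i => ?_)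
    · by_cases hi : i < X.r
      · have ho : Wire.Ok X.n X.r X.k (1, i, 0) := ok_of_lt (by omega) (by omega)
        have := key _ ho
        rw [coinState_wire hX a1 a2 ho, coinState_wire hX b1 b2 ho] at this
        grind
      grind
    · by_cases hi : i < X.k
      · have ho : Wire.Ok X.n X.r X.k (2, i, 0) := ok_of_lt (by omega) (by omega)
        have := key _ ho
        rw [coinState_wire hX a1 a2 ho, coinState_wire hX b1 b2 ho] at this
        grind
      grind
  calc _ = ∑ p ∈ S, ‖startState (coinGates X (D 4 0 0)) (base X) (coinState X p.1 p.2)‖ ^ 2 := by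
        rw [← nsmul_eq_mul, ← sum_const]
        grind [sum_congr, startState_coinState]
    _ = ∑ b ∈ S.image fun p => coinState X p.1 p.2,
          ‖startState (coinGates X (D 4 0 0)) (base X) b‖ ^ 2 := (sum_image
          (f := fun b => ‖startState (coinGates X (D 4 0 0)) (base X) b‖ ^ 2) hinj).symm
    _ ≤ _ := by
        refine sum_le_sum_of_subset_of_nonneg (fun b hb => ?_) fun _ _ _ => by simp
        obtain ⟨p, hp, rfl⟩ := mem_image.1 hb
        obtain ⟨a1, a2, _, _, a5⟩ := hS p hp
        rw [mem_filter, flag_iff (τ := D 4 0 0) hX (coinState_near a1 a2)]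
        simp_all [mem_univ, cand_congr, readW_coinState]

end coinState

/-! ## Reasoning about probabilistic programs -/

section reach

variable {X : Ctx} {q : ℕ} {g h : Prog} {v : List ℕ} {c c' : ℝ≥0∞} {D : Arr} {P Q : Arr → Prop}

/-- From `D`, the program `g` reaches a state of the arrays with the property `P` with probability
at least `c`, and does not touch the qubits. -/
def Reach (X : Ctx) (q : ℕ) (g : Prog) (v : List ℕ) (c : ℝ≥0∞) (D : Arr) (P : Arr → Prop) : Prop :=
  ∃ D', P D' ∧ ∀ (ψ : QState q) (f : St q → ℝ≥0∞), c * f ⟨D', ψ⟩ ≤ wp X 0 g v f ⟨D, ψ⟩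

abbrev Det (X : Ctx) (q : ℕ) (g : Prog) (v : List ℕ) (D : Arr) (P : Arr → Prop) : Prop :=
  Reach X q g v 1 D P

lemma Reach.mono (hg : Reach X q g v c D P) (hP : ∀ D', P D' → Q D') : Reach X q g v c D Q :=
  let ⟨D', h1, h2⟩ := hg; ⟨D', hP _ h1, h2⟩

lemma Reach.seq (hg : Reach X q g v c D fun D' => Reach X q h v c' D' Q) :
    Reach X q (.seq g h) v (c * c') D Q := by
  obtain ⟨D', ⟨D'', h1, h2⟩, h3⟩ := hg
  refine ⟨D'', h1, fun ψ f => ?_⟩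
  rw [mul_assoc]
  exact (mul_le_mul_right (h2 ψ f) c).trans (h3 ψ _)

lemma Det.seq (hg : Det X q g v D fun D' => Det X q h v D' Q) : Det X q (.seq g h) v D Q := by
  simpa using Reach.seq hg

lemma Det.set {ρ : Fin 16} {i j e : Exp}
    (h : P (D.put ρ (i.ev X v D) (j.ev X v D) (e.ev X v D % X.top))) :
    Det X q (.set ρ i j e) v D P := ⟨_, h, fun ψ f => by simp [wp]⟩

lemma Reach.rnd {ρ : Fin 16} {i j e : Exp} {m x : ℕ} (he : e.ev X v D = m) (hm : m < X.top)
    (hx : x < m) (h : P (D.put ρ (i.ev X v D) (j.ev X v D) x)) :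
    Reach X q (.rnd ρ i j e) v (m : ℝ≥0∞)⁻¹ D P := by
  refine ⟨_, h, fun ψ f => ?_⟩
  simp only [wp, he, Nat.mod_eq_of_lt hm, zero_add]
  rw [if_neg (by omega), mul_comm, div_eq_mul_inv]
  refine mul_le_mul_left ?_ _
  exact single_le_sum (f := fun x => f ⟨D.put ρ (i.ev X v D) (j.ev X v D) x, ψ⟩)
    (fun _ _ => zero_le) (mem_range.2 hx)

lemma Det.ite {e : Exp} (h0 : e.ev X v D = 0 → Det X q h v D P)
    (h1 : e.ev X v D ≠ 0 → Det X q g v D P) : Det X q (.ite e g h) v D P := by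
  by_cases he : e.ev X v D = 0
  · obtain ⟨D', a, b⟩ := h0 he
    exact ⟨D', a, fun ψ f => by simp_all [wp]⟩
  · obtain ⟨D', a, b⟩ := h1 he
    exact ⟨D', a, fun ψ f => by simp_all [wp]⟩

lemma Det.skip (h : P D) : Det X q skip v D P := ⟨D, h, fun ψ f => by rw [wp_skip, one_mul]⟩

lemma Reach.list {I : List ℕ → Arr → Prop} {cs : ℕ → ℝ≥0∞} (l : List ℕ)
    (hI : ∀ i l', (i :: l') <:+ l → ∀ D, I (i :: l') D → Reach X q g (v ++ [i]) (cs i) D (I l'))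
    (h0 : I l D) : ∃ D', I [] D' ∧ ∀ (ψ : QState q) (f : St q → ℝ≥0∞), (l.map cs).prod * f ⟨D', ψ⟩ ≤
      l.foldr (fun i F s => 0 + wp X 0 g (v ++ [i]) (fun s => 0 + F s) s) (fun s => 0 + f s)
        ⟨D, ψ⟩ := by
  induction l generalizing D with
  | nil => exact ⟨D, h0, fun ψ f => by simp⟩
  | cons i l ih =>
    obtain ⟨D₁, a, b⟩ := hI i l List.suffix_rfl D h0
    obtain ⟨D₂, a', b'⟩ := ih (fun i l' hl => hI i l' (hl.trans (List.suffix_cons _ _))) a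
    refine ⟨D₂, a', fun ψ f => ?_⟩
    rw [List.map_cons, List.prod_cons, mul_assoc, List.foldr_cons, zero_add]
    refine (mul_le_mul_right (b' ψ f) _).trans ((le_of_eq ?_).trans (b ψ _))
    simp

lemma Det.loop {e : Exp} {m : ℕ} (I : ℕ → Arr → Prop) (he : e.ev X v D = m) (hm : m < X.top)
    (h0 : I 0 D) (hI : ∀ i < m, ∀ D, I i D → Det X q g (v ++ [i]) D (I (i + 1)))
    (hP : ∀ D, I m D → P D) : Det X q (.loop false e g) v D P := by
  obtain ⟨D', a, b⟩ := Reach.list (X := X) (q := q) (g := g) (v := v) (D := D) (cs := fun _ => 1)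
    (I := fun l D => I (m - l.length) D) (List.range m) (fun i l' hl D hD => by
      obtain ⟨t, ht⟩ := hl
      have h1 : t.length + (l'.length + 1) = m := by simpa using congrArg List.length ht
      have h2 : i = t.length := by
        have h3 := congrArg (fun l => l.getD t.length 0) ht
        grind
      grind) (by grind)
  refine ⟨D', hP _ (by omega), fun ψ f => ?_⟩
  simp_all [wp, Nat.mod_eq_of_lt, order]

lemma Reach.loop_rev {e : Exp} {m : ℕ} (I : ℕ → Arr → Prop) (cs : ℕ → ℝ≥0∞)
    (he : e.ev X v D = m) (hm : m < X.top)
    (h0 : I m D) (hI : ∀ i < m, ∀ D, I (i + 1) D → Reach X q g (v ++ [i]) (cs i) D (I i))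
    (hP : ∀ D, I 0 D → P D) :
    Reach X q (.loop true e g) v (∏ i ∈ range m, cs i) D P := by
  obtain ⟨D', a, b⟩ := Reach.list (X := X) (q := q) (g := g) (v := v) (D := D) (cs := cs)
    (I := fun l D => I l.length D) (List.range m).reverse (fun i l' hl D hD => by
      obtain ⟨t, ht⟩ := hl
      have h1 : t.length + (l'.length + 1) = m := by simpa using congrArg List.length ht
      have ht' := congrArg List.reverse ht
      rw [List.reverse_append, List.reverse_reverse, List.reverse_cons, List.append_assoc] at ht'
      have h2 : i = l'.length := by
        have h3 := congrArg (fun l => l.getD l'.length 0) ht'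
        rw [List.getD_append_right _ _ _ _ (by simp), List.length_reverse, Nat.sub_self,
          List.getD_append _ _ _ _ (by simp), List.getD_cons_zero,
          List.getD_eq_getElem _ _ (by grind), List.getElem_range] at h3
        exact h3
      grind) (by grind)
  refine ⟨D', hP _ a, fun ψ f => ?_⟩
  have e2 : ((List.range m).reverse.map cs).prod = ∏ i ∈ range m, cs i := by
    rw [List.map_reverse, List.prod_reverse]; rfl
  simp_all [wp, Nat.mod_eq_of_lt, order]

lemma Det.loop_rev {e : Exp} {m : ℕ} (I : ℕ → Arr → Prop) (he : e.ev X v D = m) (hm : m < X.top)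
    (h0 : I m D) (hI : ∀ i < m, ∀ D, I (i + 1) D → Det X q g (v ++ [i]) D (I i))
    (hP : ∀ D, I 0 D → P D) : Det X q (.loop true e g) v D P := by
  simpa using Reach.loop_rev I (fun _ => 1) he hm h0 hI hP

lemma Reach.loop {e : Exp} {m : ℕ} (I : ℕ → Arr → Prop) (c : ℝ≥0∞)
    (he : e.ev X v D = m) (hm : m < X.top)
    (h0 : I m D) (hI : ∀ i < m, ∀ D, I (i + 1) D → Reach X q g (v ++ [i]) c D (I i))
    (hP : ∀ D, I 0 D → P D) : Reach X q (.loop true e g) v (c ^ m) D P := by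
  simpa using Reach.loop_rev I (fun _ => c) he hm h0 hI hP

/-- The events are disjoint, so the sum of the values on their indicators stays below F and
expectation is additive. -/
lemma wp_sum_reach {ι : Type*} (S : Finset ι) (E : ι → Arr → Prop) (c val : ι → ℝ≥0∞)
    {ψ : QState q} (hψ : ψ.Normalized) (F : St q → ℝ≥0∞)
    (hE : ∀ i ∈ S, Reach X q g v (c i) D (E i))
    (hd : ∀ i ∈ S, ∀ j ∈ S, ∀ D, E i D → E j D → i = j)
    (hF : ∀ i ∈ S, ∀ D', E i D' → val i ≤ F ⟨D', ψ⟩) :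
    ∑ i ∈ S, c i * val i ≤ wp X 0 g v F ⟨D, ψ⟩ := by
  classical
  set ind : ι → St q → ℝ≥0∞ := fun i s => if E i s.arr ∧ s.amp = ψ then 1 else 0 with hind
  have key : ∀ T : Finset ι, T ⊆ S → ∑ i ∈ T, c i * val i ≤
      wp X 0 g v (fun s => ∑ i ∈ T, val i * ind i s) ⟨D, ψ⟩ := by
    intro T
    induction T using Finset.induction_on with
    | empty => simp
    | insert i T hi ih =>
      intro hT
      obtain ⟨D', h1, h2⟩ := hE i (hT (mem_insert_self _ _))
      simp only [sum_insert hi]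
      rw [wp_add]
      grind [add_le_add, mem_insert_of_mem, wp_mul, mul_comm, mul_le_mul_right]
  refine (key S subset_rfl).trans (wp_mono _ _ _ _ _ hψ ?_)
  intro s _
  by_cases h : ∃ i ∈ S, E i s.arr ∧ s.amp = ψ
  · obtain ⟨i, hi, h1, h2⟩ := h
    rw [sum_eq_single i]
    · obtain ⟨D', ψ'⟩ := s
      grind
    · grind
    grind
  grind [sum_eq_zero, zero_le]

end reach

/-! ## Random permutations and bits -/

/-- The number of equations. -/
def Ctx.m (X : Ctx) : ℕ := X.inp 0 - X.inp 1
def eR0 : Exp := .inp (.const 0) - .inp (.const 1)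

@[simp] lemma ev_eR0 (X : Ctx) (v : List ℕ) (D : Arr) : eR0.ev X v D = X.m := rfl
@[simp] lemma ev_var (X : Ctx) (v : List ℕ) (D : Arr) (i : ℕ) :
    (Exp.var i).ev X v D = v.getD i 0 := rfl

/-- A Fisher–Yates shuffle of the identity, from the last position down. Array 0 holds the
permutation, array 1 the drawn position and the entry to be swapped. -/
def pPerm : Prog := .seq (.loop false eN (.set 0 (.var 0) (.const 0) (.var 0)))
  (.loop true eN (.seq (.rnd 1 (.const 0) (.const 0) (.var 0 + .const 1))
    (.seq (.set 1 (.const 1) (.const 0) (.arr 0 (.arr 1 (.const 0) (.const 0)) (.const 0)))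
    (.seq (.set 0 (.arr 1 (.const 0) (.const 0)) (.const 0) (.arr 0 (.var 0) (.const 0)))
    (.set 0 (.var 0) (.const 0) (.arr 1 (.const 1) (.const 0)))))))

/-- `D'` differs from `D` only in the arrays with a number in `S`. -/
def Frame (S : List (Fin 16)) (D D' : Arr) : Prop := ∀ ρ, ρ ∉ S → D' ρ = D ρ

lemma Frame.refl (S : List (Fin 16)) (D : Arr) : Frame S D D := fun _ _ => rfl

lemma Frame.put {S : List (Fin 16)} {D D' : Arr} (h : Frame S D D') {ρ : Fin 16} (hρ : ρ ∈ S)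
    (i j x : ℕ) : Frame S D (D'.put ρ i j x) := by
  intro ρ' h'
  rw [← h ρ' h']
  funext i' j'
  rw [Arr.put_apply, if_neg]
  grind

variable {X : Ctx} {q : ℕ} {D : Arr}

/-- At position i exactly one of the i + 1 draws brings the value π i into place, and later steps
leave it there. So each permutation is reached by one sequence of draws, of probability 1/n!. -/
lemma reach_pPerm (hX : Fits X) (π : ℕ → ℕ) (hπ : ∀ j < X.n, π j < X.n)
    (hinj : ∀ i < X.n, ∀ j < X.n, π i = π j → i = j) :
    Reach X q pPerm [] (X.n.factorial : ℝ≥0∞)⁻¹ D fun D' =>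
      Frame [0, 1] D D' ∧ ∀ j < X.n, D' 0 j 0 = π j := by
  have hn := hX.n_lt
  have hfac : (X.n.factorial : ℝ≥0∞)⁻¹ = 1 * ∏ i ∈ range X.n, ((i + 1 : ℕ) : ℝ≥0∞)⁻¹ := by
    induction X.n with
    | zero => simp
    | succ n ih =>
      simp_all [prod_range_succ, Nat.factorial_succ, Nat.cast_mul, mul_comm, ENNReal.mul_inv, ENNReal.natCast_ne_top]
  rw [hfac]
  refine Reach.seq (Det.loop (fun i D' => Frame [0, 1] D D' ∧ ∀ j < i, D' 0 j 0 = j) rfl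
    (m := X.n) (by omega) ⟨Frame.refl _ _, by simp⟩ (fun i hi D₁ h => ?_) fun D₁ h => ?_)
  · refine Det.set ⟨h.1.put (by simp) _ _ _, fun j hj => ?_⟩
    simp only [ev_var, ev_const, List.nil_append, List.getD_cons_zero, Arr.put_apply]
    rw [Nat.mod_eq_of_lt (by omega)]
    grind
  · refine Reach.loop_rev (fun i D' => Frame [0, 1] D D' ∧ (∀ j < X.n, i ≤ j → D' 0 j 0 = π j) ∧
      (∀ j < X.n, D' 0 j 0 < X.n) ∧ ∀ j < X.n, ∀ j' < X.n, D' 0 j 0 = D' 0 j' 0 → j = j') _ rfl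
      (m := X.n) (by omega) ⟨h.1, fun j hj hj' => by omega, fun j hj => by grind,
        fun j hj j' hj' => by grind⟩ (fun i hi D₂ h2 => ?_)
        fun D₂ h2 => ⟨h2.1, fun j hj => h2.2.1 j hj (Nat.zero_le _)⟩
    obtain ⟨f2, a2, b2, c2⟩ := h2
    -- The current array is injective into n values, so π i occurs in it. It cannot occur above i,
    -- where the entries already agree with π.
    obtain ⟨u, hu, hui⟩ : ∃ u < X.n, D₂ 0 u 0 = π i := by
      have hs : (range X.n).image (fun j => D₂ 0 j 0) = range X.n := by
        refine eq_of_subset_of_card_le (fun x hx => ?_) ?_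
        · obtain ⟨j, hj, rfl⟩ := mem_image.1 hx
          grind
        · rw [card_image_of_injOn]
          intro x hx y hy e
          grind
      have := mem_range.2 (hπ i hi)
      rw [← hs] at this
      obtain ⟨u, hu, e⟩ := mem_image.1 this
      grind
    have hui' : u ≤ i := by grind
    rw [← mul_one ((i + 1 : ℕ) : ℝ≥0∞)⁻¹]
    refine Reach.seq (Reach.rnd (m := i + 1) (x := u) (by simp) (by omega) (by omega)
      (Det.seq (Det.set (Det.seq (Det.set (Det.set ?_))))))
    have e2 : ∀ j < X.n, (if j = i then D₂ 0 u 0 else if j = u then D₂ 0 i 0 else D₂ 0 j 0) =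
        D₂ 0 (Equiv.swap i u j) 0 := by
      intro j _
      rw [Equiv.swap_apply_def]
      split_ifs <;> rfl
    have e3 : ∀ j < X.n, Equiv.swap i u j < X.n := by
      intro j hj
      rw [Equiv.swap_apply_def]
      split_ifs <;> omega
    have hb := b2 u hu
    have key : ∀ {D₃ : Arr}, Frame [0, 1] D D₃ → (∀ j, D₃ 0 j 0 = if j = i then D₂ 0 u 0 else
        if j = u then D₂ 0 i 0 else D₂ 0 j 0) → Frame [0, 1] D D₃ ∧
        (∀ j < X.n, i ≤ j → D₃ 0 j 0 = π j) ∧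
        (∀ j < X.n, D₃ 0 j 0 < X.n) ∧ ∀ j < X.n, ∀ j' < X.n, D₃ 0 j 0 = D₃ 0 j' 0 → j = j' := by
      intro D₃ f3 h3
      refine ⟨f3, fun j hj hij => ?_, fun j hj => ?_, fun j hj j' hj' hjj => ?_⟩
      · rw [h3]
        split_ifs with h4 h5
        · grind
        · omega
        grind
      · grind
      · rw [h3, h3, e2 j hj, e2 j' hj'] at hjj
        exact (Equiv.swap i u).injective (c2 _ (e3 j hj) _ (e3 j' hj') hjj)
    refine key ((((f2.put (by simp) _ _ _).put (by simp) _ _ _).put (by simp) _ _ _).put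
      (by simp) _ _ _) fun j => ?_
    simp only [ev_var, ev_const, ev_arr, List.nil_append, List.getD_cons_zero, Arr.put_apply]
    have hi' := b2 i hi
    simp [Nat.mod_eq_of_lt (show D₂ 0 u 0 < X.top by omega),
      Nat.mod_eq_of_lt (show D₂ 0 i 0 < X.top by omega)]

def pBits (ρ : Fin 16) (e : Exp) : Prog := .loop true e (.rnd ρ (.var 0) (.const 0) (.const 2))

lemma two_lt_top (hX : Fits X) : 2 < X.top := by
  have := hX.top
  grind [numQubits]

lemma reach_pBits (hX : Fits X) {ρ : Fin 16} {e : Exp} {m : ℕ} (he : e.ev X [] D = m)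
    (hm : m < X.top) (b : ℕ → ZMod 2) :
    Reach X q (pBits ρ e) [] ((2 : ℝ≥0∞)⁻¹ ^ m) D fun D' =>
      Frame [ρ] D D' ∧ ∀ j < m, D' ρ j 0 = (b j).val := by
  refine Reach.loop (fun i D' => Frame [ρ] D D' ∧ ∀ j < m, i ≤ j → D' ρ j 0 = (b j).val) _ he hm
    ⟨Frame.refl _ _, fun j hj hj' => by omega⟩ (fun i hi D₁ h => ?_)
    fun D₁ h => ⟨h.1, fun j hj => h.2 j hj (Nat.zero_le _)⟩
  refine Reach.rnd (m := 2) (x := (b i).val) rfl (two_lt_top hX) (ZMod.val_lt _)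
    ⟨h.1.put (by simp) _ _ _, fun j hj hij => ?_⟩
  grind [ev_var, ev_const, List.nil_append, List.getD_cons_zero, Arr.put_apply]

/-! ## Gaussian elimination -/

/-- A system of `m` equations in `n` unknowns with an additional column `n`, after the first `i`
equations have been used for the elimination. The pivot of equation `l < i` is in column `p l`. -/
structure Partial (n m i : ℕ) (W₀ W : ℕ → ℕ → ZMod 2) (p : ℕ → ℕ) : Prop where
  lt : ∀ l < i, p l < n
  one : ∀ l < i, W l (p l) = 1
  off : ∀ l < i, ∀ l' < m, l' ≠ l → W l' (p l) = 0
  before : ∀ l < i, ∀ j < p l, W l j = 0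
  sol : ∀ x : ℕ → ZMod 2, (∀ l < m, ∑ j ∈ range (n + 1), W l j * x j = 0) ↔
    ∀ l < m, ∑ j ∈ range (n + 1), W₀ l j * x j = 0
  indep : ∀ c : ℕ → ZMod 2, (∀ j < n, ∑ l ∈ range m, c l * W l j = 0) → ∀ l < m, c l = 0

lemma zmod2_eq_one {x : ZMod 2} (h : x ≠ 0) : x = 1 := by revert x; decide

section partial_
variable {n m i : ℕ} {W₀ W : ℕ → ℕ → ZMod 2} {p : ℕ → ℕ}

lemma Partial.exists_ne (h : Partial n m i W₀ W p) (hi : i < m) : ∃ j < n, W i j ≠ 0 := by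
  by_contra hc
  have := h.indep (fun l => if l = i then 1 else 0) (fun j hj => by simp_all) i hi
  grind

/-- Clearing the pivot column in all other rows is invertible, because the pivot row itself is not
changed. So solutions and independence survive. -/
lemma Partial.step (h : Partial n m i W₀ W p) (hi : i < m) {p' : ℕ → ℕ}
    {W' : ℕ → ℕ → ZMod 2} (hp : ∀ l < i, p' l = p l) (hlt : p' i < n) (hne : W i (p' i) ≠ 0)
    (hb : ∀ j < p' i, W i j = 0) (hW : ∀ l < m, ∀ j < n + 1,
      W' l j = W l j + (if l = i then 0 else W l (p' i)) * W i j) :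
    Partial n m (i + 1) W₀ W' p' := by
  have h1 := zmod2_eq_one hne
  set t : ℕ → ZMod 2 := fun l => if l = i then 0 else W l (p' i) with ht
  have hW : ∀ l < m, ∀ j < n + 1, W' l j = W l j + t l * W i j := hW
  have hti : t i = 0 := by grind
  have hd : ∀ x : ℕ → ZMod 2, ∀ l < m, ∑ j ∈ range (n + 1), W' l j * x j =
      ∑ j ∈ range (n + 1), W l j * x j + t l * ∑ j ∈ range (n + 1), W i j * x j := by
    intro x l hl
    rw [mul_sum, ← sum_add_distrib]
    grind [sum_congr, mem_range]
  refine ⟨fun l hl => ?_, fun l hl => ?_, fun l hl l' hl' hne' => ?_, fun l hl j hj => ?_,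
    fun x => ?_, fun c hc => ?_⟩
  · by_cases e : l = i
    · grind
    · have : l < i := by omega
      rw [hp l this]; exact h.lt l this
  · by_cases e : l = i
    · grind
    · have hl : l < i := by omega
      have := h.lt l hl
      rw [hp l hl, hW l (by omega) _ (by omega), h.one l hl, h.off l hl i hi (Ne.symm e)]; simp
  · by_cases e : l = i
    · grind
    · have hl : l < i := by omega
      have := h.lt l hl
      rw [hp l hl, hW l' hl' _ (by omega), h.off l hl l' hl' hne', h.off l hl i hi (Ne.symm e)]
      simp
  · by_cases e : l = i
    · grind
    · have hl : l < i := by omega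
      have := h.lt l hl
      rw [hp l hl] at hj
      rw [hW l (by omega) _ (by omega), h.before l hl j hj, zero_add]
      -- If row l changes, its entry in the new pivot column is nonzero. The new pivot then is not
      -- left of p l, and row i vanishes left of p l.
      by_cases h2 : W l (p' i) = 0
      · grind
      · have h3 : ¬ p' i < p l := fun hh => h2 (h.before l hl _ hh)
        grind
  · rw [← h.sol]
    constructor
    · intro h2 l hl
      have h3 := hd x i hi
      have h4 := hd x l hl
      grind
    simp_all
  -- A relation c between the new rows is a relation between the old ones in which the coefficient
  -- of row i is increased by the sum of the c l * t l.
  · have h2 := h.indep (fun l => c l + if l = i then ∑ l' ∈ range m, c l' * t l' else 0)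
      fun j hj => by
        have h3 := hc j hj
        have h4 : ∀ l ∈ range m, c l * W' l j = c l * W l j + c l * t l * W i j := by grind
        rw [sum_congr rfl h4, sum_add_distrib, ← sum_mul] at h3
        simp only [add_mul, ite_mul, zero_mul]
        rw [sum_add_distrib, sum_ite_eq', if_pos (mem_range.2 hi), h3]
    grind [sum_eq_zero, mul_zero, mem_range, zero_mul]

end partial_

/-! ### The programs -/

def eMod2 (x : Exp) : Exp := x - x / .const 2 * .const 2

@[simp] lemma ev_eMod2 (X : Ctx) (v : List ℕ) (D : Arr) (x : Exp) :
    (eMod2 x).ev X v D = x.ev X v D % 2 := by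
  change x.ev X v D - x.ev X v D / 2 * 2 = _
  omega

/-- An expression that vanishes if and only if `x = y`. -/
def eNe (x y : Exp) : Exp := .op .lt x y + .op .lt y x

lemma ev_eNe (X : Ctx) (v : List ℕ) (D : Arr) (x y : Exp) :
    (eNe x y).ev X v D = if x.ev X v D = y.ev X v D then 0 else 1 := by
  change (if x.ev X v D < y.ev X v D then 1 else 0) + (if y.ev X v D < x.ev X v D then 1 else 0) = _
  grind

def pLoad : Prog := .seq (.loop false eR0 (.loop false eN (.set 5 (.var 0) (.var 1)
    (.inp (.const 6 + .var 0 * eN + .arr 0 (.var 1) (.const 0))))))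
  (.loop false eR0 (.set 5 (.var 0) eN (.inp (.const 6 + eR0 * eN + .var 0))))

/-- The scan runs downwards, so the last assignment is the leftmost nonzero entry. -/
def pPivot : Prog := .loop true eN
  (.ite (.arr 5 (.var 0) (.var 1)) (.set 6 (.var 0) (.const 0) (.var 1)) skip)

/-- The factors are saved before any row changes, since the addition of rows overwrites the pivot
column. The pivot row gets factor zero. -/
def pFactors : Prog := .loop false eR0 (.ite (eNe (.var 1) (.var 0))
  (.set 7 (.var 1) (.const 0) (.arr 5 (.var 1) (.arr 6 (.var 0) (.const 0))))
  (.set 7 (.var 1) (.const 0) (.const 0)))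

def pAddRows : Prog := .loop false eR0 (.loop false (eN + .const 1) (.set 5 (.var 1) (.var 2)
  (eMod2 (.arr 5 (.var 1) (.var 2) + .arr 7 (.var 1) (.const 0) * .arr 5 (.var 0) (.var 2)))))

def pElim : Prog := .loop false eR0 (.seq pPivot (.seq pFactors pAddRows))

/-- The identity matrix with row l of the reduced system added in row p l. Modulo two the pivot
entry cancels, so a pivot variable is expressed by the free ones. Column n carries the constant
term. -/
def pFull : Prog := .seq (.loop false eN (.loop false (eN + .const 1) (.set 13 (.var 0) (.var 1)
    (.const 1 - eNe (.var 0) (.var 1)))))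
  (.loop false eR0 (.loop false (eN + .const 1) (.set 13 (.arr 6 (.var 0) (.const 0)) (.var 1)
    (eMod2 (.arr 13 (.arr 6 (.var 0) (.const 0)) (.var 1) + .arr 5 (.var 0) (.var 1))))))

def pTable : Prog := .loop false eN (.loop false eK
  (.set 8 (.var 0) (.var 1) (.arr 13 (.var 0) (eR0 + .var 1))))

/-- The constant term plus the contribution of the random first coordinates in array 2. -/
def pShift : Prog := .loop false eN (.seq (.set 9 (.var 0) (.const 0) (.arr 13 (.var 0) eN))
  (.loop false eR0 (.set 9 (.var 0) (.const 0)
    (eMod2 (.arr 9 (.var 0) (.const 0) + .arr 13 (.var 0) (.var 1) * .arr 2 (.var 1) (.const 0))))))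

variable {X : Ctx} {q : ℕ} {D : Arr}

lemma Ctx.m_le (hX : Fits X) : X.m ≤ X.n := Nat.sub_le _ _

/-- The bits in the extended matrix. -/
def Bits (X : Ctx) (D : Arr) : Prop := ∀ l < X.m, ∀ j < X.n + 1, D 5 l j < 2

/-- The extended matrix that the arrays hold. -/
def Arr.mat (D : Arr) (l j : ℕ) : ZMod 2 := (D 5 l j : ZMod 2)

lemma natCast_ne_zero {x : ℕ} (h : x < 2) : (x : ZMod 2) ≠ 0 ↔ x ≠ 0 := by
  interval_cases x <;> decide

lemma natCast_val_bit {x : ℕ} (h : x < 2) : bit x = (x : ZMod 2) := by interval_cases x <;> rfl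

lemma det_fill (hX : Fits X) {v : List ℕ} {ρ : Fin 16} {e e' : Exp} {m m' : ℕ} {x : Exp}
    {P : Arr → Prop} (F : ℕ → ℕ → ℕ) (he : e.ev X v D = m) (hm : m < X.top)
    (he' : ∀ i < m, ∀ D, e'.ev X (v ++ [i]) D = m') (hm' : m' < X.top)
    (hF : ∀ i < m, ∀ j < m', F i j < X.top)
    (hx : ∀ i < m, ∀ j < m', ∀ D', Frame [ρ] D D' →
      (∀ i' j', D' ρ i' j' = if (i' < i ∧ j' < m') ∨ (i' = i ∧ j' < j) then F i' j' else D ρ i' j') →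
      x.ev X (v ++ [i] ++ [j]) D' = F i j)
    (hP : ∀ D', Frame [ρ] D D' →
      (∀ i' j', D' ρ i' j' = if i' < m ∧ j' < m' then F i' j' else D ρ i' j') → P D') :
    Det X q (.loop false e (.loop false e' (.set ρ (.var v.length) (.var (v.length + 1)) x))) v D
      P := by
  refine Det.loop (fun i D' => Frame [ρ] D D' ∧ ∀ i' j', D' ρ i' j' =
    if i' < i ∧ j' < m' then F i' j' else D ρ i' j') he hm ⟨Frame.refl _ _, by simp⟩
    (fun i hi D₁ h1 => ?_) fun D₁ h1 => hP D₁ h1.1 h1.2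
  refine Det.loop (fun j D' => Frame [ρ] D D' ∧ ∀ i' j', D' ρ i' j' =
    if (i' < i ∧ j' < m') ∨ (i' = i ∧ j' < j) then F i' j' else D ρ i' j') (he' i hi _) hm'
    ⟨h1.1, fun i' j' => by grind⟩ (fun j hj D₂ h2 => ?_) fun D₂ h2 => ⟨h2.1, fun i' j' => ?_⟩
  · have hlen : (Exp.var v.length).ev X (v ++ [i] ++ [j]) D₂ = i := by simp
    have hlen' : (Exp.var (v.length + 1)).ev X (v ++ [i] ++ [j]) D₂ = j :=
      ev_var_last X D₂ (v := v ++ [i]) (by simp) j []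
    refine Det.set ⟨h2.1.put (by simp) _ _ _, fun i' j' => ?_⟩
    rw [hlen, hlen', hx i hi j hj D₂ h2.1 h2.2, Nat.mod_eq_of_lt (hF i hi j hj), Arr.put_apply,
      h2.2]
    by_cases e1 : i' = i
    · by_cases e2 : j' = j
      · grind
      grind
    grind
  grind

/-- The entries of the inputs for the system are bits. -/
def Ctx.Binary (X : Ctx) : Prop := (∀ l < X.m, ∀ j < X.n, X.inp (6 + l * X.n + j) < 2) ∧
  ∀ l < X.m, X.inp (6 + X.m * X.n + l) < 2

lemma det_pLoad (hX : Fits X) (hperm : ∀ j < X.n, D 0 j 0 < X.n) (hin : X.Binary) :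
    Det X q pLoad [] D fun D' => Frame [5, 5] D D' ∧ Bits X D' ∧
      (∀ l < X.m, ∀ j < X.n, D' 5 l j = X.inp (6 + l * X.n + D 0 j 0)) ∧
      ∀ l < X.m, D' 5 l X.n = X.inp (6 + X.m * X.n + l) := by
  have hn := hX.n_lt
  have hm := Ctx.m_le hX
  have h2 := two_lt_top hX
  refine Det.seq (det_fill (v := []) hX (fun l j => X.inp (6 + l * X.n + D 0 j 0)) (m := X.m)
    (m' := X.n) rfl (by omega) (fun _ _ _ => rfl) (by omega)
    (fun i hi j hj => (hin.1 i hi _ (hperm j hj)).trans h2)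
    (fun i hi j hj D' hf _ => ?_) fun D₁ f1 h1 => ?_)
  · simp [hf 0 (by simp)]
  · refine Det.loop (fun i D' => Frame [5, 5] D D' ∧ ∀ l < X.m, (∀ j < X.n, D' 5 l j =
      X.inp (6 + l * X.n + D 0 j 0)) ∧ (l < i → D' 5 l X.n = X.inp (6 + X.m * X.n + l)))
      (m := X.m) rfl (by omega) ⟨fun ρ hρ => f1 ρ (by grind), fun l hl =>
        ⟨fun j hj => by grind, by simp⟩⟩ (fun i hi D₂ h2 => ?_) fun D₂ h2 => ?_
    · refine Det.set ⟨h2.1.put (by simp) _ _ _, fun l hl => ⟨fun j hj => ?_, fun hli => ?_⟩⟩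
      · rw [Arr.put_apply, if_neg (by simp; omega), (h2.2 l hl).1 j hj]
      · simp only [ev_var, ev_inp, ev_add, ev_mul, ev_const, ev_eN, ev_eR0, List.nil_append,
          List.getD_cons_zero, Arr.put_apply]
        split
        · rename_i h; rw [h.2.1, Nat.mod_eq_of_lt ((hin.2 _ hi).trans (two_lt_top hX))]
        grind
    · refine ⟨h2.1, fun l hl j hj => ?_, fun l hl => (h2.2 l hl).1, fun l hl => (h2.2 l hl).2 hl⟩
      rcases Nat.lt_succ_iff_lt_or_eq.1 hj with h | rfl
      · rw [(h2.2 l hl).1 j h]; exact hin.1 l hl _ (hperm j h)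
      · rw [(h2.2 l hl).2 hl]; exact hin.2 l hl

lemma det_pPivot (hX : Fits X) {i : ℕ} (hne : ∃ j < X.n, D 5 i j ≠ 0) :
    Det X q pPivot [i] D fun D' => Frame [6] D D' ∧ (∀ l, l ≠ i → D' 6 l 0 = D 6 l 0) ∧
      D' 6 i 0 < X.n ∧ D 5 i (D' 6 i 0) ≠ 0 ∧ ∀ j < D' 6 i 0, D 5 i j = 0 := by
  have hn := hX.n_lt
  refine Det.loop_rev (fun j D' => Frame [6] D D' ∧ (∀ l, l ≠ i → D' 6 l 0 = D 6 l 0) ∧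
    ((∀ j', j ≤ j' → j' < X.n → D 5 i j' = 0) ∨ (D' 6 i 0 < X.n ∧ D 5 i (D' 6 i 0) ≠ 0 ∧
      ∀ j', j ≤ j' → j' < D' 6 i 0 → D 5 i j' = 0))) (m := X.n) rfl (by omega)
    ⟨Frame.refl _ _, fun _ _ => rfl, Or.inl fun j' h1 h2 => by omega⟩ (fun j hj D₁ h1 => ?_)
    fun D₁ h1 => ?_
  · obtain ⟨f1, a1, b1⟩ := h1
    refine Det.ite (fun h => Det.skip ⟨f1, a1, ?_⟩) fun h => Det.set
      ⟨f1.put (by simp) _ _ _, fun l hl => ?_, Or.inr ?_⟩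
    · have h : D 5 i j = 0 := by simpa [f1 5 (by simp)] using h
      grind
    · simp_all [Arr.put_apply, if_neg]
    · have h : D 5 i j ≠ 0 := by simpa [f1 5 (by simp)] using h
      have e : (D₁.put 6 ((Exp.var 0).ev X ([i] ++ [j]) D₁) ((Exp.const 0).ev X ([i] ++ [j]) D₁)
          ((Exp.var 1).ev X ([i] ++ [j]) D₁ % X.top)) 6 i 0 = j := by
        simp [Arr.put_apply, Nat.mod_eq_of_lt (show j < X.top by omega)]
      grind
  grind

lemma det_pFactors (hX : Fits X) (hb : Bits X D) {i : ℕ} (hp : D 6 i 0 < X.n) :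
    Det X q pFactors [i] D fun D' => Frame [7] D D' ∧
      ∀ l < X.m, D' 7 l 0 = if l = i then 0 else D 5 l (D 6 i 0) := by
  have hn := hX.n_lt
  have hm := Ctx.m_le hX
  have h2 := two_lt_top hX
  refine Det.loop (fun j D' => Frame [7] D D' ∧
      ∀ l < j, D' 7 l 0 = if l = i then 0 else D 5 l (D 6 i 0)) (m := X.m) rfl (by omega)
    ⟨Frame.refl _ _, by simp⟩ (fun j hj D₁ h1 => ?_) fun D₁ h1 => h1
  have hbj := hb j hj (D 6 i 0) (by omega)
  have key : ∀ x, x = (if j = i then 0 else D 5 j (D 6 i 0)) → ∀ l < j + 1,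
      D₁.put 7 j 0 x 7 l 0 = if l = i then 0 else D 5 l (D 6 i 0) := by
    grind [Arr.put_apply]
  refine Det.ite (fun h => Det.set ⟨h1.1.put (by simp) _ _ _, key _ ?_⟩) fun h => Det.set
    ⟨h1.1.put (by simp) _ _ _, key _ ?_⟩
  · simp_all [ev_eNe]
  · have : j ≠ i := by
      simp_all [ev_eNe]
    simp [this, h1.1 5 (by simp), h1.1 6 (by simp),
      Nat.mod_eq_of_lt (show D 5 j (D 6 i 0) < X.top by omega)]

lemma det_pAddRows (hX : Fits X) (hb : Bits X D) {i : ℕ} (hi : i < X.m) (h7 : D 7 i 0 = 0) :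
    Det X q pAddRows [i] D fun D' => Frame [5] D D' ∧ ∀ l < X.m, ∀ j < X.n + 1,
      D' 5 l j = (D 5 l j + D 7 l 0 * D 5 i j) % 2 := by
  have hn := hX.n_lt
  have hm := Ctx.m_le hX
  have h2 := two_lt_top hX
  refine det_fill (v := [i]) hX (fun l j => (D 5 l j + D 7 l 0 * D 5 i j) % 2) (m := X.m)
    (m' := X.n + 1) rfl (by omega) (fun _ _ _ => rfl) hn
    (fun l _ j _ => (Nat.mod_lt _ two_pos).trans h2) (fun l hl j hj D₁ f1 h1 => ?_)
    fun D₁ f1 h1 => ⟨f1, fun l hl j hj => by grind⟩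
  have e1 : D₁ 5 l j = D 5 l j := by grind
  have e2 : D₁ 5 i j = D 5 i j := by
    rw [h1]
    split
    · rw [h7, zero_mul, add_zero, Nat.mod_eq_of_lt (hb i hi j hj)]
    · rfl
  simp [e1, e2, f1 7 (by simp)]

lemma det_pElim (hX : Fits X) (hb : Bits X D)
    (hind : ∀ c : ℕ → ZMod 2, (∀ j < X.n, ∑ l ∈ range X.m, c l * D.mat l j = 0) →
      ∀ l < X.m, c l = 0) :
    Det X q pElim [] D fun D' => Frame [5, 6, 7] D D' ∧ Bits X D' ∧
      Partial X.n X.m X.m D.mat D'.mat (fun l => D' 6 l 0) := by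
  have hn := hX.n_lt
  have hm := Ctx.m_le hX
  refine Det.loop (fun i D' => Frame [5, 6, 7] D D' ∧ Bits X D' ∧
      Partial X.n X.m i D.mat D'.mat (fun l => D' 6 l 0)) (m := X.m) rfl (by omega)
    ⟨Frame.refl _ _, hb, by simp, by simp, by simp, by simp, fun _ => Iff.rfl, hind⟩
    (fun i hi D₁ h1 => ?_) fun D₁ h1 => h1
  obtain ⟨f1, b1, p1⟩ := h1
  obtain ⟨j, hj, hne⟩ := p1.exists_ne hi
  refine Det.seq ((det_pPivot (i := i) hX ⟨j, hj, ?_⟩).mono fun D₂ h2 => Det.seq ?_)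
  · exact (natCast_ne_zero (b1 i hi j (by omega))).1 hne
  obtain ⟨f2, a2, lt2, ne2, bef2⟩ := h2
  have e52 : D₂ 5 = D₁ 5 := f2 5 (by simp)
  have b2 : Bits X D₂ := fun l hl j hj => by rw [e52]; exact b1 l hl j hj
  refine (det_pFactors hX b2 lt2).mono fun D₃ ⟨f3, h3⟩ => ?_
  have e53 : D₃ 5 = D₁ 5 := by rw [f3 5 (by simp), e52]
  have b3 : Bits X D₃ := fun l hl j hj => by rw [e53]; exact b1 l hl j hj
  refine (det_pAddRows hX b3 hi (by grind)).mono fun D₄ ⟨f4, h4⟩ => ?_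
  have e64 : D₄ 6 = D₂ 6 := by rw [f4 6 (by simp), f3 6 (by simp)]
  refine ⟨fun ρ hρ => ?_, fun l hl j hj => by grind,
    p1.step hi (fun l hl => ?_) ?_ ?_ (fun j hj => ?_) fun l hl j hj => ?_⟩
  · rw [f4 ρ (by grind), f3 ρ (by grind), f2 ρ (by grind), f1 ρ (by grind)]
  · grind
  · grind
  · simp only [e64]; exact (natCast_ne_zero (b1 i hi _ (by omega))).2 ne2
  · simp only [e64] at hj; simp only [Arr.mat, bef2 j hj, Nat.cast_zero]
  · simp only [Arr.mat, h4 l hl j hj, ZMod.natCast_mod, Nat.cast_add, Nat.cast_mul, h3 l hl, e53,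
      e64, e52]
    simp

/-- The solution map of the reduced system, column by column; column `n` is the constant term. -/
def solCol (m : ℕ) (W : ℕ → ℕ → ZMod 2) (p : ℕ → ℕ) (j c : ℕ) : ZMod 2 :=
  (if j = c then 1 else 0) + ∑ l ∈ range m, if p l = j then W l c else 0

lemma det_pFull (hX : Fits X) (hp : ∀ l < X.m, D 6 l 0 < X.n) :
    Det X q pFull [] D fun D' => Frame [13] D D' ∧ ∀ j < X.n, ∀ c < X.n + 1, D' 13 j c < 2 ∧
      (D' 13 j c : ZMod 2) = solCol X.m D.mat (fun l => D 6 l 0) j c := by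
  have hn := hX.n_lt
  have hm := Ctx.m_le hX
  have h2 := two_lt_top hX
  refine Det.seq (det_fill (v := []) hX (fun j c => 1 - if j = c then 0 else 1) (m := X.n)
    (m' := X.n + 1) rfl (by omega) (fun _ _ _ => rfl) hn (fun j _ c _ => by omega)
    (fun j _ c _ D' _ _ => by simp [ev_eNe]) fun D₁ f1 h1 => ?_)
  refine Det.loop (fun i D' => Frame [13] D D' ∧ ∀ j < X.n, ∀ c < X.n + 1, D' 13 j c < 2 ∧
      (D' 13 j c : ZMod 2) = solCol i D.mat (fun l => D 6 l 0) j c) (m := X.m) rfl (by omega)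
    ⟨f1, fun j hj c hc => ?_⟩ (fun i hi D₂ h2' => ?_) fun D₂ h2' => h2'
  · rw [h1, if_pos ⟨hj, hc⟩]
    by_cases h : j = c <;> simp [solCol, h]
  · refine Det.loop (fun c₀ D' => Frame [13] D D' ∧ ∀ j < X.n, ∀ c < X.n + 1, D' 13 j c < 2 ∧
      (D' 13 j c : ZMod 2) = solCol (if c < c₀ then i + 1 else i) D.mat (fun l => D 6 l 0) j c)
      (m := X.n + 1) rfl hn (by grind) (fun c₀ hc₀ D₃ h3 => ?_) fun D₃ h3 =>
        ⟨h3.1, fun j hj c hc => by grind⟩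
    have e6 : D₃ 6 = D 6 := h3.1 6 (by simp)
    have e5 : D₃ 5 = D 5 := h3.1 5 (by simp)
    refine Det.set ⟨h3.1.put (by simp) _ _ _, fun j hj c hc => ?_⟩
    simp only [List.cons_append, List.nil_append, ev_arr, ev_var, ev_const, ev_eMod2, ev_add,
      List.getD_cons_zero, List.getD_cons_succ, Arr.put_apply, e6, e5, true_and]
    split_ifs with h4 h5 h5
    · rw [Nat.mod_eq_of_lt ((Nat.mod_lt _ two_pos).trans h2)]
      refine ⟨Nat.mod_lt _ two_pos, ?_⟩
      rw [ZMod.natCast_mod, Nat.cast_add, (h3.2 _ (hp i hi) c₀ hc₀).2, if_neg (lt_irrefl _), h4.1,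
        h4.2, solCol, solCol, sum_range_succ, if_pos rfl, add_assoc]
      rfl
    · omega
    · have h6 := h3.2 j hj c hc
      refine ⟨h6.1, ?_⟩
      rw [h6.2]
      split_ifs with h7
      · rfl
      · have hcc : c = c₀ := by omega
        have : D 6 i 0 ≠ j := fun e => h4 ⟨e.symm, hcc⟩
        rw [solCol, solCol, sum_range_succ, if_neg this, add_zero]
    grind

lemma det_pTable (hX : Fits X) (hmk : X.m + X.k ≤ X.n) (h13 : ∀ j < X.n, ∀ c < X.n + 1, D 13 j c < 2) :
    Det X q pTable [] D fun D' => Frame [8] D D' ∧ ∀ j < X.n, ∀ c < X.k,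
      D' 8 j c = D 13 j (X.m + c) := by
  have hn := hX.n_lt
  have h2 := two_lt_top hX
  have hk := hX.k_lt
  refine det_fill (v := []) hX (fun j c => D 13 j (X.m + c)) (m := X.n)
    (m' := X.k) rfl (by omega) (fun _ _ _ => rfl) hk
    (fun j hj c hc => (h13 j hj _ (by omega)).trans h2) (fun j hj c hc D₁ f1 h1 => ?_)
    fun D₁ f1 h1 => ⟨f1, fun l hl j hj => by grind⟩
  simp [f1 13 (by simp)]

lemma det_pShift (hX : Fits X) (h13 : ∀ j < X.n, ∀ c < X.n + 1, D 13 j c < 2) :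
    Det X q pShift [] D fun D' => Frame [9] D D' ∧ ∀ j < X.n, D' 9 j 0 < 2 ∧
      (D' 9 j 0 : ZMod 2) = D 13 j X.n + ∑ c ∈ range X.m, (D 13 j c : ZMod 2) * D 2 c 0 := by
  have hn := hX.n_lt
  have hm := Ctx.m_le hX
  have h2 := two_lt_top hX
  refine Det.loop (fun i D' => Frame [9] D D' ∧ ∀ j < i, D' 9 j 0 < 2 ∧
      (D' 9 j 0 : ZMod 2) = D 13 j X.n + ∑ c ∈ range X.m, (D 13 j c : ZMod 2) * D 2 c 0)
    (m := X.n) rfl (by omega) ⟨Frame.refl _ _, by simp⟩ (fun i hi D₁ h1 => ?_) fun D₁ h1 => h1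
  refine Det.seq (Det.set (Det.loop (fun c₀ D' => Frame [9] D D' ∧ (∀ j < i, D' 9 j 0 < 2 ∧
      (D' 9 j 0 : ZMod 2) = D 13 j X.n + ∑ c ∈ range X.m, (D 13 j c : ZMod 2) * D 2 c 0) ∧
      D' 9 i 0 < 2 ∧ (D' 9 i 0 : ZMod 2) =
        D 13 i X.n + ∑ c ∈ range c₀, (D 13 i c : ZMod 2) * D 2 c 0)
    (m := X.m) rfl (by omega) ⟨h1.1.put (by simp) _ _ _, fun j hj => ?_, ?_⟩
    (fun c hc D₂ h2' => Det.set ⟨h2'.1.put (by simp) _ _ _, fun j hj => ?_, ?_⟩) fun D₂ h2' =>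
      ⟨h2'.1, fun j hj => ?_⟩))
  · rw [Arr.put_apply, if_neg (by simp; omega)]
    grind
  · have := h13 i hi X.n (by omega)
    simp [Arr.put_apply, h1.1 13 (by simp), Nat.mod_eq_of_lt (this.trans h2), this]
  · rw [Arr.put_apply, if_neg (by simp; omega)]
    grind
  · simp only [List.cons_append, List.nil_append, ev_arr, ev_var, ev_const, ev_eMod2, ev_add, ev_mul,
      List.getD_cons_zero, List.getD_cons_succ, Arr.put_apply, and_self, if_true]
    rw [Nat.mod_eq_of_lt ((Nat.mod_lt _ two_pos).trans h2)]
    refine ⟨Nat.mod_lt _ two_pos, ?_⟩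
    rw [ZMod.natCast_mod, Nat.cast_add, Nat.cast_mul, h2'.2.2.2, sum_range_succ, add_assoc,
      h2'.1 13 (by simp), h2'.1 2 (by simp)]
  grind

/-! ## One trial -/

/-- The measured candidate is moved back to the original order of the coordinates. -/
def pOut : Prog := .loop false eN (.set 11 (.arr 0 (.var 0) (.const 0)) (.const 0)
  (.arr 10 (.const 7 * (eN + .const 2) + .var 0) (.const 0)))

/-- In array 12, entry 0 is the weight, entry 1 the verdict and entry 2 the defect of the current
equation. -/
def pCheck : Prog := .seq
  (.loop false eN (.set 11 (.var 0) (.const 0) (eMod2 (.arr 11 (.var 0) (.const 0)))))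
  (.seq (.set 12 (.const 0) (.const 0) (.const 0)) (.seq
  (.loop false eN (.set 12 (.const 0) (.const 0)
    (.arr 12 (.const 0) (.const 0) + .arr 11 (.var 0) (.const 0)))) (.seq
  (.set 12 (.const 1) (.const 0) (.const 1 - eNe (.arr 12 (.const 0) (.const 0)) eOm))
  (.loop false eR0 (.seq (.set 12 (.const 2) (.const 0) (.inp (.const 6 + eR0 * eN + .var 0))) (.seq
    (.loop false eN (.set 12 (.const 2) (.const 0) (eMod2 (.arr 12 (.const 2) (.const 0) +
      .inp (.const 6 + .var 0 * eN + .var 1) * .arr 11 (.var 1) (.const 0)))))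
    (.ite (.arr 12 (.const 2) (.const 0)) (.set 12 (.const 1) (.const 0) (.const 0)) skip)))))))

def pRun : Prog := .seq pSearch (.seq pOut pCheck)

/-- With T = `top` - 1, draw x below T, put J = ⌊T/(x+1)⌋ and draw the number of iterations below J.
This is the distribution of `average_success`. -/
def pGuess : Prog := .seq (.rnd 4 (.const 1) (.const 0) (.top - .const 1)) (.seq
  (.set 4 (.const 2) (.const 0) ((.top - .const 1) / (.arr 4 (.const 1) (.const 0) + .const 1)))
  (.seq (.rnd 4 (.const 3) (.const 0) (.arr 4 (.const 2) (.const 0))) pRun))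

def pReduce : Prog := .seq pPerm (.seq pLoad (.seq pElim (.seq pFull pTable)))

def pRandomize : Prog := .seq (pBits 2 eR0) (.seq (pBits 3 eK) pShift)

def pSize : Prog := .rnd 4 (.const 0) (.const 0) (eN + .const 1)

def pTrial : Prog := .seq pReduce (.seq pRandomize (.seq pSize pGuess))

/-! ### The final check -/

variable {X : Ctx} {q : ℕ} {D : Arr}

/-- The vector `e` is a solution for the inputs. -/
def Solves (X : Ctx) (e : ℕ → ZMod 2) : Prop := countOnes e X.n = X.w ∧ ∀ i < X.m,
  ∑ j ∈ range X.n, (X.inp (6 + i * X.n + j) : ZMod 2) * e j = X.inp (6 + X.m * X.n + i)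

/-- The vector that the arrays hold. -/
def Arr.out (D : Arr) (j : ℕ) : ZMod 2 := (D 11 j 0 : ZMod 2)

lemma sum_bits {f : ℕ → ℕ} {m : ℕ} (h : ∀ j < m, f j < 2) :
    ∑ j ∈ range m, f j = countOnes (fun j => (f j : ZMod 2)) m := by
  unfold countOnes
  rw [card_filter]
  refine sum_congr rfl fun j hj => ?_
  have := h j (mem_range.1 hj)
  by_cases h1 : f j = 1
  · simp [h1]
  · have : f j = 0 := by omega
    simp [this]

open Classical in
lemma det_pCheck (hX : Fits X) (hin : X.Binary) :
    Det X q pCheck [] D fun D' => (∀ j < X.n, D' 11 j 0 < 2 ∧ D'.out j = D.out j) ∧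
      D' 12 1 0 = if Solves X D.out then 1 else 0 := by
  have hn := hX.n_lt
  have hm := Ctx.m_le hX
  have h2 := two_lt_top hX
  refine Det.seq (Det.loop (fun i D' => ∀ j, D' 11 j 0 = if j < i then D 11 j 0 % 2 else D 11 j 0)
    (m := X.n) rfl (by omega) (by simp) (fun i hi D₁ h1 => Det.set fun j => ?_) fun D₁ h1 => ?_)
  · simp only [List.nil_append, ev_arr, ev_var, ev_const, ev_eMod2, List.getD_cons_zero,
      Arr.put_apply, h1, lt_irrefl, if_false]
    rw [Nat.mod_eq_of_lt ((Nat.mod_lt _ two_pos).trans h2)]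
    grind
  have b1 : ∀ j < X.n, D₁ 11 j 0 < 2 := fun j hj => by grind
  have o1 : ∀ j < X.n, D₁.out j = D.out j := fun j hj => by
    simp_all [Arr.out, if_pos, ZMod.natCast_mod]
  refine Det.seq (Det.set (Det.seq (Det.loop (fun i D' => D' 11 = D₁ 11 ∧
    D' 12 0 0 = ∑ j ∈ range i, D₁ 11 j 0) (m := X.n) rfl (by omega) ⟨?_, ?_⟩
    (fun i hi D₂ h2' => Det.set ⟨?_, ?_⟩) fun D₂ h2' => Det.seq (Det.set ?_))))
  · rfl
  · rfl
  · grind [Arr.put_apply]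
  · have h3 : ∑ j ∈ range (i + 1), D₁ 11 j 0 ≤ ∑ j ∈ range (i + 1), 1 := sum_le_sum fun j hj => by
        grind
    rw [sum_const, card_range, smul_eq_mul, mul_one] at h3
    have h4 : D₂ 12 0 0 + D₂ 11 i 0 = ∑ j ∈ range (i + 1), D₁ 11 j 0 := by simp_all [sum_range_succ]
    simp [Arr.put_apply, h4, Nat.mod_eq_of_lt (show
      ∑ j ∈ range (i + 1), D₁ 11 j 0 < X.top by omega)]
  have hcount : ∑ j ∈ range X.n, D₁ 11 j 0 = countOnes D.out X.n := by
    rw [sum_bits b1]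
    unfold countOnes
    congr 1
    refine filter_congr fun j hj => ?_
    rw [← o1 j (mem_range.1 hj)]; rfl
  refine Det.loop (fun i D' => D' 11 = D₁ 11 ∧ D' 12 1 0 = if (countOnes D.out X.n = X.w ∧
    ∀ l < i, ∑ j ∈ range X.n, (X.inp (6 + l * X.n + j) : ZMod 2) * D.out j =
      X.inp (6 + X.m * X.n + l)) then 1 else 0) (m := X.m) rfl (by omega) ⟨?_, ?_⟩
    (fun i hi D₃ h3 => Det.seq (Det.set (Det.seq (Det.loop (fun c D' => D' 11 = D₁ 11 ∧
      D' 12 1 0 = D₃ 12 1 0 ∧ D' 12 2 0 < 2 ∧ (D' 12 2 0 : ZMod 2) = X.inp (6 + X.m * X.n + i) +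
        ∑ j ∈ range c, (X.inp (6 + i * X.n + j) : ZMod 2) * D.out j)
      (m := X.n) rfl (by omega) ⟨?_, ?_, ?_⟩ (fun c hc D₄ h4 => Det.set ⟨?_, ?_, ?_⟩) fun D₄ h4 =>
        Det.ite (fun h => Det.skip ?_) fun h => Det.set ?_)))) fun D₃ h3 => ?_
  · grind [Arr.put_apply]
  · simp only [ev_const, ev_sub, ev_eNe, ev_arr, ev_eOm, Arr.put_apply, and_self, if_true,
      Nat.not_lt_zero, false_implies, implies_true, and_true, h2'.2, hcount]
    rw [Nat.mod_eq_of_lt (by omega)]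
    grind
  · grind [Arr.put_apply]
  · rfl
  · have := hin.2 i hi
    simp [Arr.put_apply, Nat.mod_eq_of_lt (this.trans h2), this]
  · grind [Arr.put_apply]
  · simp_all [Arr.put_apply]
  · simp only [List.cons_append, List.nil_append, ev_arr, ev_var, ev_const, ev_eMod2, ev_add, ev_mul,
      ev_inp, ev_eN, List.getD_cons_zero, List.getD_cons_succ, Arr.put_apply, and_self, if_true]
    rw [Nat.mod_eq_of_lt ((Nat.mod_lt _ two_pos).trans h2)]
    refine ⟨Nat.mod_lt _ two_pos, ?_⟩
    rw [ZMod.natCast_mod, Nat.cast_add, Nat.cast_mul, h4.2.2.2, sum_range_succ, add_assoc,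
      h4.1, ← o1 c hc]
    rfl
  · obtain ⟨h41, h42, h43, h44⟩ := h4
    refine ⟨h41, ?_⟩
    rw [h42, h3.2]
    refine if_congr (and_congr Iff.rfl ⟨fun hh l hl => ?_, fun hh l hl => hh l (by omega)⟩) rfl rfl
    rcases Nat.lt_succ_iff_lt_or_eq.1 hl with h5 | rfl
    · grind
    · have h : D₄ 12 2 0 = 0 := h
      rw [h, Nat.cast_zero] at h44
      grind
  · obtain ⟨h41, h42, h43, h44⟩ := h4
    refine ⟨by grind [Arr.put_apply], ?_⟩
    rw [if_neg]
    · rfl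
    · intro hh
      have h : D₄ 12 2 0 ≠ 0 := h
      grind [natCast_ne_zero]
  · refine ⟨fun j hj => ?_, h3.2.trans (if_congr Iff.rfl rfl rfl)⟩
    simp_all [Arr.out]

lemma det_pOut (hX : Fits X) {π : ℕ → ℕ} (h0 : ∀ j < X.n, D 0 j 0 = π j)
    (hinj : ∀ i < X.n, ∀ j < X.n, π i = π j → i = j)
    (h10 : ∀ j < X.n, D 10 (7 * (X.n + 2) + j) 0 < 2) :
    Det X q pOut [] D fun D' => ∀ j < X.n, D' 11 (π j) 0 = D 10 (7 * (X.n + 2) + j) 0 := by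
  have hn := hX.n_lt
  have h2 := two_lt_top hX
  refine Det.loop (fun i D' => D' 0 = D 0 ∧ D' 10 = D 10 ∧ ∀ j < i, D' 11 (π j) 0 =
    D 10 (7 * (X.n + 2) + j) 0) (m := X.n) rfl (by omega) ⟨rfl, rfl, by simp⟩
    (fun i hi D₁ h1 => Det.set ⟨?_, ?_, fun j hj => ?_⟩) fun D₁ h1 => h1.2.2
  · grind [Arr.put_apply]
  · grind [Arr.put_apply]
  · simp only [List.nil_append, ev_arr, ev_var, ev_const, ev_add, ev_mul, ev_eN,
      List.getD_cons_zero, Arr.put_apply, h1.1, h1.2.1, h0 i hi]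
    rw [Nat.mod_eq_of_lt ((h10 i hi).trans h2)]
    grind

/-! ### Programs that do not touch the qubits -/

/-- The program `skip` contains a gate inside a loop of length zero. Recognizing this bound lets it
count as a program without gates. -/
def Exp.isZero : Exp → Bool
  | .const 0 => true
  | _ => false

lemma Exp.eq_of_isZero {e : Exp} (h : e.isZero = true) : e = .const 0 := by grind [Exp.isZero]

def Prog.noQubits : Prog → Bool
  | .set _ _ _ _ => true
  | .rnd _ _ _ _ => true
  | .seq g h => g.noQubits && h.noQubits
  | .ite _ g h => g.noQubits && h.noQubits
  | .loop _ e g => e.isZero || g.noQubits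
  | _ => false

lemma le_wp_of_noQubits {c : ℝ≥0∞} {ψ : QState q} : ∀ (g : Prog) (v : List ℕ)
    (f : St q → ℝ≥0∞) (D : Arr), g.noQubits = true → (∀ D, c ≤ f ⟨D, ψ⟩) →
    c ≤ wp X 0 g v f ⟨D, ψ⟩ := by
  intro g
  induction g with
  | set ρ i j e => simp_all [wp]
  | rnd ρ i j e =>
    intro v f D _ hf
    simp only [wp, zero_add]
    split
    · grind
    · rw [ENNReal.le_div_iff_mul_le (Or.inl (by simp_all)) (Or.inl (ENNReal.natCast_ne_top _))]
      calc _ = ∑ _ ∈ range (e.ev X v D % X.top), c := by simp [mul_comm]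
        _ ≤ _ := sum_le_sum fun _ _ => hf _
  | seq g h ihg ihh =>
    intro v f D hc hf
    simp only [Prog.noQubits, Bool.and_eq_true] at hc
    exact ihg _ _ _ hc.1 fun D => ihh _ _ _ hc.2 hf
  | ite e g h ihg ihh =>
    intro v f D hc hf
    simp only [Prog.noQubits, Bool.and_eq_true] at hc
    grind [wp, zero_add]
  | loop rev e g ih =>
    intro v f D hc hf
    simp only [Prog.noQubits, Bool.or_eq_true] at hc
    rcases hc with he | hg
    · rw [Exp.eq_of_isZero he]
      simp_all [wp, order, Exp.ev]
    · simp only [wp, zero_add]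
      generalize order rev (e.ev X v D % X.top) = l
      induction l generalizing D with
      | nil => grind
      | cons i l ihl => simp_all
  | _ => simp [Prog.noQubits]

/-- The final states of a trial: the qubits are zero, and if the trial reports success, then the
output is a solution. -/
def Sound (X : Ctx) (q : ℕ) (s : St q) : Prop := (∃ u : ℂ, ‖u‖ = 1 ∧ s.amp = u • QState.zero q) ∧
  (s.arr 12 1 0 ≠ 0 → Solves X s.arr.out)

lemma zero_normalized {u : ℂ} (hu : ‖u‖ = 1) : QState.Normalized (u • QState.zero q) := by
  have := single_normalized (q := q) (fun _ => false)
  simp_all [QState.Normalized, norm_smul, QState.zero]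

lemma countOnes_congr {e e' : ℕ → ZMod 2} {n : ℕ} (h : ∀ j < n, e j = e' j) :
    countOnes e n = countOnes e' n := by
  unfold countOnes
  congr 1
  grind

lemma Solves.congr {e e' : ℕ → ZMod 2} (h : ∀ j < X.n, e j = e' j) : Solves X e ↔ Solves X e' := by
  refine and_congr (by rw [countOnes_congr h]) (forall₂_congr fun i hi => ?_)
  grind [sum_congr, mem_range]

lemma wp_seq {κ : ℝ≥0∞} (g h : Prog) (v : List ℕ) (f : St q → ℝ≥0∞) (s : St q) :
    wp X κ (.seq g h) v f s = wp X κ g v (wp X κ h v f) s := rfl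

lemma le_wp_seq {c : ℝ≥0∞} {ψ : QState q} {g h : Prog} {v : List ℕ} {f : St q → ℝ≥0∞}
    (hg : g.noQubits = true) (hf : ∀ D, c ≤ wp X 0 h v f ⟨D, ψ⟩) (D : Arr) :
    c ≤ wp X 0 (.seq g h) v f ⟨D, ψ⟩ := by
  simp_all [wp_seq, le_wp_of_noQubits]

open Classical in
-- Soundness is certain and not merely probable: the register is reset after every measurement, and
-- the final check decides the verdict whatever the earlier choices were.
lemma one_le_pTrial (hX : Fits X) (hin : X.Binary) {s : St X.qubits} {u : ℂ}
    (hu : ‖u‖ = 1) (hs : s.amp = u • QState.zero X.qubits) :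
    1 ≤ wp X 0 pTrial [] (fun s => if Sound X X.qubits s then 1 else 0) s := by
  obtain ⟨D, ψ⟩ := s
  subst hs
  have hrun : ∀ D, 1 ≤ wp X 0 pRun [] (fun s => if Sound X X.qubits s then 1 else 0)
      ⟨D, u • QState.zero X.qubits⟩ := by
    intro D
    refine wp_pSearch_zero hX _ _ (zero_normalized hu) fun D' u' hu' _ => ?_
    refine le_wp_seq rfl (fun D₁ => ?_) D'
    obtain ⟨D₂, ⟨h1, h2⟩, h3⟩ := det_pCheck (q := X.qubits) (D := D₁) hX hin
    have := h3 (u' • QState.zero X.qubits) (fun s => if Sound X X.qubits s then 1 else 0)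
    rw [one_mul, if_pos] at this
    · omega
    · refine ⟨⟨u', hu', rfl⟩, fun h => ?_⟩
      simp_all [Solves.congr, if_neg]
  refine le_wp_seq rfl (le_wp_seq rfl (le_wp_seq rfl ?_)) D
  exact le_wp_seq rfl (le_wp_seq rfl (le_wp_seq rfl hrun))

/-! ### The search with a random number of iterations -/

lemma searchProb_congr {D' : Arr} (h3 : D' 3 = D 3) (h8 : D' 8 = D 8) (h9 : D' 9 = D 9)
    (h4 : D' 4 0 0 = D 4 0 0) : searchProb X D' = searchProb X D := by
  simp_all [searchProb, oracleGates]

lemma ofReal_sum_div {ι : Type*} (S : Finset ι) (f : ι → ℝ) (hf : ∀ i ∈ S, 0 ≤ f i) {m : ℕ}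
    (hm : 0 < m) : ENNReal.ofReal ((∑ i ∈ S, f i) / m) = (∑ i ∈ S, ENNReal.ofReal (f i)) / m := by
  simp_all [ENNReal.ofReal_div_of_pos, ENNReal.ofReal_sum_of_nonneg, ENNReal.ofReal_natCast]

lemma wp_pGuess (hX : Fits X) (f : St X.qubits → ℝ≥0∞) {u : ℂ} (hu : ‖u‖ = 1)
    (hP : 0 < searchProb X D) (hT : 1 ≤ √(searchProb X D) * (X.top - 1 : ℕ))
    (hf : ∀ (D' : Arr) (u' : ℂ) (w : WState), ‖u'‖ = 1 → Ready w → Frame [4, 10] D D' →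
      (∀ j < X.n, D' 10 (7 * (X.n + 2) + j) 0 = (cand X D w j).val) →
      countOnes (cand X D w) X.n = X.w →
      1 ≤ wp X 0 (.seq pOut pCheck) [] f ⟨D', u' • QState.zero X.qubits⟩) :
    ENNReal.ofReal (√(searchProb X D) / 16) ≤ wp X 0 pGuess [] f ⟨D, u • QState.zero X.qubits⟩ := by
  have h2 := two_lt_top hX
  set T := X.top - 1 with hTdef
  have hT0 : 0 < T := by omega
  refine (ENNReal.ofReal_le_ofReal (average_success hP goodProb_le_one hT)).trans ?_
  have hJ : ∀ x ∈ range T, 0 < T / (x + 1) := fun x hx => Nat.div_pos (by grind) (by omega)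
  rw [ofReal_sum_div _ _ (fun x _ => div_nonneg (sum_nonneg fun _ _ => sq_nonneg _)
    (Nat.cast_nonneg _)) hT0]
  have e1 : (Exp.top - Exp.const 1).ev X [] D % X.top = T := by simp_all
  simp only [pGuess, wp, zero_add, e1]
  rw [if_neg (by omega)]
  refine ENNReal.div_le_div_right (sum_le_sum fun x hx => ?_) _
  rw [ofReal_sum_div _ _ (fun _ _ => sq_nonneg _) (hJ x hx)]
  have hJT : T / (x + 1) < X.top := (Nat.div_le_self _ _).trans_lt (by omega)
  simp only [ev_const, ev_div, ev_sub, ev_top, ev_add, ev_arr, Arr.put_apply, and_self, if_true,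
    ← hTdef, Nat.mod_eq_of_lt hJT]
  rw [if_neg (hJ x hx).ne']
  refine ENNReal.div_le_div_right (sum_le_sum fun j hj => ?_) _
  set D₁ := ((D.put 4 1 0 x).put 4 2 0 (T / (x + 1))).put 4 3 0 j with hD₁
  have f1 : Frame [4] D D₁ := (((Frame.refl _ D).put (by simp) _ _ _).put (by simp) _ _ _).put
    (by simp) _ _ _
  have e3 : D₁ 4 3 0 = j := by rfl
  have e0 : D₁ 4 0 0 = D 4 0 0 := by rfl
  have ep : searchProb X D₁ = searchProb X D :=
    searchProb_congr (f1 _ (by simp)) (f1 _ (by simp)) (f1 _ (by simp)) e0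
  have ec : ∀ w, cand X D₁ w = cand X D w := fun w => by rfl
  have := wp_pSearch hX (wp X 0 (.seq pOut pCheck) [] f) ⟨D₁, u • QState.zero X.qubits⟩ hu rfl
    (by grind)
    (fun D' u' w hu' hw hD' h10 hcount => by
      refine hf D' u' w hu' hw (fun ρ hρ => ?_) h10 hcount
      simp only [List.mem_cons, List.not_mem_nil, or_false, not_or] at hρ
      rw [hD' ρ hρ.2]
      exact f1 ρ (by grind))
  exact this

/-! ## The number of steps of a trial -/

section steps

variable {X : Ctx} {q M d : ℕ}

lemma capped_skip (o : ℕ) : skip.Capped X M o d := by simp [skip, Prog.Capped]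

lemma capped_inv {o : ℕ} (g : Prog) : g.inv.Capped X M o d ↔ g.Capped X M o d := by
  induction g generalizing d with
  | seq g h ihg ihh => simp_all [Prog.inv, Prog.Capped, and_comm]
  | ite e g h ihg ihh => simp_all [Prog.inv, Prog.Capped]
  | loop rev e g ih => simp_all [Prog.inv, Prog.Capped]
  | _ => rfl

/-- A bound for all loops of a trial except the main loop of the search. -/
def cap (X : Ctx) : ℕ := 10 * (X.n + 2) * (X.n + 2)

lemma cap_le (hX : Fits X) : X.n + 1 ≤ cap X ∧ X.r ≤ cap X ∧ X.k ≤ cap X ∧ X.m ≤ cap X ∧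
    X.qubits ≤ cap X := by
  have h1 := hX.sum
  have h2 := Ctx.m_le hX
  have h3 : X.r * X.k ≤ X.n * X.n := Nat.mul_le_mul (by omega) (by omega)
  have h4 : cap X = 10 * (X.n * X.n) + 40 * X.n + 40 := by grind [cap]
  have h5 : X.qubits = 10 * (X.n + 2) + X.r * X.k := rfl
  omega

lemma capped_var {o i : ℕ} (h : o ≤ i) (v : List ℕ) (_ : v.length = d)
    (hv : ∀ i, o ≤ i → v.getD i 0 < M) (D : Arr) : (Exp.var i).ev X v D ≤ M := (hv i h).le

section
variable (h1 : X.n + 1 ≤ M) (h2 : X.r ≤ M) (h3 : X.k ≤ M)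

lemma capped_pColumn (h2 : X.r ≤ M) (o d : ℕ) (e : Exp)
    (he : ∀ v : List ℕ, v.length = d → (∀ i, o ≤ i → v.getD i 0 < M) → ∀ D, e.ev X v D ≤ M) :
    (pColumn d e).Capped X M o d := by
  simp_all [pColumn, pLoadCol, pReduceAll, pReduceBy, pFirstOne, pUseOne, gate1, Prog.Capped, Prog.inv, capped_skip]

lemma capped_pOracle (h1 : X.n + 1 ≤ M) (h2 : X.r ≤ M) (h3 : X.k ≤ M) (d : ℕ) :
    (pOracle d).Capped X M d d := by
  have hn : X.n ≤ M := by omega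
  have c1 := capped_pColumn h2 d (d + 1) (.var d) (capped_var le_rfl)
  have hr : (pRhs d).Capped X M d d := by
    simp_all [pRhs, pLoadRhs, pReduceAll, pReduceBy, pFirstOne, pUseOne, gate1, Prog.Capped, Prog.inv]
  simp only [pOracle, pInitE, pFillM, pInitY, pBackY, pFinalE, pCounter, gate1, Prog.Capped,
    capped_inv, c1, hr, capped_skip, ev_eN, ev_eK, ev_eR, h2, h3, hn, and_true, true_and,
    implies_true]
  exact ⟨capped_var le_rfl, fun v _ hv D => hv d le_rfl⟩

lemma capped_pGrover (h1 : X.n + 1 ≤ M) (h2 : X.r ≤ M) (h3 : X.k ≤ M) (d : ℕ) :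
    (pGrover d).Capped X M d d := by
  simp_all [pGrover, pCoins, pAllZero, gate1, Prog.Capped, capped_inv, Prog.inv, capped_pOracle]

end

lemma wp_seq_steps {g h : Prog} {v : List ℕ} {s : St q} {A : ℕ} {B : ℝ≥0∞}
    (hs : s.amp.Normalized) (hg : wp X 1 g v (fun _ => 0) s ≤ A)
    (hh : wp X 0 g v (wp X 1 h v fun _ => 0) s ≤ B) :
    wp X 1 (.seq g h) v (fun _ => 0) s ≤ A + B := by
  grind [wp_seq, wp_split, one_mul, add_le_add]

lemma wp_seq_unitary {g h : Prog} {v : List ℕ} {s : St q} {A : ℕ} {B : ℝ≥0∞}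
    (hs : s.amp.Normalized) (hg : wp X 1 g v (fun _ => 0) s ≤ A) (hu : g.unitary = true)
    (hh : ∀ ψ : QState q, ψ.Normalized → wp X 1 h v (fun _ => 0) ⟨s.arr, ψ⟩ ≤ B) :
    wp X 1 (.seq g h) v (fun _ => 0) s ≤ A + B := by
  grind [wp_seq_steps, wp_unitary, applyGates_normalized]

lemma wp_zero_le {g : Prog} {v : List ℕ} {M o : ℕ} {s : St q}
    (hc : g.Capped X M o v.length) (hv : ∀ i, o ≤ i → v.getD i 0 < M) (hs : s.amp.Normalized) :
    wp X 1 g v (fun _ => 0) s ≤ g.steps M := by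
  simpa using wp_steps (q := q) 0 g v (fun _ => 0) s hc hv (fun _ _ => le_rfl) hs

/-- The steps outside of the main loop of the search, and those for one of its iterations. -/
def fixedSteps (M : ℕ) : ℕ := (Prog.seq (.seq pReduce (.seq pRandomize pSize))
  (.seq (.seq (pCoins 0) (pOracle 0)) (.seq (measureAll (.const 0)) (.seq pOut pCheck)))).steps M + 6

def loopSteps (M : ℕ) : ℕ := 2 + (pGrover 1).steps M

lemma wp_seq_le {g h : Prog} {v : List ℕ} {s : St q} {A : ℕ} {B : ℝ≥0∞} {M : ℕ}
    (hs : s.amp.Normalized) (hv : ∀ i, 0 ≤ i → v.getD i 0 < M) (hc : g.Capped X M 0 v.length)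
    (hA : g.steps M = A) (hh : ∀ s : St q, s.amp.Normalized → wp X 1 h v (fun _ => 0) s ≤ B) :
    wp X 1 (.seq g h) v (fun _ => 0) s ≤ A + B := by
  refine wp_seq_steps hs (hA ▸ wp_zero_le hc hv hs) ?_
  exact (wp_mono _ _ _ _ _ hs hh).trans (wp_const _ _ _ _ hs).le

lemma wp_pRun_steps (hX : Fits X) {s : St q} (hs : s.amp.Normalized) :
    wp X 1 pRun [] (fun _ => 0) s ≤ (fixedSteps (cap X) - (pReduce.steps (cap X) +
      (pRandomize.steps (cap X) + 1)) - 3 + (s.arr 4 3 0) * loopSteps (cap X) : ℕ) := by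
  obtain ⟨h1, h2, h3, h4, h5⟩ := cap_le hX
  set M := cap X with hM
  have hv : ∀ i, 0 ≤ i → ([] : List ℕ).getD i 0 < M := fun i _ => by grind
  have hq : 10 * (X.n + 2) + X.r * X.k ≤ M := h5
  have hfin : ∀ s : St q, s.amp.Normalized → wp X 1 (.seq pOut pCheck) [] (fun _ => 0) s ≤
      (pOut.steps M + pCheck.steps M : ℕ) := fun s hs => by
    refine wp_zero_le (o := 0) (M := M) (g := .seq pOut pCheck) ?_ hv hs
    simp [pOut, pCheck, Prog.Capped, capped_skip, show X.n ≤ M by omega, h4]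
  obtain ⟨D, ψ⟩ := s
  have hamp : wp X 1 pAmplify [] (fun _ => 0) ⟨D, ψ⟩ ≤
      (1 : ℕ) + (((pCoins 0).steps M : ℕ) + ((2 + D 4 3 0 * (2 + (pGrover 1).steps M) : ℕ) +
        ((pOracle 0).steps M : ℝ≥0∞))) := by
    refine wp_seq_unitary hs (by simp [wp]) rfl fun ψ hψ => wp_seq_unitary hψ
      (wp_zero_le (o := 0) (M := M) ?_ hv hψ) rfl fun ψ hψ => ?_
    · simp [pCoins, Prog.Capped, h2, h3]
    · rw [wp_seq, wp_split, one_mul]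
      refine add_le_add ?_ ((wp_mono _ _ _ _ _ hψ fun s hs => wp_zero_le (o := 0) (M := M)
        (capped_pOracle h1 h2 h3 0) hv hs).trans (wp_const _ _ _ _ hψ).le)
      refine (wp_loop_steps (m := D 4 3 0 % X.top) (S := (pGrover 1).steps M) rfl
        (fun i _ s hs => wp_zero_le (o := 1) (M := M) (capped_pGrover h1 h2 h3 1)
          (fun j hj => ?_) hs) hψ).trans ?_
      · grind
      · exact_mod_cast Nat.add_le_add_left (Nat.mul_le_mul_right _ (Nat.mod_le _ _)) _
  have hmeas : ∀ s : St q, s.amp.Normalized →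
      wp X 1 (measureAll (.const 10 * (eN + .const 2) + eR * eK)) [] (fun _ => 0) s ≤
        ((measureAll (.const 0)).steps M : ℕ) := fun s hs => by
    have := wp_zero_le (o := 0) (M := M)
      (g := measureAll (.const 10 * (eN + .const 2) + eR * eK)) (X := X) (v := []) (s := s) ?_ hv hs
    · exact this
    · simp only [measureAll, measureOne, Prog.Capped, capped_skip, ev_add, ev_mul, ev_const, ev_eN,
        ev_eR, ev_eK, hq, implies_true, and_true]
  have e1 : wp X 1 pRun [] (fun _ => 0) ⟨D, ψ⟩ = wp X 1 pAmplify [] (wp X 1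
    (measureAll (.const 10 * (eN + .const 2) + eR * eK)) [] (wp X 1 (.seq pOut pCheck) []
      fun _ => 0)) ⟨D, ψ⟩ := rfl
  rw [e1, wp_split, one_mul]
  refine (add_le_add hamp ((wp_mono _ _ _ (fun _ => ((measureAll (.const 0)).steps M +
    (pOut.steps M + pCheck.steps M) : ℕ)) _ hs fun s hs => ?_).trans (wp_const _ _ _ _ hs).le)).trans ?_
  · rw [wp_split, one_mul, Nat.cast_add]
    exact add_le_add (hmeas s hs) ((wp_mono _ _ _ _ _ hs hfin).trans (wp_const _ _ _ _ hs).le)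
  · have e2 : fixedSteps M = ((pReduce.steps M + (pRandomize.steps M + 1)) +
      (((pCoins 0).steps M + (pOracle 0).steps M) + ((measureAll (.const 0)).steps M +
        (pOut.steps M + pCheck.steps M)))) + 6 := rfl
    rw [e2, loopSteps]
    generalize pReduce.steps M = a₁
    generalize (pCoins 0).steps M = a₃
    generalize (pOracle 0).steps M = a₄
    generalize pOut.steps M = a₆
    generalize pCheck.steps M = a₇
    generalize D 4 3 0 * (2 + (pGrover 1).steps M) = a₈
    norm_cast
    omega

/-- The harmonic sum in dyadic blocks: 2^L terms, each at most T/2^L, contribute at most T. -/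
lemma sum_div_le (T L : ℕ) (hT : T < 2 ^ L) : ∑ x ∈ range T, T / (x + 1) ≤ T * L := by
  have key : ∀ L : ℕ, ∑ x ∈ range (2 ^ L - 1), (T : ℝ) / (x + 1) ≤ T * L := by
    intro L
    induction L with
    | zero => simp
    | succ L ih =>
      have e : 2 ^ (L + 1) - 1 = (2 ^ L - 1) + 2 ^ L := by grind
      rw [e, sum_range_add]
      have h2 : ∑ x ∈ range (2 ^ L), (T : ℝ) / ((2 ^ L - 1 + x : ℕ) + 1) ≤ T := by
        calc _ ≤ ∑ x ∈ range (2 ^ L), (T : ℝ) / 2 ^ L := by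
              refine sum_le_sum fun x _ => ?_
              refine div_le_div_of_nonneg_left (Nat.cast_nonneg _) (by simp) ?_
              have h3 : 2 ^ L ≤ (2 ^ L - 1 + x) + 1 := by omega
              exact_mod_cast h3
          _ = T := by
              rw [sum_const, card_range, nsmul_eq_mul]
              push_cast
              field_simp
      grind
  have h1 : ((∑ x ∈ range T, T / (x + 1) : ℕ) : ℝ) ≤ (T * L : ℕ) := by
    push_cast
    calc _ ≤ ∑ x ∈ range T, (T : ℝ) / (x + 1) := sum_le_sum fun x _ => by
          grind [Nat.cast_div_le]
      _ ≤ ∑ x ∈ range (2 ^ L - 1), (T : ℝ) / (x + 1) :=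
          sum_le_sum_of_subset_of_nonneg (range_mono (by omega)) fun _ _ _ => by positivity
      _ ≤ _ := key L
  exact_mod_cast h1

lemma wp_set_eq {κ : ℝ≥0∞} (ρ : Fin 16) (i j e : Exp) (v : List ℕ) (f : St q → ℝ≥0∞) (s : St q) :
    wp X κ (.set ρ i j e) v f s =
      κ + f ⟨s.arr.put ρ (i.ev X v s.arr) (j.ev X v s.arr) (e.ev X v s.arr % X.top), s.amp⟩ := rfl

lemma wp_rnd_eq {κ : ℝ≥0∞} (ρ : Fin 16) (i j e : Exp) (v : List ℕ) (f : St q → ℝ≥0∞) (s : St q) :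
    wp X κ (.rnd ρ i j e) v f s = κ + if e.ev X v s.arr % X.top = 0 then
        f ⟨s.arr.put ρ (i.ev X v s.arr) (j.ev X v s.arr) 0, s.amp⟩
      else (∑ x ∈ range (e.ev X v s.arr % X.top),
        f ⟨s.arr.put ρ (i.ev X v s.arr) (j.ev X v s.arr) x, s.amp⟩) /
          ((e.ev X v s.arr % X.top : ℕ) : ℝ≥0∞) := rfl

/-- Given x, at most ⌊T/(x+1)⌋ iterations are made. By `sum_div_le` their average over x is at most
the logarithm of the modulus, although single runs may be exponentially long. -/
lemma wp_pGuess_steps (hX : Fits X) {s : St q} (hs : s.amp.Normalized) :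
    wp X 1 pGuess [] (fun _ => 0) s ≤ (fixedSteps (cap X) - (pReduce.steps (cap X) +
      (pRandomize.steps (cap X) + 1)) + X.lg * loopSteps (cap X) : ℕ) := by
  set A := fixedSteps (cap X) - (pReduce.steps (cap X) + (pRandomize.steps (cap X) + 1)) - 3 with hA
  set B := loopSteps (cap X) with hB
  have hA3 : fixedSteps (cap X) - (pReduce.steps (cap X) + (pRandomize.steps (cap X) + 1)) = A + 3 := by
    have : pReduce.steps (cap X) + (pRandomize.steps (cap X) + 1) + 6 ≤ fixedSteps (cap X) := by
      have e : fixedSteps (cap X) = ((pReduce.steps (cap X) + (pRandomize.steps (cap X) + 1)) +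
        (((pCoins 0).steps (cap X) + (pOracle 0).steps (cap X)) +
          ((measureAll (.const 0)).steps (cap X) + (pOut.steps (cap X) + pCheck.steps (cap X))))) + 6 := rfl
      omega
    omega
  rw [hA3]
  have h2 := two_lt_top hX
  set T := X.top - 1 with hTdef
  have hT0 : 0 < T := by omega
  obtain ⟨D, ψ⟩ := s
  have e1 : (Exp.top - Exp.const 1).ev X [] D % X.top = T := by simp_all
  have e0 : wp X 1 pGuess [] (fun _ => 0) ⟨D, ψ⟩ = wp X 1 (.rnd 4 (.const 1) (.const 0)
    (.top - .const 1)) [] (wp X 1 (.set 4 (.const 2) (.const 0)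
      ((.top - .const 1) / (.arr 4 (.const 1) (.const 0) + .const 1))) [] (wp X 1
        (.rnd 4 (.const 3) (.const 0) (.arr 4 (.const 2) (.const 0))) []
          (wp X 1 pRun [] fun _ => 0))) ⟨D, ψ⟩ := rfl
  have inner : ∀ D : Arr, 0 < D 4 2 0 → D 4 2 0 < X.top →
      wp X 1 (.rnd 4 (.const 3) (.const 0) (.arr 4 (.const 2) (.const 0))) []
          (wp X 1 pRun [] fun _ => 0) ⟨D, ψ⟩ ≤ (1 + (A + D 4 2 0 * B) : ℕ) := by
    intro D hD hD'
    simp only [wp, ev_arr, ev_const, Nat.mod_eq_of_lt hD']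
    rw [if_neg hD.ne', Nat.cast_add, Nat.cast_one]
    refine add_le_add le_rfl (ENNReal.div_le_of_le_mul ?_)
    calc _ ≤ ∑ x ∈ range (D 4 2 0), ((A + D 4 2 0 * B : ℕ) : ℝ≥0∞) := by
          refine sum_le_sum fun j hj => ?_
          refine (wp_pRun_steps (s := ⟨D.put 4 3 0 j, ψ⟩) hX hs).trans ?_
          exact_mod_cast Nat.add_le_add_left (Nat.mul_le_mul_right _ (mem_range.1 hj).le) _
      _ = _ := by rw [sum_const, card_range, nsmul_eq_mul, mul_comm]
  rw [e0]
  simp only [wp_rnd_eq, e1]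
  rw [if_neg (by omega)]
  have hsum := sum_div_le T X.lg (by grind [Ctx.top])
  calc _ ≤ 1 + (∑ x ∈ range T, ((1 + (1 + (A + (T / (x + 1)) * B)) : ℕ) : ℝ≥0∞)) / T := by
        refine add_le_add le_rfl (ENNReal.div_le_div_right (sum_le_sum fun x hx => ?_) _)
        have hx := mem_range.1 hx
        have hJT : T / (x + 1) < X.top := (Nat.div_le_self _ _).trans_lt (by omega)
        have hJ0 : 0 < T / (x + 1) := Nat.div_pos (by omega) (by omega)
        simp only [wp_set_eq, ev_const, ev_div, ev_sub, ev_top, ev_add, ev_arr, Arr.put_apply,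
          and_self, if_true, ← hTdef, Nat.mod_eq_of_lt hJT]
        rw [Nat.cast_add 1, Nat.cast_one]
        refine add_le_add le_rfl ((inner _ ?_ ?_).trans ?_) <;>
          simp only [Arr.put_apply, and_self, if_true]
        · omega
        · omega
        rfl
    _ ≤ 1 + ((T * (2 + A + X.lg * B) : ℕ) : ℝ≥0∞) / T := by
        refine add_le_add le_rfl (ENNReal.div_le_div_right ?_ _)
        rw [← Nat.cast_sum, Nat.cast_le]
        calc ∑ x ∈ range T, (1 + (1 + (A + (T / (x + 1)) * B)))
            = T * (2 + A) + (∑ x ∈ range T, T / (x + 1)) * B := by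
              rw [sum_mul]
              simp only [← add_assoc]
              rw [sum_add_distrib, sum_const, card_range, smul_eq_mul]
          _ ≤ T * (2 + A) + T * X.lg * B := Nat.add_le_add_left (Nat.mul_le_mul_right _ hsum) _
          _ = _ := by ring
    _ = _ := by
        rw [Nat.cast_mul, mul_comm, mul_div_assoc, ENNReal.div_self (by exact_mod_cast hT0.ne')
          (ENNReal.natCast_ne_top _), mul_one]
        grind

lemma wp_pTrial_steps (hX : Fits X) {s : St q} (hs : s.amp.Normalized) :
    wp X 1 pTrial [] (fun _ => 0) s ≤ (fixedSteps (cap X) + X.lg * loopSteps (cap X) : ℕ) := by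
  obtain ⟨h1, h2, h3, h4, h5⟩ := cap_le hX
  have hn : X.n ≤ cap X := by omega
  have hv : ∀ i, 0 ≤ i → ([] : List ℕ).getD i 0 < cap X := fun i _ => by grind
  refine (wp_seq_le (A := pReduce.steps (cap X)) hs hv ?_ rfl fun s hs =>
    wp_seq_le (A := pRandomize.steps (cap X)) hs hv ?_ rfl fun s hs =>
    wp_seq_le (A := 1) hs hv (by simp [pSize, Prog.Capped]) rfl fun s hs => wp_pGuess_steps hX hs).trans ?_
  · simp_all [pReduce, pPerm, pLoad, pElim, pFull, pTable, pPivot, pFactors, pAddRows, Prog.Capped, capped_skip]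
  · simp_all [pRandomize, pBits, pShift, Prog.Capped]
  · have e : fixedSteps (cap X) = ((pReduce.steps (cap X) + (pRandomize.steps (cap X) + 1)) +
        (((pCoins 0).steps (cap X) + (pOracle 0).steps (cap X)) +
          ((measureAll (.const 0)).steps (cap X) + (pOut.steps (cap X) + pCheck.steps (cap X))))) + 6 := rfl
    generalize hF : fixedSteps (cap X) = F at e ⊢
    norm_cast
    omega

lemma exists_trialSteps : ∃ C d : ℕ, ∀ (q : ℕ) (X : Ctx), Fits X → ∀ s : St q, s.amp.Normalized →
    wp X 1 pTrial [] (fun _ => 0) s ≤ (C * (X.n + 1) ^ d * (X.lg + 1) : ℕ) := by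
  obtain ⟨C₁, d₁, h1⟩ := Prog.steps_le (Prog.seq (.seq pReduce (.seq pRandomize pSize))
    (.seq (.seq (pCoins 0) (pOracle 0)) (.seq (measureAll (.const 0)) (.seq pOut pCheck))))
  obtain ⟨C₂, d₂, h2⟩ := Prog.steps_le (pGrover 1)
  have hcap : ∀ X : Ctx, cap X + 1 ≤ 50 * (X.n + 1) ^ 2 := fun X => by grind [cap]
  have hc : ∀ (X : Ctx) (d : ℕ), (cap X + 1) ^ d ≤ 50 ^ d * (X.n + 1) ^ (2 * d) := fun X d => by
    rw [pow_mul, ← mul_pow]; simp_all [Nat.pow_le_pow_left]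
  refine ⟨(C₁ * 50 ^ d₁ + 6) + (2 + C₂ * 50 ^ d₂), 2 * d₁ + 2 * d₂, fun q X hX s hs =>
    (wp_pTrial_steps hX hs).trans ?_⟩
  rw [Nat.cast_le]
  have hp : ∀ {a b : ℕ}, a ≤ b → (X.n + 1) ^ a ≤ (X.n + 1) ^ b := fun h =>
    Nat.pow_le_pow_right (by omega) h
  have hp1 : 1 ≤ (X.n + 1) ^ (2 * d₁ + 2 * d₂) := Nat.one_le_pow _ _ (by omega)
  have a1 : fixedSteps (cap X) ≤ (C₁ * 50 ^ d₁ + 6) * (X.n + 1) ^ (2 * d₁ + 2 * d₂) := by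
    calc fixedSteps (cap X) ≤ C₁ * (cap X + 1) ^ d₁ + 6 := Nat.add_le_add_right (h1 _) 6
      _ ≤ C₁ * (50 ^ d₁ * (X.n + 1) ^ (2 * d₁ + 2 * d₂)) + 6 * (X.n + 1) ^ (2 * d₁ + 2 * d₂) := by
          refine Nat.add_le_add (Nat.mul_le_mul_left _ ((hc X d₁).trans
            (Nat.mul_le_mul_left _ (hp (by omega))))) (by omega)
      _ = _ := by ring
  have a2 : loopSteps (cap X) ≤ (2 + C₂ * 50 ^ d₂) * (X.n + 1) ^ (2 * d₁ + 2 * d₂) := by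
    calc loopSteps (cap X) ≤ 2 + C₂ * (cap X + 1) ^ d₂ := Nat.add_le_add_left (h2 _) 2
      _ ≤ 2 * (X.n + 1) ^ (2 * d₁ + 2 * d₂) + C₂ * (50 ^ d₂ * (X.n + 1) ^ (2 * d₁ + 2 * d₂)) := by
          refine Nat.add_le_add (by omega) (Nat.mul_le_mul_left _ ((hc X d₂).trans
            (Nat.mul_le_mul_left _ (hp (by omega)))))
      _ = _ := by ring
  calc _ ≤ (C₁ * 50 ^ d₁ + 6) * (X.n + 1) ^ (2 * d₁ + 2 * d₂) * (X.lg + 1) +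
        (X.lg + 1) * ((2 + C₂ * 50 ^ d₂) * (X.n + 1) ^ (2 * d₁ + 2 * d₂)) := by
        refine Nat.add_le_add (a1.trans (Nat.le_mul_of_pos_right _ (by omega)))
          (Nat.mul_le_mul (by omega) a2)
    _ = _ := by ring

end steps

/-! ## The solutions of the reduced system -/

/-- A parametrization of the solutions of a system `W₀` of `m` equations in `n` unknowns (with the
constant terms in column `n`): the column `n` of `Φ` is a solution, the other columns solve the
homogeneous system, and `P` is the set of pivots. -/
structure Param (n m : ℕ) (W₀ Φ : ℕ → ℕ → ZMod 2) (P : Finset ℕ) : Prop where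
  eq_of_solves : ∀ x : ℕ → ZMod 2, (∀ l < m, ∑ j ∈ range n, W₀ l j * x j = W₀ l n) →
    ∀ j < n, x j = Φ j n + ∑ c ∈ range n, Φ j c * x c
  solves : ∀ u : ℕ → ZMod 2, ∀ l < m,
    ∑ j ∈ range n, W₀ l j * (Φ j n + ∑ c ∈ range n, Φ j c * u c) = W₀ l n
  ker : ∀ u : ℕ → ZMod 2, ∀ l < m, ∑ j ∈ range n, W₀ l j * ∑ c ∈ range n, Φ j c * u c = 0
  subset : P ⊆ range n
  card : P.card = m
  free : ∀ j < n, j ∉ P → ∀ c < n, Φ j c = if j = c then 1 else 0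
  before : ∀ j < n, m ≤ j → ∀ c < m, Φ j c = 0

lemma zmod2_eq_of_add {x y : ZMod 2} (h : x + y = 0) : x = y := by grind

section partial_
variable {n m : ℕ} {W₀ W : ℕ → ℕ → ZMod 2} {p : ℕ → ℕ}

/-- The product of the reduced system with Φ vanishes in the columns below n and is the constant
term in column n. So images under Φ solve the system, and conversely a solution is reproduced from
its own coordinates. -/
lemma Partial.param (h : Partial n m m W₀ W p) (hmn : m ≤ n) :
    Param n m W₀ (solCol m W p) ((range m).image p) := by
  have hinj : ∀ l < m, ∀ l' < m, p l = p l' → l = l' := by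
    intro l hl l' hl' e
    by_contra hne
    have h1 := h.off l hl l' hl' (Ne.symm hne)
    rw [e, h.one l' hl'] at h1
    grind
  -- Setting the extra coordinate to one or to zero makes the invariant `sol` speak of the
  -- inhomogeneous or of the homogeneous system.
  have aff : ∀ x : ℕ → ZMod 2, ∀ (V : ℕ → ℕ → ZMod 2) (l : ℕ),
      ∑ j ∈ range (n + 1), V l j * (if j = n then 1 else x j) =
        ∑ j ∈ range n, V l j * x j + V l n := by
    intro x V l
    rw [sum_range_succ, if_pos rfl, mul_one]
    congr 1
    refine sum_congr rfl fun j hj => ?_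
    grind
  have hom : ∀ x : ℕ → ZMod 2, ∀ (V : ℕ → ℕ → ZMod 2) (l : ℕ),
      ∑ j ∈ range (n + 1), V l j * (if j = n then 0 else x j) = ∑ j ∈ range n, V l j * x j := by
    intro x V l
    rw [sum_range_succ, if_pos rfl, mul_zero, add_zero]
    refine sum_congr rfl fun j hj => ?_
    grind
  have row : ∀ l < m, ∀ c, ∑ j ∈ range n, W l j * solCol m W p j c =
      if c < n then 0 else W l c := by
    intro l hl c
    simp only [solCol, mul_add, sum_add_distrib, mul_ite, mul_one, mul_zero, mul_sum]
    rw [sum_ite_eq' (range n) c, sum_comm]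
    have h1 : ∀ l' ∈ range m, ∑ j ∈ range n, (if p l' = j then W l j * W l' c else 0)
        = if l' = l then W l c else 0 := by
      intro l' hl'
      have hl' := mem_range.1 hl'
      rw [sum_ite_eq, if_pos (mem_range.2 (h.lt l' hl'))]
      split_ifs with e
      · rw [e, h.one l hl, one_mul]
      · rw [h.off l' hl' l hl (Ne.symm e), zero_mul]
    rw [sum_congr rfl h1, sum_ite_eq', if_pos (mem_range.2 hl)]
    grind
  have rowsum : ∀ l < m, ∀ u : ℕ → ZMod 2,
      ∑ j ∈ range n, W l j * ∑ c ∈ range n, solCol m W p j c * u c = 0 := by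
    intro l hl u
    simp only [mul_sum]
    rw [sum_comm]
    refine sum_eq_zero fun c hc => ?_
    simp only [← mul_assoc]
    rw [← sum_mul, row l hl, if_pos (mem_range.1 hc), zero_mul]
  refine ⟨fun x hx j hj => ?_, fun u l hl => ?_, fun u l hl => ?_, ?_, ?_, fun j hj hjP c hc => ?_,
    fun j hj hmj c hc => ?_⟩
  · have hW : ∀ l < m, ∑ j ∈ range n, W l j * x j = W l n := by
      have := (h.sol fun j => if j = n then 1 else x j).2 fun l hl => by
        rw [aff, hx l hl, zmod2_add_self]
      intro l hl
      have := this l hl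
      rw [aff] at this
      grind
    simp only [solCol, add_mul, sum_add_distrib, ite_mul, one_mul, zero_mul, if_neg hj.ne,
      zero_add, sum_mul]
    rw [sum_ite_eq, if_pos (mem_range.2 hj), sum_comm]
    have h1 : ∀ l ∈ range m, ∑ c ∈ range n, (if p l = j then W l c * x c else 0)
        = if p l = j then W l n else 0 := by
      intro l hl
      split_ifs
      · grind
      · simp
    grind [sum_congr, add_comm, add_assoc, zmod2_add_self, zero_add]
  · have := (h.sol fun j => if j = n then 1 else
      (solCol m W p j n + ∑ c ∈ range n, solCol m W p j c * u c)).1 (fun l hl => by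
        rw [aff]
        simp only [mul_add, sum_add_distrib]
        rw [rowsum l hl, row l hl, if_neg (lt_irrefl n), add_zero, zmod2_add_self]) l hl
    rw [aff] at this
    grind
  · have := (h.sol fun j => if j = n then 0 else
      ∑ c ∈ range n, solCol m W p j c * u c).1 (fun l hl => by rw [hom, rowsum l hl]) l hl
    rwa [hom] at this
  · intro j hj
    obtain ⟨l, hl, rfl⟩ := mem_image.1 hj
    exact mem_range.2 (h.lt l (mem_range.1 hl))
  · rw [card_image_of_injOn, card_range]
    intro l hl l' hl' e
    grind
  · rw [solCol, sum_eq_zero, add_zero]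
    grind
  · rw [solCol, if_neg (by omega), zero_add]
    refine sum_eq_zero fun l hl => ?_
    split_ifs with e
    · exact h.before l (mem_range.1 hl) c (by omega)
    · rfl

end partial_

/-! ### Counting -/

/-- The extension of a vector by zeros. -/
def ext {n : ℕ} (z : Fin n → ZMod 2) (j : ℕ) : ZMod 2 := if h : j < n then z ⟨j, h⟩ else 0

lemma ext_add {n : ℕ} (z z' : Fin n → ZMod 2) (j : ℕ) : ext (z + z') j = ext z j + ext z' j := by
  unfold ext; split <;> simp

lemma ext_val {n : ℕ} (z : Fin n → ZMod 2) (j : Fin n) : ext z j = z j := by simp [ext]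

lemma ext_mk {n : ℕ} (f : ℕ → ZMod 2) {j : ℕ} (hj : j < n) : ext (fun i : Fin n => f i) j = f j := by
  simp [ext, hj]

lemma add_self_fun {ι : Type*} (κ : ι → ZMod 2) : κ + κ = 0 := funext fun i => zmod2_add_self (κ i)

open Classical in
/-- The vectors in the kernel whose support is contained in `J`. -/
noncomputable def kerSet (n m : ℕ) (W₀ : ℕ → ℕ → ZMod 2) (J : Finset ℕ) :
    Finset (Fin n → ZMod 2) := univ.filter fun z =>
  (∀ j < n, j ∉ J → ext z j = 0) ∧ ∀ l < m, ∑ j ∈ range n, W₀ l j * ext z j = 0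

/-- All nonempty fibres of a homomorphism are translates of each other. -/
lemma card_le_fiber {A B : Type*} [Fintype A] [AddCommGroup A] [AddCommGroup B] [DecidableEq B]
    (f : A → B) (hf : ∀ a a', f (a + a') = f a + f a') (a₀ : A) (t : Finset B)
    (ht : ∀ a, f a ∈ t) :
    Fintype.card A ≤ (univ.filter fun a => f a = f a₀).card * t.card := by
  refine card_le_mul_card_image_of_maps_to (s := univ) (fun a _ => ht a) _ fun b _ => ?_
  by_cases hb : ∃ a₁, f a₁ = b
  · obtain ⟨a₁, rfl⟩ := hb
    refine card_le_card_of_injOn (fun a => a + (a₀ - a₁)) (fun a ha => ?_)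
      fun a _ a' _ e => add_right_cancel e
    have h1 : f (a₀ - a₁) + f a₁ = f a₀ := by grind [sub_add_cancel]
    grind
  simp_all

/-- F commutes with translations by its possible values. Translating by κ carries the fibre over κ
into the zero fibre, so no fibre is larger than that one. -/
lemma card_le_zeros {A : Type*} [Fintype A] [AddCommGroup A] [DecidableEq A]
    (t : Finset A) (F : A → A) (hF : ∀ a, F a ∈ t) (h2 : ∀ a : A, a + a = 0)
    (hs : ∀ a, ∀ κ ∈ t, F (a + κ) = F a + κ) :
    Fintype.card A ≤ (univ.filter fun a => F a = 0).card * t.card := by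
  refine card_le_mul_card_image_of_maps_to (s := univ) (fun a _ => hF a) _ fun κ hκ => ?_
  refine card_le_card_of_injOn (fun a => a + κ) (fun a ha => ?_)
    fun a _ a' _ e => add_right_cancel e
  grind

section count

variable {n m k b : ℕ} {W₀ Φ : ℕ → ℕ → ZMod 2} {P I K : Finset ℕ} {x : ℕ → ZMod 2}

/-- The part of a solution that is determined by the first `m` coordinates. -/
def headPart (n m : ℕ) (Φ : ℕ → ℕ → ZMod 2) (v : ℕ → ZMod 2) (j : ℕ) : ZMod 2 :=
  ∑ c ∈ range m, Φ j c * v c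

/-- The part of a solution that is determined by the coordinates from `m` on. -/
def tailPart (m k : ℕ) (Φ : ℕ → ℕ → ZMod 2) (z : ℕ → ZMod 2) (j : ℕ) : ZMod 2 :=
  ∑ c ∈ range k, Φ j (m + c) * z c

/-- The vector with the given head and tail. -/
def join (m k : ℕ) (v z : ℕ → ZMod 2) (c : ℕ) : ZMod 2 :=
  if c < m then v c else if c < m + k then z (c - m) else 0

lemma sum_join (hmk : m + k ≤ n) (v z : ℕ → ZMod 2) (j : ℕ) :
    ∑ c ∈ range n, Φ j c * join m k v z c = headPart n m Φ v j + tailPart m k Φ z j := by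
  obtain ⟨a, rfl⟩ := Nat.exists_eq_add_of_le hmk
  rw [sum_range_add, sum_range_add, headPart, tailPart]
  have h3 : ∑ c ∈ range a, Φ j (m + k + c) * join m k v z (m + k + c) = 0 :=
    sum_eq_zero fun c _ => by rw [join, if_neg (by omega), if_neg (by omega), mul_zero]
  rw [h3, add_zero]
  congr 1
  · simp_all [sum_congr, join, if_pos, mem_range]
  simp_all [sum_congr, mem_range, join, if_neg, if_pos, Nat.add_sub_cancel_left]

lemma tailPart_add (z z' : ℕ → ZMod 2) (j : ℕ) :
    tailPart m k Φ (fun c => z c + z' c) j = tailPart m k Φ z j + tailPart m k Φ z' j := by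
  simp [tailPart, mul_add, sum_add_distrib]

lemma headPart_add (z z' : ℕ → ZMod 2) (j : ℕ) :
    headPart n m Φ (fun c => z c + z' c) j = headPart n m Φ z j + headPart n m Φ z' j := by
  simp [headPart, mul_add, sum_add_distrib]

/-- Pivots are leftmost in their rows, so coordinates from m on do not depend on those before m. -/
lemma headPart_ker (hP : Param n m W₀ Φ P) (hmk : m + k ≤ n) (v : ℕ → ZMod 2) :
    (fun j : Fin n => headPart n m Φ v j) ∈ kerSet n m W₀ (range m) := by
  classical
  have e : ∀ j, headPart n m Φ v j = ∑ c ∈ range n, Φ j c * join m k v 0 c := fun j => by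
    simp_all [sum_join, tailPart]
  rw [kerSet, mem_filter]
  refine ⟨mem_univ _, fun j hj hjm => ?_, fun l hl => ?_⟩
  · rw [ext_mk _ hj, headPart]
    refine sum_eq_zero fun c hc => ?_
    rw [hP.before j hj (by grind) c (mem_range.1 hc), zero_mul]
  · rw [← hP.ker (join m k v 0) l hl]
    refine sum_congr rfl fun j hj => ?_
    rw [ext_mk _ (mem_range.1 hj), e]

open Classical in
-- If the first m columns were independent, the head would contribute nothing. In general its
-- contribution is a linear function with values in the kernel on the first m coordinates, and a
-- random head hits the right value with probability at least the inverse of the size of this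
-- kernel.
lemma card_goodHead (hP : Param n m W₀ Φ P) (hmk : m + k ≤ n) (x : ℕ → ZMod 2) :
    2 ^ m ≤ (univ.filter fun v : Fin m → ZMod 2 =>
      ∀ j < n, headPart n m Φ (ext v) j = headPart n m Φ x j).card *
        (kerSet n m W₀ (range m)).card := by
  have := card_le_fiber (A := Fin m → ZMod 2) (B := Fin n → ZMod 2)
    (fun v j => headPart n m Φ (ext v) j) (fun a a' => by
      funext j
      rw [Pi.add_apply, ← headPart_add]
      exact congrArg (headPart n m Φ · j) (funext fun c => ext_add _ _ c)) (fun i => x i) _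
    fun v => headPart_ker hP hmk (ext v)
  rw [Fintype.card_fun, ZMod.card, Fintype.card_fin] at this
  refine this.trans (Nat.mul_le_mul_right _ (card_le_card fun v hv => ?_))
  simp only [mem_filter, mem_univ, true_and] at hv ⊢
  intro j hj
  have h1 := congrFun hv ⟨j, hj⟩
  rw [h1, headPart, headPart]
  simp_all [sum_congr, ext_mk, mem_range]

/-- There are m pivots in all, so as many late pivots as free columns among the first m. Each subset
of these free columns yields a kernel vector that shows the subset on its free coordinates. -/
lemma two_pow_card_late (hP : Param n m W₀ Φ P) (hmk : m + k ≤ n) :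
    2 ^ (P.filter (m ≤ ·)).card ≤ (kerSet n m W₀ (range m)).card := by
  classical
  have hcard : (P.filter (m ≤ ·)).card = (range m \ P).card := by
    have h1 := card_filter_add_card_filter_not (s := P) (m ≤ ·)
    have h3 : P.filter (fun j => ¬ m ≤ j) = range m ∩ P := by grind
    rw [h3, hP.card] at h1
    grind
  have : (range m \ P).powerset.card ≤ (kerSet n m W₀ (range m)).card := by
    refine card_le_card_of_injOn (fun S j => headPart n m Φ (fun c => if c ∈ S then 1 else 0) j)
      (fun S _ => headPart_ker hP hmk _) fun S hS S' hS' e => ?_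
    have key : ∀ S ∈ (range m \ P).powerset, ∀ j < m, j ∉ P →
        headPart n m Φ (fun c => if c ∈ S then 1 else 0) j = if j ∈ S then 1 else 0 := by
      intro S _ j hj hjP
      rw [headPart, sum_eq_single j]
      · rw [hP.free j (by omega) hjP j (by omega), if_pos rfl, one_mul]
      · intro c hc hne
        have := mem_range.1 hc
        rw [hP.free j (by omega) hjP c (by omega), if_neg (Ne.symm hne), zero_mul]
      grind
    ext j
    by_cases hj : j ∈ range m \ P
    · obtain ⟨h1, h2⟩ := mem_sdiff.1 hj
      have h1 := mem_range.1 h1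
      have := congrFun e ⟨j, by omega⟩
      grind
    grind
  simp_all

open Classical in
/-- The ambiguity of the equations for the coins `I`, `K`. -/
noncomputable def ambiguity (m k b : ℕ) (Φ : ℕ → ℕ → ZMod 2) (I K : Finset ℕ) :
    Finset (Fin k → ZMod 2) := univ.filter fun κ =>
  (∀ c, c ∉ K → ext κ c = 0) ∧ ∀ i ∈ I, tailPart m k Φ (ext κ) (b + i) = 0

/-- The positions at which the vectors for the coins `I`, `K` may be nonzero. -/
def openSet (m r b : ℕ) (I K : Finset ℕ) : Finset ℕ :=
  range b ∪ (range r \ I).image (b + ·) ∪ K.image (m + ·)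

/-- The ambiguity is a group of translations, as required by the count in `card_ambiguity`. -/
lemma ambiguity_add {κ κ' : Fin k → ZMod 2} (h : κ ∈ ambiguity m k b Φ I K)
    (h' : κ' ∈ ambiguity m k b Φ I K) : κ + κ' ∈ ambiguity m k b Φ I K := by
  classical
  rw [ambiguity, mem_filter] at *
  refine ⟨mem_univ _, fun c hc => ?_, fun i hi => ?_⟩
  · simp_all [ext_add, add_zero]
  · have : ext (κ + κ') = fun c => ext κ c + ext κ' c := funext (ext_add κ κ')
    simp_all [tailPart_add, add_zero]

/-- An ambiguous κ produces a kernel vector that vanishes outside the open positions, except perhaps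
at late pivots. The values of κ and of this vector at the late pivots take at most 2^|T| values
each. Once they are fixed, differences map injectively into the kernel on the open positions.
Finally 2^|T| is bounded by `two_pow_card_late`. -/
lemma card_ambiguity {r : ℕ} (hP : Param n m W₀ Φ P) (hmk : m + k ≤ n) (hm : m = b + r) :
    (ambiguity m k b Φ I K).card ≤ (kerSet n m W₀ (range m)).card ^ 2 *
      (kerSet n m W₀ (openSet m r b I K)).card := by
  classical
  set T := P.filter (m ≤ ·) with hT
  have htail : ∀ (z : ℕ → ZMod 2) (j : ℕ),
      tailPart m k Φ z j = ∑ c ∈ range n, Φ j c * join m k 0 z c := fun z j => by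
    simp_all [sum_join, headPart]
  have hfree : ∀ j < n, j ∉ P → ∀ z : ℕ → ZMod 2, tailPart m k Φ z j = join m k 0 z j := by
    intro j hj hjP z
    rw [htail, sum_eq_single j]
    · rw [hP.free j hj hjP j hj, if_pos rfl, one_mul]
    · intro c hc hne
      rw [hP.free j hj hjP c (mem_range.1 hc), if_neg (Ne.symm hne), zero_mul]
    grind
  -- At a late pivot the vector is not controlled by κ, and κ cannot be read off from the vector; so
  -- both values are recorded.
  set f : (Fin k → ZMod 2) → (T → ZMod 2) × (T → ZMod 2) := fun κ =>
    (fun t => ext κ (t - m), fun t => tailPart m k Φ (ext κ) t) with hf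
  have h1 : (ambiguity m k b Φ I K).card ≤ (kerSet n m W₀ (openSet m r b I K)).card *
      (univ : Finset ((T → ZMod 2) × (T → ZMod 2))).card := by
    refine card_le_mul_card_image_of_maps_to (f := f) (fun _ _ => mem_univ _) _
      fun y _ => ?_
    by_cases hne : ∃ κ₀ ∈ ambiguity m k b Φ I K, f κ₀ = y
    swap
    · simp_all
    obtain ⟨κ₀, h0, rfl⟩ := hne
    have hd : ∀ κ ∈ (ambiguity m k b Φ I K).filter (fun κ => f κ = f κ₀),
        κ + κ₀ ∈ ambiguity m k b Φ I K ∧ (∀ t ∈ T, ext (κ + κ₀) (t - m) = 0) ∧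
          ∀ t ∈ T, tailPart m k Φ (ext (κ + κ₀)) t = 0 := by
      intro κ hκ
      obtain ⟨h2, h3⟩ := mem_filter.1 hκ
      have e : ext (κ + κ₀) = fun c => ext κ c + ext κ₀ c := funext (ext_add κ κ₀)
      refine ⟨ambiguity_add h2 h0, fun t ht => ?_, fun t ht => ?_⟩
      · have := congrFun (congrArg Prod.fst h3) ⟨t, ht⟩
        simp only [hf] at this
        rw [ext_add, this, zmod2_add_self]
      · have := congrFun (congrArg Prod.snd h3) ⟨t, ht⟩
        simp only [hf] at this
        rw [e, tailPart_add, this, zmod2_add_self]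
    refine card_le_card_of_injOn (fun κ j => tailPart m k Φ (ext (κ + κ₀)) j)
      (fun κ hκ => ?_) fun κ hκ κ' hκ' e => ?_
    · obtain ⟨h2, h3, h4⟩ := hd κ (mem_coe.1 hκ)
      rw [ambiguity, mem_filter] at h2
      rw [mem_coe, kerSet, mem_filter]
      refine ⟨mem_univ _, fun j hj hjJ => ?_, fun l hl => ?_⟩
      · rw [ext_mk (fun j => tailPart m k Φ (ext (κ + κ₀)) j) hj]
        simp only [openSet, mem_union, mem_range, mem_image,
          mem_sdiff, not_or, not_exists, not_and] at hjJ
        obtain ⟨⟨j1, j2⟩, j3⟩ := hjJ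
        by_cases hjm : j < m
        · have hi : j - b ∈ I := by
            by_contra hi
            exact j2 (j - b) ⟨by omega, hi⟩ (by omega)
          have := h2.2.2 _ hi
          rwa [show b + (j - b) = j by omega] at this
        · by_cases hjP : j ∈ P
          · exact h4 j (mem_filter.2 ⟨hjP, by omega⟩)
          · rw [hfree j hj hjP, join, if_neg hjm]
            split_ifs
            · exact h2.2.1 _ fun hc => j3 _ hc (by omega)
            · rfl
      · rw [← hP.ker (join m k 0 (ext (κ + κ₀))) l hl]
        refine sum_congr rfl fun j hj => ?_
        rw [ext_mk (fun j => tailPart m k Φ (ext (κ + κ₀)) j) (mem_range.1 hj), htail]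
    · obtain ⟨h2, h3, h4⟩ := hd κ (mem_coe.1 hκ)
      obtain ⟨h2', h3', h4'⟩ := hd κ' (mem_coe.1 hκ')
      have key : κ + κ₀ = κ' + κ₀ := by
        funext c
        rw [← ext_val (κ + κ₀) c, ← ext_val (κ' + κ₀) c]
        by_cases hcP : m + c ∈ P
        · have ht : m + (c : ℕ) ∈ T := mem_filter.2 ⟨hcP, by omega⟩
          have a1 := h3 _ ht
          have a2 := h3' _ ht
          rw [Nat.add_sub_cancel_left] at a1 a2
          rw [a1, a2]
        · have : tailPart m k Φ (ext (κ + κ₀)) (m + c) = tailPart m k Φ (ext (κ' + κ₀)) (m + c) :=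
            congrFun e ⟨m + c, by omega⟩
          have hjoin : ∀ z : ℕ → ZMod 2, join m k 0 z (m + c) = z c := fun z => by simp [join]
          rwa [hfree _ (by omega) hcP, hfree _ (by omega) hcP, hjoin, hjoin] at this
      exact add_right_cancel key
  have h2 : (univ : Finset ((T → ZMod 2) × (T → ZMod 2))).card = (2 ^ T.card) ^ 2 := by
    rw [card_univ, Fintype.card_prod, Fintype.card_fun, ZMod.card, Fintype.card_coe, sq]
  rw [h2] at h1
  refine h1.trans ?_
  rw [mul_comm]
  exact Nat.mul_le_mul_right _ (Nat.pow_le_pow_left (two_pow_card_late hP hmk) 2)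

/-! ### The equations for the coins -/

/-- The solution that the search finds for the coins `I`, `K` and the offset `x₀`. -/
def tailSolution (n m r k b : ℕ) (Φ : ℕ → ℕ → ZMod 2) (v : ℕ → ZMod 2) (I K : Finset ℕ)
    (x₀ : ℕ → ZMod 2) : ℕ → ZMod 2 :=
  solve r k (fun i l => if i ∈ I ∧ l ∈ K then Φ (b + i) (m + l) else 0) fun i => if i ∈ I then
    Φ (b + i) n + headPart n m Φ v (b + i) +
      tailPart m k Φ (fun c => if c ∈ K then x₀ c else 0) (b + i) else 0

/-- The tail of the candidate. -/
def tail (n m r k b : ℕ) (Φ : ℕ → ℕ → ZMod 2) (v : ℕ → ZMod 2) (I K : Finset ℕ)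
    (x₀ : ℕ → ZMod 2) (c : ℕ) : ZMod 2 :=
  if c ∈ K then x₀ c + tailSolution n m r k b Φ v I K x₀ c else 0

open Classical in
-- The tail of x solves the masked equations, so the solver finds some solution, and its error lies
-- in the ambiguity. Shifting the offset by an ambiguous κ does not change the equations to be
-- solved and shifts the result by κ. Hence `card_le_zeros` applies: a random offset makes the error
-- zero with probability at least the inverse of the size of the ambiguity.
lemma card_goodTail {r : ℕ} (hP : Param n m W₀ Φ P) (hmk : m + k ≤ n) (hm : m = b + r)
    (hI : I ⊆ range r)
    (hx : ∀ l < m, ∑ j ∈ range n, W₀ l j * x j = W₀ l n)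
    (hxI : ∀ i ∈ I, x (b + i) = 0) (hxK : ∀ c < k, c ∉ K → x (m + c) = 0)
    (hx0 : ∀ j < n, m + k ≤ j → x j = 0) :
    2 ^ k ≤ (univ.filter fun x₀ : Fin k → ZMod 2 =>
      ∀ c < k, tail n m r k b Φ x I K (ext x₀) c = x (m + c)).card *
        ((kerSet n m W₀ (range m)).card ^ 2 *
          (kerSet n m W₀ (openSet m r b I K)).card) := by
  have hxj : ∀ j < n, x j = Φ j n + headPart n m Φ x j + tailPart m k Φ (fun c => x (m + c)) j := by
    intro j hj
    rw [hP.eq_of_solves x hx j hj, add_assoc, ← sum_join hmk]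
    congr 1
    refine sum_congr rfl fun c hc => ?_
    grind [mem_range, join]
  have hkey : ∀ i ∈ I, tailPart m k Φ (fun c => x (m + c)) (b + i) =
      Φ (b + i) n + headPart n m Φ x (b + i) := by
    grind
  have hmask : ∀ (z : ℕ → ZMod 2), ∀ i, i ∈ I → ∑ l ∈ range k,
      (if i ∈ I ∧ l ∈ K then Φ (b + i) (m + l) else 0) * z l =
        tailPart m k Φ (fun c => if c ∈ K then z c else 0) (b + i) := by
    intro z i hi
    refine sum_congr rfl fun l _ => ?_
    grind
  have hsolve : ∀ x₀ : ℕ → ZMod 2, ∀ i ∈ I, tailPart m k Φ (tail n m r k b Φ x I K x₀) (b + i) =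
        Φ (b + i) n + headPart n m Φ x (b + i) := by
    intro x₀ i hi
    have hir := mem_range.1 (hI hi)
    have := solve_spec (r := r) (k := k)
      (col := fun i l => if i ∈ I ∧ l ∈ K then Φ (b + i) (m + l) else 0)
      (T := fun i => if i ∈ I then Φ (b + i) n + headPart n m Φ x (b + i) +
        tailPart m k Φ (fun c => if c ∈ K then x₀ c else 0) (b + i) else 0)
      (y := fun c => x₀ c + x (m + c)) (fun i' hi' => by
        by_cases h : i' ∈ I
        · rw [hmask _ i' h, if_pos h, ← hkey i' h, add_comm, ← tailPart_add]
          refine sum_congr rfl fun c hc => ?_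
          grind
        simp_all) i hir
    rw [hmask _ i hi, if_pos hi] at this
    have e : tailPart m k Φ (tail n m r k b Φ x I K x₀) (b + i) =
        tailPart m k Φ (fun c => if c ∈ K then x₀ c else 0) (b + i) +
        tailPart m k Φ (fun c => if c ∈ K then tailSolution n m r k b Φ x I K x₀ c else 0)
          (b + i) := by
      rw [← tailPart_add]
      refine sum_congr rfl fun c _ => ?_
      grind [tail]
    rw [e]
    unfold tailSolution
    grind
  have hmain := card_le_zeros (A := Fin k → ZMod 2) (ambiguity m k b Φ I K)
    (fun x₀ c => tail n m r k b Φ x I K (ext x₀) c + x (m + c)) (fun x₀ => ?_) add_self_fun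
    (fun x₀ κ hκ => ?_)
  · rw [Fintype.card_fun, ZMod.card, Fintype.card_fin] at hmain
    refine hmain.trans (Nat.mul_le_mul (card_le_card fun x₀ h => ?_) (card_ambiguity hP hmk hm))
    simp only [mem_filter, mem_univ, true_and] at h ⊢
    intro c hc
    exact zmod2_eq_of_add (congrFun h ⟨c, hc⟩)
  · rw [ambiguity, mem_filter]
    refine ⟨mem_univ _, fun c hc => ?_, fun i hi => ?_⟩
    · simp_all [ext_mk, tail, ext, if_neg, add_zero]
    · have : tailPart m k Φ (ext fun c : Fin k => tail n m r k b Φ x I K (ext x₀) c + x (m + c))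
          (b + i) = tailPart m k Φ (tail n m r k b Φ x I K (ext x₀)) (b + i) +
            tailPart m k Φ (fun c => x (m + c)) (b + i) := by
        rw [← tailPart_add]
        refine sum_congr rfl fun c hc => ?_
        simp_all [ext_mk, tail, ext, mem_range]
      grind
  · rw [ambiguity, mem_filter] at hκ
    have hsame : tailSolution n m r k b Φ x I K (ext (x₀ + κ)) =
        tailSolution n m r k b Φ x I K (ext x₀) := by
      unfold tailSolution
      congr 1
      funext i
      split_ifs with hi
      · congr 1
        have : tailPart m k Φ (fun c => if c ∈ K then ext (x₀ + κ) c else 0) (b + i) =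
            tailPart m k Φ (fun c => if c ∈ K then ext x₀ c else 0) (b + i) +
              tailPart m k Φ (ext κ) (b + i) := by
          rw [← tailPart_add]
          grind [sum_congr, ext_add, add_zero]
        grind
      · rfl
    funext c
    simp only [Pi.add_apply, tail, hsame]
    grind [ext_add, ext_val, add_zero]

end count

/-! ## The success probability for a fixed permutation -/

/-- A permutation as a function on the natural numbers. -/
def permFun {n : ℕ} (σ : Equiv.Perm (Fin n)) (j : ℕ) : ℕ := if h : j < n then σ ⟨j, h⟩ else j

section permFun
variable {n : ℕ} (σ : Equiv.Perm (Fin n))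

lemma permFun_val (j : Fin n) : permFun σ j = σ j := by simp [permFun]

lemma permFun_lt (j : ℕ) (hj : j < n) : permFun σ j < n := by simp [permFun, hj]

lemma permFun_inj (i : ℕ) (hi : i < n) (j : ℕ) (hj : j < n) (h : permFun σ i = permFun σ j) :
    i = j := by
  simpa [permFun, hi, hj, Fin.ext_iff.symm] using h

lemma permFun_symm {j : ℕ} (hj : j < n) : permFun σ (permFun σ.symm j) = j := by simp [permFun, hj]

lemma sum_permFun {M : Type*} [AddCommMonoid M] (f : ℕ → M) :
    ∑ j ∈ range n, f (permFun σ j) = ∑ j ∈ range n, f j := by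
  rw [sum_range, sum_range]
  simp only [permFun_val]
  exact Equiv.sum_comp σ fun j => f j

lemma countOnes_permFun (e : ℕ → ZMod 2) :
    countOnes (fun j => e (permFun σ j)) n = countOnes e n := by
  unfold countOnes
  rw [card_filter, card_filter]
  exact sum_permFun σ fun j => if e j = 1 then 1 else 0

end permFun

/-- The permuted system with its constant terms. -/
def sysMat (X : Ctx) (π : ℕ → ℕ) (l j : ℕ) : ZMod 2 :=
  if j < X.n then (X.inp (6 + l * X.n + π j) : ZMod 2) else X.inp (6 + X.m * X.n + l)

lemma Param.congr {n m : ℕ} {W W' Φ : ℕ → ℕ → ZMod 2} {P : Finset ℕ} (h : Param n m W Φ P)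
    (e : ∀ l < m, ∀ j < n + 1, W l j = W' l j) : Param n m W' Φ P := by
  have key : ∀ l < m, ∀ y : ℕ → ZMod 2, ∑ j ∈ range n, W' l j * y j = ∑ j ∈ range n, W l j * y j :=
    fun l hl y => sum_congr rfl fun j hj => by grind
  refine ⟨fun x hx => h.eq_of_solves x fun l hl => ?_, fun u l hl => ?_, fun u l hl => ?_, h.subset,
    h.card, h.free, h.before⟩
  · simp_all
  · rw [key l hl, h.solves u l hl, e l hl n (by omega)]
  · rw [key l hl, h.ker u l hl]

variable {X : Ctx} {D : Arr}

/-- The state of the arrays after the elimination. -/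
def Reduced (X : Ctx) (π : ℕ → ℕ) (D : Arr) : Prop := (∀ j < X.n, D 0 j 0 = π j) ∧
  (∀ j < X.n, ∀ c < X.k, D 8 j c = D 13 j (X.m + c)) ∧ ∃ Φ P, Param X.n X.m (sysMat X π) Φ P ∧
  ∀ j < X.n, ∀ c < X.n + 1, D 13 j c < 2 ∧ (D 13 j c : ZMod 2) = Φ j c

lemma reach_pReduce (hX : Fits X) {q : ℕ} (hmk : X.m + X.k ≤ X.n) (hin : X.Binary)
    (hind : ∀ c : ℕ → ZMod 2, (∀ j < X.n, ∑ l ∈ range X.m, c l * (X.inp (6 + l * X.n + j) : ZMod 2)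
      = 0) → ∀ l < X.m, c l = 0) (σ : Equiv.Perm (Fin X.n)) (D : Arr) :
    Reach X q pReduce [] (X.n.factorial : ℝ≥0∞)⁻¹ D (Reduced X (permFun σ)) := by
  have := Reach.seq (Q := Reduced X (permFun σ)) (c' := 1)
    (h := .seq pLoad (.seq pElim (.seq pFull pTable)))
    ((reach_pPerm (q := q) (D := D) hX (permFun σ) (permFun_lt σ) (permFun_inj σ)).mono
      fun D₁ ⟨_, h0⟩ => ?_)
  · rwa [mul_one] at this
  refine Det.seq ((det_pLoad hX (fun j hj => by simp_all [permFun_lt]) hin).mono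
    fun D₂ ⟨f2, b2, h2, h2'⟩ => ?_)
  have hsys : ∀ l < X.m, ∀ j < X.n + 1, D₂.mat l j = sysMat X (permFun σ) l j := by
    grind [sysMat, Arr.mat]
  refine Det.seq ((det_pElim hX b2 fun c hc => hind c fun j hj => ?_).mono
    fun D₃ ⟨f3, b3, h3⟩ => ?_)
  · rw [← hc (permFun σ.symm j) (permFun_lt _ j hj)]
    refine sum_congr rfl fun l hl => ?_
    have hj' := permFun_lt σ.symm j hj
    rw [hsys l (mem_range.1 hl) _ (by omega), sysMat, if_pos hj', permFun_symm σ hj]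
  refine Det.seq ((det_pFull hX h3.lt).mono fun D₄ ⟨f4, h4⟩ => ?_)
  refine (det_pTable hX hmk fun j hj c hc => (h4 j hj c hc).1).mono fun D₅ ⟨f5, h5⟩ => ?_
  have e13 : D₅ 13 = D₄ 13 := f5 _ (by decide)
  refine ⟨fun j hj => ?_, fun j hj c hc => by grind, _, _,
    (h3.param (Ctx.m_le hX)).congr hsys, fun j hj c hc => by grind⟩
  rw [f5 _ (by decide), f4 _ (by decide), f3 _ (by decide), f2 _ (by decide), h0 j hj]

/-- The state of the arrays before the search. -/
structure Seeded (X : Ctx) (π : ℕ → ℕ) (Φ : ℕ → ℕ → ZMod 2) (v x₀ : ℕ → ZMod 2) (D : Arr) :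
    Prop where
  perm : ∀ j < X.n, D 0 j 0 = π j
  table : ∀ j < X.n, ∀ c < X.k, bit (D 8 j c) = Φ j (X.m + c)
  shift : ∀ j < X.n, bit (D 9 j 0) = Φ j X.n + headPart X.n X.m Φ v j
  offset : ∀ c < X.k, bit (D 3 c 0) = x₀ c

variable {π : ℕ → ℕ} {Φ : ℕ → ℕ → ZMod 2} {P : Finset ℕ} {v x x₀ : ℕ → ZMod 2}

lemma Seeded.congr (h : Seeded X π Φ v x₀ D) {D' : Arr} (h0 : D' 0 = D 0) (h8 : D' 8 = D 8)
    (h9 : D' 9 = D 9) (h3 : D' 3 = D 3) : Seeded X π Φ v x₀ D' :=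
  ⟨by rw [h0]; exact h.perm, by rw [h8]; exact h.table, by rw [h9]; exact h.shift,
    by rw [h3]; exact h.offset⟩

lemma Seeded.cand_eq (h : Seeded X π Φ v x₀ D) (w : WState) {j : ℕ} (hj : j < X.n) :
    cand X D w j = Φ j X.n + headPart X.n X.m Φ v j + tailPart X.m X.k Φ (fun c => w (2, c, 0) *
      (x₀ c + solution X.r X.k X.b (D 8) (fun j => D 9 j 0) (fun c => D 3 c 0) w c)) j := by
  rw [cand, candidate, preCandidate, h.shift j hj, tailPart, add_assoc, ← sum_add_distrib]
  congr 1
  refine sum_congr rfl fun c hc => ?_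
  have := mem_range.1 hc
  rw [h.table j hj c this, h.offset c this]
  ring

lemma Seeded.solution_eq (h : Seeded X π Φ v x₀ D) (hX : Fits X) {I K : Finset ℕ}
    (hI : I ⊆ range X.r) (hK : K ⊆ range X.k) :
    solution X.r X.k X.b (D 8) (fun j => D 9 j 0) (fun c => D 3 c 0) (coinW I K) =
      tailSolution X.n X.m X.r X.k X.b Φ v I K x₀ := by
  have hb := hX.bound
  rw [solution, tailSolution]
  congr 1
  · funext i l
    have e := fun (hi : i ∈ I) (hl : l ∈ K) => h.table (X.b + i) (by grind) l (mem_range.1 (hK hl))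
    grind [maskedCol, coinW, bit]
  · funext i
    by_cases hi : i ∈ I
    · have hi' : X.b + i < X.n := by grind
      simp only [coinW, if_true, hi, one_mul, preCandidate, h.shift _ hi', tailPart]
      congr 1
      refine sum_congr rfl fun c hc => ?_
      have := mem_range.1 hc
      rw [h.table _ hi' c this, h.offset c this]
      simp
    grind [coinW]

lemma Seeded.cand_coinW (h : Seeded X π Φ v x₀ D) (hX : Fits X) {I K : Finset ℕ}
    (hI : I ⊆ range X.r) (hK : K ⊆ range X.k) {j : ℕ} (hj : j < X.n) :
    cand X D (coinW I K) j = Φ j X.n + headPart X.n X.m Φ v j +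
      tailPart X.m X.k Φ (tail X.n X.m X.r X.k X.b Φ v I K x₀) j := by
  rw [h.cand_eq _ hj, h.solution_eq hX hI hK]
  congr 1
  refine sum_congr rfl fun c hc => ?_
  simp [tail, coinW]

/-- The trial has been successful. -/
noncomputable def won {q : ℕ} (s : St q) : ℝ≥0∞ := if s.arr 12 1 0 = 0 then 0 else 1

/-- Every candidate lies in the image of the parametrization and hence satisfies the equations,
whichever coins it comes from. The flag guarantees the weight, so the check succeeds. -/
lemma Seeded.wins {σ : Equiv.Perm (Fin X.n)} (h : Seeded X (permFun σ) Φ v x₀ D) (hX : Fits X)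
    (hin : X.Binary) (hmk : X.m + X.k ≤ X.n)
    (hP : Param X.n X.m (sysMat X (permFun σ)) Φ P) {w : WState}
    (hw : countOnes (cand X D w) X.n = X.w)
    {D' : Arr} (h0 : D' 0 = D 0)
    (hD : ∀ j < X.n, D' 10 (7 * (X.n + 2) + j) 0 = (cand X D w j).val) (ψ : QState X.qubits) :
    1 ≤ wp X 0 (.seq pOut pCheck) [] won ⟨D', ψ⟩ := by
  have := Det.seq (q := X.qubits) (D := D') (g := pOut) (h := pCheck) (Q := fun D => D 12 1 0 = 1)
    ((det_pOut hX (fun j hj => by rw [h0]; exact h.perm j hj)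
    (permFun_inj σ) fun j hj => by grind).mono fun D₁ h1 =>
    (det_pCheck hX hin).mono fun D₂ h2 => ?_)
  · obtain ⟨D₃, h3, h4⟩ := this
    have := h4 ψ won
    simp_all [won, St.arr, one_mul, if_neg, one_ne_zero]
  have ho : ∀ j < X.n, D₁.out (permFun σ j) = cand X D w j := fun j hj => by
    simp_all [Arr.out, ZMod.natCast_zmod_val]
  rw [h2.2, if_pos]
  refine ⟨?_, fun i hi => ?_⟩
  · rw [← hw, ← countOnes_permFun σ]
    exact countOnes_congr ho
  · have := hP.solves (join X.m X.k v fun c => w (2, c, 0) *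
      (x₀ c + solution X.r X.k X.b (D 8) (fun j => D 9 j 0) (fun c => D 3 c 0) w c)) i hi
    rw [sysMat, if_neg (lt_irrefl _)] at this
    rw [← this, ← sum_permFun σ]
    refine sum_congr rfl fun j hj => ?_
    have hj := mem_range.1 hj
    rw [ho j hj, h.cand_eq w hj, sum_join hmk, sysMat, if_pos hj, add_assoc (Φ j X.n), add_assoc 6]

/-- The columns of the masks for which the solution `x` is found. -/
structure Masks (X : Ctx) (x : ℕ → ZMod 2) (τ : ℕ) (S : Finset (Finset ℕ × Finset ℕ)) : Prop where
  left : ∀ p ∈ S, p.1 ⊆ range X.r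
  right : ∀ p ∈ S, p.2 ⊆ range X.k
  card_left : ∀ p ∈ S, p.1.card = τ
  card_right : ∀ p ∈ S, p.2.card = τ
  avoid : ∀ p ∈ S, ∀ i ∈ p.1, x (X.b + i) = 0
  cover : ∀ p ∈ S, ∀ c < X.k, c ∉ p.2 → x (X.m + c) = 0

lemma coinWeight_nonneg (τ m : ℕ) : 0 ≤ coinWeight τ m :=
  mul_nonneg (pow_nonneg (rotProb_nonneg _ _) _) (pow_nonneg (sub_nonneg.2 (rotProb_le_one _ _)) _)

/-- The weight of a pair of masks. -/
noncomputable def maskWeight (X : Ctx) (τ : ℕ) : ℝ := coinWeight τ X.r * coinWeight τ X.k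

lemma maskWeight_nonneg (X : Ctx) (τ : ℕ) : 0 ≤ maskWeight X τ :=
  mul_nonneg (coinWeight_nonneg _ _) (coinWeight_nonneg _ _)

open Classical in
lemma Seeded.le_wp_pGuess {σ : Equiv.Perm (Fin X.n)} (h : Seeded X (permFun σ) Φ v x₀ D)
    (hX : Fits X) (hin : X.Binary) (hmk : X.m + X.k ≤ X.n)
    (hP : Param X.n X.m (sysMat X (permFun σ)) Φ P)
    (hx : ∀ l < X.m, ∑ j ∈ range X.n, sysMat X (permFun σ) l j * x j = sysMat X (permFun σ) l X.n)
    (hx0 : ∀ j < X.n, X.m + X.k ≤ j → x j = 0) (hw : countOnes x X.n = X.w)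
    {S : Finset (Finset ℕ × Finset ℕ)} (hS : Masks X x (D 4 0 0) S)
    (hhead : ∀ j < X.n, headPart X.n X.m Φ v j = headPart X.n X.m Φ x j)
    (htail : ∀ p ∈ S, ∀ c < X.k, tail X.n X.m X.r X.k X.b Φ v p.1 p.2 x₀ c = x (X.m + c))
    (hT : 1 ≤ √(maskWeight X (D 4 0 0)) * (X.top - 1 : ℕ)) {u : ℂ} (hu : ‖u‖ = 1) :
    ENNReal.ofReal (√(S.card * maskWeight X (D 4 0 0)) / 16) ≤
      wp X 0 pGuess [] won ⟨D, u • QState.zero X.qubits⟩ := by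
  rcases S.eq_empty_or_nonempty with rfl | hne
  · simp
  have hle : S.card * maskWeight X (D 4 0 0) ≤ searchProb X D := by
    refine le_searchProb hX S fun p hp => ⟨hS.left p hp, hS.right p hp, hS.card_left p hp,
      hS.card_right p hp, ?_⟩
    rw [← hw]
    refine countOnes_congr fun j hj => ?_
    rw [h.cand_coinW hX (hS.left p hp) (hS.right p hp) hj, hhead j hj, hP.eq_of_solves x hx j hj,
      add_assoc]
    congr 1
    rw [tailPart, sum_congr rfl fun c hc => by rw [htail p hp c (mem_range.1 hc)]]
    change _ + tailPart X.m X.k Φ (fun c => x (X.m + c)) j = _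
    rw [← sum_join hmk]
    refine sum_congr rfl fun c hc => ?_
    rw [join]
    grind
  have hcard : (1 : ℝ) ≤ S.card := by simp_all
  have h1 : maskWeight X (D 4 0 0) ≤ searchProb X D :=
    (le_mul_of_one_le_left (maskWeight_nonneg _ _) hcard).trans hle
  have h2 : 0 < maskWeight X (D 4 0 0) := by
    by_contra hc
    rw [Real.sqrt_eq_zero_of_nonpos (not_lt.1 hc), zero_mul] at hT
    grind
  refine (ENNReal.ofReal_le_ofReal (div_le_div_of_nonneg_right (Real.sqrt_le_sqrt hle)
    (by simp))).trans (wp_pGuess hX won hu (h2.trans_le h1) (hT.trans ?_)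
    fun D' u' w _ hw f hD hc => h.wins hX hin hmk hP hc (f 0 (by decide)) hD _)
  gcongr

/-- Concavity of the square root: on [0, g] it lies above its chord. This makes the bound linear in
N, so that only the mean of N over the random seeds is needed. -/
lemma sqrt_mul_ge {w : ℝ} {N g : ℕ} (hN : N ≤ g) : √(w / g) * N ≤ √(N * w) := by
  rcases N.eq_zero_or_pos with rfl | h0
  · simp
  have h1 : (0 : ℝ) < N := by simp_all
  have h2 : (N : ℝ) ≤ g := by simp_all
  rcases le_or_gt w 0 with hw | hw
  · simp_all [Real.sqrt_eq_zero_of_nonpos, div_nonpos_of_nonpos_of_nonneg, zero_mul, Real.sqrt_nonneg]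
  refine Real.le_sqrt_of_sq_le ?_
  rw [mul_pow, Real.sq_sqrt (by positivity), div_mul_eq_mul_div, div_le_iff₀ (h1.trans_le h2)]
  nlinarith [mul_le_mul_of_nonneg_left h2 (mul_pos hw h1).le]

open Classical in
-- A seed consists of a head and an offset, and N counts the masks for which it leads to x. Given
-- the seed and the right size τ, drawn with probability 1/(n + 1), the search succeeds with
-- probability at least √(N w)/16. After `sqrt_mul_ge` the sum over the seeds is exchanged with the
-- sum over the masks.
lemma Reduced.le_wp {σ : Equiv.Perm (Fin X.n)} (h : Reduced X (permFun σ) D)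
    (hX : Fits X) (hin : X.Binary) (hmk : X.m + X.k ≤ X.n) (hm : X.m = X.b + X.r)
    (hx : ∀ l < X.m, ∑ j ∈ range X.n, sysMat X (permFun σ) l j * x j = sysMat X (permFun σ) l X.n)
    (hx0 : ∀ j < X.n, X.m + X.k ≤ j → x j = 0) (hw : countOnes x X.n = X.w) {τ : ℕ}
    {S : Finset (Finset ℕ × Finset ℕ)} (hS : Masks X x τ S) (hτ : τ ≤ X.n)
    (hT : 1 ≤ √(maskWeight X τ) * (X.top - 1 : ℕ)) {u : ℂ} (hu : ‖u‖ = 1) :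
    ENNReal.ofReal (√(maskWeight X τ / S.card) / (16 * (X.n + 1)) * ∑ p ∈ S,
      1 / ((kerSet X.n X.m (sysMat X (permFun σ)) (range X.m)).card ^ 3 *
        (kerSet X.n X.m (sysMat X (permFun σ)) (openSet X.m X.r X.b p.1 p.2)).card : ℝ)) ≤
      wp X 0 (.seq pRandomize (.seq pSize pGuess)) [] won ⟨D, u • QState.zero X.qubits⟩ := by
  obtain ⟨h0, h8, Φ, P, hP, h13⟩ := h
  have hn := hX.n_lt
  have hk := hX.k_lt
  have hmn := Ctx.m_le hX
  set ψ := u • QState.zero X.qubits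
  set good : (Fin X.m → ZMod 2) → Prop := fun v =>
    ∀ j < X.n, headPart X.n X.m Φ (ext v) j = headPart X.n X.m Φ x j with hgood
  set hit : (Fin X.k → ZMod 2) → Finset ℕ × Finset ℕ → Prop := fun x₀ p =>
    ∀ c < X.k, tail X.n X.m X.r X.k X.b Φ x p.1 p.2 (ext x₀) c = x (X.m + c) with hhit
  set N : (Fin X.m → ZMod 2) × (Fin X.k → ZMod 2) → ℕ := fun s =>
    if good s.1 then (S.filter (hit s.2)).card else 0 with hN
  set k₀ := (kerSet X.n X.m (sysMat X (permFun σ)) (range X.m)).card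
  set k₁ := fun p : Finset ℕ × Finset ℕ =>
    (kerSet X.n X.m (sysMat X (permFun σ)) (openSet X.m X.r X.b p.1 p.2)).card
  -- For one mask the fraction of suitable seeds is at least the product of the bounds for head and
  -- tail; the powers of the first kernel, one and two, combine to the cube.
  have hcount : ∑ p ∈ S, 1 / (k₀ ^ 3 * k₁ p : ℝ) ≤ (1 / 2 ^ X.m * (1 / 2 ^ X.k)) * ∑ s, (N s : ℝ) := by
    have h1 : ∑ y, (S.filter (hit y)).card = ∑ p ∈ S, (univ.filter (hit · p)).card := by
      simp only [card_filter]; exact sum_comm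
    have e : ∑ s, N s = ∑ p ∈ S, (univ.filter good).card * (univ.filter (hit · p)).card := by
      rw [Fintype.sum_prod_type, ← mul_sum, ← h1, ← smul_eq_mul, ← sum_const, sum_filter]
      grind [sum_const_zero]
    have h2 : 2 ^ X.m ≤ (univ.filter good).card * k₀ := card_goodHead hP hmk x
    rw [← Nat.cast_sum, e, Nat.cast_sum, mul_sum]
    refine sum_le_sum fun p hp => ?_
    have h3 : 2 ^ X.k ≤ (univ.filter (hit · p)).card * (k₀ ^ 2 * k₁ p) :=
      card_goodTail hP hmk hm (hS.left p hp) hx (hS.avoid p hp) (hS.cover p hp) hx0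
    have h4 : 0 < k₀ := Nat.pos_of_mul_pos_left ((Nat.two_pow_pos _).trans_le h2)
    have h5 : 0 < k₁ p := Nat.pos_of_mul_pos_left (Nat.pos_of_mul_pos_left
      ((Nat.two_pow_pos _).trans_le h3))
    have h6 : (2 ^ X.m * 2 ^ X.k : ℝ) ≤ (univ.filter good).card * (univ.filter (hit · p)).card *
        (k₀ ^ 3 * k₁ p) := by
      have := Nat.mul_le_mul h2 h3
      rw [show ∀ a b c d : ℕ, a * c * (b * (c ^ 2 * d)) = a * b * (c ^ 3 * d) by grind] at this
      exact_mod_cast this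
    rw [div_mul_div_comm, one_mul, one_div_mul_eq_div, div_le_div_iff₀ (by positivity)
      (by simp), one_mul]
    grind
  have hreach : ∀ s ∈ (univ : Finset ((Fin X.m → ZMod 2) × (Fin X.k → ZMod 2))),
      Reach X X.qubits pRandomize [] (2⁻¹ ^ X.m * 2⁻¹ ^ X.k) D fun D' =>
        Seeded X (permFun σ) Φ (ext s.1) (ext s.2) D' ∧ (∀ j < X.m, D' 2 j 0 = (ext s.1 j).val) ∧
          ∀ j < X.k, D' 3 j 0 = (ext s.2 j).val := by
    intro s _
    refine Reach.seq ((reach_pBits hX (m := X.m) rfl (by omega) (ext s.1)).mono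
      fun D₁ ⟨f1, h1⟩ => ?_)
    rw [← mul_one (_ ^ X.k)]
    refine Reach.seq ((reach_pBits hX (m := X.k) rfl hk (ext s.2)).mono fun D₂ ⟨f2, h2⟩ => ?_)
    have e13 : D₂ 13 = D 13 := (f2 _ (by decide)).trans (f1 _ (by decide))
    refine (det_pShift hX fun j hj c hc => by grind).mono fun D₃ ⟨f3, h3⟩ => ?_
    have e2 : D₂ 2 = D₁ 2 := f2 _ (by decide)
    have e2' : D₃ 2 = D₁ 2 := (f3 _ (by decide)).trans e2
    have e3 : D₃ 3 = D₂ 3 := f3 _ (by decide)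
    have e0 : D₃ 0 = D 0 := (f3 _ (by decide)).trans ((f2 _ (by decide)).trans (f1 _ (by decide)))
    have e8 : D₃ 8 = D 8 := (f3 _ (by decide)).trans ((f2 _ (by decide)).trans (f1 _ (by decide)))
    refine ⟨⟨by rwa [e0], fun j hj c hc => ?_, fun j hj => ?_, fun c hc => ?_⟩, by grind,
      by rwa [e3]⟩
    · grind [natCast_val_bit]
    · grind [natCast_val_bit, headPart, sum_congr, mem_range, ZMod.natCast_zmod_val]
    grind [natCast_val_bit, ZMod.val_lt, ZMod.natCast_zmod_val]
  have hval : ∀ s ∈ (univ : Finset ((Fin X.m → ZMod 2) × (Fin X.k → ZMod 2))), ∀ D',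
      (Seeded X (permFun σ) Φ (ext s.1) (ext s.2) D' ∧ (∀ j < X.m, D' 2 j 0 = (ext s.1 j).val) ∧
          ∀ j < X.k, D' 3 j 0 = (ext s.2 j).val) →
      ((X.n + 1 : ℕ) : ℝ≥0∞)⁻¹ * ENNReal.ofReal (√(N s * maskWeight X τ) / 16) ≤
        wp X 0 (.seq pSize pGuess) [] won ⟨D', ψ⟩ := by
    rintro s - D' ⟨h1, -⟩
    obtain ⟨D'', e, h2⟩ := Reach.rnd (X := X) (q := X.qubits) (D := D') (v := []) (ρ := 4)
      (i := .const 0) (j := .const 0) (e := eN + .const 1) (m := X.n + 1) (x := τ) (P := fun D => D = D'.put 4 0 0 τ)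
      rfl hn (by omega) rfl
    refine le_trans ?_ (h2 ψ _)
    refine mul_le_mul_right ?_ _
    have e4 : D'' 4 0 0 = τ := by simp [e, Arr.put_apply]
    have e5 : ∀ ρ : Fin 16, ρ ≠ 4 → D'' ρ = D' ρ := fun ρ hρ => by
      funext i j; simp [e, Arr.put_apply, hρ]
    have hs := h1.congr (e5 0 (by decide)) (e5 8 (by decide)) (e5 9 (by decide)) (e5 3 (by decide))
    by_cases hg : good s.1
    · have hsub := filter_subset (hit s.2) S
      have htl : ∀ p ∈ S.filter (hit s.2), ∀ c < X.k,
          tail X.n X.m X.r X.k X.b Φ (ext s.1) p.1 p.2 (ext s.2) c = x (X.m + c) := by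
        intro p hp c hc
        rw [← (mem_filter.1 hp).2 c hc, tail, tail, tailSolution, tailSolution]
        congr 4
        funext i
        by_cases hi : i ∈ p.1
        · have := mem_range.1 (hS.left p (hsub hp) hi)
          grind
        grind
      have := hs.le_wp_pGuess hX hin hmk hP hx hx0 hw (S := S.filter (hit s.2))
        ⟨fun p hp => hS.left p (hsub hp), fun p hp => hS.right p (hsub hp),
          fun p hp => by rw [e4]; exact hS.card_left p (hsub hp),
          fun p hp => by rw [e4]; exact hS.card_right p (hsub hp),
          fun p hp => hS.avoid p (hsub hp), fun p hp => hS.cover p (hsub hp)⟩ hg htl (by rwa [e4]) hu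
      grind
    · simp [hN, hg]
  refine le_trans ?_ (wp_sum_reach univ _ _ (fun s => ((X.n + 1 : ℕ) : ℝ≥0∞)⁻¹ *
    ENNReal.ofReal (√(N s * maskWeight X τ) / 16)) (zero_normalized hu)
    (wp X 0 (.seq pSize pGuess) [] won) hreach ?_ hval)
  · have e1 : ∀ m : ℕ, (2⁻¹ : ℝ≥0∞) ^ m = ENNReal.ofReal (1 / 2 ^ m) := fun m => by
      rw [one_div, ← inv_pow, ENNReal.ofReal_pow (by simp),
        ENNReal.ofReal_inv_of_pos two_pos, ENNReal.ofReal_ofNat]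
    have e2 : ((X.n + 1 : ℕ) : ℝ≥0∞)⁻¹ = ENNReal.ofReal (1 / (X.n + 1 : ℕ)) := by
      rw [one_div, ENNReal.ofReal_inv_of_pos (by grind), ENNReal.ofReal_natCast]
    simp only [e1, e2]
    simp only [← ENNReal.ofReal_mul (show (0 : ℝ) ≤ 1 / (X.n + 1 : ℕ) by positivity),
      ← ENNReal.ofReal_mul (show (0 : ℝ) ≤ 1 / 2 ^ X.m by simp),
      ← ENNReal.ofReal_mul (show (0 : ℝ) ≤ 1 / 2 ^ X.m * (1 / 2 ^ X.k) by simp)]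
    rw [← ENNReal.ofReal_sum_of_nonneg fun _ _ => by positivity, ← mul_sum]
    refine ENNReal.ofReal_le_ofReal ?_
    refine (mul_le_mul_of_nonneg_left hcount (by positivity)).trans ?_
    rw [mul_left_comm]
    refine mul_le_mul_of_nonneg_left ?_ (by simp)
    rw [mul_sum]
    refine sum_le_sum fun s _ => ?_
    have hle : N s ≤ S.card := by grind
    have := sqrt_mul_ge (w := maskWeight X τ) hle
    rw [div_mul_eq_mul_div, div_mul_div_comm, one_mul, mul_comm (_ : ℝ) 16]
    push_cast
    gcongr
  · rintro s - s' - D' ⟨-, a1, a2⟩ ⟨-, b1, b2⟩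
    refine Prod.ext (funext fun j => ?_) (funext fun j => ?_)
    · rw [← ext_val s.1, ← ext_val s'.1]
      grind [ZMod.val_injective]
    · rw [← ext_val s.2, ← ext_val s'.2]
      grind [ZMod.val_injective]

/-! ## Kernels of random parity-check matrices -/

section kernels
variable {n m : ℕ}

open Classical in
/-- The vectors in the kernel of `H` that vanish outside `J`. -/
noncomputable def kernelOn (H : Matrix (Fin m) (Fin n) (ZMod 2)) (J : Finset (Fin n)) :
    Finset (Fin n → ZMod 2) := univ.filter fun z => (∀ j, j ∉ J → z j = 0) ∧ H *ᵥ z = 0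

/-- The matrices with linearly independent rows. -/
def FullRank (H : Matrix (Fin m) (Fin n) (ZMod 2)) : Prop := ∀ c : Fin m → ZMod 2, c ᵥ* H = 0 → c = 0

lemma fullRank_iff (H : Matrix (Fin m) (Fin n) (ZMod 2)) : FullRank H ↔ H.rank = m := by
  have h : LinearIndependent (ZMod 2) H.row ↔ FullRank H := by
    rw [← Matrix.vecMul_injective_iff]
    exact injective_iff_map_eq_zero H.vecMulLinear
  rw [← h]
  refine ⟨fun h => by rw [h.rank_matrix, Fintype.card_fin], fun h => ?_⟩
  rw [linearIndependent_iff_card_eq_finrank_span, Fintype.card_fin, Set.finrank,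
    ← H.rank_eq_finrank_span_row, h]

lemma dual_dotProduct (φ : (Fin n → ZMod 2) →ₗ[ZMod 2] ZMod 2) (z : Fin n → ZMod 2) :
    (fun j => φ (Pi.single j 1)) ⬝ᵥ z = φ z := by
  rw [φ.pi_apply_eq_sum_univ z]
  refine sum_congr rfl fun j _ => ?_
  rw [smul_eq_mul, mul_comm]
  congr 1
  exact congrArg φ (funext fun i => by grind)

/-- A relation between the rows of the new matrix, evaluated at y, annihilates c. Then the
perturbation disappears and the relation holds for the old rows. -/
lemma FullRank.add {H : Matrix (Fin m) (Fin n) (ZMod 2)} (hH : FullRank H) {y : Fin n → ZMod 2}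
    (hy : H *ᵥ y = 0) {φ : (Fin n → ZMod 2) →ₗ[ZMod 2] ZMod 2} (hφ : φ y = 1) (c : Fin m → ZMod 2) :
    FullRank (H + Matrix.vecMulVec c fun j => φ (Pi.single j 1)) := by
  intro a ha
  have h1 : (a ᵥ* (H + Matrix.vecMulVec c fun j => φ (Pi.single j 1))) ⬝ᵥ y = 0 := by simp_all
  rw [← Matrix.dotProduct_mulVec, Matrix.add_mulVec, hy, zero_add, Matrix.vecMulVec_mulVec,
    dual_dotProduct, hφ] at h1
  have h2 : a ⬝ᵥ c = 0 := by simp_all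
  rw [Matrix.vecMul_add, Matrix.vecMul_vecMulVec, h2] at ha
  exact hH a (by simp_all)

open Classical in
-- A functional φ that kills the given vectors but not y allows a rank-one change of H that keeps
-- the conditions on these vectors and the rank, while moving H y to an arbitrary c. Since c can be
-- read off, each H with H y = 0 gives 2^m different matrices.
lemma card_mulVec_eq_zero {ι : Type*} (ys : ι → Fin n → ZMod 2) {y : Fin n → ZMod 2}
    (hy : y ∉ Submodule.span (ZMod 2) (Set.range ys)) :
    2 ^ m * (univ.filter fun H : Matrix (Fin m) (Fin n) (ZMod 2) =>
      (FullRank H ∧ ∀ i, H *ᵥ ys i = 0) ∧ H *ᵥ y = 0).card ≤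
    (univ.filter fun H : Matrix (Fin m) (Fin n) (ZMod 2) =>
      FullRank H ∧ ∀ i, H *ᵥ ys i = 0).card := by
  obtain ⟨φ, h1, h2⟩ := Submodule.exists_le_ker_of_notMem hy
  have hφ : φ y = 1 := zmod2_eq_one h1
  have hc : (univ : Finset (Fin m → ZMod 2)).card = 2 ^ m := by simp
  have hz : ∀ (H : Matrix (Fin m) (Fin n) (ZMod 2)) (c : Fin m → ZMod 2) z,
      (H + Matrix.vecMulVec c fun j => φ (Pi.single j 1)) *ᵥ z = H *ᵥ z + φ z • c := fun H c z => by
    simp [Matrix.add_mulVec, Matrix.vecMulVec_mulVec, dual_dotProduct]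
  rw [← hc, ← card_product]
  refine card_le_card_of_injOn (fun p => p.2 + Matrix.vecMulVec p.1 fun j => φ (Pi.single j 1))
    (fun p hp => ?_) fun p hp p' hp' e => ?_
  · simp only [coe_product, coe_univ, coe_filter, mem_univ, true_and, Set.mem_prod, Set.mem_univ,
      Set.mem_setOf_eq] at hp ⊢
    refine ⟨hp.1.1.add hp.2 hφ _, fun i => ?_⟩
    rw [hz, hp.1.2, h2 (Submodule.subset_span ⟨i, rfl⟩), zero_smul, zero_add]
  · simp only [coe_product, coe_univ, coe_filter, mem_univ, true_and, Set.mem_prod, Set.mem_univ,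
      Set.mem_setOf_eq] at hp hp'
    have e1 : p.1 = p'.1 := by
      have := congrArg (· *ᵥ y) e
      simpa [hz, hp.2, hp'.2, hφ] using this
    refine Prod.ext e1 ?_
    simp_all

open Classical in
-- Expand the power as a sum over μ-tuples of kernel vectors. A further vector either lies in their
-- span, which has at most 2^μ elements, or is in the kernel for a fraction of at most 2^(-m) of the
-- matrices. At most 2^m vectors are supported on J, so the second case contributes at most one.
lemma sum_card_kernelOn_pow_succ {J : Finset (Fin n)} (hJ : J.card ≤ m) (μ : ℕ) :
    ∑ H : Matrix (Fin m) (Fin n) (ZMod 2) with FullRank H, (kernelOn H J).card ^ (μ + 1) ≤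
      (2 ^ μ + 1) * ∑ H : Matrix (Fin m) (Fin n) (ZMod 2) with FullRank H, (kernelOn H J).card ^ μ := by
  set V : Finset (Fin n → ZMod 2) := univ.filter fun z => ∀ j, j ∉ J → z j = 0 with hV
  have hVc : V.card ≤ 2 ^ m := by
    have : V.card ≤ (univ : Finset (J → ZMod 2)).card := by
      refine card_le_card_of_injOn (fun z j => z j) (fun _ _ => mem_coe.2 (mem_univ _))
        fun z hz z' hz' e => funext fun j => ?_
      by_cases hj : j ∈ J
      · exact congrFun e ⟨j, hj⟩
      grind
    refine this.trans ?_
    simpa using Nat.pow_le_pow_right two_pos hJ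
  set Q : (Fin μ → Fin n → ZMod 2) → Finset (Matrix (Fin m) (Fin n) (ZMod 2)) := fun ys =>
    univ.filter fun H => FullRank H ∧ ∀ i, H *ᵥ ys i = 0 with hQ
  set Y : Finset (Fin μ → Fin n → ZMod 2) := Fintype.piFinset fun _ => V with hY
  have hpow : ∀ f : Matrix (Fin m) (Fin n) (ZMod 2) → ℕ, ∑ H : Matrix (Fin m) (Fin n) (ZMod 2) with
      FullRank H, (kernelOn H J).card ^ μ * f H = ∑ ys ∈ Y, ∑ H ∈ Q ys, f H := by
    intro f
    rw [sum_comm' (t' := univ.filter FullRank)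
      (s' := fun H => Fintype.piFinset fun _ : Fin μ => kernelOn H J)]
    · simp
    · simp only [hY, hQ, hV, Fintype.mem_piFinset, kernelOn, mem_filter, mem_univ, true_and]
      grind
  have h1 := hpow fun H => (kernelOn H J).card
  have h2 := hpow fun _ => 1
  simp only [mul_one, ← pow_succ] at h1 h2
  rw [h1, h2, mul_sum]
  refine sum_le_sum fun ys _ => ?_
  rw [sum_const, smul_eq_mul, mul_one]
  set U : Finset (Fin n → ZMod 2) :=
    univ.filter fun y => y ∈ Submodule.span (ZMod 2) (Set.range ys) with hU
  have hUc : U.card ≤ 2 ^ μ := by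
    have : U ⊆ (univ : Finset (Fin μ → ZMod 2)).image fun c => ∑ i, c i • ys i := by
      intro y hy
      obtain ⟨c, hc⟩ := (Submodule.mem_span_range_iff_exists_fun _).1 (mem_filter.1 hy).2
      exact mem_image.2 ⟨c, mem_univ _, hc⟩
    simpa using (card_le_card this).trans card_image_le
  have h3 : ∑ H ∈ Q ys, (kernelOn H J).card = ∑ y ∈ V, ((Q ys).filter fun H => H *ᵥ y = 0).card := by
    simp only [kernelOn, ← filter_filter, ← hV]
    simp only [card_filter]
    exact sum_comm
  rw [h3, ← sum_filter_add_sum_filter_not V (· ∈ U), add_mul, one_mul]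
  refine add_le_add ?_ ?_
  · refine (sum_le_card_nsmul _ _ _ fun y _ => card_filter_le _ _).trans ?_
    exact Nat.mul_le_mul_right _ ((card_le_card fun y hy => (mem_filter.1 hy).2).trans hUc)
  · refine Nat.le_of_mul_le_mul_left ?_ (Nat.two_pow_pos m)
    rw [mul_sum]
    refine (sum_le_card_nsmul _ _ (Q ys).card fun y hy => ?_).trans
      (Nat.mul_le_mul_right _ ((card_filter_le _ _).trans hVc))
    have := card_mulVec_eq_zero (m := m) ys fun h => (mem_filter.1 hy).2
      (mem_filter.2 ⟨mem_univ y, h⟩)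
    rw [filter_filter]
    grind

open Classical in
-- Here 270 = 2 · 3 · 5 · 9 is the product of 2^μ + 1 for μ < 4.
lemma sum_card_kernelOn_pow_four {J : Finset (Fin n)} (hJ : J.card ≤ m) :
    ∑ H : Matrix (Fin m) (Fin n) (ZMod 2) with FullRank H, (kernelOn H J).card ^ 4 ≤
      270 * (univ.filter (FullRank (n := n) (m := m))).card := by
  have h := fun μ => sum_card_kernelOn_pow_succ hJ μ
  obtain ⟨S, hS⟩ : ∃ S : ℕ → ℕ, ∀ μ, S μ = ∑ H : Matrix (Fin m) (Fin n) (ZMod 2) with FullRank H,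
      (kernelOn H J).card ^ μ := ⟨_, fun _ => rfl⟩
  have e := hS 0
  simp only [pow_zero, sum_const, smul_eq_mul, mul_one] at e
  simp only [← hS] at h ⊢
  grind

end kernels

/-! ## Binomial coefficients -/

lemma choose_mul_choose_symm (r s τ : ℕ) :
    r.choose s * (r - s).choose τ = r.choose τ * (r - τ).choose s := by
  have h1 := Nat.choose_mul (n := r) (Nat.le_add_right s τ)
  have h2 := Nat.choose_mul (n := r) (Nat.le_add_left τ s)
  grind [Nat.add_sub_cancel_left, Nat.add_sub_cancel, Nat.choose_symm_add]

/-- Sum C(k,τ) C(r,ρ) C(τ,j) C(ρ,i) over τ + ρ = r and j + i = t. Vandermonde's identity, applied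
twice, gives C(k+r,r) C(r,t), and some term is at least the average. In this term C(k,τ) C(r,ρ) ≤
C(k+r,r) gives the first bound. For the second, the nested subsets are chosen in the other order on
both sides, and C(k-j,τ-j) C(r-i,ρ-i) ≤ C(k+r-t,r-t) is cancelled. -/
lemma exists_parameters {r k t : ℕ} (ht : t ≤ r) : ∃ τ j, τ ≤ r ∧ τ ≤ k ∧ j ≤ τ ∧ j ≤ t ∧
    t - j ≤ r - τ ∧ r.choose t ≤ (r + k + 1) ^ 2 * (τ.choose j * (r - τ).choose (t - j)) ∧
    (r + k).choose t ≤ (r + k + 1) ^ 2 * (k.choose j * r.choose (t - j)) := by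
  have hV : ∑ x ∈ antidiagonal r ×ˢ antidiagonal t, k.choose x.1.1 * r.choose x.1.2 *
      (x.1.1.choose x.2.1 * x.1.2.choose x.2.2) = (k + r).choose r * r.choose t := by
    rw [sum_product, Nat.add_choose_eq, sum_mul]
    grind [sum_congr, HasAntidiagonal.mem_antidiagonal, Nat.add_choose_eq, mul_sum]
  obtain ⟨⟨⟨τ, ρ⟩, ⟨j, i⟩⟩, hx, hle⟩ := exists_le_of_sum_le
    (s := antidiagonal r ×ˢ antidiagonal t) (f := fun _ => (k + r).choose r * r.choose t)
    (g := fun x => (antidiagonal r ×ˢ antidiagonal t).card * (k.choose x.1.1 * r.choose x.1.2 *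
      (x.1.1.choose x.2.1 * x.1.2.choose x.2.2)))
    ⟨⟨(0, r), (0, t)⟩, by simp⟩ (by rw [sum_const, ← mul_sum, hV, smul_eq_mul])
  simp only [mem_product, HasAntidiagonal.mem_antidiagonal, card_product, Nat.card_antidiagonal] at hx hle
  obtain ⟨rfl, rfl⟩ := hx
  set r := τ + ρ
  set t := j + i
  have hN : (r + 1) * (t + 1) ≤ (r + k + 1) ^ 2 := by
    rw [sq]; exact Nat.mul_le_mul (by omega) (by omega)
  have hpos : 0 < (k + r).choose r * r.choose t :=
    Nat.mul_pos (Nat.choose_pos (by omega)) (Nat.choose_pos ht)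
  have hτk : τ ≤ k := by grind
  have hjτ : j ≤ τ := by grind
  have hiρ : i ≤ ρ := by grind
  have hV1 : ∀ a b c d : ℕ, a.choose c * b.choose d ≤ (a + b).choose (c + d) := fun a b c d => by
    rw [Nat.add_choose_eq]
    exact single_le_sum (f := fun x : ℕ × ℕ => a.choose x.1 * b.choose x.2)
      (fun _ _ => Nat.zero_le _) (HasAntidiagonal.mem_antidiagonal.2 (show (c, d).1 + (c, d).2 = c + d from rfl))
  refine ⟨τ, j, by omega, hτk, hjτ, by omega, by omega, ?_, ?_⟩
  · rw [show r - τ = ρ by omega, show t - j = i by omega]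
    refine Nat.le_of_mul_le_mul_left (hle.trans ?_) (Nat.choose_pos (show r ≤ k + r by omega))
    calc (r + 1) * (t + 1) * (k.choose τ * r.choose ρ * (τ.choose j * ρ.choose i))
        ≤ (r + k + 1) ^ 2 * ((k + r).choose r * (τ.choose j * ρ.choose i)) := by gcongr; grind
      _ = _ := by ring
  · rw [show t - j = i by omega]
    have e1 := Nat.choose_mul (n := k) hjτ
    have e2 := Nat.choose_mul (n := r) hiρ
    have e3 := Nat.choose_mul (n := k + r) ht
    have e4 := hV1 (k - j) (r - i) (τ - j) (ρ - i)
    rw [show k - j + (r - i) = k + r - t by omega, show τ - j + (ρ - i) = r - t by omega] at e4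
    rw [add_comm r k]
    refine Nat.le_of_mul_le_mul_right ?_ (Nat.choose_pos (show r - t ≤ k + r - t by omega))
    rw [← e3]
    refine hle.trans ?_
    calc (r + 1) * (t + 1) * (k.choose τ * r.choose ρ * (τ.choose j * ρ.choose i))
        = (r + 1) * (t + 1) * ((k.choose τ * τ.choose j) * (r.choose ρ * ρ.choose i)) := by ring
      _ = (r + 1) * (t + 1) * (k.choose j * r.choose i *
          ((k - j).choose (τ - j) * (r - i).choose (ρ - i))) := by grind
      _ ≤ (r + k + 1) ^ 2 * (k.choose j * r.choose i * (k + r - t).choose (r - t)) := by gcongr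
      _ = _ := by ring

/-- In the binomial expansion of (τ + (m - τ))^m the term with index τ is the largest of the m + 1
terms. -/
lemma pow_self_le_choose {τ m : ℕ} (h : τ ≤ m) :
    m ^ m ≤ (m + 1) * (m.choose τ * (τ ^ τ * (m - τ) ^ (m - τ))) := by
  set f : ℕ → ℕ := fun i => τ ^ i * (m - τ) ^ (m - i) * m.choose i with hf
  have up : ∀ i, i < τ → f i ≤ f (i + 1) := fun i hi => by
    have h1 := Nat.choose_succ_right_eq m i
    simp only [hf]
    rw [show m - i = m - (i + 1) + 1 by omega, pow_succ, pow_succ]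
    have : m.choose i * (m - τ) ≤ m.choose (i + 1) * τ := calc _ ≤ m.choose i * (m - i) := by gcongr
        _ = _ := h1.symm
        _ ≤ _ := by gcongr; omega
    calc _ = τ ^ i * (m - τ) ^ (m - (i + 1)) * (m.choose i * (m - τ)) := by ring
      _ ≤ τ ^ i * (m - τ) ^ (m - (i + 1)) * (m.choose (i + 1) * τ) := by gcongr
      _ = _ := by ring
  have down : ∀ i, τ ≤ i → i < m → f (i + 1) ≤ f i := fun i hi him => by
    have h1 := Nat.choose_succ_right_eq m i
    simp only [hf]
    rw [show m - i = m - (i + 1) + 1 by omega, pow_succ, pow_succ]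
    have : m.choose (i + 1) * τ ≤ m.choose i * (m - τ) :=
      calc _ ≤ m.choose (i + 1) * (i + 1) := by gcongr; omega
        _ = _ := h1
        _ ≤ _ := by gcongr
    calc _ = τ ^ i * (m - τ) ^ (m - (i + 1)) * (m.choose (i + 1) * τ) := by ring
      _ ≤ τ ^ i * (m - τ) ^ (m - (i + 1)) * (m.choose i * (m - τ)) := by gcongr
      _ = _ := by ring
  have le1 : ∀ d, d ≤ τ → f (τ - d) ≤ f τ := fun d => by
    induction d with
    | zero => simp
    | succ d ih =>
      intro hd
      grind
  have le2 : ∀ d, τ + d ≤ m → f (τ + d) ≤ f τ := fun d => by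
    induction d with
    | zero => simp
    | succ d ih => grind
  have hsum : ∑ i ∈ range (m + 1), f i = m ^ m := by grind [add_pow, Nat.add_sub_cancel']
  rw [← hsum]
  refine (sum_le_card_nsmul _ _ (f τ) fun i hi => ?_).trans ?_
  · rcases le_total i τ with h' | h'
    · simpa [Nat.sub_sub_self h'] using le1 (τ - i) (by omega)
    grind [Nat.add_sub_cancel']
  · rw [card_range, smul_eq_mul]
    grind

/-- Equivalently, m coins of bias τ/m show exactly τ ones with probability at least 1/(m + 1). So
independent coins, which are easy to prepare, replace a uniform superposition of subsets at
polynomial loss. -/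
lemma coinWeight_ge {τ m : ℕ} (h : τ ≤ m) : 1 / ((m + 1) * m.choose τ : ℝ) ≤ coinWeight τ m := by
  have hc : (0 : ℝ) < m.choose τ := by simp_all [Nat.choose_pos]
  rcases m.eq_zero_or_pos with rfl | hm
  · simp_all [coinWeight]
  have hm' : (0 : ℝ) < m := by simp_all
  have hr : rotProb τ m = (τ : ℝ) / m := by simp_all [rotProb, min_eq_left, div_le_one]
  have hs : 1 - (τ : ℝ) / m = ((m - τ : ℕ) : ℝ) / m := by grind [Nat.cast_sub]
  have := pow_self_le_choose h
  have h2 : (m : ℝ) ^ m ≤ (m + 1) * (m.choose τ * (τ ^ τ * ((m - τ : ℕ) : ℝ) ^ (m - τ))) := by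
    exact_mod_cast this
  rw [coinWeight, hr, hs, div_pow, div_pow, div_mul_div_comm, ← pow_add, Nat.add_sub_cancel' h,
    div_le_div_iff₀ (by positivity) (by positivity), one_mul]
  linarith

/-! ## Good permutations -/

section permutations
variable {n : ℕ}

/-- All sets of the right size are equally likely: composing with a permutation that carries one to
the other maps the corresponding permutations injectively. -/
lemma card_preimage_mul_choose (p : Fin n → Prop) [DecidablePred p] {T : Finset (Fin n)}
    (hT : T.card = (univ.filter p).card) :
    (univ.filter fun σ : Equiv.Perm (Fin n) => univ.filter (fun i => p (σ i)) = T).card *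
      n.choose T.card = n.factorial := by
  set F : Finset (Fin n) → Finset (Equiv.Perm (Fin n)) := fun T =>
    univ.filter fun σ => univ.filter (fun i => p (σ i)) = T with hF
  have hle : ∀ T T' : Finset (Fin n), T.card = T'.card → (F T).card ≤ (F T').card := by
    intro T T' h
    set ρ : Equiv.Perm (Fin n) := (equivOfCardEq h.symm).extendSubtype with hρ
    have hmem : ∀ i, ρ i ∈ T ↔ i ∈ T' := fun i => by
      by_cases hi : i ∈ T'
      · simp_all [iff_of_true, Equiv.extendSubtype_mem]
      simp_all [iff_of_false, Equiv.extendSubtype_not_mem]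
    refine card_le_card_of_injOn (fun σ => ρ.trans σ) (fun σ hσ => ?_) fun σ _ σ' _ e => ?_
    · grind
    · ext i
      simpa using congrArg (fun f : Equiv.Perm (Fin n) => (f (ρ.symm i) : ℕ)) e
  have hsum : ∑ T' ∈ powersetCard T.card univ, (F T').card = n.factorial := by
    rw [← card_eq_sum_card_fiberwise (s := univ) (fun σ _ => ?_), card_univ, Fintype.card_perm,
      Fintype.card_fin]
    refine mem_coe.2 (mem_powersetCard.2 ⟨subset_univ _, ?_⟩)
    rw [hT, ← card_map σ.toEmbedding]
    congr 1
    ext i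
    simp
  rw [sum_congr rfl fun T' hT' => le_antisymm (hle T' T (mem_powersetCard.1 hT').2)
    (hle T T' (mem_powersetCard.1 hT').2.symm), sum_const, card_powersetCard, card_univ,
    Fintype.card_fin, smul_eq_mul] at hsum
  grind

variable (m b r k i j : ℕ) (e : Fin n → ZMod 2)

/-- The permuted vector. -/
def permVec (σ : Equiv.Perm (Fin n)) (c : ℕ) : ZMod 2 := ext e (permFun σ c)

/-- The ones of a vector among `r` coordinates from `b` on. -/
def ones (x : ℕ → ZMod 2) (b r : ℕ) : Finset ℕ := (range r).filter fun i => x (b + i) = 1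

/-- The permutations for which the search is successful. -/
def goodPerms : Finset (Equiv.Perm (Fin n)) := univ.filter fun σ =>
  (∀ c : Fin n, m + k ≤ c → permVec e σ c = 0) ∧ (ones (permVec e σ) b r).card = i ∧
    (ones (permVec e σ) m k).card = j

variable {m b r k i j e}

/-- The triples of p, i and j positions in the three blocks give disjoint classes of permutations,
each of size n!/C(n, p+i+j). -/
lemma card_goodPerms {p : ℕ} (hm : m = b + r) (hmk : m + k ≤ n) (he : hammingNorm e = p + i + j) :
    n.factorial * (b.choose p * (r.choose i * k.choose j)) ≤
      (goodPerms m b r k i j e).card * n.choose (p + i + j) := by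
  set T : Finset ℕ × Finset ℕ × Finset ℕ → Finset ℕ := fun x =>
    x.1 ∪ x.2.1.image (b + ·) ∪ x.2.2.image (m + ·) with hT
  set S := powersetCard p (range b) ×ˢ powersetCard i (range r) ×ˢ powersetCard j (range k) with hS
  have hmem : ∀ x ∈ S, (∀ c < b, c ∈ T x ↔ c ∈ x.1) ∧ (∀ c < r, b + c ∈ T x ↔ c ∈ x.2.1) ∧
      (∀ c, m + c ∈ T x ↔ c ∈ x.2.2) ∧ (∀ c ∈ T x, c < m + k) ∧ (T x).card = p + i + j := by
    rintro ⟨A, B, C⟩ hx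
    simp only [hS, mem_product, mem_powersetCard] at hx
    obtain ⟨⟨hA, cA⟩, ⟨hB, cB⟩, hC, cC⟩ := hx
    grind [card_union_of_disjoint, card_image_of_injective, add_right_injective, disjoint_left, mem_image, mem_union]
  have hSc : S.card = b.choose p * (r.choose i * k.choose j) := by simp [hS]
  set F : Finset ℕ × Finset ℕ × Finset ℕ → Finset (Equiv.Perm (Fin n)) := fun x =>
    univ.filter fun σ => ∀ c : Fin n, permVec e σ c = 1 ↔ (c : ℕ) ∈ T x with hF
  have hFc : ∀ x ∈ S, (F x).card * n.choose (p + i + j) = n.factorial := by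
    intro x hx
    obtain ⟨-, -, -, h4, h5⟩ := hmem x hx
    have hn : ∀ c ∈ T x, c < n := fun c hc => (h4 c hc).trans_le hmk
    have hcard : ((T x).attachFin hn).card = p + i + j := by rw [card_attachFin, h5]
    have := card_preimage_mul_choose (fun c => e c = 1) (T := (T x).attachFin hn) (by
      rw [hcard, ← he, hammingNorm]
      congr 1
      ext c
      simp only [mem_filter, mem_univ, true_and]
      exact ⟨zmod2_eq_one, fun h => by grind⟩)
    rw [hcard] at this
    rw [← this]
    congr 2
    simp only [hF, mem_filter, mem_univ, true_and, Finset.ext_iff, mem_attachFin, permVec,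
      permFun_val, ext_val]
  rw [← hSc, mul_comm, ← smul_eq_mul, ← sum_const, ← sum_congr rfl hFc, ← sum_mul]
  refine Nat.mul_le_mul_right _ ?_
  have hper : ∀ x ∈ S, ∀ σ ∈ F x, (x.1 = ones (permVec e σ) 0 b ∧ x.2.1 = ones (permVec e σ) b r ∧
      x.2.2 = ones (permVec e σ) m k) ∧ ∀ c : Fin n, m + k ≤ c → permVec e σ c = 0 := by
    intro x hx σ hσ
    obtain ⟨h1, h2, h3, h4, -⟩ := hmem x hx
    have hσ' : ∀ c < n, permVec e σ c = 1 ↔ c ∈ T x := fun c hc => (mem_filter.1 hσ).2 ⟨c, hc⟩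
    refine ⟨⟨?_, ?_, ?_⟩, fun c hc => ?_⟩
    · grind [ones, mem_filter, mem_range, zero_add]
    · grind [ones, mem_filter, mem_range]
    · grind [ones, mem_filter, mem_range]
    · by_contra hne
      have := h4 c ((hσ' c c.2).1 (zmod2_eq_one hne))
      omega
  rw [← card_biUnion]
  · refine card_le_card fun σ hσ => ?_
    obtain ⟨x, hx, hσ⟩ := mem_biUnion.1 hσ
    obtain ⟨⟨-, h2, h3⟩, h4⟩ := hper x hx σ hσ
    exact mem_filter.2 ⟨mem_univ _, h4, by grind, by grind⟩
  · intro x hx y hy hne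
    grind [disjoint_left, Prod.ext]

end permutations

/-- The masks for which the search finds the vector `x`. -/
def goodMasks (m b r k τ j : ℕ) (x : ℕ → ZMod 2) : Finset (Finset ℕ × Finset ℕ) :=
  powersetCard τ (range r \ ones x b r) ×ˢ
    (powersetCard (τ - j) (range k \ ones x m k)).image (ones x m k ∪ ·)

lemma goodMasks_spec {X : Ctx} {τ j : ℕ} {x : ℕ → ZMod 2} (hj : j ≤ τ)
    (hx : (ones x X.m X.k).card = j) :
    Masks X x τ (goodMasks X.m X.b X.r X.k τ j x) ∧ (goodMasks X.m X.b X.r X.k τ j x).card =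
        (X.r - (ones x X.b X.r).card).choose τ * (X.k - j).choose (τ - j) := by
  have hs : ∀ b r, ones x b r ⊆ range r := fun b r => filter_subset _ _
  have hd : ∀ K ∈ powersetCard (τ - j) (range X.k \ ones x X.m X.k), Disjoint (ones x X.m X.k) K :=
    fun K hK => disjoint_sdiff.mono_right (mem_powersetCard.1 hK).1
  have key : ∀ p ∈ goodMasks X.m X.b X.r X.k τ j x, (p.1 ⊆ range X.r \ ones x X.b X.r ∧
      p.1.card = τ) ∧ ∃ K ∈ powersetCard (τ - j) (range X.k \ ones x X.m X.k),
        ones x X.m X.k ∪ K = p.2 := fun p hp => by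
    simp_all [goodMasks, mem_product, mem_powersetCard, mem_image]
  refine ⟨⟨fun p hp => (key p hp).1.1.trans sdiff_subset, fun p hp => ?_, fun p hp => (key p hp).1.2,
    fun p hp => ?_, fun p hp i hi => ?_, fun p hp c hc hcp => ?_⟩, ?_⟩
  · grind
  · grind [card_union_of_disjoint, mem_powersetCard]
  · have := mem_sdiff.1 ((key p hp).1.1 hi)
    by_contra h
    exact this.2 (mem_filter.2 ⟨this.1, zmod2_eq_one h⟩)
  · obtain ⟨-, K, hK, h⟩ := key p hp
    by_contra h'
    rw [← h] at hcp
    exact hcp (mem_union_left _ (mem_filter.2 ⟨mem_range.2 hc, zmod2_eq_one h'⟩))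
  · rw [goodMasks, card_product, card_powersetCard, card_image_of_injOn, card_powersetCard,
      card_sdiff_of_subset (hs _ _), card_sdiff_of_subset (hs _ _), hx, card_range, card_range]
    intro K hK K' hK' e
    rw [← (hd K hK).sup_sdiff_cancel_left, ← (hd K' hK').sup_sdiff_cancel_left]
    grind

/-! ## The success probability of a trial -/

/-- The context for a syndrome decoding instance. -/
noncomputable def codeCtx (n κ w a b p : ℕ) (H : Matrix (Fin (n - κ)) (Fin n) (ZMod 2))
    (s : Fin (n - κ) → ZMod 2) : Ctx where
  inp
    | 0 => n
    | 1 => κ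
    | 2 => w
    | 3 => a
    | 4 => b
    | 5 => p
    | c + 6 => if c + 6 < (n + 4) * (n + 4) then (initState 0 n κ w a b p H s).mem (c + 6) else n
  lg := 2 * n + 8

section codeCtx
variable {n κ w a b p : ℕ} {H : Matrix (Fin (n - κ)) (Fin n) (ZMod 2)} {s : Fin (n - κ) → ZMod 2}

lemma initState_mem_six (c : ℕ) : (initState 0 n κ w a b p H s).mem (c + 6) =
    ((List.ofFn fun t : Fin ((n - κ) * n) => (H t.divNat t.modNat).val) ++
      List.ofFn fun i => (s i).val).getD c 0 := by
  have : (List.finRange (n - κ)).flatMap (fun i => List.ofFn fun j => (H i j).val) =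
      List.ofFn fun t : Fin ((n - κ) * n) => (H t.divNat t.modNat).val := by
    rw [List.ofFn_mul, List.flatMap_def, ← List.ofFn_eq_map]
    congr 2
    funext i
    congr 1
    funext j
    have hn : 0 < n := j.pos
    congr 2 <;> apply Fin.ext
    · simp_all [Fin.coe_divNat, Nat.mul_add_div, mul_comm, Nat.add_mul_div_left, Nat.div_eq_of_lt]
    simp [Fin.coe_modNat, Nat.mod_eq_of_lt]
  simp only [initState, this, List.cons_append, List.nil_append, List.getD_cons_succ]

lemma initState_row {l j : ℕ} (hl : l < n - κ) (hj : j < n) :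
    (initState 0 n κ w a b p H s).mem (l * n + j + 6) = (H ⟨l, hl⟩ ⟨j, hj⟩).val := by
  have h : l * n + j < (n - κ) * n := by
    calc l * n + j < (l + 1) * n := by grind
      _ ≤ _ := Nat.mul_le_mul_right _ hl
  rw [initState_mem_six, List.getD_append _ _ _ _ (by grind), List.getD_eq_getElem _ _
    (by grind), List.getElem_ofFn]
  congr 2 <;> apply Fin.ext
  · grind [Fin.coe_divNat, mul_comm, Nat.mul_add_div, Nat.div_eq_of_lt, add_zero]
  simp_all [Fin.coe_modNat, Nat.mul_add_mod_self_right, Nat.mod_eq_of_lt]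

lemma initState_syndrome {l : ℕ} (hl : l < n - κ) :
    (initState 0 n κ w a b p H s).mem ((n - κ) * n + l + 6) = (s ⟨l, hl⟩).val := by
  simp_all [initState_mem_six, List.getD_append_right, List.length_ofFn, Nat.add_sub_cancel_left, List.getD_eq_getElem, List.getElem_ofFn]

local notation "𝓧" => codeCtx n κ w a b p H s

lemma codeCtx_row {l j : ℕ} (hl : l < n - κ) (hj : j < n) :
    (𝓧).inp (6 + l * n + j) = (H ⟨l, hl⟩ ⟨j, hj⟩).val := by
  rw [show 6 + l * n + j = l * n + j + 6 by ring]
  have : l * n ≤ n * n := Nat.mul_le_mul_right _ (by omega)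
  simp only [codeCtx]
  rw [if_pos (by grind), initState_row hl hj]

lemma codeCtx_syndrome {l : ℕ} (hl : l < n - κ) :
    (𝓧).inp (6 + (n - κ) * n + l) = (s ⟨l, hl⟩).val := by
  rw [show 6 + (n - κ) * n + l = (n - κ) * n + l + 6 by ring]
  have : (n - κ) * n ≤ n * n := Nat.mul_le_mul_right _ (by omega)
  simp only [codeCtx]
  rw [if_pos (by grind), initState_syndrome hl]

lemma codeCtx_binary : (𝓧).Binary :=
  ⟨fun l (hl : l < n - κ) j (hj : j < n) => (codeCtx_row hl hj).trans_lt (ZMod.val_lt _),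
    fun l (hl : l < n - κ) => (codeCtx_syndrome hl).trans_lt (ZMod.val_lt _)⟩

lemma sysMat_codeCtx (π : ℕ → ℕ) (l j : ℕ) : sysMat 𝓧 π l j = if j < n then
    ((𝓧).inp (6 + l * n + π j) : ZMod 2) else (𝓧).inp (6 + (n - κ) * n + l) := rfl

lemma codeCtx_row_cast {l j : ℕ} (hl : l < n - κ) (hj : j < n) :
    ((𝓧).inp (6 + l * n + j) : ZMod 2) = H ⟨l, hl⟩ ⟨j, hj⟩ := by
  rw [codeCtx_row hl hj, ZMod.natCast_zmod_val]

lemma sum_row (hl : l < n - κ) (z : Fin n → ZMod 2) :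
    ∑ j ∈ range n, ((𝓧).inp (6 + l * n + j) : ZMod 2) * ext z j = (H *ᵥ z) ⟨l, hl⟩ := by
  rw [sum_range]
  refine sum_congr rfl fun j _ => ?_
  grind [codeCtx_row_cast, ext_val]

lemma codeCtx_indep (hH : FullRank H) (c : ℕ → ZMod 2) (hc : ∀ j < n, ∑ l ∈ range (n - κ),
    c l * ((𝓧).inp (6 + l * n + j) : ZMod 2) = 0) (l : ℕ) (hl : l < n - κ) : c l = 0 := by
  have h : (fun l : Fin (n - κ) => c l) = 0 := hH _ (funext fun j => ?_)
  · exact congrFun h ⟨l, hl⟩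
  rw [Pi.zero_apply, ← hc j j.2, sum_range, Matrix.vecMul, dotProduct]
  simp [sum_congr, codeCtx_row_cast]

lemma sysMat_sum (σ : Equiv.Perm (Fin n)) {l : ℕ} (hl : l < n - κ) (z : ℕ → ZMod 2) :
    ∑ j ∈ range n, sysMat 𝓧 (permFun σ) l j * z j =
      (H *ᵥ fun i => z (permFun σ.symm i)) ⟨l, hl⟩ := by
  have h : ∀ j ∈ range n, sysMat 𝓧 (permFun σ) l j * z j =
      ((𝓧).inp (6 + l * n + permFun σ j) : ZMod 2) *
        ext (fun i : Fin n => z (permFun σ.symm i)) (permFun σ j) := fun j hj => by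
    have hj := mem_range.1 hj
    rw [sysMat_codeCtx, if_pos hj, ext_mk (fun i => z (permFun σ.symm i)) (permFun_lt σ j hj)]
    congr 2
    exact (permFun_symm σ.symm hj).symm
  rw [sum_congr rfl h, sum_permFun σ fun j => ((𝓧).inp (6 + l * n + j) : ZMod 2) *
    ext (fun i : Fin n => z (permFun σ.symm i)) j, sum_row hl]

lemma sysMat_permVec (e : Fin n → ZMod 2) (hs : s = H *ᵥ e) (σ : Equiv.Perm (Fin n)) {l : ℕ}
    (hl : l < n - κ) : ∑ j ∈ range n, sysMat 𝓧 (permFun σ) l j * permVec e σ j =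
      sysMat 𝓧 (permFun σ) l n := by
  rw [sysMat_sum σ hl, sysMat_codeCtx, if_neg (lt_irrefl n), codeCtx_syndrome hl,
    ZMod.natCast_zmod_val, hs]
  simp [permVec, permFun_symm, ext_val]

/-- Undoing the permutation carries kernel vectors of the permuted system to kernel vectors of H. -/
lemma card_kerSet_le (σ : Equiv.Perm (Fin n)) {J : Finset ℕ} : (kerSet n (n - κ)
    (sysMat 𝓧 (permFun σ)) J).card ≤
      (kernelOn H (univ.filter fun i : Fin n => permFun σ.symm i ∈ J)).card := by
  refine card_le_card_of_injOn (fun z i => z (σ.symm i)) (fun z hz => ?_) fun z _ z' _ h => ?_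
  · have hz := mem_filter.1 (mem_coe.1 hz)
    refine mem_coe.2 (mem_filter.2 ⟨mem_univ _, fun i hi => show z (σ.symm i) = 0 from ?_, funext fun l => ?_⟩)
    · grind [ext_val, mem_filter, mem_univ, permFun_val]
    simp_all [Pi.zero_apply, sysMat_sum, permFun_val, ext_val]
  · funext i
    simpa using congrFun h (σ i)

lemma card_filter_permFun_le (σ : Equiv.Perm (Fin n)) (J : Finset ℕ) :
    (univ.filter fun i : Fin n => permFun σ i ∈ J).card ≤ J.card :=
  card_le_card_of_injOn (fun i => permFun σ i) (fun i hi => (mem_filter.1 (mem_coe.1 hi)).2)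
    fun i _ i' _ h => Fin.ext (permFun_inj σ i i.2 i' i'.2 h)

lemma countOnes_ext (e : Fin n → ZMod 2) : countOnes (ext e) n = hammingNorm e := by
  rw [countOnes, card_filter, sum_range, hammingNorm, card_filter]
  refine sum_congr rfl fun i _ => ?_
  rw [ext_val]
  refine if_congr ⟨fun h => by grind, zmod2_eq_one⟩ rfl rfl

lemma codeCtx_fits (hκ : κ ≤ n) (hb : b ≤ n - κ) (hw : w ≤ n) : Fits 𝓧 where
  bound := show b + (n - κ - b) ≤ n by omega
  sum := show n - κ - b + (κ - a) ≤ n by omega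
  weight := hw
  top := by
    change numQubits n (n - κ - b) (κ - a) < 2 ^ (2 * n + 8)
    have h1 : n + 1 ≤ 2 ^ n := Nat.lt_two_pow_self
    have h2 : (n - κ - b) * (κ - a) ≤ n * n := Nat.mul_le_mul (by omega) (by omega)
    rw [pow_add, mul_comm 2 n, pow_mul, numQubits]
    nlinarith

/-- One pair of masks has weight at least 1/((n+1)² 4^n), so the range 2^(2n+8) of the iteration
numbers reaches the inverse square root of every success probability that can occur. -/
lemma one_le_sqrt_maskWeight {τ : ℕ} (hκ : κ ≤ n) (hr : τ ≤ n - κ - b) (hk : τ ≤ κ - a) :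
    1 ≤ √(maskWeight 𝓧 τ) * ((𝓧).top - 1 : ℕ) := by
  have h1 := coinWeight_ge hr
  have h2 := coinWeight_ge hk
  have hm : 1 / ((n + 1) ^ 2 * (2 ^ n) ^ 2 : ℝ) ≤ maskWeight 𝓧 τ := by
    refine le_trans ?_ (mul_le_mul h1 h2 (by positivity) (coinWeight_nonneg _ _))
    have c1 := Nat.choose_pos hr
    have c2 := Nat.choose_pos hk
    have d : ∀ m ≤ n, m.choose τ ≤ 2 ^ n := fun m hm =>
      (Nat.choose_le_two_pow m τ).trans (Nat.pow_le_pow_right two_pos hm)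
    have d1 : ((n - κ - b).choose τ : ℝ) ≤ 2 ^ n := by exact_mod_cast d _ (by omega)
    have d2 : ((κ - a).choose τ : ℝ) ≤ 2 ^ n := by exact_mod_cast d _ (by omega)
    have d3 : ((n - κ - b : ℕ) : ℝ) ≤ n := by exact_mod_cast (by omega)
    have d4 : ((κ - a : ℕ) : ℝ) ≤ n := by exact_mod_cast (by omega)
    rw [div_mul_div_comm, one_mul]
    refine div_le_div_of_nonneg_left one_pos.le (by positivity) ?_
    calc _ ≤ ((n + 1) * 2 ^ n * ((n + 1) * 2 ^ n) : ℝ) := by gcongr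
      _ = _ := by ring
  have hs : 1 / ((n + 1) * 2 ^ n : ℝ) ≤ √(maskWeight 𝓧 τ) := by
    refine Real.le_sqrt_of_sq_le (le_trans (le_of_eq ?_) hm)
    grind
  have ht : ((n + 1) * 2 ^ n : ℝ) ≤ ((𝓧).top - 1 : ℕ) := by
    have : (n + 1) * 2 ^ n ≤ (𝓧).top - 1 := by
      change _ ≤ 2 ^ (2 * n + 8) - 1
      have h1 : n + 1 ≤ 2 ^ n := Nat.lt_two_pow_self
      have : (n + 1) * 2 ^ n ≤ 2 ^ n * 2 ^ n := Nat.mul_le_mul_right _ h1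
      rw [pow_add, two_mul, pow_add]
      omega
    exact_mod_cast this
  calc (1 : ℝ) = 1 / ((n + 1) * 2 ^ n) * ((n + 1) * 2 ^ n) := by field_simp
    _ ≤ _ := by gcongr

end codeCtx

/-! ### Averaging over permutations and matrices -/

section success
variable {n κ w a b p : ℕ} {H : Matrix (Fin (n - κ)) (Fin n) (ZMod 2)}

lemma card_kerSet_pos {n m : ℕ} {W : ℕ → ℕ → ZMod 2} {J : Finset ℕ} : 0 < (kerSet n m W J).card :=
  card_pos.2 ⟨0, mem_filter.2 ⟨mem_univ _, fun _ _ _ => by simp [ext], fun _ _ => by simp [ext]⟩⟩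

/-- The expected number of solutions with which the given one is confused. -/
noncomputable def confusion (n κ b : ℕ) (X : Ctx) (σ : Equiv.Perm (Fin n))
    (q : Finset ℕ × Finset ℕ) : ℝ :=
  (kerSet n (n - κ) (sysMat X (permFun σ)) (range (n - κ))).card ^ 3 *
    (kerSet n (n - κ) (sysMat X (permFun σ)) (openSet (n - κ) (n - κ - b) b q.1 q.2)).card

lemma confusion_pos (X : Ctx) (σ : Equiv.Perm (Fin n)) (q : Finset ℕ × Finset ℕ) :
    0 < confusion n κ b X σ q := by
  have h := fun J => card_kerSet_pos (n := n) (m := n - κ) (W := sysMat X (permFun σ)) (J := J)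
  simp_all [openSet, confusion]

open Classical in
-- By the inequality x³y ≤ (3x⁴ + y⁴)/4 it suffices to know fourth moments of kernel sizes on single
-- coordinate sets.
lemma sum_confusion (e : Fin n → ZMod 2) (hb : b ≤ n - κ) (σ : Equiv.Perm (Fin n)) {τ : ℕ}
    {q : Finset ℕ × Finset ℕ} (h1 : q.1 ⊆ range (n - κ - b)) (c1 : q.1.card = τ)
    (c2 : q.2.card = τ) :
    ∑ H : Matrix (Fin (n - κ)) (Fin n) (ZMod 2) with FullRank H,
      confusion n κ b (codeCtx n κ w a b p H (H *ᵥ e)) σ q ≤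
    270 * (univ.filter (FullRank (n := n) (m := n - κ))).card := by
  set J := fun J : Finset ℕ => univ.filter fun i : Fin n => permFun σ.symm i ∈ J with hJ
  set J₀ := J (range (n - κ))
  set J₁ := J (openSet (n - κ) (n - κ - b) b q.1 q.2)
  have hJ₀ : J₀.card ≤ n - κ := (card_filter_permFun_le _ _).trans (card_range _).le
  -- There are at most b + (r - τ) + τ = m open positions. Here it matters that both masks have the
  -- same size.
  have hJ₁ : J₁.card ≤ n - κ := by
    refine (card_filter_permFun_le _ _).trans ((card_union_le _ _).trans
      ((Nat.add_le_add (card_union_le _ _) card_image_le).trans ?_))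
    have := card_le_card h1
    grind
  have m0 : (∑ H : Matrix (Fin (n - κ)) (Fin n) (ZMod 2) with FullRank H,
      ((kernelOn H J₀).card : ℝ) ^ 4) ≤ 270 * (univ.filter (FullRank (n := n) (m := n - κ))).card := by
    exact_mod_cast sum_card_kernelOn_pow_four hJ₀
  have m1 : (∑ H : Matrix (Fin (n - κ)) (Fin n) (ZMod 2) with FullRank H,
      ((kernelOn H J₁).card : ℝ) ^ 4) ≤ 270 * (univ.filter (FullRank (n := n) (m := n - κ))).card := by
    exact_mod_cast sum_card_kernelOn_pow_four hJ₁
  have hle : ∀ H : Matrix (Fin (n - κ)) (Fin n) (ZMod 2),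
      confusion n κ b (codeCtx n κ w a b p H (H *ᵥ e)) σ q ≤
        3 / 4 * ((kernelOn H J₀).card : ℝ) ^ 4 + 1 / 4 * ((kernelOn H J₁).card : ℝ) ^ 4 := by
    intro H
    have k0 := card_kerSet_le (w := w) (a := a) (b := b) (p := p)
      (H := H) (s := H *ᵥ e) σ (J := range (n - κ))
    have k1 := card_kerSet_le (w := w) (a := a) (b := b) (p := p)
      (H := H) (s := H *ᵥ e) σ (J := openSet (n - κ) (n - κ - b) b q.1 q.2)
    have amgm : ∀ x y : ℝ, 0 ≤ x → 0 ≤ y → x ^ 3 * y ≤ 3 / 4 * x ^ 4 + 1 / 4 * y ^ 4 :=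
      fun x y hx hy => by
        nlinarith [mul_nonneg (sq_nonneg (x - y)) (show 0 ≤ 3 * x ^ 2 + 2 * (x * y) + y ^ 2
          by positivity)]
    refine le_trans ?_ (amgm _ _ (Nat.cast_nonneg _) (Nat.cast_nonneg _))
    unfold confusion; gcongr
  refine (sum_le_sum fun H _ => hle H).trans ?_
  rw [sum_add_distrib, ← mul_sum, ← mul_sum]
  linarith

variable {e : Fin n → ZMod 2} {τ j : ℕ}

local notation "𝓧" => codeCtx n κ w a b p H (H *ᵥ e)
local notation "𝓖" => goodPerms (n - κ) b (n - κ - b) (κ - a) (w - p - j) j e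
local notation "𝓜" => fun σ => goodMasks (n - κ) b (n - κ - b) (κ - a) τ j (permVec e σ)

variable (n κ w a b p τ j e) in
/-- A lower bound for the success probability of a trial, for one permutation. -/
noncomputable def permBound (X : Ctx) (σ : Equiv.Perm (Fin n)) : ℝ :=
  √(maskWeight X τ / ((n - κ - b - (w - p - j)).choose τ * (κ - a - j).choose (τ - j) : ℕ)) /
    (16 * (n + 1)) * ∑ q ∈ (𝓜) σ, 1 / confusion n κ b X σ q

open Classical in
lemma le_wp_pTrial (hH : FullRank H) (hκ : κ ≤ n) (hb : b ≤ n - κ) (hw : w ≤ n)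
    (he : hammingNorm e = w) (hτr : τ ≤ n - κ - b) (hτk : τ ≤ κ - a) (hj : j ≤ τ)
    (D : Arr) {u : ℂ} (hu : ‖u‖ = 1) :
    ∑ σ ∈ 𝓖, (n.factorial : ℝ≥0∞)⁻¹ * ENNReal.ofReal (permBound n κ w a b p e τ j 𝓧 σ) ≤
      wp 𝓧 0 pTrial [] won ⟨D, u • QState.zero (𝓧).qubits⟩ := by
  have hX : Fits 𝓧 := codeCtx_fits hκ hb hw
  have hmk : n - κ + (κ - a) ≤ n := by omega
  have hm : n - κ = b + (n - κ - b) := by omega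
  rw [pTrial, wp_seq]
  refine wp_sum_reach 𝓖 (fun σ => Reduced 𝓧 (permFun σ)) (fun _ => (n.factorial : ℝ≥0∞)⁻¹) _
    (zero_normalized hu) _ (fun σ _ => reach_pReduce hX hmk codeCtx_binary (codeCtx_indep hH) σ D)
    (fun σ _ σ' _ D h h' => Equiv.ext fun i => Fin.ext ?_) fun σ hσ D' hD' => ?_
  · rw [← permFun_val, ← permFun_val]
    exact (h.1 i i.2).symm.trans (h'.1 i i.2)
  · obtain ⟨-, g1, g2, g3⟩ := mem_filter.1 hσ
    obtain ⟨s1, s2⟩ := goodMasks_spec (X := 𝓧) (x := permVec e σ) hj g3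
    have hc : countOnes (permVec e σ) n = w := by
      rw [← he, ← countOnes_ext, ← countOnes_permFun σ (ext e)]; rfl
    have := hD'.le_wp hX codeCtx_binary hmk hm (x := permVec e σ)
      (fun l hl => sysMat_permVec e rfl σ hl) (fun c hc h => g1 ⟨c, hc⟩ h) hc s1
      (hτk.trans ((Nat.sub_le _ _).trans hκ)) (one_le_sqrt_maskWeight hκ hτr hτk) hu
    rw [s2, show (𝓧).r - (ones (permVec e σ) (𝓧).b (𝓧).r).card = n - κ - b - (w - p - j) by
      rw [← g2]; rfl] at this
    exact this

variable (n κ w a b p τ j e) in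
/-- A lower bound for the success probability of a trial. -/
noncomputable def trialBound (X : Ctx) : ℝ :=
  (n.factorial : ℝ)⁻¹ * ∑ σ ∈ 𝓖, permBound n κ w a b p e τ j X σ

lemma permBound_nonneg (X : Ctx) (σ : Equiv.Perm (Fin n)) :
    0 ≤ permBound n κ w a b p e τ j X σ := by
  refine mul_nonneg (by positivity) (sum_nonneg fun q _ => ?_)
  have := confusion_pos (κ := κ) (b := b) X σ q
  positivity

lemma ofReal_trialBound (X : Ctx) : ENNReal.ofReal (trialBound n κ w a b p e τ j X) =
    ∑ σ ∈ 𝓖, (n.factorial : ℝ≥0∞)⁻¹ * ENNReal.ofReal (permBound n κ w a b p e τ j X σ) := by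
  have hn : (0 : ℝ) < n.factorial := by exact_mod_cast n.factorial_pos
  simp_all [trialBound, ENNReal.ofReal_mul, ENNReal.ofReal_inv_of_pos, ENNReal.ofReal_natCast, ENNReal.ofReal_sum_of_nonneg, permBound_nonneg, mul_sum]

end success

/-- Square both sides. Exchanging the order of nested choices, C(r,i) C(r-i,τ) / C(r,τ) = C(r-τ,i)
and C(k,j) C(k-j,τ-j) / C(k,τ) = C(τ,j). What remains is the product of the two bounds of
`exists_parameters`; they cost four factors n + 1, and the coin weights cost two more. -/
lemma sqrt_choose_le {n r k t τ j i : ℕ} {W : ℝ} (hrk : r + k ≤ n) (hj : j ≤ τ) (hτr : τ ≤ r)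
    (hτk : τ ≤ k)
    (hWge : 1 / ((r + 1) * r.choose τ * ((k + 1) * k.choose τ) : ℝ) ≤ W)
    (hq1 : r.choose t ≤ (r + k + 1) ^ 2 * (τ.choose j * (r - τ).choose i))
    (hq2 : (r + k).choose t ≤ (r + k + 1) ^ 2 * (k.choose j * r.choose i)) :
    √((r + k).choose t * r.choose t : ℝ) ≤ (n + 1) ^ 3 * (r.choose i * k.choose j) *
      √(W * ((r - i).choose τ * (k - j).choose (τ - j) : ℕ)) := by
  have hτ1 : (0 : ℝ) < r.choose τ := by simp_all [Nat.choose_pos]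
  have hτ2 : (0 : ℝ) < k.choose τ := by simp_all [Nat.choose_pos]
  have e1 : (r.choose i * (r - i).choose τ : ℝ) = r.choose τ * (r - τ).choose i := by
    exact_mod_cast choose_mul_choose_symm r i τ
  have e2 : (k.choose τ * τ.choose j : ℝ) = k.choose j * (k - j).choose (τ - j) := by
    exact_mod_cast Nat.choose_mul (n := k) hj
  have a1 : (r.choose t : ℝ) ≤ (r + k + 1) ^ 2 * (τ.choose j * (r - τ).choose i) := by
    exact_mod_cast hq1
  have a2 : ((r + k).choose t : ℝ) ≤ (r + k + 1) ^ 2 * (k.choose j * r.choose i) := by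
    exact_mod_cast hq2
  have a3 : (r + k : ℝ) ≤ n := by exact_mod_cast hrk
  have a4 : (1 : ℝ) ≤ (r + 1) * r.choose τ * ((k + 1) * k.choose τ) * W := by
    rwa [div_le_iff₀' (by positivity)] at hWge
  have hr0 : (0 : ℝ) ≤ r := Nat.cast_nonneg r
  have hk0 : (0 : ℝ) ≤ k := Nat.cast_nonneg k
  have hW0 : 0 ≤ W := (by positivity : (0 : ℝ) ≤ _).trans hWge
  refine (Real.sqrt_le_left (by positivity)).2 ?_
  rw [mul_pow, Real.sq_sqrt (by positivity)]
  set Y : ℝ := r.choose i * k.choose j with hY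
  calc _ ≤ ((r + k + 1) ^ 2 * (k.choose j * r.choose i)) *
        ((r + k + 1) ^ 2 * (τ.choose j * (r - τ).choose i) : ℝ) := by gcongr
    _ = (r + k + 1) ^ 4 * (Y * (τ.choose j * (r - τ).choose i)) * 1 := by grind
    _ ≤ (n + 1) ^ 4 * (Y * (τ.choose j * (r - τ).choose i)) *
        ((n + 1) * r.choose τ * ((n + 1) * k.choose τ) * W) := by
        gcongr
        refine a4.trans ?_
        gcongr <;> linarith
    _ = (n + 1) ^ 6 * Y * ((r.choose τ * (r - τ).choose i) * (k.choose τ * τ.choose j)) * W := by ring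
    _ = _ := by grind

open Classical in
-- For each H the bound is a constant times the sum of 1/Z over all pairs of a good permutation and
-- a good pair of masks, where Z is the confusion. Its inverse is estimated by the sum of Z, whose
-- average over H is bounded termwise by `sum_confusion`. The rest is the count of good permutations
-- and masks.
lemma exists_trialBound {n κ w a b p : ℕ} (hκ : κ ≤ n) (hb : b ≤ n - κ) (hw : w ≤ n)
    (hpb : p ≤ b) (hpw : p ≤ w) (ht : w - p ≤ n - κ - b) {e : Fin n → ZMod 2}
    (he : hammingNorm e = w) : ∃ pr : Matrix (Fin (n - κ)) (Fin n) (ZMod 2) → ℝ,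
    (∀ H, FullRank H → 0 < pr H ∧ ∀ (D : Arr) (u : ℂ), ‖u‖ = 1 → ENNReal.ofReal (pr H) ≤
      wp (codeCtx n κ w a b p H (H *ᵥ e)) 0 pTrial [] won
        ⟨D, u • QState.zero (codeCtx n κ w a b p H (H *ᵥ e)).qubits⟩) ∧
    ∑ H : Matrix (Fin (n - κ)) (Fin n) (ZMod 2) with FullRank H, 1 / pr H ≤
      4320 * (n + 1) ^ 4 * (univ.filter (FullRank (n := n) (m := n - κ))).card * (n.choose w /
        (√((n - κ - b + (κ - a)).choose (w - p) * (n - κ - b).choose (w - p)) * b.choose p)) := by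
  obtain ⟨τ, j, hτr, hτk, hj, hjt, hi, hq1, hq2⟩ := exists_parameters (k := κ - a) ht
  set r := n - κ - b with hr
  set k := κ - a with hk
  set i := w - p - j with hidef
  set X := fun H : Matrix (Fin (n - κ)) (Fin n) (ZMod 2) => codeCtx n κ w a b p H (H *ᵥ e)
  set G := goodPerms (n - κ) b r k i j e with hG
  set S := fun σ : Equiv.Perm (Fin n) => goodMasks (n - κ) b r k τ j (permVec e σ) with hS
  set g := (r - i).choose τ * (k - j).choose (τ - j) with hg
  set W := coinWeight τ r * coinWeight τ k with hW
  set B := (univ.filter (FullRank (n := n) (m := n - κ))).card with hB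
  have hirτ : i + τ ≤ r := by omega
  have hg0 : 0 < g := Nat.mul_pos (Nat.choose_pos (by omega)) (Nat.choose_pos (by omega))
  have hGc : n.factorial * (b.choose p * (r.choose i * k.choose j)) ≤ G.card * n.choose w := by
    have := card_goodPerms (m := n - κ) (b := b) (r := r) (k := k) (i := i) (j := j) (e := e) (p := p)
      (by omega) (by omega) (by omega)
    rwa [show p + i + j = w by omega] at this
  have hp0 : 0 < b.choose p := Nat.choose_pos hpb
  have hi0 : 0 < r.choose i := Nat.choose_pos (by omega)
  have hj0 : 0 < k.choose j := Nat.choose_pos (by omega)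
  have hG0 : 0 < G.card := Nat.pos_of_mul_pos_right ((Nat.mul_pos n.factorial_pos
    (Nat.mul_pos hp0 (Nat.mul_pos hi0 hj0))).trans_le hGc)
  have hSc : ∀ σ ∈ G, Masks (X 0) (permVec e σ) τ (S σ) ∧ (S σ).card = g := by
    intro σ hσ
    obtain ⟨-, -, g2, g3⟩ := mem_filter.1 hσ
    have := goodMasks_spec (X := X 0) (x := permVec e σ) hj g3
    refine ⟨this.1, this.2.trans ?_⟩
    rw [hg, ← g2]; rfl
  have w1 := coinWeight_ge hτr
  have w2 := coinWeight_ge hτk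
  have hτ1 : (0 : ℝ) < r.choose τ := by exact_mod_cast Nat.choose_pos hτr
  have hτ2 : (0 : ℝ) < k.choose τ := by exact_mod_cast Nat.choose_pos hτk
  have hWge : 1 / ((r + 1) * r.choose τ * ((k + 1) * k.choose τ) : ℝ) ≤ W := by
    rw [← one_div_mul_one_div]
    exact mul_le_mul w1 w2 (by positivity) (coinWeight_nonneg _ _)
  have hW0 : 0 < W := (by positivity : (0 : ℝ) < _).trans_le hWge
  set Ω := G.sigma S with hΩ
  have hΩc : Ω.card = G.card * g := by
    rw [hΩ, card_sigma, sum_congr rfl fun σ hσ => (hSc σ hσ).2, sum_const, smul_eq_mul]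
  have hΩ0 : (0 : ℝ) < Ω.card := by rw [hΩc]; exact_mod_cast Nat.mul_pos hG0 hg0
  set Z := fun (H : Matrix (Fin (n - κ)) (Fin n) (ZMod 2)) (x : Σ _ : Equiv.Perm (Fin n),
    Finset ℕ × Finset ℕ) => confusion n κ b (X H) x.1 x.2 with hZ
  have hZ0 : ∀ H x, 0 < Z H x := fun H x => confusion_pos _ _ _
  have hn0 : (0 : ℝ) < n.factorial := by exact_mod_cast n.factorial_pos
  set M : ℝ := (n.factorial : ℝ)⁻¹ * (√(W / g) / (16 * (n + 1))) with hM
  have hM0 : 0 < M := by positivity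
  have hpr : ∀ H, trialBound n κ w a b p e τ j (X H) = M * ∑ x ∈ Ω, 1 / Z H x := fun H => by
    rw [trialBound, hM, hΩ, sum_sigma, mul_assoc, mul_sum _ _ (√(W / g) / _)]; rfl
  have hne : Ω.Nonempty := card_pos.1 (by exact_mod_cast hΩ0)
  have hsum0 : ∀ H, 0 < ∑ x ∈ Ω, 1 / Z H x := fun H =>
    sum_pos (fun x _ => one_div_pos.2 (hZ0 H x)) hne
  refine ⟨fun H => trialBound n κ w a b p e τ j (X H), fun H hH => ⟨?_, fun D u hu => ?_⟩, ?_⟩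
  · exact (mul_pos hM0 (hsum0 H)).trans_eq (hpr H).symm
  · rw [ofReal_trialBound]
    grind [le_wp_pTrial]
  have hinv : ∀ H, 1 / trialBound n κ w a b p e τ j (X H) ≤
      1 / (M * Ω.card ^ 2) * ∑ x ∈ Ω, Z H x := by
    intro H
    -- Cauchy–Schwarz in the form |Ω|² ≤ (∑ 1/Z)(∑ Z).
    have := sum_sq_le_sum_mul_sum_of_sq_le_mul Ω (r := fun _ => (1 : ℝ)) (f := fun x => 1 / Z H x)
      (g := Z H) (fun x _ => (one_div_pos.2 (hZ0 H x)).le) (fun x _ => (hZ0 H x).le)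
      (fun x _ => by grind)
    rw [sum_const, nsmul_eq_mul, mul_one] at this
    rw [hpr, one_div_mul_eq_div, div_le_div_iff₀ (mul_pos hM0 (hsum0 H)) (by positivity), one_mul]
    calc M * (Ω.card : ℝ) ^ 2 ≤ M * ((∑ x ∈ Ω, 1 / Z H x) * ∑ x ∈ Ω, Z H x) := by gcongr
      _ = _ := by ring
  refine (sum_le_sum fun H _ => hinv H).trans ?_
  rw [← mul_sum, sum_comm]
  have hZs : ∀ x ∈ Ω, ∑ H : Matrix (Fin (n - κ)) (Fin n) (ZMod 2) with FullRank H, Z H x ≤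
      270 * B := by
    intro x hx
    obtain ⟨h1, h2⟩ := mem_sigma.1 hx
    have hm := (hSc x.1 h1).1
    exact sum_confusion e hb x.1 (hm.left _ h2) (hm.card_left _ h2) (hm.card_right _ h2)
  have h1 : (∑ x ∈ Ω, ∑ H : Matrix (Fin (n - κ)) (Fin n) (ZMod 2) with FullRank H, Z H x) ≤
      Ω.card * (270 * B) := by
    rw [← nsmul_eq_mul]; exact sum_le_card_nsmul _ _ _ hZs
  refine (mul_le_mul_of_nonneg_left h1 (by positivity)).trans ?_
  have h2 : √((r + k).choose (w - p) * r.choose (w - p) : ℝ) ≤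
      (n + 1) ^ 3 * (r.choose i * k.choose j) * √(W * g) :=
    sqrt_choose_le (by omega) hj hτr hτk hWge hq1 hq2
  have h3 : (n.factorial * (b.choose p * (r.choose i * k.choose j)) : ℝ) ≤ G.card * n.choose w := by
    exact_mod_cast hGc
  have hg1 : (0 : ℝ) < g := by exact_mod_cast hg0
  have hG1 : (0 : ℝ) < G.card := by exact_mod_cast hG0
  have hQ : (0 : ℝ) < √((r + k).choose (w - p) * r.choose (w - p) : ℝ) := Real.sqrt_pos.2 (by
    have := Nat.choose_pos (show w - p ≤ r + k by omega)
    have := Nat.choose_pos ht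
    positivity)
  have hp1 : (0 : ℝ) < b.choose p := by exact_mod_cast hp0
  have e1 : √(W / g) * g = √(W * g) := by
    rw [Real.sqrt_div hW0.le, Real.sqrt_mul hW0.le, div_mul_eq_mul_div, div_eq_iff (by grind),
      mul_assoc, Real.mul_self_sqrt hg1.le]
  have hWg : 0 < √(W * g) := Real.sqrt_pos.2 (mul_pos hW0 hg1)
  -- The constant is 4320 = 16 · 270, with 16 from the random number of iterations. One factor n + 1
  -- is the price of guessing τ.
  calc 1 / (M * Ω.card ^ 2) * (Ω.card * (270 * B))
      = 4320 * (n + 1) * B * (n.factorial / (G.card * √(W * g))) := by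
        rw [← e1, hM, hΩc]
        grind
    _ ≤ 4320 * (n + 1) * B * ((n + 1) ^ 3 * n.choose w /
          (√((r + k).choose (w - p) * r.choose (w - p)) * b.choose p)) := by
        gcongr ?_ * ?_
        rw [div_le_div_iff₀ (by positivity) (by positivity)]
        calc _ ≤ n.factorial * ((n + 1) ^ 3 * (r.choose i * k.choose j) * √(W * g) *
              b.choose p) := by gcongr
          _ = (n + 1) ^ 3 * √(W * g) * (n.factorial * (b.choose p * (r.choose i * k.choose j))) := by
              ring
          _ ≤ (n + 1) ^ 3 * √(W * g) * (G.card * n.choose w) := by gcongr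
          _ = _ := by ring
    _ = _ := by ring

/-! ## The main program -/

/-- The program `c` leads from `s` to `s'` in time at most `B`. -/
def Runs {q : ℕ} (c : Cmd) (s s' : State q) (B : ℕ) : Prop :=
  ∃ t ≤ B, ∀ (τ : ℝ≥0∞) (F : State q → ℝ≥0∞), expect τ c F s = τ * (t : ℕ) + F s'

section runs
variable {q : ℕ} {c c' : Cmd} {s s' s'' : State q} {B B' L : ℕ}

lemma Runs.store (h : ∀ c, s.mem c < 2 ^ L) (a e : Expr) :
    Runs (.store a e) s (s.write (a.eval s.mem) (e.eval s.mem)) ((Cmd.store a e).wt * (L + 1) ^ 2) := by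
  refine ⟨_, ?_, fun τ F => rfl⟩
  have := one_le_sq L
  rw [Cmd.wt, add_mul, add_mul, one_mul]
  exact Nat.add_le_add (Nat.add_le_add this (a.cost_le h)) (e.cost_le h)

lemma Runs.seq (h : Runs c s s' B) (h' : Runs c' s' s'' B') : Runs (.seq c c') s s'' (B + B') := by
  obtain ⟨t, ht, h⟩ := h
  obtain ⟨t', ht', h'⟩ := h'
  refine ⟨t + t', Nat.add_le_add ht ht', fun τ F => ?_⟩
  grind [expect, Nat.cast_add, mul_add, add_assoc]

lemma Runs.loop {e : Expr} (I : ℕ → State q → Prop) (hL : ∀ i s, I i s → ∀ c, s.mem c < 2 ^ L)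
    (h0 : ∀ i s, I i s → e.eval s.mem = i)
    (h1 : ∀ i s, I (i + 1) s → ∃ s', I i s' ∧ Runs c s s' (c.wt * (L + 1) ^ 2)) :
    ∀ i s, I i s → ∃ s', I 0 s' ∧ Runs (.loop e c) s s' ((i + 1) * ((1 + e.wt + c.wt) * (L + 1) ^ 2)) := by
  have hc : ∀ i s, I i s → 1 + e.cost s.mem ≤ (1 + e.wt) * (L + 1) ^ 2 := fun i s hs => by
    rw [add_mul, one_mul]
    exact Nat.add_le_add (one_le_sq L) (e.cost_le (hL i s hs))
  have key : ∀ i s, I i s → ∃ s', I 0 s' ∧ ∃ t ≤ (i + 1) * ((1 + e.wt + c.wt) * (L + 1) ^ 2),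
      ∀ (τ : ℝ≥0∞) (F : State q → ℝ≥0∞), (∀ N, loopIter τ e c F N s ≤ τ * (t : ℕ) + F s') ∧
        loopIter τ e c F (i + 1) s = τ * (t : ℕ) + F s' := by
    intro i
    induction i with
    | zero =>
      intro s hs
      refine ⟨s, hs, 1 + e.cost s.mem, ?_, fun τ F => ?_⟩
      · grind
      · have : ∀ N, loopIter τ e c F (N + 1) s = τ * (1 + e.cost s.mem : ℕ) + F s := fun N => by
          rw [loopIter_succ, if_pos (h0 0 s hs)]
        refine ⟨fun N => ?_, this 0⟩
        cases N with
        | zero => exact zero_le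
        | succ N => grind
    | succ i ih =>
      intro s hs
      obtain ⟨s₁, hs₁, t₁, ht₁, hr₁⟩ := h1 i s hs
      obtain ⟨s', hs', t, ht, hr⟩ := ih s₁ hs₁
      refine ⟨s', hs', 1 + e.cost s.mem + t₁ + t, ?_, fun τ F => ?_⟩
      · grind
      · have : ∀ N, loopIter τ e c F (N + 1) s =
            τ * (1 + e.cost s.mem : ℕ) + (τ * (t₁ : ℕ) + loopIter τ e c F N s₁) := fun N => by
          rw [loopIter_succ, if_neg (by grind), hr₁]
        have e2 : τ * ((1 + e.cost s.mem + t₁ + t : ℕ) : ℝ≥0∞) + F s' =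
            τ * (1 + e.cost s.mem : ℕ) + (τ * (t₁ : ℕ) + (τ * (t : ℕ) + F s')) := by
          grind
        rw [e2]
        refine ⟨fun N => ?_, by grind⟩
        cases N with
        | zero => exact zero_le
        | succ N => rw [this]; gcongr; grind
  intro i s hs
  obtain ⟨s', hs', t, ht, h⟩ := key i s hs
  exact ⟨s', hs', t, ht, fun τ F => le_antisymm (iSup_le (h τ F).1)
    ((h τ F).2.symm.le.trans (le_iSup (fun N => loopIter τ e c F N s) (i + 1)))⟩

end runs

/-- The addresses of the modulus and of a counter. -/
def topA : Expr := cellE 18 (.const 0)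
def ctrA : Expr := cellE 16 (.const 0)
def decr (a : Expr) : Cmd := .store a (.op .sub (.load a) (.const 1))

def initBody : Cmd := .seq (.store topA (.op .mul (.load topA) (.const 2))) (decr ctrA)

/-- Compute the modulus. -/
def initCmd : Cmd := .seq (.store topA (.const 1)) (.seq
  (.store ctrA (.op .add (.op .mul (.const 2) (.load (.const 0))) (.const 8)))
  (.loop (.load ctrA) initBody))

def outBody : Cmd :=
  .seq (.store (.load topA) (.load (cellE 11 (prE (.load topA) (.const 0))))) (decr topA)

/-- Write the output. -/
def outCmd : Cmd := .seq (.store topA (.op .sub (.load (.const 0)) (.const 1))) (.seq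
  (.loop (.load topA) outBody)
  -- Cell 0 holds n, on which all addresses depend, so it is overwritten last.
  (.store (.const 0) (.load (cellE 11 (prE (.const 0) (.const 0))))))

lemma cell_ne_zero (n t y : ℕ) : cell n t y ≠ 0 := by simp [cell]

lemma cell_ge (n t y : ℕ) : n < cell n t y := by grind [cell]

lemma cube_bound {A B W x y : ℕ} (h : x + 1 ≤ y) :
    A * y ^ 2 + (B * y ^ 2 + (x + 1) * (W * y ^ 2)) ≤ (A + (B + W)) * y ^ 3 := by
  have h1 : y ^ 2 ≤ y ^ 3 := Nat.pow_le_pow_right (by omega) (by omega)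
  calc _ ≤ A * y ^ 3 + (B * y ^ 3 + y * (W * y ^ 2)) := by gcongr
    _ = _ := by ring

lemma State.write_mem_of_ne {q a v c : ℕ} {s : State q} (h : c ≠ a) :
    (s.write a v).mem c = s.mem c := update_of_ne h _ _

lemma runs_initCmd {q n : ℕ} {s : State q} (h0 : s.mem 0 = n) (hle : ∀ c, s.mem c ≤ n)
    (hc : s.mem (cell n 16 0) = 0) :
    Runs initCmd s (s.write (cell n 18 0) (2 ^ (2 * n + 8))) (initCmd.wt * (2 * n + 10) ^ 3) := by
  have hne : cell n 18 0 ≠ cell n 16 0 := by simp [cell_inj]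
  have hn : n < 2 ^ (2 * n + 9) := Nat.lt_two_pow_self.trans (Nat.pow_lt_pow_right one_lt_two (by omega))
  set I : ℕ → State q → Prop := fun i s' => i ≤ 2 * n + 8 ∧
    s' = (s.write (cell n 18 0) (2 ^ (2 * n + 8 - i))).write (cell n 16 0) i with hI
  have hmem : ∀ (x i c : ℕ), ((s.write (cell n 18 0) x).write (cell n 16 0) i).mem c =
      if c = cell n 16 0 then i else if c = cell n 18 0 then x else s.mem c := fun x i c => by
    simp [State.write, update_apply]
  have hz : ∀ x i, ((s.write (cell n 18 0) x).write (cell n 16 0) i).mem 0 = n := fun x i => by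
    rw [hmem, if_neg (cell_ne_zero _ _ _).symm, if_neg (cell_ne_zero _ _ _).symm, h0]
  have hct : ∀ x i, (Expr.load ctrA).eval ((s.write (cell n 18 0) x).write (cell n 16 0) i).mem = i :=
    fun x i => by simp_all [Expr.eval, ctrA, cellE_eval_of, if_pos]
  have htp : ∀ x i, (Expr.load topA).eval ((s.write (cell n 18 0) x).write (cell n 16 0) i).mem = x :=
    fun x i => by
      simp_all [Expr.eval, topA, cellE_eval_of, if_neg, if_pos]
  have hlt : ∀ i ≤ 2 * n + 8, ∀ x ≤ 2 ^ (2 * n + 8), ∀ c,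
      ((s.write (cell n 18 0) x).write (cell n 16 0) i).mem c < 2 ^ (2 * n + 9) := by
    grind [Nat.lt_two_pow_self, Nat.pow_lt_pow_right, one_lt_two]
  have hpow : ∀ i, 2 ^ (2 * n + 8 - i) ≤ 2 ^ (2 * n + 8) := fun i =>
    Nat.pow_le_pow_right two_pos (by omega)
  obtain ⟨s', ⟨-, hs'⟩, hloop⟩ := Runs.loop (L := 2 * n + 9) (e := .load ctrA) (c := initBody) I
    (fun i s' ⟨h1, h2⟩ c => by grind)
    (fun i s' ⟨_, h2⟩ => by grind) (fun i s' ⟨h1, h2⟩ => by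
      set x := 2 ^ (2 * n + 8 - (i + 1)) with hx
      have hx2 : 2 ^ (2 * n + 8 - i) = x * 2 := by
        rw [hx, ← pow_succ]; grind
      have hw : ∀ x y i j, (((s.write (cell n 18 0) x).write (cell n 16 0) i).write (cell n 18 0) y)
          = ((s.write (cell n 18 0) y).write (cell n 16 0) i) ∧
          (((s.write (cell n 18 0) x).write (cell n 16 0) i).write (cell n 16 0) j)
          = ((s.write (cell n 18 0) x).write (cell n 16 0) j) := fun x y i j => by
        grind [State.write, update_idem, update_comm]
      have r1 := Runs.store (hlt (i + 1) h1 x (hpow _)) topA (.op .mul (.load topA) (.const 2))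
      have r2 := Runs.store (hlt (i + 1) h1 (x * 2) (by grind)) ctrA
        (.op .sub (.load ctrA) (.const 1))
      rw [show topA.eval _ = cell n 18 0 from cellE_eval_of (hz x (i + 1)) _ _, Expr.eval, htp,
        (hw _ _ _ 0).1] at r1
      rw [show ctrA.eval _ = cell n 16 0 from cellE_eval_of (hz (x * 2) (i + 1)) _ _, Expr.eval, hct,
        (hw _ 0 _ _).2] at r2
      refine ⟨_, ⟨by omega, rfl⟩, ?_⟩
      rw [h2, hx2, initBody, Cmd.wt, add_mul]
      exact r1.seq r2)
    (2 * n + 8) _ ⟨le_rfl, rfl⟩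
  have hs2 : s' = s.write (cell n 18 0) (2 ^ (2 * n + 8)) := by
    rw [hs']
    simp only [State.write, Nat.sub_zero]
    congr 1
    grind
  have h0' : (s.write (cell n 18 0) 1).mem 0 = n := by
    rw [State.write_mem_of_ne (cell_ne_zero _ _ _).symm, h0]
  have r1 := Runs.store (L := 2 * n + 9) (s := s) (fun c => (hle c).trans_lt hn) topA (.const 1)
  have r2 := Runs.store (L := 2 * n + 9) (s := s.write (cell n 18 0) 1) (fun c => by
    change update s.mem _ _ c < _
    grind) ctrA
    (.op .add (.op .mul (.const 2) (.load (.const 0))) (.const 8))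
  rw [show topA.eval _ = cell n 18 0 from cellE_eval_of h0 _ _] at r1
  rw [show ctrA.eval _ = cell n 16 0 from cellE_eval_of h0' _ _,
    show Expr.eval _ (.op .add (.op .mul (.const 2) (.load (.const 0))) (.const 8)) = 2 * n + 8 by
      grind [Expr.eval, Op.eval]] at r2
  rw [Nat.sub_self, pow_zero] at hloop
  rw [← hs2]
  obtain ⟨t, ht, h⟩ := r1.seq (r2.seq hloop)
  refine ⟨t, ht.trans ?_, h⟩
  exact cube_bound (by omega)

lemma runs_outCmd {q n : ℕ} {s : State q} (h0 : s.mem 0 = n) (hn : n ≠ 0)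
    (hL : ∀ c, s.mem c < 2 ^ (2 * n + 9)) :
    ∃ s', Runs outCmd s s' (outCmd.wt * (2 * n + 10) ^ 3) ∧
      ∀ j < n, s'.mem j = s.mem (cell n 11 (pr j 0)) := by
  set I : ℕ → State q → Prop := fun i s' => i ≤ n - 1 ∧ s'.mem 0 = n ∧ s'.mem (cell n 18 0) = i ∧
    (∀ c, s'.mem c < 2 ^ (2 * n + 9)) ∧ (∀ y, s'.mem (cell n 11 y) = s.mem (cell n 11 y)) ∧
    ∀ j, i < j → j < n → s'.mem j = s.mem (cell n 11 (pr j 0)) with hI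
  have hne : ∀ y, cell n 11 y ≠ cell n 18 0 := fun y => by simp [cell_inj]
  have hge := cell_ge n
  have hup : ∀ (m : ℕ → ℕ) a x, (∀ c, m c < 2 ^ (2 * n + 9)) → x < 2 ^ (2 * n + 9) →
      ∀ c, update m a x c < 2 ^ (2 * n + 9) := fun m a x h hx c => by
    grind
  have hsm : ∀ i ≤ n, i < 2 ^ (2 * n + 9) := fun i hi =>
    lt_of_le_of_lt (by omega) (Nat.lt_two_pow_self (n := 2 * n + 9))
  have ht : ∀ m : ℕ → ℕ, m 0 = n → topA.eval m = cell n 18 0 := fun m h => cellE_eval_of h _ _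
  have hv : ∀ i s', I i s' → (Expr.load topA).eval s'.mem = i := fun i s' h => by
    simp_all [Expr.eval]
  have r1 := Runs.store hL topA (.op .sub (.load (.const 0)) (.const 1))
  rw [ht _ h0, show Expr.eval s.mem (.op .sub (.load (.const 0)) (.const 1)) = n - 1 by
    simp_all [Expr.eval, Op.eval]] at r1
  obtain ⟨s', ⟨-, h2, -, h4, h5, h6⟩, hloop⟩ := Runs.loop (L := 2 * n + 9) (e := .load topA)
    (c := outBody) I (fun i s' h => h.2.2.2.1) hv (fun i s' h => by
      have ⟨h1, h2, h3, h4, h5, h6⟩ := h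
      have hi0 : (0 : ℕ) ≠ i + 1 := by omega
      have hi : ∀ t y, cell n t y ≠ i + 1 := fun t y => by grind
      have r1 := Runs.store h4 (.load topA) (.load (cellE 11 (prE (.load topA) (.const 0))))
      have e1 : (Expr.load (cellE 11 (prE (.load topA) (.const 0)))).eval s'.mem =
          s.mem (cell n 11 (pr (i + 1) 0)) := by
        simp_all [Expr.eval, cellE_eval_of, prE, Op.eval, pr]
      rw [hv _ _ h, e1] at r1
      set x := s.mem (cell n 11 (pr (i + 1) 0))
      set m := update s'.mem (i + 1) x with hm
      have m0 : m 0 = n := by grind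
      have mt : m (cell n 18 0) = i + 1 := by grind
      have mL : ∀ c, m c < 2 ^ (2 * n + 9) := hup _ _ _ h4 (hL _)
      have r2 := Runs.store (s := ⟨m, s'.amp⟩) mL topA (.op .sub (.load topA) (.const 1))
      rw [show topA.eval _ = cell n 18 0 from ht _ m0,
        show (Expr.op Op.sub (.load topA) (.const 1)).eval _ = i by
          simp only [Expr.eval, Op.eval, ht _ m0, mt]; omega] at r2
      refine ⟨(⟨m, s'.amp⟩ : State q).write (cell n 18 0) i,
        ⟨by omega, ?_, update_self .., hup _ _ _ mL (hsm i (by omega)),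
        fun y => ?_, fun j hj hj' => ?_⟩, ?_⟩
      · exact (State.write_mem_of_ne (cell_ne_zero _ _ _).symm).trans m0
      · refine (update_of_ne (hne y) _ _).trans ?_
        grind
      · refine (update_of_ne (by grind) _ _).trans ?_
        change update s'.mem _ _ j = _
        grind
      · rw [outBody, Cmd.wt, add_mul]
        exact r1.seq r2)
    (n - 1) (s.write (cell n 18 0) (n - 1)) ⟨le_rfl, (State.write_mem_of_ne (cell_ne_zero _ _ _).symm).trans h0,
      update_self .., hup _ _ _ hL (hsm _ (by omega)),
      fun y => update_of_ne (hne y) _ _, fun j _ _ => by omega⟩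
  have r3 := Runs.store h4 (.const 0) (.load (cellE 11 (prE (.const 0) (.const 0))))
  rw [show (Expr.load (cellE 11 (prE (.const 0) (.const 0)))).eval s'.mem =
      s.mem (cell n 11 (pr 0 0)) by rw [Expr.eval, cellE_eval_of h2, ← h5]; rfl] at r3
  obtain ⟨t, ht, h⟩ := r1.seq (hloop.seq r3)
  refine ⟨_, ⟨t, ht.trans ?_, h⟩, fun j hj => ?_⟩
  · rw [add_comm (_ * _) (_ * (2 * n + 9 + 1) ^ 2)]
    refine (cube_bound (by omega)).trans_eq ?_
    rfl
  · change update s'.mem 0 _ j = _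
    rw [update_apply]
    grind

/-- The condition for another trial. -/
def doneE : Expr := .op .lt (.load (cellE 12 (prE (.const 1) (.const 0)))) (.const 1)

/-- The algorithm. -/
def mainCmd : Cmd := .seq initCmd (.seq (.loop doneE (pTrial.comp 0)) outCmd)

/-! ### The loop of trials -/

section trials
variable {X : Ctx}

/-- The indicator of failure of a trial. -/
noncomputable def lost {q : ℕ} (s : St q) : ℝ≥0∞ := if s.arr 12 1 0 = 0 then 1 else 0

lemma lost_add_won {q : ℕ} (s : St q) : lost s + won s = 1 := by
  unfold lost won; split_ifs <;> simp

lemma wp_lost_le {q : ℕ} {π : ℝ≥0∞} {g : Prog} {v : List ℕ} {s : St q} (hs : s.amp.Normalized)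
    (h : π ≤ wp X 0 g v won s) : wp X 0 g v lost s ≤ 1 - π := by
  have h1 : wp X 0 g v lost s + wp X 0 g v won s = 1 := by
    rw [← wp_add]; simp_all [lost_add_won, wp_const]
  have h2 : π ≠ ⊤ := ne_top_of_le_ne_top ENNReal.one_ne_top (h.trans (h1 ▸ le_add_self))
  refine ENNReal.le_sub_of_add_le_right h2 ?_
  rw [← h1]; gcongr

open Classical in
/-- The indicator of the states that do not occur after a trial. -/
noncomputable def unsound (X : Ctx) {q : ℕ} (s : St q) : ℝ≥0∞ := if Sound X q s then 0 else 1

open Classical in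
lemma wp_unsound (hX : Fits X) (hin : X.Binary) {s : St X.qubits} (hs : Sound X X.qubits s) :
    wp X 0 pTrial [] (unsound X) s = 0 := by
  obtain ⟨⟨u, hu, hs⟩, -⟩ := hs
  have hn : s.amp.Normalized := by simp_all [zero_normalized]
  have h1 := one_le_pTrial hX hin hu hs
  have h2 : wp X 0 pTrial [] (unsound X) s +
      wp X 0 pTrial [] (fun s => if Sound X X.qubits s then 1 else 0) s = 1 := by
    rw [← wp_add]
    refine Eq.trans ?_ (wp_const (X := X) 1 pTrial [] s hn)
    congr 1
    funext s
    unfold unsound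
    split_ifs <;> simp
  by_contra h
  have h3 : wp X 0 pTrial [] (unsound X) s + 1 ≤ 0 + 1 := by
    rw [zero_add]; nth_rw 2 [← h2]; gcongr
  grind [nonpos_iff_eq_zero, ENNReal.add_le_add_iff_right, ENNReal.one_ne_top]

/-- The states between two trials. -/
def Good (X : Ctx) (s : State X.qubits) : Prop :=
  Inv X [] [] s.mem ∧ Sound X X.qubits (s.abs (X.inp 0))

lemma doneE_eval {s : State X.qubits} (h : Good X s) :
    doneE.eval s.mem = if (s.abs (X.inp 0)).arr 12 1 0 = 0 then 1 else 0 := by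
  have : (s.abs (X.inp 0)).arr 12 1 0 = s.mem (cell (X.inp 0) 12 (pr 1 0)) := rfl
  simp only [doneE, Expr.eval, cellE_eval h.1, prE, Op.eval, this, Nat.lt_one_iff]
  rfl

variable {c : ℝ≥0∞} {f : State X.qubits → ℝ≥0∞}

/-- B is a potential for the state before a successful trial: one trial costs T and a test c₀, and
it leaves the potential B with probability at most c. The hypothesis T + c₀ + Bc ≤ B makes this
balance, uniformly in the number N of tests. -/
lemma loop_le (hX : Fits X) (hin : X.Binary)
    (hc : ∀ s, Sound X X.qubits s → wp X 0 pTrial [] lost s ≤ c) {τ κ T c₀ A B : ℝ≥0∞}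
    (hκ : τ * ((pTrial.comp 0).wt * (X.lg + 1 + 1) ^ 2 : ℕ) ≤ κ)
    (hT : ∀ s : St X.qubits, s.amp.Normalized → κ * wp X 1 pTrial [] (fun _ => 0) s ≤ T)
    (h0 : τ * ((1 + doneE.wt) * (X.lg + 1 + 1) ^ 2 : ℕ) ≤ c₀) (hB : T + c₀ + B * c ≤ B)
    (hA : ∀ s, Good X s → doneE.eval s.mem = 0 → f s ≤ A) (N : ℕ) :
    ∀ s, Good X s → loopIter τ doneE (pTrial.comp 0) f N s ≤ c₀ + A + B * lost (s.abs (X.inp 0)) := by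
  induction N with
  | zero => exact fun s _ => zero_le
  | succ N ih =>
    intro s hs
    have hcost : τ * (1 + doneE.cost s.mem : ℕ) ≤ c₀ := by
      refine le_trans ?_ h0
      gcongr
      rw [add_mul, one_mul]
      exact Nat.add_le_add (one_le_sq _) (doneE.cost_le hs.1.lt)
    rw [loopIter_succ, add_assoc]
    refine add_le_add hcost ?_
    split_ifs with hd
    · exact (hA s hs hd).trans le_self_add
    have hl : lost (s.abs (X.inp 0)) = 1 := by
      simp_all [doneE_eval, lost]
    rw [hl, mul_one]
    have hn : (s.abs (X.inp 0)).amp.Normalized := by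
      obtain ⟨u, hu, h⟩ := hs.2.1
      simp_all [zero_normalized]
    -- The infinite weight on unsound states makes the upper bound trivial there. It costs nothing,
    -- because such states have expectation zero and ∞ · 0 = 0.
    refine ((simulates X τ κ pTrial [] [] rfl hκ (fun _ => 0)
      (fun s => ⊤ * unsound X s + ((c₀ + A) + B * lost s)) _ (fun s hs => ⟨zero_le, ?_⟩) s hs.1).2).trans ?_
    · by_cases hS : Sound X X.qubits (s.abs (X.inp 0))
      · exact (ih s ⟨hs, hS⟩).trans le_add_self
      · simp [unsound, hS]
    · rw [wp_split, wp_add, wp_add, wp_mul _ _ _ _ hn, wp_mul _ _ _ _ hn, wp_const _ _ _ _ hn,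
        wp_unsound hX hin hs.2, mul_zero, zero_add]
      calc _ ≤ T + (c₀ + A + B * c) := by gcongr; exacts [hT _ hn, hc _ hs.2]
        _ = A + (T + c₀ + B * c) := by ring
        _ ≤ _ := by gcongr

/-- The probability that N trials all fail is at most c^N, so the truncated loops reach the desired
final states up to this error. -/
lemma one_le_loop (hX : Fits X) (hin : X.Binary)
    (hc : ∀ s, Sound X X.qubits s → wp X 0 pTrial [] lost s ≤ c)
    (hA : ∀ s, Good X s → doneE.eval s.mem = 0 → 1 ≤ f s) (N : ℕ) :
    ∀ s, Good X s →
      1 ≤ loopIter 0 doneE (pTrial.comp 0) f (N + 1) s + c ^ N * lost (s.abs (X.inp 0)) := by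
  induction N with
  | zero =>
    intro s hs
    have h := doneE_eval hs
    rw [loopIter_succ, zero_mul, zero_add, pow_zero, one_mul]
    split_ifs with hd
    · exact (hA s hs hd).trans le_self_add
    simp_all [lost]
  | succ N ih =>
    intro s hs
    have h := doneE_eval hs
    rw [loopIter_succ, zero_mul, zero_add]
    split_ifs with hd
    · exact (hA s hs hd).trans le_self_add
    have hl : lost (s.abs (X.inp 0)) = 1 := by
      simp_all [lost]
    have hn : (s.abs (X.inp 0)).amp.Normalized := by
      obtain ⟨u, hu, h⟩ := hs.2.1
      simp_all [zero_normalized]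
    rw [hl, mul_one]
    classical
    -- Truncated subtraction turns the induction hypothesis into a lower bound for the remaining
    -- loop. Adding the error terms back recovers at least one at every state.
    set f₀ : St X.qubits → ℝ≥0∞ :=
      fun s => if Sound X X.qubits s then 1 - c ^ N * lost s else 0 with hf₀
    have h1 := (simulates X 0 0 pTrial [] [] rfl (by simp) f₀ (fun _ => ⊤)
      (loopIter 0 doneE (pTrial.comp 0) f (N + 1)) (fun s hs => ⟨?_, le_top⟩) s hs.1).1
    · calc (1 : ℝ≥0∞) = wp X 0 pTrial [] (fun _ => 1) (s.abs (X.inp 0)) := (wp_const _ _ _ _ hn).symm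
        _ ≤ wp X 0 pTrial [] (fun s => f₀ s + (unsound X s + c ^ N * lost s)) (s.abs (X.inp 0)) := by
            grind [wp_mono, unsound, zero_add, le_tsub_add, le_self_add]
        _ = wp X 0 pTrial [] f₀ (s.abs (X.inp 0)) +
              c ^ N * wp X 0 pTrial [] lost (s.abs (X.inp 0)) := by
            rw [wp_add, wp_add, wp_mul _ _ _ _ hn, wp_unsound hX hin hs.2, zero_add]
        _ ≤ _ := by rw [pow_succ]; gcongr; exacts [h1, hc _ hs.2]
    · simp only [hf₀]
      split_ifs with hS
      · exact tsub_le_iff_right.2 (ih s ⟨hs, hS⟩)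
      simp

end trials

/-! ### Initial memory and output -/

section init
variable {n κ w a b p : ℕ} {H : Matrix (Fin (n - κ)) (Fin n) (ZMod 2)} {s : Fin (n - κ) → ZMod 2}

lemma initState_le (hn : n ≠ 0) (hκ : κ ≤ n) (hw : w ≤ n) (ha : a ≤ n) (hb : b ≤ n) (hp : p ≤ n)
    (c : ℕ) : (initState 0 n κ w a b p H s).mem c ≤ n := by
  match c with
  | 0 => rfl
  | 1 => exact hκ
  | 2 => exact hw
  | 3 => exact ha
  | 4 => exact hb
  | 5 => exact hp
  | c + 6 =>
    rw [initState_mem_six, List.getD_eq_getElem?_getD]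
    grind

lemma initState_cell (t y : ℕ) : (initState 0 n κ w a b p H s).mem (cell n t y) = 0 := by
  have h : (n - κ) * n ≤ n * n := Nat.mul_le_mul_right _ (by omega)
  have h' : cell n t y = (cell n t y - 6) + 6 := by unfold cell; grind
  rw [h', initState_mem_six, List.getD_eq_default]
  simp only [List.length_append, List.length_ofFn, cell]
  grind

lemma inv_init (hn : n ≠ 0) (hκ : κ ≤ n) (hw : w ≤ n) (ha : a ≤ n) (hb : b ≤ n) (hp : p ≤ n) :
    Inv (codeCtx n κ w a b p H s) [] []
      (update (initState 0 n κ w a b p H s).mem (cell n 18 0) (2 ^ (2 * n + 8))) where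
  inp c := by
    have h4 : 16 ≤ (n + 4) * (n + 4) := by grind
    refine (update_of_ne (inp_ne_cell n c 18 0) _ _).trans ?_
    match c with
    | 0 => rfl
    | 1 => rfl
    | 2 => rfl
    | 3 => rfl
    | 4 => rw [if_pos (by omega)]; rfl
    | 5 => rw [if_pos (by omega)]; rfl
    | c + 6 =>
      simp only [codeCtx]
      split_ifs
      · simp
      rfl
  top := update_self ..
  le c := by
    rw [update_apply]
    split_ifs
    · rfl
    · exact (initState_le hn hκ hw ha hb hp c).trans
        ((by omega : n ≤ 2 * n + 8).trans Nat.lt_two_pow_self.le)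
  idx i hi := absurd hi (Nat.not_lt_zero _)
  cnt i hi := absurd hi (Nat.not_lt_zero _)

local notation "𝓧" => codeCtx n κ w a b p H s

lemma good_init (hn : n ≠ 0) (hκ : κ ≤ n) (hw : w ≤ n) (ha : a ≤ n) (hb : b ≤ n) (hp : p ≤ n) :
    Good 𝓧 ((initState (𝓧).qubits n κ w a b p H s).write (cell n 18 0) (2 ^ (2 * n + 8))) := by
  refine ⟨inv_init hn hκ hw ha hb hp, ⟨1, norm_one, (one_smul _ _).symm⟩, fun h => absurd ?_ h⟩
  refine (update_of_ne ?_ _ _).trans (initState_cell 12 (pr 1 0))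
  change cell n 12 (pr 1 0) ≠ cell n 18 0
  simp [cell_inj]

lemma runs_out (hn : n ≠ 0) {s' : State (𝓧).qubits} (h : Good 𝓧 s') (hd : doneE.eval s'.mem = 0) :
    ∃ s'', Runs outCmd s' s'' (outCmd.wt * (2 * n + 10) ^ 3) ∧ ∃ D : Arr, Solves 𝓧 D.out ∧
      ∀ j < n, s''.mem j = D 11 j 0 := by
  obtain ⟨s'', hr, ho⟩ := runs_outCmd (n := n) h.1.zero hn h.1.lt
  refine ⟨s'', hr, (s'.abs n).arr, h.2.2 ?_, ho⟩
  simp_all [doneE_eval]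

end init

lemma exists_mainCmd_spec : ∃ K d : ℕ, ∀ (n κ w a b p : ℕ), n ≠ 0 → κ ≤ n → b ≤ n - κ → w ≤ n →
    a ≤ n → p ≤ n → ∀ (H : Matrix (Fin (n - κ)) (Fin n) (ZMod 2)) (s : Fin (n - κ) → ZMod 2) (X : Ctx),
    X = codeCtx n κ w a b p H s → ∀ π : ℝ≥0∞, π ≠ 0 → (∀ (D : Arr) (u : ℂ), ‖u‖ = 1 →
      π ≤ wp X 0 pTrial [] won ⟨D, u • QState.zero X.qubits⟩) →
    (∀ E : State X.qubits → Prop, (∀ (D : Arr) s', Solves X D.out → (∀ j < n, s'.mem j = D 11 j 0) →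
      E s') → haltProb mainCmd E (initState X.qubits n κ w a b p H s) = 1) ∧
    expectedTime mainCmd (initState X.qubits n κ w a b p H s) ≤ (K * (n + 1) ^ d : ℕ) / π := by
  obtain ⟨C, d, hCd⟩ := exists_trialSteps
  refine ⟨(initCmd.wt + outCmd.wt + 2 * (1 + doneE.wt) + (pTrial.comp 0).wt * C) * 1000, d + 3,
    fun n κ w a b p hn hκ hb hw ha hp H s X hXe π h0 hP => ?_⟩
  subst hXe
  set X := codeCtx n κ w a b p H s with hXdef
  have hX : Fits X := codeCtx_fits hκ hb hw
  have hin : X.Binary := codeCtx_binary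
  have hP' : ∀ st, Sound X X.qubits st → π ≤ wp X 0 pTrial [] won st := by
    rintro ⟨D, ψ⟩ ⟨⟨u, hu, h⟩, -⟩
    grind
  have hc : ∀ st, Sound X X.qubits st → wp X 0 pTrial [] lost st ≤ 1 - π := fun st hst => by
    refine wp_lost_le ?_ (hP' st hst)
    obtain ⟨u, hu, h⟩ := hst.1
    simp_all [zero_normalized]
  have hG : Good X _ := good_init hn hκ hw ha (hb.trans (Nat.sub_le _ _)) hp
  set s₁ := (initState X.qubits n κ w a b p H s).write (cell n 18 0) (2 ^ (2 * n + 8)) with hs₁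
  have hπ1 : π ≤ 1 := by
    refine (hP' _ hG.2).trans ?_
    have : (s₁.abs (X.inp 0)).amp.Normalized := by
      obtain ⟨u, hu, h⟩ := hG.2.1
      simp_all [zero_normalized]
    refine (wp_mono _ _ _ _ _ this fun st _ => ?_).trans (wp_const 1 _ _ _ this).le
    exact le_add_self.trans (lost_add_won st).le
  obtain ⟨t, ht, hrun⟩ := runs_initCmd (s := initState X.qubits n κ w a b p H s) (n := n) rfl
    (initState_le hn hκ hw ha (hb.trans (Nat.sub_le _ _)) hp) (initState_cell 16 0)
  have hexp : ∀ (τ : ℝ≥0∞) F, expect τ mainCmd F (initState X.qubits n κ w a b p H s) =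
      τ * (t : ℕ) + ⨆ N, loopIter τ doneE (pTrial.comp 0) (expect τ outCmd F) N s₁ :=
    fun τ F => hrun τ _
  have hlost : ∀ st : St X.qubits, lost st ≤ 1 := fun st => le_self_add.trans (lost_add_won st).le
  refine ⟨fun E hE => ?_, ?_⟩
  · classical
    rw [haltProb, hexp, zero_mul, zero_add]
    have hf : ∀ st, Good X st → doneE.eval st.mem = 0 →
        expect 0 outCmd (fun s' => if E s' then 1 else 0) st = 1 := fun st hst hd => by
      obtain ⟨s', ⟨t, _, hr⟩, D, hD, hj⟩ := runs_out hn hst hd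
      rw [hr, zero_mul, zero_add, if_pos (hE D s' hD hj)]
    refine le_antisymm (iSup_le fun N => ?_) ?_
    -- With all costs and the potential equal to zero, `loop_le` says that the probability is at
    -- most one.
    · refine (loop_le hX hin hc (τ := 0) (κ := 0) (T := 0) (c₀ := 0) (A := 1) (B := 0)
        (zero_mul _).le (by simp) (zero_mul _).le (by simp) (fun st hst hd => (hf st hst hd).le) N s₁ hG).trans (by simp)
    · have hlim := (ENNReal.tendsto_pow_atTop_nhds_zero_of_lt_one (r := 1 - π)
        (ENNReal.sub_lt_self ENNReal.one_ne_top one_ne_zero h0)).const_add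
        (⨆ N, loopIter 0 doneE (pTrial.comp 0)
          (expect 0 outCmd (fun s' => if E s' then 1 else 0)) N s₁)
      rw [add_zero] at hlim
      refine ge_of_tendsto' hlim fun N => ?_
      refine (one_le_loop hX hin hc (fun st hst hd => (hf st hst hd).ge) N s₁ hG).trans ?_
      exact add_le_add (le_iSup (fun N => loopIter 0 doneE (pTrial.comp 0)
          (expect 0 outCmd (fun s' => if E s' then 1 else 0)) N s₁) (N + 1))
        (mul_le_of_le_one_right' (hlost _))
  · have hπt : π ≠ ⊤ := ne_top_of_le_ne_top ENNReal.one_ne_top hπ1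
    set κ₁ := (pTrial.comp 0).wt * (2 * n + 10) ^ 2
    set T := κ₁ * (C * (n + 1) ^ d * (2 * n + 9))
    set c₀ := (1 + doneE.wt) * (2 * n + 10) ^ 2
    set A := outCmd.wt * (2 * n + 10) ^ 3
    -- The mean of a geometric number of trials; it balances T + c₀ + B(1 - π) = B.
    set B : ℝ≥0∞ := ((T + c₀ : ℕ) : ℝ≥0∞) / π with hB
    have hBπ : B * π = (T + c₀ : ℕ) := ENNReal.div_mul_cancel h0 hπt
    rw [expectedTime, hexp, one_mul]
    have h1 : ∀ N, loopIter 1 doneE (pTrial.comp 0) (expect 1 outCmd fun _ => 0) N s₁ ≤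
        (c₀ : ℕ) + (A : ℕ) + B := fun N => by
      refine (loop_le hX hin hc (κ := (κ₁ : ℕ)) (T := (T : ℕ)) (c₀ := (c₀ : ℕ)) (A := (A : ℕ))
        (B := B) (one_mul _).le (fun st hst => ?_) (one_mul _).le ?_ (fun st hst hd => ?_) N s₁
        hG).trans (add_le_add le_rfl (mul_le_of_le_one_right' (hlost _)))
      · rw [Nat.cast_mul κ₁]
        gcongr
        exact hCd _ X hX st hst
      · rw [← Nat.cast_add, ← hBπ, ← mul_add, add_tsub_cancel_of_le hπ1, mul_one]
      · obtain ⟨s', ⟨t, ht, hr⟩, -⟩ := runs_out hn hst hd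
        rw [hr, one_mul, add_zero]
        exact Nat.cast_le.2 ht
    calc _ ≤ ((initCmd.wt * (2 * n + 10) ^ 3 : ℕ) : ℝ≥0∞) + ((c₀ : ℕ) + (A : ℕ) + B) :=
          add_le_add (Nat.cast_le.2 ht) (iSup_le h1)
      _ = ((initCmd.wt * (2 * n + 10) ^ 3 + c₀ + A : ℕ) : ℝ≥0∞) + B := by grind
      _ ≤ ((initCmd.wt * (2 * n + 10) ^ 3 + c₀ + A : ℕ) : ℝ≥0∞) / π + B := by
          gcongr
          grind [ENNReal.le_div_iff_mul_le, mul_le_of_le_one_right']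
      _ = ((initCmd.wt * (2 * n + 10) ^ 3 + c₀ + A + (T + c₀) : ℕ) : ℝ≥0∞) / π := by
          simp_all [ENNReal.add_div, Nat.cast_add]
      _ ≤ _ := by
          refine ENNReal.div_le_div_right (Nat.cast_le.2 ?_) _
          have e1 : (2 * n + 10) ^ 2 ≤ (2 * n + 10) ^ 3 := Nat.pow_le_pow_right (by omega) (by omega)
          have e2 : (2 * n + 10) ^ 3 ≤ 1000 * (n + 1) ^ 3 := by
            grind
          have e3 : 1 ≤ (n + 1) ^ d := Nat.one_le_pow _ _ (by omega)
          have e4 : (2 * n + 10) ^ 3 ≤ (n + 1) ^ d * (2 * n + 10) ^ 3 := Nat.le_mul_of_pos_left _ e3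
          have e5 : T ≤ (pTrial.comp 0).wt * C * ((n + 1) ^ d * (2 * n + 10) ^ 3) := by
            grind
          have e6 : c₀ ≤ (1 + doneE.wt) * ((n + 1) ^ d * (2 * n + 10) ^ 3) :=
            Nat.mul_le_mul_left _ (e1.trans e4)
          have e7 := Nat.mul_le_mul_left initCmd.wt e4
          have e8 : A ≤ outCmd.wt * ((n + 1) ^ d * (2 * n + 10) ^ 3) := Nat.mul_le_mul_left _ e4
          calc _ ≤ (initCmd.wt + outCmd.wt + 2 * (1 + doneE.wt) + (pTrial.comp 0).wt * C) *
                ((n + 1) ^ d * (2 * n + 10) ^ 3) := by rw [add_mul, add_mul, add_mul, mul_assoc 2]; omega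
            _ ≤ (initCmd.wt + outCmd.wt + 2 * (1 + doneE.wt) + (pTrial.comp 0).wt * C) *
                ((n + 1) ^ d * (1000 * (n + 1) ^ 3)) := by gcongr
            _ = _ := by ring

end Hybrid

/-! ### The main theorem -/

theorem mainTheorem3 :
    ∃ (P : Hybrid.Cmd) (C d : ℕ),
      ∀ (n k ω a b p : ℕ) (R δ α β : ℝ),
        1 ≤ ω → ω ≤ n → k ≤ n → R = k / n →
        0 ≤ δ → δ ≤ 1 →
        0 ≤ α → α < R → (a : ℝ) = α * n →
        β = (1 - R) * (1 - δ * R / (R - α)) → (b : ℝ) = β * n →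
        p ≤ min ω b → ((ω - p : ℕ) : ℝ) ≤ (1 - β - R) * n →
        ∃ q : ℕ, (q : ℝ) ≤ δ * (1 - R) * R * (n : ℝ) ^ 2 + C * n ∧
          ∀ e : Fin n → ZMod 2, hammingNorm e = ω →
            (∀ H ∈ parityCheckMatrices n k,
              Hybrid.haltProb P (fun s => IsSDSolution H (H *ᵥ e) ω (Hybrid.output n s))
                (Hybrid.initState q n k ω a b p H (H *ᵥ e)) = 1) ∧
            (∑ H ∈ parityCheckMatrices n k,
                Hybrid.expectedTime P (Hybrid.initState q n k ω a b p H (H *ᵥ e))) /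
                ((parityCheckMatrices n k).card : ℝ≥0∞)
              ≤ ENNReal.ofReal (C * (n : ℝ) ^ d * combinedHybridBound n k ω a b p) := by
  obtain ⟨K, d, hK⟩ := Hybrid.exists_mainCmd_spec
  -- The summand 30 pays for the 10(n + 2) auxiliary qubits, and 2^(d+4) comes from n + 1 ≤ 2n.
  refine ⟨Hybrid.mainCmd, K * 4320 * 2 ^ (d + 4) + 30, d + 4, ?_⟩
  intro n k ω a b p R δ α β hω hωn hkn hR hδ hδ1 hα hαR ha hβ hb hp ht
  have hn : n ≠ 0 := by omega
  have hn0 : (0 : ℝ) < n := by exact_mod_cast Nat.pos_of_ne_zero hn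
  have hkR : (k : ℝ) = R * n := by rw [hR, div_mul_cancel₀ _ hn0.ne']
  have hk1 : (k : ℝ) ≤ n := by exact_mod_cast hkn
  have hR1 : R ≤ 1 := by rw [hR]; exact div_le_one_of_le₀ hk1 hn0.le
  have hRα : 0 < R - α := by linarith
  have hβ' : 1 - β - R = (1 - R) * (δ * R / (R - α)) := by rw [hβ]; ring
  have hβ0 : 0 ≤ 1 - β - R := by
    rw [hβ']
    exact mul_nonneg (by linarith) (div_nonneg (mul_nonneg hδ (by linarith)) hRα.le)
  have hak : a < k := by
    have : (a : ℝ) < k := by rw [ha, hkR]; gcongr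
    exact_mod_cast this
  have hbk : b + k ≤ n := by
    have : (b : ℝ) + k ≤ n := by rw [hb, hkR]; nlinarith
    exact_mod_cast this
  have hr : ((n - k - b : ℕ) : ℝ) = (1 - β - R) * n := by
    rw [Nat.sub_sub, Nat.cast_sub (by omega)]; push_cast; rw [hkR, hb]; ring
  have ht' : ω - p ≤ n - k - b := by rw [← hr] at ht; exact_mod_cast ht
  obtain ⟨hpω, hpb⟩ := le_min_iff.1 hp
  refine ⟨Hybrid.numQubits n (n - k - b) (k - a), ?_, fun e he => ?_⟩
  · have h1 : ((k - a : ℕ) : ℝ) = (R - α) * n := by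
      rw [Nat.cast_sub hak.le, hkR, ha]; ring
    -- The choice of β makes the matrix register of size (n - k - b)(k - a) exactly as large as
    -- allowed.
    have h2 : (1 - β - R) * (R - α) = δ * (1 - R) * R := by
      rw [hβ']; field_simp
    have h3 : (1 : ℝ) ≤ n := by exact_mod_cast Nat.pos_of_ne_zero hn
    have h4 : (0 : ℝ) ≤ (K * 4320 * 2 ^ (d + 4) : ℕ) := Nat.cast_nonneg _
    rw [Hybrid.numQubits, Nat.cast_add, Nat.cast_mul, Nat.cast_mul, hr, h1, Nat.cast_add, ← h2,
      Nat.cast_add]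
    push_cast at h4 ⊢
    nlinarith
  classical
  obtain ⟨pr, hpr, hsum⟩ := Hybrid.exists_trialBound hkn (by omega : b ≤ n - k) hωn hpb hpω ht'
    (a := a) he
  have hmem : ∀ {H}, H ∈ parityCheckMatrices n k → Hybrid.FullRank H := fun {H} hH =>
    (Hybrid.fullRank_iff H).2 (Finset.mem_filter.1 hH).2
  have hspec := fun H (hH : H ∈ parityCheckMatrices n k) => hK n k ω a b p hn hkn (by omega) hωn
    (by omega) (by omega) H (H *ᵥ e) _ rfl (ENNReal.ofReal (pr H))
    (ENNReal.ofReal_pos.2 (hpr H (hmem hH)).1).ne' (hpr H (hmem hH)).2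
  refine ⟨fun H hH => (hspec H hH).1 _ fun D s' hD hs' => ?_, ?_⟩
  -- The verified vector need not be e; any solution is accepted.
  · have ho : ∀ j < n, Hybrid.ext (Hybrid.output n s') j = D.out j := fun j hj => by
      rw [Hybrid.ext, dif_pos hj, Hybrid.output, hs' j hj]; rfl
    obtain ⟨h1, h2⟩ := (Hybrid.Solves.congr
      (X := Hybrid.codeCtx n k ω a b p H (H *ᵥ e)) ho).2 hD
    refine ⟨funext fun l => ?_, (Hybrid.countOnes_ext _).symm.trans h1⟩
    rw [← Hybrid.sum_row l.2]
    refine (h2 l l.2).trans ?_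
    refine (congrArg Nat.cast (Hybrid.codeCtx_syndrome l.2)).trans ?_
    rw [ZMod.natCast_zmod_val]
  set Q : ℝ := n.choose ω / (√((n - k - b + (k - a)).choose (ω - p) * (n - k - b).choose (ω - p)) *
    b.choose p) with hQ
  have hQ0 : 0 ≤ Q := by positivity
  have hset : Finset.univ.filter (Hybrid.FullRank (n := n) (m := n - k)) = parityCheckMatrices n k :=
    Finset.ext fun H => by
      rw [Finset.mem_filter, parityCheckMatrices, Finset.mem_filter, Hybrid.fullRank_iff]
  rw [hset] at hsum
  -- The estimate holds without the maximum, which is at least one; here n - a - b is the length r +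
  -- K of the two searched blocks.
  have hbound : Q ≤ combinedHybridBound n k ω a b p := by
    rw [combinedHybridBound, show n - a - b = n - k - b + (k - a) by omega]
    exact le_mul_of_one_le_right hQ0 (le_max_left _ _)
  refine ENNReal.div_le_of_le_mul ?_
  calc _ ≤ ∑ H ∈ parityCheckMatrices n k, ENNReal.ofReal (K * (n + 1) ^ d * (1 / pr H)) := by
        refine Finset.sum_le_sum fun H hH => (hspec H hH).2.trans_eq ?_
        rw [← ENNReal.ofReal_natCast, ← ENNReal.ofReal_div_of_pos (hpr H (hmem hH)).1]
        congr 1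
        push_cast
        rw [mul_one_div]
    _ = ENNReal.ofReal (K * (n + 1) ^ d * ∑ H ∈ parityCheckMatrices n k, 1 / pr H) := by
        rw [Finset.mul_sum, ENNReal.ofReal_sum_of_nonneg fun H hH => ?_]
        have := (hpr H (hmem hH)).1
        positivity
    _ ≤ ENNReal.ofReal (((K * 4320 * 2 ^ (d + 4) + 30 : ℕ) * (n : ℝ) ^ (d + 4) *
          combinedHybridBound n k ω a b p) * (parityCheckMatrices n k).card) := by
        refine ENNReal.ofReal_le_ofReal ?_
        calc _ ≤ K * (n + 1) ^ d * (4320 * (n + 1) ^ 4 * (parityCheckMatrices n k).card * Q) := by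
              gcongr
          _ = K * 4320 * ((n : ℝ) + 1) ^ (d + 4) * Q * (parityCheckMatrices n k).card := by ring
          _ ≤ K * 4320 * (2 * (n : ℝ)) ^ (d + 4) * combinedHybridBound n k ω a b p *
                (parityCheckMatrices n k).card := by
              have h3 : (1 : ℝ) ≤ n := by exact_mod_cast Nat.pos_of_ne_zero hn
              have h4 : ((n : ℝ) + 1) ^ (d + 4) ≤ (2 * (n : ℝ)) ^ (d + 4) :=
                pow_le_pow_left₀ (by linarith) (by linarith) _
              exact mul_le_mul_of_nonneg_right (mul_le_mul (mul_le_mul_of_nonneg_left h4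
                (by positivity)) hbound hQ0 (by positivity)) (Nat.cast_nonneg _)
          _ = (K * 4320 * 2 ^ (d + 4)) * (n : ℝ) ^ (d + 4) * combinedHybridBound n k ω a b p *
                (parityCheckMatrices n k).card := by rw [mul_pow]; ring
          _ ≤ _ := by
              refine mul_le_mul_of_nonneg_right (mul_le_mul_of_nonneg_right
                (mul_le_mul_of_nonneg_right ?_ (by positivity)) (hQ0.trans hbound))
                (Nat.cast_nonneg _)
              push_cast
              exact le_add_of_nonneg_right (by norm_num)
    _ = _ := by
        rw [ENNReal.ofReal_mul' (Nat.cast_nonneg _), ENNReal.ofReal_natCast]
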